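/- **Setting.** For events $E_r$ and numbers $L_r\to\infty$, "$E_r$ has probability $1-\Delta(L_r)$" means $\mathbf P[E_r^c]=O(L_r^{-k})$ as $r\to\infty$ for every $k\ge 1$. For random variables $X,Y$ on one probability space, $X\Rrightarrow Y$ ("$X$ determines $Y$") is the event of all $\omega$ such that, conditioned on $X=X(\omega)$, $Y=Y(\omega)$ almost surely. $I$ denotes information ($-\log$ of probability). For a process $X$ and a state $a$, $\widehat X=\widehat X^a=(\mathbf 1\{X_n=a\})_n$, and $h(X|\widehat X)=\lim_n \frac1n\mathbf E[I(X_{[0,n-1]})-I(\widehat X_{[0,n-1]})]$. A state $a$ is renewal if, given $X_0=a$, $X_{[-n,-1]}$ and $X_{[1,n]}$ are independent for all $n$. *Process.* Let $M$ be a bi-marked process: a stationary process on three states $a,b,c$, with $\mathbf P[M_0=c]>0$, such that $a$ and $b$ are renewal states and each of $\widehat M^a,\widehat M^b$ has the law of $\widehat Y^s$ for some state $s$ of some finite-state aperiodic Markov process $Y$. Let $p$ be a probability on a finite set $K$ that is not a point mass, and let $Z$ be the independent splitting: $Z_n=M_n$ if $M_n\ne c$, and $Z_n=B_n$ if $M_n=c$,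 where $B$ is i.i.d. with marginal $p$, independent of $M$, and the alphabet $K$ of $B$ does not contain $a,b$. *Markers and skeletons.* A marker factor for the state $a$ is a (measurable, almost surely shift-equivariant) map $\xi=\xi(\widehat Z^a)\in\{0,1,2,\dots\}^{\mathbb Z}$ with $\xi_0>0\Rightarrow Z_0=a$ a.s. and $\mathbf P[\xi_0\ge r]>0$ for all $r$. For $r\ge1$, an interval $[\alpha,\beta]$ carries an $r$-skeleton if $\xi_\alpha,\xi_{\beta+1}\ge r>\xi_i$ for $\alpha<i\le\beta$; the skeleton $S$ consists of the interval, $\widehat Z^a$ on $[\alpha,\beta]$ and $\xi$ on $[\alpha+1,\beta]$, and $|S|=\beta-\alpha+1$. $S_r$ is the $r$-skeleton that covers $0$. $\xi$ is nice with lengths sequence $L_r\to\infty$ if for some $c>0$ the events $\{Z_{[-L_r,L_r]}\Rrightarrow S_r\}$ and $\{L_r/\log^c L_r\le |S_r|\le L_r\}$ have probability $1-\Delta(L_r)$. *Systems of fillers.* A filler of $S$ is a word on $[\alpha,\beta]$ whose $0$-$1$ word is that of $S$; $\mu_S$ is the law of $Z_{[\alpha,\beta]}$ given that $\widehat Z^a$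 on $[\alpha,\beta+1]$ is as prescribed by $S$ (with $Z_{\beta+1}=a$). A system of fillers (SOF) is a translation-invariant family of equivalence relations $\sim_S$ on the fillers of $S$, for all skeletons $S$, such that equivalent fillers of $S$ restrict to equivalent fillers of each sub-skeleton of $S$, and $\mathbf E\big[|S_r|^{-1}\sum_{i\in S_r}\mathbf 1\{[Z_{S_r}]\Rrightarrow Z_i\}\big]\to1$ as $r\to\infty$. It is good if there are real $k\le K$ such that (1) for every skeleton $S$ of positive probability and large enough size, every class $[w]$ with $\mu_S([w])>0$ satisfies $I_{\mu_S}([w])\le |S|\,h(Z|\widehat Z^a)-|S|^{1/2}\log^k|S|$; and (2) with probability $1-\Delta(L_r)$, $I_{\mu_{S_r}}([Z_{S_r}])\ge |S_r|\,h(Z|\widehat Z^a)-|S_r|^{1/2}\log^K|S_r|$. The random variables $Z_S$ and $[Z_S]$ are understood to include the skeleton $S$. **Lemma (nested fillers).** Let $\varsigma$ be a nice marker factor for the state $a$ of $Z$, with lengths sequence $(L_{\varsigma,r})$, and $\vartheta$ a nice marker factor for the state $b$, with lengths sequence $(L_{\vartheta,r})$. Write $S_r$ and $T_r$ for the respective $r$-skeletons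 covering $0$. There exist good SOFs $\mathscr C_a$ for $(Z,a,\varsigma)$ and $\mathscr C_b$ for $(Z,b,\vartheta)$ such that: 1. for every $0<\epsilon<\frac12$, with probability $1-\Delta(L_{\varsigma,r})$, for every $\vartheta$-skeleton $T$ appearing in $Z_{S_r}$ with $|T|\ge|S_r|^\epsilon$: if $Z_{S_r}\Rrightarrow T,[Z_T]_{\mathscr C_b}$, then $[Z_{S_r}]_{\mathscr C_a}\Rrightarrow T,[Z_T]_{\mathscr C_b}$; 2. for every $0<\epsilon<\frac12$, with probability $1-\Delta(L_{\vartheta,r})$, for every $\varsigma$-skeleton $S$ appearing in $Z_{T_r}$ with $|S|\ge|T_r|^\epsilon$: if $Z_{T_r}\Rrightarrow S,[Z_S]_{\mathscr C_a}$, then $[Z_{T_r}]_{\mathscr C_b}\Rrightarrow S,[Z_S]_{\mathscr C_a}$. -/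

import Mathlib

open MeasureTheory ProbabilityTheory Filter Topology Asymptotics

noncomputable section

namespace Fillers

/-! ### Sequences, words, events -/

section Basics

variable {Ω α β A : Type*}

/-- The left shift on two-sided sequences. -/
def shift (x : ℤ → A) : ℤ → A := fun n => x (n + 1)

/-- The word `x_m x_{m+1} ⋯ x_{m+n-1}`, read along the interval `[m, m+n-1]`. -/
def word (x : ℤ → A) (m : ℤ) (n : ℕ) : List A := List.ofFn fun i : Fin n => x (m + (i : ℕ))

open Classical in
/-- The distribution of the state `a`: the 0-1 sequence `(1{x_n = a})_n`. -/
def hat (a : A) (x : ℤ → A) : ℤ → Bool := fun n => decide (x n = a)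

/-- The event that `X` determines `Y`: the set of all `ω` such that, conditioned on `X = X(ω)`,
the random variable `Y` is almost surely equal to `Y(ω)`. -/
def Determines [MeasurableSpace Ω] (μ : Measure Ω) (X : Ω → α) (Y : Ω → β) : Set Ω :=
  {ω | ∀ᵐ ω' ∂μ, X ω' = X ω → Y ω' = Y ω}

/-- `f(r) = Δ(L_r)`: superpolynomial decay in terms of `L_r`. -/
def SuperpolyDecay (L f : ℕ → ℝ) : Prop :=
  ∀ k : ℕ, f =O[atTop] fun r => ((L r) ^ k)⁻¹

/-- The events `E_r` hold with probability `1 - Δ(L_r)`. -/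
def WithHighProb [MeasurableSpace Ω] (μ : Measure Ω) (L : ℕ → ℝ) (E : ℕ → Set Ω) : Prop :=
  SuperpolyDecay L fun r => μ.real (E r)ᶜ

/-- The random information `I(X) = -log P[X' = X]`, where `X'` is an independent copy. -/
def info [MeasurableSpace Ω] (μ : Measure Ω) (X : Ω → α) (ω : Ω) : ℝ :=
  -Real.log (μ.real {ω' | X ω' = X ω})

/-- The function `Λ_{k,1/2}(t) = t^{1/2} log^k t`. -/
def lam (k t : ℝ) : ℝ := t ^ (1 / 2 : ℝ) * Real.log t ^ k

end Basics

/-! ### Processes -/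

section Processes

variable {A : Type*} [MeasurableSpace A]

/-- `a` is a renewal state: conditioned on `X_0 = a`, the samples `X_{[-n,-1]}` and `X_{[1,n]}`
are independent for all `n`. -/
def IsRenewalState (μ : Measure (ℤ → A)) (a : A) : Prop :=
  ∀ n : ℕ, IndepFun (fun x : ℤ → A => (Set.Icc (-(n : ℤ)) (-1)).domRestrict x)
    (fun x : ℤ → A => (Set.Icc (1 : ℤ) n).domRestrict x) (μ[|{x | x 0 = a}])

/-- A stationary aperiodic Markov process of memory one. -/
structure IsAperiodicMarkov (μ : Measure (ℤ → A)) : Prop where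
  prob : IsProbabilityMeasure μ
  stationary : MeasurePreserving shift μ μ
  /-- `P[X_0 = x_0 | X_{[-n-1,-1]} = x_{[-n-1,-1]}] = P[X_0 = x_0 | X_{-1} = x_{-1}]`, with the
  denominators multiplied out. -/
  memory_one : ∀ (n : ℕ) (x : ℤ → A),
    μ {y | ∀ i ∈ Set.Icc (-(n : ℤ) - 1) 0, y i = x i} * μ {y | y (-1) = x (-1)} =
      μ {y | ∀ i ∈ Set.Icc (-(n : ℤ) - 1) (-1), y i = x i} *
        μ {y | y (-1) = x (-1) ∧ y 0 = x 0}
  irreducible : ∀ s t : A, ∃ n : ℕ, 1 ≤ n ∧ 0 < μ {x | x 0 = s ∧ x n = t}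
  /-- The set of all `n ≥ 1` with `P[X_0 = s, X_n = t] > 0` has greatest common divisor one. -/
  period_one : ∀ s t : A, ∀ d : ℕ,
    (∀ n : ℕ, 1 ≤ n → 0 < μ {x | x 0 = s ∧ x n = t} → d ∣ n) → d = 1

/-- The conditional entropy rate `h(X | X̂)` of a process given the distribution of its state `a`:
the limit of `E[I(X_{[0,n-1]} | X̂_{[0,n-1]})] / n`. Here `I(X_{[0,n-1]} | X̂_{[0,n-1]})` is
`I(X_{[0,n-1]}) - I(X̂_{[0,n-1]})`, since the second word is a function of the first. For a
stationary process with finitely many states the limit exists, so that it is the `limsup`. -/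
def condEntropyRate (μ : Measure (ℤ → A)) (a : A) : ℝ :=
  limsup (fun n : ℕ => (∫ x, (info μ (fun y => word y 0 n) x -
    info μ (fun y => word (hat a y) 0 n) x) ∂μ) / n) atTop

end Processes

/-! ### Bi-marked processes and their independent splittings -/

/-- The three states of a bi-marked process. -/
inductive BiState : Type
  | a | b | c

instance : MeasurableSpace BiState := ⊤

/-- A bi-marked process: a stationary process on the three states `a, b, c` (all of which occur),
such that `a`, `b` are renewal states and the distributions of `a` and of `b` each have the law of
the distribution of a state of some finite state aperiodic Markov process. (That `a` and `b` occur
follows from the last two conditions.) -/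
structure IsBiMarked (μ : Measure (ℤ → BiState)) : Prop where
  prob : IsProbabilityMeasure μ
  stationary : MeasurePreserving shift μ μ
  renewal_a : IsRenewalState μ BiState.a
  renewal_b : IsRenewalState μ BiState.b
  dist_a : ∃ (N : ℕ) (ρ : Measure (ℤ → Fin N)) (s : Fin N),
    IsAperiodicMarkov ρ ∧ μ.map (hat BiState.a) = ρ.map (hat s)
  dist_b : ∃ (N : ℕ) (ρ : Measure (ℤ → Fin N)) (s : Fin N),
    IsAperiodicMarkov ρ ∧ μ.map (hat BiState.b) = ρ.map (hat s)
  pos_c : 0 < μ {x | x 0 = BiState.c}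

/-- The states of an independent splitting: `a`, `b`, and the symbols into which `c` is split. -/
inductive Split (K : Type*) : Type _
  | a | b
  | sym (k : K)

instance {K : Type*} : MeasurableSpace (Split K) := ⊤

/-- Replace every occurrence of `c` in `m` by the symbol of `u` at the same place. -/
def splitMap {K : Type*} (m : ℤ → BiState) (u : ℤ → K) : ℤ → Split K := fun n =>
  match m n with
  | BiState.a => Split.a
  | BiState.b => Split.b
  | BiState.c => Split.sym (u n)

/-- The law of the independent splitting `Z` of a process `M` of law `μ` by an i.i.d. process
`B(p)`, independent of `M`, with marginal `p`. -/
def splitting {K : Type*} [MeasurableSpace K] (μ : Measure (ℤ → BiState)) (p : Measure K)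
    [IsProbabilityMeasure p] : Measure (ℤ → Split K) :=
  (μ.prod (Measure.infinitePi fun _ : ℤ => p)).map fun q => splitMap q.1 q.2

/-! ### Marker factors and skeletons -/

/-- `ξ` is a marker factor of the 0-1 process of law `ρ`. -/
structure IsMarkerFactor (ρ : Measure (ℤ → Bool)) (ξ : (ℤ → Bool) → ℤ → ℕ) : Prop where
  measurable : Measurable ξ
  stationary : ∀ᵐ y ∂ρ, ξ (shift y) = shift (ξ y)
  marks : ∀ᵐ y ∂ρ, 0 < ξ y 0 → y 0 = true
  unbounded : ∀ r : ℕ, 0 < r → 0 < ρ {y | r ≤ ξ y 0}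

/-- The interval `[m, m+n-1]` carries a skeleton of rank `r` for the marker sequence `q`. -/
def IsRankSkeleton (q : ℤ → ℕ) (r : ℕ) (m : ℤ) (n : ℕ) : Prop :=
  0 < n ∧ r ≤ q m ∧ r ≤ q (m + n) ∧ ∀ i : ℤ, m < i → i < m + n → q i < r

/-- The interval `[m, m+n-1]` carries a skeleton for the marker sequence `q`. -/
def IsSkeleton (q : ℤ → ℕ) (m : ℤ) (n : ℕ) : Prop :=
  ∃ r : ℕ, 0 < r ∧ IsRankSkeleton q r m n

/-- The data of a skeleton on `[α, β]`: its first coordinate `α`, the 0-1 word on `[α, β]` and the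
marker values on `[α+1, β]`. Of the marker value at `α` one only knows that it exceeds these. -/
structure Skeleton where
  pos : ℤ
  dist : List Bool
  marks : List ℕ

/-- The translate of a skeleton. -/
def Skeleton.translate (S : Skeleton) (k : ℤ) : Skeleton := ⟨S.pos + k, S.dist, S.marks⟩

section Systems

variable {A : Type*}

/-- The skeleton of the point `x` on the interval `[m, m+n-1]`. -/
def skel (a : A) (ξ : (ℤ → Bool) → ℤ → ℕ) (x : ℤ → A) (m : ℤ) (n : ℕ) : Skeleton :=
  ⟨m, word (hat a x) m n, word (ξ (hat a x)) (m + 1) (n - 1)⟩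

/-- First coordinate of the `r`-skeleton `S_r(x)` that covers `x` at zero. -/
def left (a : A) (ξ : (ℤ → Bool) → ℤ → ℕ) (r : ℕ) (x : ℤ → A) : ℤ :=
  sSup {i : ℤ | i ≤ 0 ∧ r ≤ ξ (hat a x) i}

/-- First coordinate after the `r`-skeleton `S_r(x)` that covers `x` at zero. -/
def right (a : A) (ξ : (ℤ → Bool) → ℤ → ℕ) (r : ℕ) (x : ℤ → A) : ℤ :=
  sInf {i : ℤ | 0 < i ∧ r ≤ ξ (hat a x) i}

/-- The size `|S_r(x)|`. -/
def size (a : A) (ξ : (ℤ → Bool) → ℤ → ℕ) (r : ℕ) (x : ℤ → A) : ℕ :=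
  (right a ξ r x - left a ξ r x).toNat

/-- The skeleton `S_r(x)`. -/
def skel₀ (a : A) (ξ : (ℤ → Bool) → ℤ → ℕ) (r : ℕ) (x : ℤ → A) : Skeleton :=
  skel a ξ x (left a ξ r x) (size a ξ r x)

/-- The skeleton `S_r(x)` together with the filler `x_{S_r(x)}`. -/
def filler₀ (a : A) (ξ : (ℤ → Bool) → ℤ → ℕ) (r : ℕ) (x : ℤ → A) : Skeleton × List A :=
  (skel₀ a ξ r x, word x (left a ξ r x) (size a ξ r x))

/-- For every skeleton `S` an equivalence relation on words. Only its restriction to the fillers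
of `S`, the words whose 0-1 word is that of `S`, is ever used. -/
abbrev Relations (A : Type*) := Skeleton → Setoid (List A)

/-- The skeleton of `x` on `[m, m+n-1]` together with the class of the filler of `x` there. -/
def cls (a : A) (ξ : (ℤ → Bool) → ℤ → ℕ) (R : Relations A) (x : ℤ → A) (m : ℤ) (n : ℕ) :
    Skeleton × Set (List A) :=
  (skel a ξ x m n, {w | R (skel a ξ x m n) w (word x m n)})

/-- The class `[x_{S_r(x)}]`, together with `S_r(x)`. -/
def cls₀ (a : A) (ξ : (ℤ → Bool) → ℤ → ℕ) (R : Relations A) (r : ℕ) (x : ℤ → A) :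
    Skeleton × Set (List A) :=
  cls a ξ R x (left a ξ r x) (size a ξ r x)

open Classical in
/-- The pair `T, [x_T]` for the interval `T = [m, m+n-1]` if that carries a skeleton of `x`. -/
def clsAt (a : A) (ξ : (ℤ → Bool) → ℤ → ℕ) (R : Relations A) (m : ℤ) (n : ℕ) (x : ℤ → A) :
    Option (Skeleton × Set (List A)) :=
  if IsSkeleton (ξ (hat a x)) m n then some (cls a ξ R x m n) else none

variable [MeasurableSpace A]

/-- `ξ` is a nice marker factor of the distribution of `a`, with lengths sequence `L`. -/
structure IsNice (μ : Measure (ℤ → A)) (a : A) (ξ : (ℤ → Bool) → ℤ → ℕ) (L : ℕ → ℝ) : Prop where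
  marker : IsMarkerFactor (μ.map (hat a)) ξ
  tendsto : Tendsto L atTop atTop
  determined : WithHighProb μ L fun r =>
    Determines μ (fun x : ℤ → A => {i : ℤ | |(i : ℝ)| ≤ L r}.domRestrict x) (skel₀ a ξ r)
  size_bounds : ∃ c : ℝ, 0 < c ∧ WithHighProb μ L fun r =>
    {x | L r / Real.log (L r) ^ c ≤ size a ξ r x ∧ (size a ξ r x : ℝ) ≤ L r}

/-- System of fillers. -/
structure IsSOF (μ : Measure (ℤ → A)) (a : A) (ξ : (ℤ → Bool) → ℤ → ℕ) (R : Relations A) :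
    Prop where
  translation : ∀ (S : Skeleton) (k : ℤ), R (S.translate k) = R S
  /-- If two fillers of a skeleton `S` (on `[m, m+n-1]`) are equivalent, so are their restrictions
  to every sub-skeleton (on `[m', m'+n'-1]`), hence to all pieces of any decomposition of `S`. -/
  refines : ∀ᵐ x ∂μ, ∀ (m : ℤ) (n : ℕ) (m' : ℤ) (n' : ℕ),
    IsSkeleton (ξ (hat a x)) m n → IsSkeleton (ξ (hat a x)) m' n' →
    m ≤ m' → m' + n' ≤ m + n →
    ∀ z z' : ℤ → A, word (hat a z) m n = word (hat a x) m n →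
      word (hat a z') m n = word (hat a x) m n →
      R (skel a ξ x m n) (word z m n) (word z' m n) →
      R (skel a ξ x m' n') (word z m' n') (word z' m' n')
  /-- The expected fraction of coordinates of `S_r` that are determined by `[X_{S_r}]` tends
  to one. -/
  fraction : Tendsto (fun r : ℕ => ∫ x,
    (Set.ncard {i : ℤ | left a ξ r x ≤ i ∧ i < right a ξ r x ∧
      x ∈ Determines μ (cls₀ a ξ R r) fun y => y i} : ℝ) / size a ξ r x ∂μ) atTop (𝓝 1)

/-- The information `I_{μ_S}([x_S])` of the class of the filler of `x` on `S = [m, m+n-1]`. The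
measure `μ_S` on fillers is the law of `X_S` conditioned on `X̂_{[m,m+n]} = x̂_{[m,m+n]}`. -/
def classInfo (μ : Measure (ℤ → A)) (a : A) (ξ : (ℤ → Bool) → ℤ → ℕ) (R : Relations A)
    (x : ℤ → A) (m : ℤ) (n : ℕ) : ℝ :=
  -Real.log ((μ[|{y | word (hat a y) m (n + 1) = word (hat a x) m (n + 1)}]).real
    {y | R (skel a ξ x m n) (word y m n) (word x m n)})

/-- Good system of fillers. In the upper bound, the skeletons and classes of almost every point
are all those of positive probability. -/
structure IsGoodSOF (μ : Measure (ℤ → A)) (a : A) (ξ : (ℤ → Bool) → ℤ → ℕ) (L : ℕ → ℝ)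
    (R : Relations A) : Prop where
  sof : IsSOF μ a ξ R
  bounds : ∃ k K : ℝ, k ≤ K ∧
    (∃ n₀ : ℕ, ∀ᵐ x ∂μ, ∀ (m : ℤ) (n : ℕ), IsSkeleton (ξ (hat a x)) m n → n₀ ≤ n →
      classInfo μ a ξ R x m n ≤ n * condEntropyRate μ a - lam k n) ∧
    WithHighProb μ L fun r =>
      {x | size a ξ r x * condEntropyRate μ a - lam K (size a ξ r x) ≤
        classInfo μ a ξ R x (left a ξ r x) (size a ξ r x)}

/-- For any `0 < ε < 1/2`, with probability `1 - Δ(L_r)`, for every `η`-skeleton `T` (for the state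
`b`, on the interval `[m, m+n-1]`) that appears in `Z_{S_r}` and has size at least `|S_r|^ε`: if
`Z_{S_r}` determines `T, [Z_T]`, then `[Z_{S_r}]` determines `T, [Z_T]`. Here `S_r` is the
`ξ`-skeleton of rank `r` for the state `a` that covers zero. -/
def NestedFillers (μ : Measure (ℤ → A)) (a : A) (ξ : (ℤ → Bool) → ℤ → ℕ) (L : ℕ → ℝ)
    (R : Relations A) (b : A) (η : (ℤ → Bool) → ℤ → ℕ) (R' : Relations A) : Prop :=
  ∀ ε : ℝ, 0 < ε → ε < 1 / 2 → WithHighProb μ L fun r =>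
    {z | ∀ (m : ℤ) (n : ℕ), IsSkeleton (η (hat b z)) m n →
      left a ξ r z ≤ m → m + n ≤ right a ξ r z → (size a ξ r z : ℝ) ^ ε ≤ n →
      z ∈ Determines μ (filler₀ a ξ r) (clsAt b η R' m n) →
      z ∈ Determines μ (cls₀ a ξ R r) (clsAt b η R' m n)}

end Systems

end Fillers

end

noncomputable section

namespace Fillers

open Classical

set_option linter.unusedSectionVars false

/-! ### Words -/

section Words

variable {A : Type*}

/-! Both systems of fillers are built from one family of masks. Fix a return time ℓ of `a` whose
probability q lies strictly between 0 and 1. The level of a site is the number of consecutive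
`a`-blocks of length ℓ directly before the block that contains it; it depends only on the pattern of
the letters a, b, c. The mask of a word of length n shows its pattern and the symbols at sites of
known level below j = `lvl q n`, and hides all other symbols. About a fraction q^j of the sites is
hidden, and j is chosen so that q^j is about log³ n / √n. Hence the information of a typical mask is
below n h - √n log² n and above n h - √n log⁵ n, where h is the conditional entropy rate
(`condEntropyRate_eq` computes it from blocks). Longer words have higher thresholds, and less
context only makes levels unknown, so a mask determines the masks of all parts of the word, on
arbitrary intervals (`mask_sub`).

Masks alone do not suffice, since atypical fillers may have masks of too little mass. Let ψ(n) = n h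
- √n log² n for large n, modified so as to be nonnegative and superadditive. A filler is `Good` if
its mask class is heavy enough; good fillers are identified up to `ME`, while the others are
distinguished only through their restrictions to sub-skeletons. The danger is that the fillers which
are not good, left over beside good ones with the same restrictions, have mass below exp(-ψ(n)). The
key event `Kap` prevents this: the bits 1{symbol = k₀} at the sites of level exactly j begin with a
code word for n. These sites are hidden in the word itself. A filler with the key event is never
good, and goodness demands mass at least exp(-ψ(n)) both with and without the key event inside the
`ME`-class. So the leftover either contains the keyed half of a good class, or it consists of all
fillers with the given restrictions; in the second case its mass is estimated by induction, with the
renewal property at an interior mark of highest rank and the superadditivity of ψ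
(`exp_le_mass_rel`). The relation `ME` must also record the key events of proper parts. Those of
lower threshold are visible in the mask. For those of equal threshold the code words are
non-overlapping and name the length, so that with large conditional probability no proper part has
its key event (`not_kap_sub_of_code`, `Eb_noCode`).

Given the mask, the key bits are independent (`sum_wt_mask`), which gives the masses of mask classes
(`Unsplit.mass_mask`). The conditional information and the numbers of hidden symbols and of key
sites are controlled by supermartingales along the blocks of the renewal process
(`RenewalLaw.potential`). It follows that fillers of large skeletons are good with high probability,
which yields the bounds of a good system with exponents 2 and 5.

For the nesting, the class of a good filler determines its mask and the key events of all its parts,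
hence the class of the filler on every subinterval in either system: both systems use the same
scheme of masks, and goodness depends only on the `ME`-class and the key event. It remains to see
that the class determines the inner skeleton T. This skeleton is a function of the pattern. As the
symbols are independent of the pattern, what the whole filler says about the pattern is already said
by the pattern of the filler (`ae_pat_of_ae_word`), and the class shows that. -/

@[simp] lemma word_length (x : ℤ → A) (m : ℤ) (n : ℕ) : (word x m n).length = n := by
  simp [word]

@[simp] lemma word_zero (x : ℤ → A) (m : ℤ) : word x m 0 = [] := by simp [word]

lemma word_succ (x : ℤ → A) (m : ℤ) (n : ℕ) : word x m (n + 1) = x m :: word x (m + 1) n := by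
  simp only [word, List.ofFn_succ]
  congr 1
  · simp
  · congr 1
    funext i
    congr 1
    simp
    ring

lemma word_add (x : ℤ → A) (m : ℤ) (n k : ℕ) :
    word x m (n + k) = word x m n ++ word x (m + n) k := by
  induction n generalizing m with
  | zero => simp
  | succ n ih =>
    rw [show n + 1 + k = (n + k) + 1 by ring, word_succ, ih, word_succ]
    simp [add_comm, add_left_comm]

lemma word_snoc (x : ℤ → A) (m : ℤ) (n : ℕ) : word x m (n + 1) = word x m n ++ [x (m + n)] := by
  rw [word_add, word_succ, word_zero]

lemma word_map {B : Type*} (f : A → B) (x : ℤ → A) (m : ℤ) (n : ℕ) :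
    word (fun i => f (x i)) m n = (word x m n).map f := by
  simp [word, List.map_ofFn, Function.comp_def]

lemma word_sub (x : ℤ → A) (m : ℤ) {n i l : ℕ} (h : i + l ≤ n) :
    ((word x m n).drop i).take l = word x (m + i) l := by
  obtain ⟨k, rfl⟩ := Nat.exists_eq_add_of_le h
  rw [add_assoc, word_add, word_add]
  simp

lemma word_eq_iff (x : ℤ → A) (m : ℤ) (n : ℕ) (w : List A) :
    word x m n = w ↔ w.length = n ∧ ∀ i (h : i < w.length), x (m + i) = w[i] := by
  constructor
  · rintro rfl
    simp [word]
  · rintro ⟨rfl, h⟩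
    apply List.ext_getElem
    · simp
    · intro i h1 h2
      simp [word, h i h2]

lemma word_shift (x : ℤ → A) (m k : ℤ) (n : ℕ) :
    word (fun i => x (i + k)) m n = word x (m + k) n := by
  simp only [word]
  congr 1
  funext i
  congr 1
  ring

variable [Fintype A]

/-- All words of length `n`. -/
def words (A : Type*) [Fintype A] (n : ℕ) : Finset (List A) :=
  (Finset.univ : Finset (Fin n → A)).image List.ofFn

@[simp] lemma mem_words {n : ℕ} {w : List A} : w ∈ words A n ↔ w.length = n := by
  simp only [words, Finset.mem_image, Finset.mem_univ, true_and]
  constructor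
  · rintro ⟨f, rfl⟩
    simp
  · rintro rfl
    exact ⟨w.get, by simp⟩

lemma words_zero : words A 0 = {[]} := by
  ext w
  simp

lemma sum_words_succ (n : ℕ) (F : List A → ℝ) :
    ∑ w ∈ words A (n + 1), F w = ∑ a, ∑ w ∈ words A n, F (a :: w) := by
  rw [← Finset.sum_product']
  symm
  refine Finset.sum_bij (fun p _ => p.1 :: p.2) ?_ ?_ ?_ ?_
  · simp
  · rintro ⟨a, u⟩ _ ⟨b, v⟩ _ h
    simpa using h
  · intro w hw
    rw [mem_words] at hw
    obtain ⟨a, u, rfl⟩ := List.exists_cons_of_length_eq_add_one hw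
    exact ⟨(a, u), by simpa using hw, rfl⟩
  · simp

lemma sum_words_add (m n : ℕ) (F : List A → ℝ) :
    ∑ w ∈ words A (m + n), F w = ∑ u ∈ words A m, ∑ v ∈ words A n, F (u ++ v) := by
  induction m generalizing F with
  | zero => simp [words_zero]
  | succ m ih =>
    rw [show m + 1 + n = (m + n) + 1 by ring, sum_words_succ, sum_words_succ]
    refine Finset.sum_congr rfl fun a _ => ?_
    rw [ih]
    rfl

lemma sum_words_snoc (n : ℕ) (F : List A → ℝ) :
    ∑ w ∈ words A (n + 1), F w = ∑ w ∈ words A n, ∑ a, F (w ++ [a]) := by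
  rw [sum_words_add]
  refine Finset.sum_congr rfl fun u _ => ?_
  rw [← zero_add 1, sum_words_succ]
  simp [words_zero]

lemma card_words (n : ℕ) : (words A n).card = Fintype.card A ^ n := by
  rw [words, Finset.card_image_of_injective _ List.ofFn_injective]
  simp

/-- The words of length `n` in which `s` does not occur. -/
def frees (s : A) (n : ℕ) : Finset (List A) := (words A n).filter (s ∉ ·)

@[simp] lemma mem_frees {s : A} {n : ℕ} {w : List A} : w ∈ frees s n ↔ w.length = n ∧ s ∉ w := by
  simp [frees]

lemma frees_zero (s : A) : frees s 0 = {[]} := by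
  ext w
  simp only [mem_frees, List.length_eq_zero_iff, Finset.mem_singleton, and_iff_left_iff_imp]
  rintro rfl
  simp

lemma sum_frees (s : A) (n : ℕ) (F : List A → ℝ) :
    ∑ u ∈ frees s n, F u = ∑ u ∈ words A n, if s ∈ u then 0 else F u := by
  rw [frees, Finset.sum_filter]
  refine Finset.sum_congr rfl fun u _ => ?_
  by_cases h : s ∈ u <;> simp [h]

lemma sum_frees_succ (s : A) (n : ℕ) (F : List A → ℝ) :
    ∑ u ∈ frees s (n + 1), F u =
      ∑ a ∈ Finset.univ.erase s, ∑ u ∈ frees s n, F (a :: u) := by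
  rw [sum_frees, sum_words_succ, ← Finset.add_sum_erase _ _ (Finset.mem_univ s)]
  simp only [List.mem_cons, true_or, if_true, Finset.sum_const_zero, zero_add]
  refine Finset.sum_congr rfl fun a ha => ?_
  rw [sum_frees]
  refine Finset.sum_congr rfl fun u _ => ?_
  simp [(Finset.ne_of_mem_erase ha).symm]

lemma sum_frees_snoc (s : A) (n : ℕ) (F : List A → ℝ) :
    ∑ u ∈ frees s (n + 1), F u =
      ∑ u ∈ frees s n, ∑ a ∈ Finset.univ.erase s, F (u ++ [a]) := by
  rw [sum_frees, sum_words_snoc, sum_frees]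
  refine Finset.sum_congr rfl fun u _ => ?_
  rw [← Finset.add_sum_erase _ _ (Finset.mem_univ s)]
  by_cases h : s ∈ u
  · simp [h]
  · simp only [List.mem_append, List.mem_singleton, or_true, if_true, zero_add, h, false_or,
      if_false]
    refine Finset.sum_congr rfl fun a ha => ?_
    simp [(Finset.ne_of_mem_erase ha).symm]

/-- Words are decomposed at the first occurrence of `s`. -/
lemma sum_words_split (s : A) (n : ℕ) (F : List A → ℝ) :
    ∑ w ∈ words A n, F w =
      ∑ k ∈ Finset.range n, ∑ u ∈ frees s k, ∑ v ∈ words A (n - 1 - k), F (u ++ s :: v) +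
        ∑ u ∈ frees s n, F u := by
  induction n generalizing F with
  | zero => simp [words_zero, frees_zero]
  | succ n ih =>
    rw [sum_words_succ, ← Finset.add_sum_erase _ _ (Finset.mem_univ s), Finset.sum_range_succ',
      frees_zero, sum_frees_succ]
    have h : ∀ k ∈ Finset.range n,
        ∑ a ∈ Finset.univ.erase s, ∑ u ∈ frees s k, ∑ v ∈ words A (n - 1 - k),
          F (a :: (u ++ s :: v)) =
        ∑ u ∈ frees s (k + 1), ∑ v ∈ words A (n + 1 - 1 - (k + 1)), F (u ++ s :: v) := by
      intro k _
      rw [sum_frees_succ, show n + 1 - 1 - (k + 1) = n - 1 - k by omega]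
      simp
    rw [← Finset.sum_congr rfl h, Finset.sum_congr rfl fun a _ => ih fun w => F (a :: w),
      Finset.sum_add_distrib, Finset.sum_comm (s := Finset.univ.erase s) (t := Finset.range n)]
    simp
    ring

end Words

/-! ### Distributions of words -/

section WordLaw

variable {A : Type*} [MeasurableSpace A] [MeasurableSingletonClass A]

lemma measurableSet_word (m : ℤ) (n : ℕ) (w : List A) :
    MeasurableSet {x : ℤ → A | word x m n = w} := by
  simp only [word_eq_iff]
  by_cases h : w.length = n
  · subst h
    simp only [true_and]
    have : {x : ℤ → A | ∀ i (h : i < w.length), x (m + i) = w[i]} =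
        ⋂ i, ⋂ (h : i < w.length), (fun x : ℤ → A => x (m + i)) ⁻¹' {w[i]} := by
      ext x
      simp
    rw [this]
    exact MeasurableSet.iInter fun i => MeasurableSet.iInter fun h =>
      (measurable_pi_apply _) (measurableSet_singleton _)
  · simp [h]

/-- The probability of a word. -/
def pr (P : Measure (ℤ → A)) (w : List A) : ℝ := P.real {x | word x 0 w.length = w}

/-- The distribution of words does not depend on the place. -/
def WordStationary (P : Measure (ℤ → A)) : Prop :=
  ∀ (m : ℤ) (w : List A), P.real {x | word x m w.length = w} = pr P w

lemma wordStationary_of_measurePreserving {P : Measure (ℤ → A)}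
    (h : MeasurePreserving shift P P) : WordStationary P := by
  have key : ∀ (m : ℤ) (w : List A), P.real {x | word x (m + 1) w.length = w} =
      P.real {x | word x m w.length = w} := by
    intro m w
    have := h.measure_preimage (measurableSet_word m w.length w).nullMeasurableSet
    rw [measureReal_def, measureReal_def, ← this]
    congr 2
    ext x
    simp only [Set.mem_ofPred_eq, Set.mem_preimage]
    rw [show shift x = fun i => x (i + 1) from rfl, word_shift]
  intro m w
  induction m using Int.induction_on with
  | zero => rfl
  | succ i ih => rw [key, ih]
  | pred i ih => rw [← ih, ← key]; simp

variable [Fintype A]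

lemma real_word_mem (P : Measure (ℤ → A)) [IsFiniteMeasure P] (m : ℤ) (n : ℕ) (E : Set (List A)) :
    P.real {x | word x m n ∈ E} =
      ∑ w ∈ (words A n).filter (· ∈ E), P.real {x | word x m n = w} := by
  rw [← measureReal_biUnion_finset]
  · congr 1
    ext x
    simp
  · intro u _ v _ huv
    rw [Function.onFun, Set.disjoint_left]
    intro x hx hy
    exact huv (hx.symm.trans hy)
  · intro w _
    exact measurableSet_word m n w

lemma WordStationary.real_word_mem {P : Measure (ℤ → A)} [IsFiniteMeasure P]
    (h : WordStationary P) (m : ℤ) (n : ℕ) (E : Set (List A)) :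
    P.real {x | word x m n ∈ E} = ∑ w ∈ (words A n).filter (· ∈ E), pr P w := by
  rw [Fillers.real_word_mem]
  refine Finset.sum_congr rfl fun w hw => ?_
  obtain rfl : w.length = n := by simpa using (Finset.mem_filter.1 hw).1
  exact h m w

lemma integral_word (P : Measure (ℤ → A)) [IsFiniteMeasure P] (n : ℕ) (F : List A → ℝ) :
    ∫ x, F (word x 0 n) ∂P = ∑ w ∈ words A n, pr P w * F w := by
  have h : ∀ x : ℤ → A, F (word x 0 n) =
      ∑ w ∈ words A n, Set.indicator {x | word x 0 n = w} (fun _ => F w) x := by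
    intro x
    rw [Finset.sum_eq_single (word x 0 n)]
    · simp
    · intro b _ hb
      simp [hb.symm]
    · simp
  simp_rw [h]
  rw [integral_finsetSum]
  · refine Finset.sum_congr rfl fun w hw => ?_
    rw [integral_indicator_const _ (measurableSet_word 0 n w), smul_eq_mul, pr,
      mem_words.1 hw]
  · intro w _
    exact (integrable_const _).indicator (measurableSet_word 0 n w)

lemma pr_nonneg (P : Measure (ℤ → A)) (w : List A) : 0 ≤ pr P w := measureReal_nonneg

lemma pr_nil (P : Measure (ℤ → A)) [IsProbabilityMeasure P] : pr P [] = 1 := by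
  simp [pr]

lemma pr_snoc (P : Measure (ℤ → A)) [IsFiniteMeasure P] (w : List A) :
    ∑ a, pr P (w ++ [a]) = pr P w := by
  have h := measureReal_biUnion_finset (μ := P) (s := (Finset.univ : Finset A))
    (f := fun a => {x | word x 0 (w ++ [a]).length = w ++ [a]}) ?_ ?_
  · simp only [pr]
    rw [← h]
    congr 1
    ext x
    simp [word_snoc]
  · intro a _ b _ hab
    rw [Function.onFun, Set.disjoint_left]
    intro x hx hy
    simp only [Set.mem_ofPred_eq, List.length_append, List.length_singleton] at hx hy
    have := hx.symm.trans hy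
    simp at this
    exact hab this
  · intro a _
    exact measurableSet_word _ _ _

lemma WordStationary.pr_cons {P : Measure (ℤ → A)} [IsFiniteMeasure P] (hs : WordStationary P)
    (w : List A) : ∑ a, pr P (a :: w) = pr P w := by
  have h := measureReal_biUnion_finset (μ := P) (s := (Finset.univ : Finset A))
    (f := fun a => {x | word x 0 (a :: w).length = a :: w}) ?_ ?_
  · rw [← hs 1 w]
    simp only [pr]
    rw [← h]
    congr 1
    ext x
    simp [word_succ]
  · intro a _ b _ hab
    rw [Function.onFun, Set.disjoint_left]
    intro x hx hy
    have := hx.symm.trans hy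
    simp at this
    exact hab this
  · intro a _
    exact measurableSet_word _ _ _

end WordLaw



/-! ### Renewal laws on words -/

section Renewal

variable {A : Type*} [Fintype A]

/-- The distribution of words of a stationary process with the renewal state `s`, the return times
of which have exponential tails. -/
structure RenewalLaw (pr : List A → ℝ) (s : A) : Prop where
  nil : pr [] = 1
  nonneg : ∀ w, 0 ≤ pr w
  cons : ∀ w, ∑ a, pr (a :: w) = pr w
  snoc : ∀ w, ∑ a, pr (w ++ [a]) = pr w
  renewal : ∀ u v, pr (u ++ s :: v) * pr [s] = pr (u ++ [s]) * pr (s :: v)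
  pos : 0 < pr [s]
  tail : ∃ C ρ : ℝ, 0 < ρ ∧ ρ < 1 ∧ ∀ n, ∑ u ∈ frees s n, pr u ≤ C * ρ ^ n

/-- The word of occurrences of `s`. -/
def hw (s : A) (w : List A) : List Bool := w.map fun y => decide (y = s)

@[simp] lemma hw_length (s : A) (w : List A) : (hw s w).length = w.length := by simp [hw]

lemma hw_append (s : A) (u v : List A) : hw s (u ++ v) = hw s u ++ hw s v := by simp [hw]

lemma hw_append_eq {s : A} {u u' v v' : List A} (h : u.length = u'.length) :
    hw s (u ++ v) = hw s (u' ++ v') ↔ hw s u = hw s u' ∧ hw s v = hw s v' := by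
  rw [hw_append, hw_append]
  constructor
  · exact fun e => List.append_inj e (by simpa using h)
  · rintro ⟨e1, e2⟩
    rw [e1, e2]

lemma hw_cons_self {s a : A} {v v' : List A} :
    hw s (a :: v) = hw s (s :: v') ↔ a = s ∧ hw s v = hw s v' := by
  simp [hw]

lemma hw_eq_of_notMem {s : A} {u u' : List A} (hu : s ∉ u) (h : u'.length = u.length) :
    hw s u' = hw s u ↔ s ∉ u' := by
  have key : ∀ w : List A, s ∉ w ↔ hw s w = List.replicate w.length false := by
    intro w
    rw [List.eq_replicate_iff]
    simp [hw]
    exact ⟨fun h a ha hs => h (hs ▸ ha), fun h hs => h s hs rfl⟩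
  rw [key u', (key u).1 hu, h]

variable (pr : List A → ℝ) (s : A)

/-- The probability of the word of occurrences of `s` in `w`. -/
def hpr (w : List A) : ℝ := ∑ w' ∈ (words A w.length).filter (fun w' => hw s w' = hw s w), pr w'

/-- The probability that the word `v` follows an occurrence of `s`. -/
def p0 (v : List A) : ℝ := pr (s :: v) / pr [s]

/-- The probability that an occurrence of `s` is followed by the word `u` and another `s`. -/
def qb (u : List A) : ℝ := p0 pr s (u ++ [s])

/-- The distribution of return times. -/
def qh (n : ℕ) : ℝ := ∑ u ∈ frees s n, qb pr s u

/-- The tail of the distribution of return times. -/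
def tl (n : ℕ) : ℝ := ∑ u ∈ frees s n, p0 pr s u

/-- The probability that there is no `s` in an interval. -/
def zf (n : ℕ) : ℝ := ∑ u ∈ frees s n, pr u

/-- The probability that an occurrence of `s` is followed by given occurrences of `s`. -/
def h0 (v : List A) : ℝ := hpr pr s (s :: v) / pr [s]

/-- Conditional information of a word following `s`. -/
def D0 (v : List A) : ℝ := Real.log (h0 pr s v / p0 pr s v)

/-- Conditional information of a block. -/
def gb (u : List A) : ℝ := Real.log (qh pr s u.length / qb pr s u)

/-- The conditional entropy rate in terms of blocks. -/
def hrate : ℝ := pr [s] * ∑' k, ∑ u ∈ frees s k, qb pr s u * gb pr s u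

/-- The word is empty or ends with `s`. -/
def Ends (v : List A) : Prop := ∀ y ∈ v.getLast?, y = s

lemma ends_nil : Ends s [] := by simp [Ends]

lemma ends_snoc (v : List A) : Ends s (v ++ [s]) := by simp [Ends]

lemma ends_append (u v : List A) : Ends s (u ++ s :: v) ↔ Ends s v := by
  rcases List.eq_nil_or_concat v with rfl | ⟨v, y, rfl⟩
  · simp [Ends]
  · rw [List.concat_eq_append, ← List.cons_append, ← List.append_assoc, Ends, Ends,
      List.getLast?_concat, List.getLast?_concat]

lemma not_ends {u : List A} (h : s ∉ u) (hu : u ≠ []) : ¬ Ends s u := by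
  intro he
  apply h
  rw [← he _ (List.getLast?_eq_getLast_of_ne_nil hu)]
  exact List.getLast_mem hu

/-- The letter `s` is visible in the word of occurrences, so words with the same occurrences have
`s` at the same place and the sum splits there. -/
lemma hpr_split (u v : List A) : hpr pr s (u ++ s :: v) =
    ∑ u' ∈ (words A u.length).filter (fun u' => hw s u' = hw s u),
      ∑ v' ∈ (words A v.length).filter (fun v' => hw s v' = hw s v), pr (u' ++ s :: v') := by
  simp only [hpr]
  rw [Finset.sum_filter, List.length_append, List.length_cons, sum_words_add, Finset.sum_filter]
  refine Finset.sum_congr rfl fun u' hu' => ?_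
  rw [mem_words] at hu'
  simp_rw [hw_append_eq hu']
  by_cases h : hw s u' = hw s u
  · simp only [h, true_and, if_true]
    rw [sum_words_succ, ← Finset.add_sum_erase _ _ (Finset.mem_univ s), Finset.sum_filter]
    simp_rw [hw_cons_self]
    simp only [true_and]
    rw [add_eq_left]
    refine Finset.sum_eq_zero fun a ha => ?_
    simp [Finset.ne_of_mem_erase ha]
  · simp [h]

variable {pr s}

lemma sum_filter_nil (F : List A → ℝ) :
    ∑ v' ∈ (words A ([] : List A).length).filter (fun v' => hw s v' = hw s []), F v' = F [] := by
  simp [words_zero, Finset.sum_filter]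

lemma hpr_snoc (u : List A) : hpr pr s (u ++ [s]) =
    ∑ u' ∈ (words A u.length).filter (fun u' => hw s u' = hw s u), pr (u' ++ [s]) := by
  rw [hpr_split]
  simp_rw [sum_filter_nil]

lemma hpr_cons (v : List A) : hpr pr s (s :: v) =
    ∑ v' ∈ (words A v.length).filter (fun v' => hw s v' = hw s v), pr (s :: v') := by
  have := hpr_split pr s [] v
  rw [sum_filter_nil] at this
  exact this

lemma filter_frees {u : List A} (hu : s ∉ u) :
    (words A u.length).filter (fun u' => hw s u' = hw s u) = frees s u.length := by
  ext u'
  simp only [Finset.mem_filter, mem_words, mem_frees]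
  constructor
  · rintro ⟨h1, h2⟩
    exact ⟨h1, (hw_eq_of_notMem hu h1).1 h2⟩
  · rintro ⟨h1, h2⟩
    exact ⟨h1, (hw_eq_of_notMem hu h1).2 h2⟩

/-- The entropy of a distribution on a finite set is at most the logarithm of its cardinality. -/
lemma sum_mul_log_le {ι : Type*} (S : Finset ι) (f : ι → ℝ) (hf : ∀ i ∈ S, 0 ≤ f i) :
    ∑ i ∈ S, f i * Real.log ((∑ j ∈ S, f j) / f i) ≤ (∑ j ∈ S, f j) * Real.log S.card := by
  set T := ∑ j ∈ S, f j with hT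
  rcases S.eq_empty_or_nonempty with rfl | hS
  · simp [hT]
  have hc : (0 : ℝ) < S.card := by exact_mod_cast hS.card_pos
  have hT0 : 0 ≤ T := Finset.sum_nonneg hf
  have h : ∀ i ∈ S, f i * Real.log (T / f i) ≤ T / S.card - f i + f i * Real.log S.card := by
    intro i hi
    rcases (hf i hi).eq_or_lt with h0 | h0
    · rw [← h0]
      simp
      positivity
    · have hTi : 0 < T := h0.trans_le (Finset.single_le_sum hf hi)
      have e : Real.log (T / f i) = Real.log (T / (S.card * f i)) + Real.log S.card := by
        rw [← Real.log_mul (by positivity) (by positivity)]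
        congr 1
        field_simp
      have l := Real.log_le_sub_one_of_pos (show 0 < T / (S.card * f i) by positivity)
      rw [e]
      calc f i * (Real.log (T / (S.card * f i)) + Real.log S.card)
          ≤ f i * ((T / (S.card * f i) - 1) + Real.log S.card) := by gcongr
        _ = _ := by field_simp
  calc _ ≤ ∑ i ∈ S, (T / S.card - f i + f i * Real.log S.card) := Finset.sum_le_sum h
    _ = T * Real.log S.card := by
      rw [Finset.sum_add_distrib, Finset.sum_sub_distrib, ← Finset.sum_mul, ← hT]
      simp
      field_simp
      ring

lemma sum_mul_log_nonneg {ι : Type*} (S : Finset ι) (f : ι → ℝ) (hf : ∀ i ∈ S, 0 ≤ f i) :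
    0 ≤ ∑ i ∈ S, f i * Real.log ((∑ j ∈ S, f j) / f i) := by
  refine Finset.sum_nonneg fun i hi => ?_
  rcases (hf i hi).eq_or_lt with h0 | h0
  · simp [← h0]
  · refine mul_nonneg h0.le (Real.log_nonneg ?_)
    rw [le_div_iff₀ h0, one_mul]
    exact Finset.single_le_sum hf hi

lemma log_card_frees_le (n : ℕ) :
    Real.log (frees s n).card ≤ n * Real.log (Fintype.card A) := by
  have hc : (0 : ℝ) < Fintype.card A := by exact_mod_cast Fintype.card_pos_iff.2 ⟨s⟩
  rcases (frees s n).eq_empty_or_nonempty with h | h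
  · rw [h]
    simp
    refine mul_nonneg (by positivity) (Real.log_nonneg ?_)
    exact_mod_cast Fintype.card_pos_iff.2 ⟨s⟩
  · rw [← Real.log_pow]
    refine Real.log_le_log (by exact_mod_cast h.card_pos) ?_
    have := Finset.card_le_card (Finset.filter_subset (s ∉ ·) (words A n))
    rw [card_words] at this
    exact_mod_cast this

namespace RenewalLaw

variable (hr : RenewalLaw pr s)
include hr

lemma p0_nonneg (v : List A) : 0 ≤ p0 pr s v := div_nonneg (hr.nonneg _) hr.pos.le

lemma qb_nonneg (v : List A) : 0 ≤ qb pr s v := hr.p0_nonneg _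

lemma p0_nil : p0 pr s [] = 1 := div_self hr.pos.ne'

lemma pr_split (u v : List A) : pr (u ++ s :: v) = pr (u ++ [s]) * p0 pr s v := by
  rw [p0, mul_div_assoc', eq_div_iff hr.pos.ne']
  exact hr.renewal u v

lemma p0_split (u v : List A) : p0 pr s (u ++ s :: v) = qb pr s u * p0 pr s v := by
  rw [p0, ← List.cons_append, hr.pr_split, qb, mul_div_right_comm]
  rfl

lemma p0_snoc (w : List A) : ∑ a, p0 pr s (w ++ [a]) = p0 pr s w := by
  simp only [p0, ← Finset.sum_div]
  rw [← hr.snoc (s :: w)]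
  simp

lemma sum_p0 (n : ℕ) : ∑ v ∈ words A n, p0 pr s v = 1 := by
  induction n with
  | zero => simp [words_zero, hr.p0_nil]
  | succ n ih =>
    rw [sum_words_snoc, ← ih]
    exact Finset.sum_congr rfl fun w _ => hr.p0_snoc w

lemma sum_pr (n : ℕ) : ∑ v ∈ words A n, pr v = 1 := by
  induction n with
  | zero => simp [words_zero, hr.nil]
  | succ n ih =>
    rw [sum_words_snoc, ← ih]
    exact Finset.sum_congr rfl fun w _ => hr.snoc w

lemma tl_zero : tl pr s 0 = 1 := by simp [tl, frees_zero, hr.p0_nil]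

lemma zf_zero : zf pr s 0 = 1 := by simp [zf, frees_zero, hr.nil]

lemma tl_eq (n : ℕ) : tl pr s n = qh pr s n + tl pr s (n + 1) := by
  simp only [tl, qh, qb]
  rw [sum_frees_snoc, ← Finset.sum_add_distrib]
  refine Finset.sum_congr rfl fun u _ => ?_
  rw [Finset.add_sum_erase _ (fun a => p0 pr s (u ++ [a])) (Finset.mem_univ s), hr.p0_snoc]

/-- A free interval is extended by a letter on the left, which is either `s` or leaves the longer
interval free. Summation over n gives the formula for the total mass of the tails from which Kac's
lemma follows. -/
lemma zf_eq (n : ℕ) : zf pr s n = pr [s] * tl pr s n + zf pr s (n + 1) := by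
  simp only [tl, zf, p0]
  rw [sum_frees_succ, Finset.sum_comm, Finset.mul_sum, ← Finset.sum_add_distrib]
  refine Finset.sum_congr rfl fun u _ => ?_
  rw [mul_div_cancel₀ _ hr.pos.ne',
    Finset.add_sum_erase _ (fun a => pr (a :: u)) (Finset.mem_univ s), hr.cons]

lemma zf_eq' (n : ℕ) : zf pr s n = ∑ u ∈ frees s n, pr (u ++ [s]) + zf pr s (n + 1) := by
  simp only [zf]
  rw [sum_frees_snoc, ← Finset.sum_add_distrib]
  refine Finset.sum_congr rfl fun u _ => ?_
  rw [Finset.add_sum_erase _ (fun a => pr (u ++ [a])) (Finset.mem_univ s), hr.snoc]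

lemma tl_nonneg (n : ℕ) : 0 ≤ tl pr s n := Finset.sum_nonneg fun _ _ => hr.p0_nonneg _

lemma zf_nonneg (n : ℕ) : 0 ≤ zf pr s n := Finset.sum_nonneg fun _ _ => hr.nonneg _

lemma qh_nonneg (n : ℕ) : 0 ≤ qh pr s n := Finset.sum_nonneg fun _ _ => hr.qb_nonneg _

lemma qb_le_qh {u : List A} (hu : s ∉ u) : qb pr s u ≤ qh pr s u.length :=
  Finset.single_le_sum (f := qb pr s) (fun _ _ => hr.qb_nonneg _) (by simp [hu])

lemma gb_nonneg {u : List A} (hu : s ∉ u) : 0 ≤ gb pr s u := by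
  rcases (hr.qb_nonneg u).eq_or_lt with h0 | h0
  · simp [gb, ← h0]
  · refine Real.log_nonneg ?_
    rw [le_div_iff₀ h0, one_mul]
    exact hr.qb_le_qh hu

/-- The exponential bound for free intervals passes to the tails of return times by `zf_eq` and to
the return times themselves by `tl_eq`. -/
lemma exists_tail : ∃ C ρ : ℝ, 0 < C ∧ 0 < ρ ∧ ρ < 1 ∧ (∀ n, zf pr s n ≤ C * ρ ^ n) ∧
    (∀ n, tl pr s n ≤ C * ρ ^ n) ∧ ∀ n, qh pr s n ≤ C * ρ ^ n := by
  obtain ⟨C, ρ, h0, h1, h⟩ := hr.tail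
  have hC : 0 < C := by
    have := h 0
    rw [← zf, hr.zf_zero] at this
    simp at this
    linarith
  have hp1 : pr [s] ≤ 1 := by
    rw [← hr.sum_pr 1]
    exact Finset.single_le_sum (f := pr) (fun _ _ => hr.nonneg _) (by simp)
  have ht : ∀ n, tl pr s n ≤ C / pr [s] * ρ ^ n := by
    intro n
    have := hr.zf_eq n
    have h2 : zf pr s n ≤ C * ρ ^ n := h n
    have h3 := hr.zf_nonneg (n + 1)
    rw [div_mul_eq_mul_div, le_div_iff₀ hr.pos]
    linarith
  refine ⟨C / pr [s], ρ, div_pos hC hr.pos, h0, h1, ?_, ht, ?_⟩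
  · intro n
    refine (h n).trans ?_
    gcongr
    rw [le_div_iff₀ hr.pos]
    nlinarith
  · intro n
    have := hr.tl_eq n
    have h3 := hr.tl_nonneg (n + 1)
    linarith [ht n]

lemma sum_range_tl (n : ℕ) : ∑ k ∈ Finset.range n, pr [s] * tl pr s k = 1 - zf pr s n := by
  induction n with
  | zero => simp [hr.zf_zero]
  | succ n ih =>
    rw [Finset.sum_range_succ, ih]
    linarith [hr.zf_eq n]

lemma sum_range_qh (n : ℕ) : ∑ k ∈ Finset.range n, qh pr s k = 1 - tl pr s n := by
  induction n with
  | zero => simp [hr.tl_zero]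
  | succ n ih =>
    rw [Finset.sum_range_succ, ih]
    linarith [hr.tl_eq n]

lemma sum_range_mul_qh (n : ℕ) : ∑ k ∈ Finset.range n, ((k : ℝ) + 1) * qh pr s k =
    ∑ k ∈ Finset.range n, tl pr s k - n * tl pr s n := by
  induction n with
  | zero => simp
  | succ n ih =>
    rw [Finset.sum_range_succ, ih, Finset.sum_range_succ, hr.tl_eq n]
    push_cast
    ring

lemma sum_range_mul_zf (n : ℕ) :
    ∑ k ∈ Finset.range n, ((k : ℝ) + 1) * (zf pr s k - zf pr s (k + 1)) =
      ∑ k ∈ Finset.range n, zf pr s k - n * zf pr s n := by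
  induction n with
  | zero => simp
  | succ n ih =>
    rw [Finset.sum_range_succ, ih, Finset.sum_range_succ]
    push_cast
    ring

lemma tendsto_tl : Tendsto (tl pr s) atTop (𝓝 0) := by
  obtain ⟨C, ρ, hC, h0, h1, -, h, -⟩ := hr.exists_tail
  refine squeeze_zero hr.tl_nonneg h ?_
  simpa using (tendsto_pow_atTop_nhds_zero_of_lt_one h0.le h1).const_mul C

lemma tendsto_zf : Tendsto (zf pr s) atTop (𝓝 0) := by
  obtain ⟨C, ρ, hC, h0, h1, h, -, -⟩ := hr.exists_tail
  refine squeeze_zero hr.zf_nonneg h ?_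
  simpa using (tendsto_pow_atTop_nhds_zero_of_lt_one h0.le h1).const_mul C

lemma tendsto_mul_tl : Tendsto (fun n : ℕ => (n : ℝ) * tl pr s n) atTop (𝓝 0) := by
  obtain ⟨C, ρ, hC, h0, h1, -, h, -⟩ := hr.exists_tail
  refine squeeze_zero (fun n => mul_nonneg n.cast_nonneg (hr.tl_nonneg n))
    (fun n => mul_le_mul_of_nonneg_left (h n) n.cast_nonneg) ?_
  have := (tendsto_self_mul_const_pow_of_lt_one h0.le h1).const_mul C
  simp only [mul_zero] at this
  refine this.congr fun n => ?_
  ring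

lemma hasSum_qh : HasSum (qh pr s) 1 := by
  rw [hasSum_iff_tendsto_nat_of_nonneg hr.qh_nonneg]
  simp_rw [hr.sum_range_qh]
  simpa using tendsto_const_nhds.sub hr.tendsto_tl

lemma hasSum_tl : HasSum (tl pr s) (1 / pr [s]) := by
  rw [hasSum_iff_tendsto_nat_of_nonneg hr.tl_nonneg]
  have : ∀ n, ∑ k ∈ Finset.range n, tl pr s k = (1 - zf pr s n) / pr [s] := by
    intro n
    rw [← hr.sum_range_tl, ← Finset.mul_sum, mul_div_cancel_left₀ _ hr.pos.ne']
  simp_rw [this]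
  simpa using ((tendsto_const_nhds (x := (1 : ℝ))).sub hr.tendsto_zf).div_const (pr [s])

/-- Kac's lemma. -/
lemma hasSum_mul_qh : HasSum (fun k : ℕ => ((k : ℝ) + 1) * qh pr s k) (1 / pr [s]) := by
  rw [hasSum_iff_tendsto_nat_of_nonneg fun k => mul_nonneg (by positivity) (hr.qh_nonneg k)]
  simp_rw [hr.sum_range_mul_qh]
  simpa using hr.hasSum_tl.tendsto_sum_nat.sub hr.tendsto_mul_tl

lemma sum_range_qh_le (n : ℕ) : ∑ k ∈ Finset.range n, qh pr s k ≤ 1 := by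
  rw [hr.sum_range_qh]
  linarith [hr.tl_nonneg n]

lemma h0_free {u : List A} (hu : s ∉ u) : h0 pr s u = tl pr s u.length := by
  rw [h0, hpr_cons, filter_frees hu, tl, Finset.sum_div]
  rfl

lemma h0_split (u v : List A) : h0 pr s (u ++ s :: v) = h0 pr s (u ++ [s]) * h0 pr s v := by
  have key : ∀ u v, hpr pr s (u ++ s :: v) * pr [s] = hpr pr s (u ++ [s]) * hpr pr s (s :: v) := by
    intro u v
    rw [hpr_split, hpr_snoc, hpr_cons, Finset.sum_mul_sum, Finset.sum_mul]
    refine Finset.sum_congr rfl fun u' _ => ?_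
    rw [Finset.sum_mul]
    exact Finset.sum_congr rfl fun v' _ => hr.renewal u' v'
  simp only [h0]
  rw [← List.cons_append, ← List.cons_append, div_mul_div_comm,
    div_eq_div_iff hr.pos.ne' (mul_pos hr.pos hr.pos).ne', ← key]
  ring

lemma hpr_split' (u v : List A) :
    hpr pr s (u ++ s :: v) = hpr pr s (u ++ [s]) * h0 pr s v := by
  rw [h0, hpr_split, hpr_snoc, hpr_cons, mul_div_assoc', eq_div_iff hr.pos.ne',
    Finset.sum_mul_sum, Finset.sum_mul]
  refine Finset.sum_congr rfl fun u' _ => ?_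
  rw [Finset.sum_mul]
  exact Finset.sum_congr rfl fun v' _ => hr.renewal u' v'

lemma h0_block {u : List A} (hu : s ∉ u) : h0 pr s (u ++ [s]) = qh pr s u.length := by
  rw [h0, ← List.cons_append, hpr_snoc, qh]
  have e : (words A (s :: u).length).filter (fun u' => hw s u' = hw s (s :: u)) =
      (frees s u.length).image (s :: ·) := by
    ext w
    simp only [Finset.mem_filter, mem_words, Finset.mem_image, mem_frees, List.length_cons]
    constructor
    · rintro ⟨h1, h2⟩
      obtain ⟨a, v, rfl⟩ := List.exists_cons_of_length_eq_add_one h1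
      rw [hw_cons_self] at h2
      simp at h1
      exact ⟨v, ⟨h1, (hw_eq_of_notMem hu h1).1 h2.2⟩, by rw [h2.1]⟩
    · rintro ⟨v, ⟨h1, h2⟩, rfl⟩
      exact ⟨by simp [h1], hw_cons_self.2 ⟨rfl, (hw_eq_of_notMem hu h1).2 h2⟩⟩
  rw [e, Finset.sum_image (by simp), Finset.sum_div]
  rfl

lemma p0_le_h0 (v : List A) : p0 pr s v ≤ h0 pr s v := by
  rw [h0, hpr_cons, p0]
  gcongr
  · exact hr.pos.le
  · exact Finset.single_le_sum (f := fun v => pr (s :: v)) (fun _ _ => hr.nonneg _) (by simp)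

lemma pr_le_hpr (w : List A) : pr w ≤ hpr pr s w :=
  Finset.single_le_sum (f := pr) (fun _ _ => hr.nonneg _) (by simp)

/-- Both probabilities in `D0` factor at a renewal, so the conditional information is additive along
blocks. -/
lemma D0_split {u v : List A} (hu : s ∉ u) (h : 0 < p0 pr s (u ++ s :: v)) :
    D0 pr s (u ++ s :: v) = gb pr s u + D0 pr s v := by
  have h' := h
  rw [hr.p0_split] at h'
  have hv : 0 < p0 pr s v := (hr.p0_nonneg v).lt_of_ne fun e => by simp [← e] at h'
  have hq : 0 < qb pr s u := (hr.qb_nonneg u).lt_of_ne fun e => by simp [← e] at h'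
  have h1 := hv.trans_le (hr.p0_le_h0 v)
  have h2 := hq.trans_le (hr.qb_le_qh hu)
  rw [D0, hr.p0_split, hr.h0_split, hr.h0_block hu, gb, D0, ← Real.log_mul (by positivity)
    (by positivity)]
  congr 1
  field_simp

/-- Supermartingales along the blocks of a renewal process. -/
theorem potential {σ : Type*} (next : σ → List A → σ) (W : σ → List A → ℝ) (G : σ → ℝ)
    (F : σ → List A → ℝ) (hF0 : ∀ t, F t [] ≤ G t)
    (hF : ∀ t u v, s ∉ u → 0 < p0 pr s (u ++ s :: v) →
      F t (u ++ s :: v) ≤ W t u * F (next t u) v)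
    (hW : ∀ t u, 0 ≤ W t u)
    (hG : ∀ t N, ∑ k ∈ Finset.range N, ∑ u ∈ frees s k, qb pr s u * W t u * G (next t u) ≤ G t)
    (t : σ) (n : ℕ) :
    ∑ v ∈ (words A n).filter (Ends s), p0 pr s v * F t v ≤ G t := by
  induction n using Nat.strong_induction_on generalizing t with
  | _ n ih =>
    rw [Finset.sum_filter, sum_words_split s]
    rcases Nat.eq_zero_or_pos n with rfl | hn
    · simpa [frees_zero, ends_nil, hr.p0_nil] using hF0 t
    have e1 : ∑ u ∈ frees s n, (if Ends s u then p0 pr s u * F t u else 0) = 0 := by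
      refine Finset.sum_eq_zero fun u hu => if_neg (not_ends s (mem_frees.1 hu).2 ?_)
      rintro rfl
      simp at hu
      omega
    rw [e1, add_zero]
    -- The word is cut at its first `s`. The rest is a shorter word that follows an `s`, to which
    -- the induction hypothesis applies in the state `next t u`.
    refine le_trans (Finset.sum_le_sum fun k hk => Finset.sum_le_sum fun u hu => ?_) (hG t n)
    rw [Finset.mem_range] at hk
    rw [mem_frees] at hu
    simp_rw [ends_append]
    rw [← Finset.sum_filter]
    calc ∑ v ∈ (words A (n - 1 - k)).filter (Ends s), p0 pr s (u ++ s :: v) * F t (u ++ s :: v)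
        ≤ ∑ v ∈ (words A (n - 1 - k)).filter (Ends s),
            qb pr s u * W t u * (p0 pr s v * F (next t u) v) := by
          refine Finset.sum_le_sum fun v _ => ?_
          rcases (hr.p0_nonneg (u ++ s :: v)).eq_or_lt with h | h
          · have h2 := hr.p0_split u v
            rw [← h] at h2
            rw [← h, zero_mul, show qb pr s u * W t u * (p0 pr s v * F (next t u) v) =
              (qb pr s u * p0 pr s v) * (W t u * F (next t u) v) by ring, ← h2, zero_mul]
          · calc _ ≤ p0 pr s (u ++ s :: v) * (W t u * F (next t u) v) :=
                  mul_le_mul_of_nonneg_left (hF t u v hu.2 h) h.le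
              _ = _ := by rw [hr.p0_split]; ring
      _ ≤ qb pr s u * W t u * G (next t u) := by
          rw [← Finset.mul_sum]
          exact mul_le_mul_of_nonneg_left (ih _ (by omega) _)
            (mul_nonneg (hr.qb_nonneg u) (hW t u))

end RenewalLaw

end Renewal



/-! ### Exponential moments of blocks and concentration of the conditional information. -/

section Concentration

variable {A : Type*} [Fintype A] {pr : List A → ℝ} {s : A}

/-- Serves to expand moment generating functions to second order while only an exponential moment of
the remainder is required. -/
lemma exp_le_quadratic (y : ℝ) : Real.exp y ≤ 1 + y + y ^ 2 * Real.exp |y| := by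
  rcases le_or_gt |y| 1 with h | h
  · have h1 := (abs_le.1 (Real.abs_exp_sub_one_sub_id_le h)).2
    have h2 : 1 ≤ Real.exp |y| := Real.one_le_exp (abs_nonneg y)
    nlinarith [sq_nonneg y]
  · rcases le_or_gt 0 y with h0 | h0
    · rw [abs_of_nonneg h0] at h ⊢
      nlinarith [mul_nonneg (Real.exp_pos y).le (show 0 ≤ y ^ 2 - 1 by nlinarith)]
    · rw [abs_of_neg h0] at h ⊢
      have h1 : Real.exp y ≤ 1 := Real.exp_le_one_iff.2 h0.le
      have h2 : 1 ≤ Real.exp (-y) := Real.one_le_exp (by linarith)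
      nlinarith [sq_nonneg y, mul_nonneg (sq_nonneg y) (sub_nonneg.2 h2)]

namespace RenewalLaw

variable (hr : RenewalLaw pr s)
include hr

/-- Exponential moments of the lengths and of the information of blocks. -/
lemma exp_moment : ∃ l C r : ℝ, 0 < l ∧ 0 ≤ C ∧ 0 ≤ r ∧ r < 1 ∧ ∀ k : ℕ,
    ∑ u ∈ frees s k, qb pr s u * Real.exp (l * (gb pr s u + (k + 1))) ≤ C * r ^ k := by
  obtain ⟨C, ρ, hC, h0, h1, -, -, hq⟩ := hr.exists_tail
  set N : ℝ := (Fintype.card A : ℝ) with hN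
  have hN1 : 1 ≤ N := by
    rw [hN]
    exact_mod_cast Fintype.card_pos_iff.2 ⟨s⟩
  set c : ℝ := 2 * Real.log N with hc
  have hc0 : 0 ≤ c := by have := Real.log_nonneg hN1; positivity
  have hlρ : 0 < -Real.log ρ := by linarith [Real.log_neg h0 h1]
  -- The second bound makes the factor exp(l (c + 1) (k + 1)) use up only half of the decay rate of
  -- ρ^k.
  set l : ℝ := min (1 / 2) (-Real.log ρ / (2 * (c + 1))) with hl
  have hl0 : 0 < l := lt_min (by norm_num) (by positivity)
  have hl2 : l ≤ 1 / 2 := min_le_left _ _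
  have hl3 : l * (c + 1) ≤ -Real.log ρ / 2 := by
    have : l ≤ -Real.log ρ / (2 * (c + 1)) := min_le_right _ _
    rw [le_div_iff₀ (by positivity)] at this
    linarith
  set r : ℝ := Real.exp (Real.log ρ / 2) with hrr
  have hr1 : r < 1 := Real.exp_lt_one_iff.2 (by linarith)
  refine ⟨l, 2 * C * Real.exp (-Real.log ρ / 2), r, hl0, by positivity, (Real.exp_pos _).le, hr1,
    fun k => ?_⟩
  -- Blocks of information at most c (k + 1) are bounded directly. For the others qb = qh exp(-gb),
  -- and since l ≤ 1/2 the product is at most qh exp(-gb / 2) ≤ qh N^(-k), which is summable over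
  -- the at most N^k blocks of this length.
  have key : ∀ u ∈ frees s k, qb pr s u * Real.exp (l * gb pr s u) ≤
      qb pr s u * Real.exp (l * (c * (k + 1))) + qh pr s k * (N ^ k)⁻¹ := by
    intro u hu
    rw [mem_frees] at hu
    have hq0 := hr.qh_nonneg k
    rcases (hr.qb_nonneg u).eq_or_lt with e | e
    · rw [← e]
      simp
      positivity
    rcases le_or_gt (gb pr s u) (c * (k + 1)) with h | h
    · have : qb pr s u * Real.exp (l * gb pr s u) ≤ qb pr s u * Real.exp (l * (c * (k + 1))) := by
        gcongr
      have : 0 ≤ qh pr s k * (N ^ k)⁻¹ := by positivity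
      linarith
    · have hqk : 0 < qh pr s k := by
        rw [← hu.1]
        exact e.trans_le (hr.qb_le_qh hu.2)
      have e1 : qb pr s u = qh pr s k * Real.exp (-gb pr s u) := by
        rw [gb, hu.1, ← Real.log_inv, Real.exp_log (by positivity)]
        field_simp
      have e2 : (N ^ k)⁻¹ = Real.exp (-(k * Real.log N)) := by
        rw [Real.exp_neg, ← Real.log_pow, Real.exp_log (by positivity)]
      have e3 : qb pr s u * Real.exp (l * gb pr s u) ≤ qh pr s k * (N ^ k)⁻¹ := by
        rw [e1, mul_assoc, ← Real.exp_add, e2]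
        gcongr
        have hg := hr.gb_nonneg hu.2
        have := Real.log_nonneg hN1
        have : l * gb pr s u ≤ 1 / 2 * gb pr s u := by gcongr
        have h3 : (k : ℝ) * Real.log N ≤ 1 / 2 * (c * (k + 1)) := by
          rw [hc]
          nlinarith
        linarith
      have : 0 ≤ qb pr s u * Real.exp (l * (c * (k + 1))) := by positivity
      linarith
  have hcard : ((frees s k).card : ℝ) ≤ N ^ k := by
    have := Finset.card_le_card (Finset.filter_subset (s ∉ ·) (words A k))
    rw [card_words] at this
    rw [hN]
    exact_mod_cast this
  have hsum : ∑ u ∈ frees s k, qb pr s u * Real.exp (l * gb pr s u) ≤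
      2 * qh pr s k * Real.exp (l * (c * (k + 1))) := by
    refine (Finset.sum_le_sum key).trans ?_
    rw [Finset.sum_add_distrib, ← Finset.sum_mul, ← qh, Finset.sum_const, nsmul_eq_mul]
    have h4 : ((frees s k).card : ℝ) * (qh pr s k * (N ^ k)⁻¹) ≤ qh pr s k := by
      calc _ ≤ N ^ k * (qh pr s k * (N ^ k)⁻¹) := by
            have := hr.qh_nonneg k
            gcongr
        _ = qh pr s k := by field_simp
    have h5 : qh pr s k ≤ qh pr s k * Real.exp (l * (c * (k + 1))) :=
      le_mul_of_one_le_right (hr.qh_nonneg k) (Real.one_le_exp (by positivity))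
    linarith
  calc ∑ u ∈ frees s k, qb pr s u * Real.exp (l * (gb pr s u + (k + 1)))
      = (∑ u ∈ frees s k, qb pr s u * Real.exp (l * gb pr s u)) * Real.exp (l * (k + 1)) := by
        rw [Finset.sum_mul]
        refine Finset.sum_congr rfl fun u _ => ?_
        rw [mul_add, Real.exp_add]
        ring
    _ ≤ 2 * qh pr s k * Real.exp (l * (c * (k + 1))) * Real.exp (l * (k + 1)) := by gcongr
    _ = 2 * qh pr s k * Real.exp (l * (c + 1) * (k + 1)) := by
        rw [mul_assoc, ← Real.exp_add]
        congr 2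
        ring
    _ ≤ 2 * (C * ρ ^ k) * Real.exp (-Real.log ρ / 2 * (k + 1)) := by
        gcongr
        exact hq k
    _ = 2 * C * Real.exp (-Real.log ρ / 2) * r ^ k := by
        have e1 : ρ ^ k = Real.exp (k * Real.log ρ) := by
          rw [← Real.log_pow, Real.exp_log (by positivity)]
        rw [e1, hrr, ← Real.exp_nat_mul]
        rw [show 2 * (C * Real.exp (k * Real.log ρ)) * Real.exp (-Real.log ρ / 2 * (k + 1)) =
          2 * C * (Real.exp (k * Real.log ρ) * Real.exp (-Real.log ρ / 2 * (k + 1))) by ring,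
          mul_assoc (2 * C), ← Real.exp_add, ← Real.exp_add]
        congr 2
        ring

lemma summable_gb : Summable fun k => ∑ u ∈ frees s k, qb pr s u * gb pr s u := by
  obtain ⟨l, C, r, hl, hC, h0, h1, h⟩ := hr.exp_moment
  refine Summable.of_nonneg_of_le (fun k => Finset.sum_nonneg fun u hu => ?_) (fun k => ?_)
    ((summable_geometric_of_lt_one h0 h1).mul_left (l⁻¹ * C))
  · exact mul_nonneg (hr.qb_nonneg u) (hr.gb_nonneg (mem_frees.1 hu).2)
  · rw [mul_assoc]
    refine le_trans ?_ (mul_le_mul_of_nonneg_left (h k) (by positivity))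
    rw [Finset.mul_sum]
    refine Finset.sum_le_sum fun u hu => ?_
    rw [mul_left_comm]
    refine mul_le_mul_of_nonneg_left ?_ (hr.qb_nonneg u)
    rw [inv_mul_eq_div, le_div_iff₀ hl]
    have := Real.add_one_le_exp (l * (gb pr s u + (k + 1)))
    nlinarith

lemma hasSum_gb : HasSum (fun k => ∑ u ∈ frees s k, qb pr s u * gb pr s u)
    (hrate pr s / pr [s]) := by
  rw [hrate, mul_div_cancel_left₀ _ hr.pos.ne']
  exact hr.summable_gb.hasSum

lemma hrate_nonneg : 0 ≤ hrate pr s := by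
  refine mul_nonneg hr.pos.le (tsum_nonneg fun k => Finset.sum_nonneg fun u hu => ?_)
  exact mul_nonneg (hr.qb_nonneg u) (hr.gb_nonneg (mem_frees.1 hu).2)

/-- The information of a block minus `hrate` times its length has mean zero, by the definition of
`hrate` and Kac's lemma. So the linear term of the expansion in t vanishes, and the exponential
moment bounds the quadratic one. -/
lemma mgf_block : ∃ t₀ C : ℝ, 0 < t₀ ∧ 0 ≤ C ∧ ∀ t, |t| ≤ t₀ → ∀ N : ℕ,
    ∑ k ∈ Finset.range N, ∑ u ∈ frees s k,
      qb pr s u * Real.exp (t * (gb pr s u - hrate pr s * (k + 1))) ≤ Real.exp (C * t ^ 2) := by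
  obtain ⟨l, C, r, hl, hC, h0, h1, h⟩ := hr.exp_moment
  set H := hrate pr s with hH
  have hH0 : 0 ≤ H := hr.hrate_nonneg
  set B : ℝ := 1 + H with hB
  have hB0 : 0 < B := by positivity
  set C3 : ℝ := B ^ 2 * (8 / l ^ 2) with hC3
  have hM : Summable fun k => ∑ u ∈ frees s k, qb pr s u * Real.exp (l * (gb pr s u + (k + 1))) :=
    Summable.of_nonneg_of_le (fun k => Finset.sum_nonneg fun u _ =>
      mul_nonneg (hr.qb_nonneg u) (Real.exp_pos _).le) h
      ((summable_geometric_of_lt_one h0 h1).mul_left C)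
  obtain ⟨M, hM⟩ := hM
  have hM0 : 0 ≤ M := hM.nonneg fun k => Finset.sum_nonneg fun u _ =>
      mul_nonneg (hr.qb_nonneg u) (Real.exp_pos _).le
  refine ⟨l / (2 * B), C3 * M, by positivity, by positivity, fun t ht N => ?_⟩
  have point : ∀ k : ℕ, ∀ u ∈ frees s k, Real.exp (t * (gb pr s u - H * (k + 1))) ≤
      1 + t * (gb pr s u - H * (k + 1)) +
        t ^ 2 * C3 * Real.exp (l * (gb pr s u + (k + 1))) := by
    intro k u hu
    have hg := hr.gb_nonneg (mem_frees.1 hu).2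
    set g := gb pr s u
    set X := g - H * (k + 1) with hX
    set Y := g + (k + 1) with hY
    have hY0 : 0 ≤ Y := by positivity
    have hXY : |X| ≤ B * Y := by
      rw [abs_le, hX, hY, hB]
      have : (0 : ℝ) ≤ k := k.cast_nonneg
      constructor <;> nlinarith [mul_nonneg hH0 hg, mul_nonneg hH0 this]
    have h2 : |t * X| ≤ l / 2 * Y := by
      rw [abs_mul]
      calc |t| * |X| ≤ l / (2 * B) * (B * Y) := by gcongr
        _ = _ := by field_simp
    refine (exp_le_quadratic _).trans (add_le_add le_rfl ?_)
    have h3 : (t * X) ^ 2 ≤ t ^ 2 * (B * Y) ^ 2 := by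
      rw [mul_pow]
      gcongr t ^ 2 * ?_
      rw [← sq_abs X]
      gcongr
    have h4 : Y ^ 2 ≤ 8 / l ^ 2 * Real.exp (l / 2 * Y) := by
      have := Real.quadratic_le_exp_of_nonneg (show 0 ≤ l / 2 * Y by positivity)
      have h5 : (l / 2 * Y) ^ 2 / 2 ≤ Real.exp (l / 2 * Y) := by
        have : 0 ≤ l / 2 * Y := by positivity
        linarith
      calc Y ^ 2 = 8 / l ^ 2 * ((l / 2 * Y) ^ 2 / 2) := by field_simp; ring
        _ ≤ _ := by gcongr
    calc (t * X) ^ 2 * Real.exp |t * X| ≤ t ^ 2 * (B * Y) ^ 2 * Real.exp (l / 2 * Y) := by gcongr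
      _ = t ^ 2 * B ^ 2 * Y ^ 2 * Real.exp (l / 2 * Y) := by ring
      _ ≤ t ^ 2 * B ^ 2 * (8 / l ^ 2 * Real.exp (l / 2 * Y)) * Real.exp (l / 2 * Y) := by gcongr
      _ = t ^ 2 * C3 * (Real.exp (l / 2 * Y) * Real.exp (l / 2 * Y)) := by rw [hC3]; ring
      _ = t ^ 2 * C3 * Real.exp (l * Y) := by rw [← Real.exp_add]; congr 2; ring
  set R : ℕ → ℝ := fun k => qh pr s k +
    t * (∑ u ∈ frees s k, qb pr s u * gb pr s u - H * ((k + 1) * qh pr s k)) +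
      t ^ 2 * C3 * ∑ u ∈ frees s k, qb pr s u * Real.exp (l * (gb pr s u + (k + 1))) with hR
  -- The bracket multiplied by t is zero: this is the centering of the blocks.
  have hsum : HasSum R (1 + t * (H / pr [s] - H * (1 / pr [s])) + t ^ 2 * C3 * M) :=
    (hr.hasSum_qh.add ((hr.hasSum_gb.sub (hr.hasSum_mul_qh.mul_left H)).mul_left t)).add
      (hM.mul_left _)
  have hle : ∀ k, ∑ u ∈ frees s k, qb pr s u * Real.exp (t * (gb pr s u - H * (k + 1))) ≤ R k := by
    intro k
    refine (Finset.sum_le_sum fun u hu => mul_le_mul_of_nonneg_left (point k u hu)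
      (hr.qb_nonneg u)).trans (le_of_eq ?_)
    simp only [hR, qh, Finset.mul_sum, ← Finset.sum_add_distrib, ← Finset.sum_sub_distrib]
    refine Finset.sum_congr rfl fun u _ => ?_
    ring
  have hR0 : ∀ k, 0 ≤ R k := fun k => le_trans (Finset.sum_nonneg fun u _ =>
      mul_nonneg (hr.qb_nonneg u) (Real.exp_pos _).le) (hle k)
  calc _ ≤ ∑ k ∈ Finset.range N, R k := Finset.sum_le_sum fun k _ => hle k
    _ ≤ 1 + t * (H / pr [s] - H * (1 / pr [s])) + t ^ 2 * C3 * M :=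
      sum_le_hasSum _ (fun k _ => hR0 k) hsum
    _ = C3 * M * t ^ 2 + 1 := by ring
    _ ≤ _ := Real.add_one_le_exp _

/-- Concentration of the conditional information. -/
theorem concentration : ∃ t₀ C : ℝ, 0 < t₀ ∧ 0 ≤ C ∧ ∀ t, 0 < t → t ≤ t₀ → ∀ (n : ℕ) (τ : ℝ),
    ∑ v ∈ (words A n).filter (fun v => Ends s v ∧ τ ≤ |D0 pr s v - hrate pr s * n|), p0 pr s v ≤
      2 * Real.exp (C * t ^ 2 * n - t * τ) := by
  obtain ⟨t₀, C, ht₀, hC, h⟩ := hr.mgf_block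
  refine ⟨t₀, C, ht₀, hC, fun t ht htt n τ => ?_⟩
  -- The potential is constant. The weight exp(-C t'²) pays for the moment generating function of
  -- one block, and a word of length n has at most n blocks.
  have one : ∀ t', |t'| ≤ t₀ → ∑ v ∈ (words A n).filter (Ends s),
      p0 pr s v * Real.exp (t' * (D0 pr s v - hrate pr s * n)) ≤ Real.exp (C * t' ^ 2 * n) := by
    intro t' ht'
    have := hr.potential (σ := Unit) (fun _ _ => ())
      (fun _ u => Real.exp (t' * (gb pr s u - hrate pr s * (u.length + 1))) *
        Real.exp (-(C * t' ^ 2))) (fun _ => 1)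
      (fun _ v => Real.exp (t' * (D0 pr s v - hrate pr s * v.length)) *
        Real.exp (-(C * t' ^ 2 * v.length))) ?_ ?_ ?_ ?_ () n
    · rw [Finset.sum_congr rfl (g := fun v => p0 pr s v *
        Real.exp (t' * (D0 pr s v - hrate pr s * n)) * Real.exp (-(C * t' ^ 2 * n)))] at this
      · rwa [← Finset.sum_mul, Real.exp_neg, ← div_eq_mul_inv, div_le_one (Real.exp_pos _)] at this
      · intro v hv
        simp only [Finset.mem_filter, mem_words] at hv
        rw [hv.1]
        ring
    · intro _
      have : D0 pr s [] = 0 := by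
        have h1 := hr.h0_free (u := []) (by simp)
        simp only [List.length_nil, hr.tl_zero] at h1
        simp [D0, hr.p0_nil, h1]
      simp [this]
    · intro _ u v hu hp
      rw [hr.D0_split hu hp, ← Real.exp_add, ← Real.exp_add, ← Real.exp_add, ← Real.exp_add]
      apply Real.exp_le_exp.2
      simp only [List.length_append, List.length_cons]
      push_cast
      have : 0 ≤ C * t' ^ 2 * u.length := by positivity
      linarith
    · intro _ u
      positivity
    · intro _ N
      have := h t' ht' N
      simp only [mul_one]
      rw [← div_le_one (Real.exp_pos _), div_eq_mul_inv, ← Real.exp_neg, Finset.sum_mul] at this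
      refine le_trans (le_of_eq ?_) this
      refine Finset.sum_congr rfl fun k _ => ?_
      rw [Finset.sum_mul]
      refine Finset.sum_congr rfl fun u hu => ?_
      rw [(mem_frees.1 hu).1]
      ring
  have h1 := one t (by rwa [abs_of_pos ht])
  have h2 := one (-t) (by rwa [abs_neg, abs_of_pos ht])
  rw [neg_sq] at h2
  calc _ ≤ ∑ v ∈ (words A n).filter (Ends s),
        (p0 pr s v * Real.exp (t * (D0 pr s v - hrate pr s * n)) +
          p0 pr s v * Real.exp (-t * (D0 pr s v - hrate pr s * n))) * Real.exp (-(t * τ)) := by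
        rw [← Finset.filter_filter, Finset.sum_filter]
        refine Finset.sum_le_sum fun v _ => ?_
        have hp := hr.p0_nonneg v
        split_ifs with hv
        · rw [← mul_add, mul_assoc]
          refine le_mul_of_one_le_right hp ?_
          rw [add_mul, ← Real.exp_add, ← Real.exp_add]
          rcases le_abs.1 hv with h3 | h3
          · have h4 : 1 ≤ Real.exp (t * (D0 pr s v - hrate pr s * n) + -(t * τ)) :=
              Real.one_le_exp (by nlinarith)
            have := Real.exp_pos (-t * (D0 pr s v - hrate pr s * n) + -(t * τ))
            linarith
          · have h4 : 1 ≤ Real.exp (-t * (D0 pr s v - hrate pr s * n) + -(t * τ)) :=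
              Real.one_le_exp (by nlinarith)
            have := Real.exp_pos (t * (D0 pr s v - hrate pr s * n) + -(t * τ))
            linarith
        · positivity
    _ ≤ (Real.exp (C * t ^ 2 * n) + Real.exp (C * t ^ 2 * n)) * Real.exp (-(t * τ)) := by
        rw [← Finset.sum_mul, Finset.sum_add_distrib]
        gcongr
    _ = _ := by
        rw [sub_eq_add_neg, Real.exp_add]
        ring

end RenewalLaw

/-! ### The conditional entropy rate -/

namespace RenewalLaw

variable (hr : RenewalLaw pr s)
include hr

/-- The renewal equation for the mean conditional information: by additivity, a first block of
length k + 1 contributes its own information and then restarts the process. -/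
lemma sum_D0_rec (n : ℕ) : ∑ v ∈ words A n, p0 pr s v * D0 pr s v =
    ∑ k ∈ Finset.range n, (∑ u ∈ frees s k, qb pr s u * gb pr s u +
      qh pr s k * ∑ v ∈ words A (n - 1 - k), p0 pr s v * D0 pr s v) +
    ∑ u ∈ frees s n, p0 pr s u * Real.log (tl pr s n / p0 pr s u) := by
  rw [sum_words_split s]
  congr 1
  · refine Finset.sum_congr rfl fun k _ => ?_
    rw [qh, Finset.sum_mul, ← Finset.sum_add_distrib]
    refine Finset.sum_congr rfl fun u hu => ?_
    rw [← mul_one (qb pr s u * gb pr s u), ← hr.sum_p0 (n - 1 - k), Finset.mul_sum,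
      Finset.mul_sum, ← Finset.sum_add_distrib]
    refine Finset.sum_congr rfl fun v _ => ?_
    rcases (hr.p0_nonneg (u ++ s :: v)).eq_or_lt with h | h
    · have h2 := hr.p0_split u v
      rw [← h] at h2
      rw [← h]
      linear_combination (gb pr s u + D0 pr s v) * h2
    · rw [hr.D0_split (mem_frees.1 hu).2 h, hr.p0_split]
      ring
  · refine Finset.sum_congr rfl fun u hu => ?_
    rw [mem_frees] at hu
    rw [D0, hr.h0_free hu.2, hu.1]

/-- The same decomposition for a word that does not start at a renewal: the part before the first
`s` is treated separately, and the part behind it has the law of words following `s`. -/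
lemma sum_D_rec (n : ℕ) : ∑ w ∈ words A n, pr w * Real.log (hpr pr s w / pr w) =
    ∑ k ∈ Finset.range n,
      (∑ u ∈ frees s k, pr (u ++ [s]) *
          Real.log ((∑ u' ∈ frees s k, pr (u' ++ [s])) / pr (u ++ [s])) +
        (zf pr s k - zf pr s (k + 1)) * ∑ v ∈ words A (n - 1 - k), p0 pr s v * D0 pr s v) +
    ∑ u ∈ frees s n, pr u * Real.log (zf pr s n / pr u) := by
  rw [sum_words_split s]
  congr 1
  · refine Finset.sum_congr rfl fun k _ => ?_
    rw [show zf pr s k - zf pr s (k + 1) = ∑ u ∈ frees s k, pr (u ++ [s]) by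
      linarith [hr.zf_eq' k], Finset.sum_mul, ← Finset.sum_add_distrib]
    refine Finset.sum_congr rfl fun u hu => ?_
    set T := ∑ u' ∈ frees s k, pr (u' ++ [s]) with hT
    have hTu : hpr pr s (u ++ [s]) = T := by
      rw [mem_frees] at hu
      rw [hpr_snoc, filter_frees hu.2, hu.1]
    rw [← mul_one (pr (u ++ [s]) * Real.log (T / pr (u ++ [s]))), ← hr.sum_p0 (n - 1 - k),
      Finset.mul_sum, Finset.mul_sum, ← Finset.sum_add_distrib]
    refine Finset.sum_congr rfl fun v _ => ?_
    rw [hr.pr_split]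
    rcases (hr.p0_nonneg v).eq_or_lt with h | h
    · simp [← h]
    rcases (hr.nonneg (u ++ [s])).eq_or_lt with h' | h'
    · simp [← h']
    have h1 := h.trans_le (hr.p0_le_h0 v)
    have h2 : 0 < T := by
      rw [← hTu]
      exact h'.trans_le (hr.pr_le_hpr _)
    have e : Real.log (hpr pr s (u ++ s :: v) / (pr (u ++ [s]) * p0 pr s v)) =
        Real.log (T / pr (u ++ [s])) + D0 pr s v := by
      rw [hr.hpr_split', hTu, D0, ← Real.log_mul (by positivity) (by positivity)]
      congr 1
      field_simp
    rw [e]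
    ring
  · refine Finset.sum_congr rfl fun u hu => ?_
    rw [mem_frees] at hu
    rw [hpr, filter_frees hu.2, hu.1, zf]

/-- The conditional entropies of words following `s` grow linearly. -/
lemma exists_sum_D0_bound : ∃ b : ℕ → ℝ, Monotone b ∧ (∀ n, 0 ≤ b n) ∧
    Tendsto (fun n : ℕ => b n / n) atTop (𝓝 0) ∧
    ∀ n, |∑ v ∈ words A n, p0 pr s v * D0 pr s v - hrate pr s * n| ≤ b n := by
  set H := hrate pr s with hH
  set f : ℕ → ℝ := fun n => ∑ v ∈ words A n, p0 pr s v * D0 pr s v with hf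
  set r : ℕ → ℝ := fun n => ∑ u ∈ frees s n, p0 pr s u * Real.log (tl pr s n / p0 pr s u) with hrr
  -- The inhomogeneity of the renewal equation for f n - H n. It tends to zero since the mean
  -- information of a block is H / pr [s] and the tails of the return times sum to 1 / pr [s].
  set c : ℕ → ℝ := fun n => ∑ k ∈ Finset.range n, ∑ u ∈ frees s k, qb pr s u * gb pr s u + r n -
    H * ∑ k ∈ Finset.range n, tl pr s k with hc
  have hr0 : Tendsto r atTop (𝓝 0) := by
    refine squeeze_zero (fun n => sum_mul_log_nonneg _ _ fun u _ => hr.p0_nonneg u)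
      (g := fun n => (n * tl pr s n) * Real.log (Fintype.card A)) (fun n => ?_) ?_
    · refine (sum_mul_log_le _ _ fun u _ => hr.p0_nonneg u).trans ?_
      rw [show (n * tl pr s n) * Real.log (Fintype.card A) =
        tl pr s n * (n * Real.log (Fintype.card A)) by ring]
      exact mul_le_mul_of_nonneg_left (log_card_frees_le n) (hr.tl_nonneg n)
    · simpa using hr.tendsto_mul_tl.mul_const (Real.log (Fintype.card A))
  have hc0 : Tendsto c atTop (𝓝 0) := by
    have := (hr.hasSum_gb.tendsto_sum_nat.add hr0).sub
      (hr.hasSum_tl.tendsto_sum_nat.const_mul H)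
    rwa [← hH, show H / pr [s] + 0 - H * (1 / pr [s]) = 0 by ring] at this
  have hrec : ∀ n, f n - H * n =
      c n + ∑ k ∈ Finset.range n, qh pr s k * (f (n - 1 - k) - H * (n - 1 - k : ℕ)) := by
    intro n
    have h1 := hr.sum_D0_rec n
    have h2 : ∑ k ∈ Finset.range n, qh pr s k * (n - 1 - k : ℕ) =
        n - ∑ k ∈ Finset.range n, tl pr s k := by
      have h3 : ∑ k ∈ Finset.range n, qh pr s k * (n - 1 - k : ℕ) =
          n * ∑ k ∈ Finset.range n, qh pr s k -
            ∑ k ∈ Finset.range n, ((k : ℝ) + 1) * qh pr s k := by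
        rw [Finset.mul_sum, ← Finset.sum_sub_distrib]
        refine Finset.sum_congr rfl fun k hk => ?_
        rw [Finset.mem_range] at hk
        have : ((n - 1 - k : ℕ) : ℝ) = n - (k + 1) := by
          rw [show n - 1 - k = n - (k + 1) by omega, Nat.cast_sub (by omega)]
          push_cast
          ring
        rw [this]
        ring
      rw [h3, hr.sum_range_qh, hr.sum_range_mul_qh]
      ring
    have h4 : ∑ k ∈ Finset.range n, qh pr s k * (f (n - 1 - k) - H * (n - 1 - k : ℕ)) =
        ∑ k ∈ Finset.range n, qh pr s k * f (n - 1 - k) -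
          H * ∑ k ∈ Finset.range n, qh pr s k * (n - 1 - k : ℕ) := by
      rw [Finset.mul_sum, ← Finset.sum_sub_distrib]
      refine Finset.sum_congr rfl fun k _ => ?_
      ring
    rw [h4, h2]
    simp only [hc, hf]
    rw [h1, Finset.sum_add_distrib]
    ring
  -- As the return probabilities sum to at most one, the solution of the renewal equation is at most
  -- the sum of the |c j|, and that is o(n) by Cesàro.
  set b : ℕ → ℝ := fun n => ∑ j ∈ Finset.range (n + 1), |c j| with hb
  have hbm : Monotone b := by
    intro m n hmn
    exact Finset.sum_le_sum_of_subset_of_nonneg (Finset.range_mono (by omega))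
      fun _ _ _ => abs_nonneg _
  have hb0 : ∀ n, 0 ≤ b n := fun n => Finset.sum_nonneg fun _ _ => abs_nonneg _
  refine ⟨b, hbm, hb0, ?_, ?_⟩
  · have h1 : Tendsto (fun n => |c n|) atTop (𝓝 0) := by simpa using hc0.abs
    have h2 := h1.cesaro
    have h3 : Tendsto (fun n : ℕ => |c n| / n) atTop (𝓝 0) :=
      h1.div_atTop tendsto_natCast_atTop_atTop
    have := h2.add h3
    rw [add_zero] at this
    refine this.congr fun n => ?_
    rw [hb]
    simp only [Finset.sum_range_succ]
    ring
  · intro n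
    induction n using Nat.strong_induction_on with
    | _ n ih =>
      have := hrec n
      simp only [hf] at this ih
      rw [this]
      rcases Nat.eq_zero_or_pos n with rfl | hn
      · simp [hb]
      refine (abs_add_le _ _).trans ?_
      have h1 : |∑ k ∈ Finset.range n, qh pr s k *
          (f (n - 1 - k) - H * (n - 1 - k : ℕ))| ≤ b (n - 1) := by
        calc _ ≤ ∑ k ∈ Finset.range n, qh pr s k * b (n - 1) := by
              refine (Finset.abs_sum_le_sum_abs _ _).trans (Finset.sum_le_sum fun k hk => ?_)
              rw [Finset.mem_range] at hk
              rw [abs_mul, abs_of_nonneg (hr.qh_nonneg k)]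
              refine mul_le_mul_of_nonneg_left ?_ (hr.qh_nonneg k)
              exact (ih _ (by omega)).trans (hbm (by omega))
          _ ≤ b (n - 1) := by
              rw [← Finset.sum_mul]
              exact mul_le_of_le_one_left (hb0 _) (hr.sum_range_qh_le n)
      have h2 : b n = b (n - 1) + |c n| := by
        simp only [hb]
        rw [Finset.sum_range_succ, show n - 1 + 1 = n by omega]
      rw [h2]
      linarith

/-- Up to a bounded error the mean information is that of a word starting at a renewal: the waiting
time for the first `s` has finite mean, and the entropy of the part before it is at most its length
times log |A|. -/
theorem tendsto_sum_D : Tendsto (fun n : ℕ =>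
    (∑ w ∈ words A n, pr w * Real.log (hpr pr s w / pr w)) / n) atTop (𝓝 (hrate pr s)) := by
  obtain ⟨b, hbm, hb0, hb, hf⟩ := hr.exists_sum_D0_bound
  set H := hrate pr s with hH
  have hH0 : 0 ≤ H := hr.hrate_nonneg
  obtain ⟨C, ρ, hC, hρ0, hρ1, hz, -, -⟩ := hr.exists_tail
  set La := Real.log (Fintype.card A)
  have hLa : 0 ≤ La := Real.log_natCast_nonneg _
  have hzs : ∀ n, ∑ k ∈ Finset.range n, zf pr s k ≤ C * (1 - ρ)⁻¹ := by
    intro n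
    calc _ ≤ ∑ k ∈ Finset.range n, C * ρ ^ k := Finset.sum_le_sum fun k _ => hz k
      _ ≤ C * (1 - ρ)⁻¹ := by
        rw [← Finset.mul_sum]
        gcongr
        exact sum_le_hasSum _ (fun k _ => by positivity) (hasSum_geometric_of_lt_one hρ0.le hρ1)
  have key : ∀ n : ℕ, 0 < n → |∑ w ∈ words A n, pr w * Real.log (hpr pr s w / pr w) - H * n| ≤
      b n + (H + La) * (C * (1 - ρ)⁻¹) := by
    intro n hn
    set zd : ℕ → ℝ := fun k => zf pr s k - zf pr s (k + 1) with hzd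
    have hzd' : ∀ k, zd k = ∑ u ∈ frees s k, pr (u ++ [s]) := fun k => by
      have := hr.zf_eq' k
      simp only [hzd]
      linarith
    have hzd0 : ∀ k, 0 ≤ zd k := fun k => by
      rw [hzd']
      exact Finset.sum_nonneg fun _ _ => hr.nonneg _
    set f : ℕ → ℝ := fun n => ∑ v ∈ words A n, p0 pr s v * D0 pr s v with hfd
    set β : ℕ → ℝ := fun k => ∑ u ∈ frees s k, pr (u ++ [s]) *
          Real.log ((∑ u' ∈ frees s k, pr (u' ++ [s])) / pr (u ++ [s])) with hβ
    set r' := ∑ u ∈ frees s n, pr u * Real.log (zf pr s n / pr u) with hr'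
    have hβ0 : ∀ k, 0 ≤ β k := fun k => sum_mul_log_nonneg _ _ fun u _ => hr.nonneg _
    have hβ1 : ∀ k, β k ≤ zd k * ((k + 1) * La) := fun k => by
      refine (sum_mul_log_le _ _ fun u _ => hr.nonneg _).trans ?_
      rw [← hzd']
      refine mul_le_mul_of_nonneg_left ((log_card_frees_le k).trans ?_) (hzd0 k)
      gcongr
      linarith
    have hr'0 : 0 ≤ r' := sum_mul_log_nonneg _ _ fun u _ => hr.nonneg _
    have hr'1 : r' ≤ zf pr s n * (n * La) :=
      (sum_mul_log_le _ _ fun u _ => hr.nonneg _).trans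
        (mul_le_mul_of_nonneg_left (log_card_frees_le n) (hr.zf_nonneg n))
    have hzdsum : ∑ k ∈ Finset.range n, zd k = 1 - zf pr s n := by
      simp only [hzd]
      rw [Finset.sum_range_sub', hr.zf_zero]
    have hzdm := hr.sum_range_mul_zf n
    have e : ∑ w ∈ words A n, pr w * Real.log (hpr pr s w / pr w) - H * n =
        ∑ k ∈ Finset.range n, zd k * (f (n - 1 - k) - H * (n - 1 - k : ℕ)) +
          (∑ k ∈ Finset.range n, β k + r') -
          H * (∑ k ∈ Finset.range n, ((k : ℝ) + 1) * zd k + n * zf pr s n) := by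
      have h1 : ∑ k ∈ Finset.range n, zd k * (f (n - 1 - k) - H * (n - 1 - k : ℕ)) =
          ∑ k ∈ Finset.range n, zd k * f (n - 1 - k) - H * (n * ∑ k ∈ Finset.range n, zd k) +
            H * ∑ k ∈ Finset.range n, ((k : ℝ) + 1) * zd k := by
        rw [Finset.mul_sum, Finset.mul_sum, Finset.mul_sum, ← Finset.sum_sub_distrib,
          ← Finset.sum_add_distrib]
        refine Finset.sum_congr rfl fun k hk => ?_
        rw [Finset.mem_range] at hk
        have : ((n - 1 - k : ℕ) : ℝ) = n - (k + 1) := by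
          rw [show n - 1 - k = n - (k + 1) by omega, Nat.cast_sub (by omega)]
          push_cast
          ring
        rw [this]
        ring
      rw [h1, hr.sum_D_rec n, Finset.sum_add_distrib, hzdsum]
      ring
    have h1 : |∑ k ∈ Finset.range n, zd k * (f (n - 1 - k) - H * (n - 1 - k : ℕ))| ≤ b n := by
      calc _ ≤ ∑ k ∈ Finset.range n, zd k * b n := by
            refine (Finset.abs_sum_le_sum_abs _ _).trans (Finset.sum_le_sum fun k hk => ?_)
            rw [abs_mul, abs_of_nonneg (hzd0 k)]
            exact mul_le_mul_of_nonneg_left ((hf _).trans (hbm (by omega))) (hzd0 k)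
        _ ≤ b n := by
            rw [← Finset.sum_mul, hzdsum]
            exact mul_le_of_le_one_left (hb0 _) (by linarith [hr.zf_nonneg n])
    have h2 : 0 ≤ ∑ k ∈ Finset.range n, β k + r' :=
      add_nonneg (Finset.sum_nonneg fun k _ => hβ0 k) hr'0
    have h3 : ∑ k ∈ Finset.range n, β k + r' ≤
        La * (∑ k ∈ Finset.range n, ((k : ℝ) + 1) * zd k + n * zf pr s n) := by
      have : ∑ k ∈ Finset.range n, β k ≤ La * ∑ k ∈ Finset.range n, ((k : ℝ) + 1) * zd k := by
        rw [Finset.mul_sum]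
        refine Finset.sum_le_sum fun k _ => (hβ1 k).trans (le_of_eq ?_)
        ring
      linarith
    have hS : ∑ k ∈ Finset.range n, ((k : ℝ) + 1) * zd k + n * zf pr s n ≤ C * (1 - ρ)⁻¹ := by
      simp only [hzd]
      rw [hzdm]
      linarith [hzs n]
    have hS0 : 0 ≤ ∑ k ∈ Finset.range n, ((k : ℝ) + 1) * zd k + n * zf pr s n :=
      add_nonneg (Finset.sum_nonneg fun k _ => mul_nonneg (by positivity) (hzd0 k))
        (mul_nonneg n.cast_nonneg (hr.zf_nonneg n))
    generalize ∑ k ∈ Finset.range n, ((k : ℝ) + 1) * zd k + n * zf pr s n = S at *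
    have h4 : H * S ≤ H * (C * (1 - ρ)⁻¹) := by gcongr
    have h5 : La * S ≤ La * (C * (1 - ρ)⁻¹) := by gcongr
    have h6 : 0 ≤ H * S := by positivity
    have h7 : 0 ≤ La * S := by positivity
    rw [e, abs_le]
    rw [abs_le] at h1
    have h8 : (H + La) * (C * (1 - ρ)⁻¹) = H * (C * (1 - ρ)⁻¹) + La * (C * (1 - ρ)⁻¹) := by ring
    rw [h8]
    obtain ⟨h1a, h1b⟩ := h1
    have h9 : 0 ≤ La * (C * (1 - ρ)⁻¹) := h7.trans h5
    have h10 : 0 ≤ H * (C * (1 - ρ)⁻¹) := h6.trans h4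
    constructor
    · linarith only [h1a, h2, h4, h9]
    · linarith only [h1b, h3, h5, h6, h10]
  rw [tendsto_iff_norm_sub_tendsto_zero]
  refine squeeze_zero' (Eventually.of_forall fun n => norm_nonneg _)
    (g := fun n : ℕ => b n / n + (H + La) * (C * (1 - ρ)⁻¹) / n) ?_ ?_
  · filter_upwards [eventually_gt_atTop 0] with n hn
    have hn' : (0 : ℝ) < n := by exact_mod_cast hn
    rw [Real.norm_eq_abs, ← add_div, le_div_iff₀ hn', ← abs_of_pos hn', ← abs_mul,
      abs_of_pos hn', sub_mul, div_mul_cancel₀ _ hn'.ne']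
    exact key n hn
  · simpa using hb.add (tendsto_const_nhds.div_atTop tendsto_natCast_atTop_atTop)

end RenewalLaw

end Concentration

/-- Almost every point shows only words of positive probability, for which the difference of the two
informations is log (hpr / pr). The limit superior is then a limit, by `tendsto_sum_D`. -/
lemma condEntropyRate_eq {A : Type*} [Fintype A] [MeasurableSpace A] [MeasurableSingletonClass A]
    {P : Measure (ℤ → A)} [IsProbabilityMeasure P] {s : A} (hr : RenewalLaw (pr P) s) :
    condEntropyRate P s = hrate (pr P) s := by
  rw [condEntropyRate]
  refine Tendsto.limsup_eq (hr.tendsto_sum_D.congr fun n => ?_)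
  congr 1
  rw [← integral_word P n fun w => Real.log (hpr (pr P) s w / pr P w)]
  refine integral_congr_ae ?_
  have hae : ∀ᵐ x ∂P, 0 < pr P (word x 0 n) := by
    rw [ae_iff]
    have : {x : ℤ → A | ¬ 0 < pr P (word x 0 n)} =
        {x | word x 0 n ∈ {w | ¬ 0 < pr P w}} := rfl
    rw [this, ← measureReal_eq_zero_iff, real_word_mem]
    refine Finset.sum_eq_zero fun w hw => ?_
    simp only [Finset.mem_filter, mem_words, Set.mem_ofPred_eq, not_lt] at hw
    rw [← hw.1]
    exact le_antisymm hw.2 (pr_nonneg P w)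
  filter_upwards [hae] with x hx
  have e1 : P.real {y | word y 0 n = word x 0 n} = pr P (word x 0 n) := by simp [pr]
  have e2 : P.real {y | word (hat s y) 0 n = word (hat s x) 0 n} =
      hpr (pr P) s (word x 0 n) := by
    have e3 : ∀ y : ℤ → A, word (hat s y) 0 n = hw s (word y 0 n) := fun y =>
    word_map (fun a => decide (a = s)) y 0 n
    simp_rw [e3]
    rw [show {y : ℤ → A | hw s (word y 0 n) = hw s (word x 0 n)} =
      {y | word y 0 n ∈ {w | hw s w = hw s (word x 0 n)}} from rfl, real_word_mem, hpr,
      word_length]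
    refine Finset.sum_congr (by ext w; simp) fun w hw => ?_
    rw [pr, mem_words.1 (Finset.mem_filter.1 hw).1]
  rw [info, info, e1, e2, Real.log_div ?_ hx.ne']
  · ring
  · exact (hx.trans_le (hr.pr_le_hpr _)).ne'



/-! ### Levels of sites -/

section Levels

variable {K : Type*}

/-- The level of the present site (the number of `a`-blocks of length `ℓ` that directly precede the
present one, if known), and the number of sites since the last `a` (if there was one). -/
abbrev LState := Option ℕ × Option ℕ

/-- Passing to the next site. -/
def lstep (ℓ : ℕ) (t : LState) : Split K → LState
  | Split.a => (match t.2 with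
      | none => none
      | some k => if k + 1 = ℓ then t.1.map (· + 1) else some 0, some 0)
  | _ => (t.1, t.2.map (· + 1))

/-- Passing to the end of a word. -/
def adv (ℓ : ℕ) (t : LState) (w : List (Split K)) : LState := w.foldl (lstep ℓ) t

@[simp] lemma adv_nil (ℓ : ℕ) (t : LState) : adv ℓ t ([] : List (Split K)) = t := rfl

@[simp] lemma adv_cons (ℓ : ℕ) (t : LState) (x : Split K) (w : List (Split K)) :
    adv ℓ t (x :: w) = adv ℓ (lstep ℓ t x) w := rfl

/-- `t'` holds part of the knowledge of `t`. -/
def LLe (t' t : LState) : Prop := t' = t ∨ t'.1 = none ∧ (t'.2 = none ∨ t'.2 = t.2)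

lemma LLe.init (t : LState) : LLe (none, none) t := Or.inr ⟨rfl, Or.inl rfl⟩

/-- Partial knowledge stays partial or becomes complete: a first `a` reveals the position inside the
block, and the first block of a length other than ℓ sets the level to zero whatever it was before.
-/
lemma LLe.lstep {ℓ : ℕ} {t' t : LState} (h : LLe t' t) (x : Split K) :
    LLe (lstep ℓ t' x) (lstep ℓ t x) := by
  rcases h with rfl | ⟨h1, h2⟩
  · exact Or.inl rfl
  obtain ⟨t1', t2'⟩ := t'
  obtain ⟨t1, t2⟩ := t
  simp only at h1 h2
  subst h1
  cases x with
  | a =>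
    rcases h2 with rfl | rfl
    · exact Or.inr ⟨rfl, Or.inr rfl⟩
    · cases t2' with
      | none => exact Or.inl rfl
      | some k =>
        by_cases hk : k + 1 = ℓ
        · exact Or.inr ⟨by simp [Fillers.lstep, hk], Or.inr rfl⟩
        · exact Or.inl (by simp [Fillers.lstep, hk])
  | b => rcases h2 with rfl | rfl <;> exact Or.inr (by simp [Fillers.lstep])
  | sym k => rcases h2 with rfl | rfl <;> exact Or.inr (by simp [Fillers.lstep])

/-- The level is known to be less than `j`. -/
def Shown (j : ℕ) (t : LState) : Prop := ∃ l, t.1 = some l ∧ l < j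

/-- The symbol at a site as far as it is shown. -/
def maskSym (j : ℕ) (t : LState) : Split K → Split (Option K)
  | Split.a => Split.a
  | Split.b => Split.b
  | Split.sym k => Split.sym (if Shown j t then some k else none)

/-- The word in which only the symbols at sites of level less than `j` are shown. -/
def mk (ℓ j : ℕ) : LState → List (Split K) → List (Split (Option K))
  | _, [] => []
  | t, x :: w => maskSym j t x :: mk ℓ j (lstep ℓ t x) w

variable (k₀ : K)

/-- The indicator of `k₀` at a site of level `j`. -/
def keySym (j : ℕ) (t : LState) : Split K → List Bool
  | Split.sym k => if t.1 = some j then [decide (k = k₀)] else []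
  | _ => []

/-- The indicators of `k₀` at the sites of level `j`. -/
def kb (ℓ j : ℕ) : LState → List (Split K) → List Bool
  | _, [] => []
  | t, x :: w => keySym k₀ j t x ++ kb ℓ j (lstep ℓ t x) w

/-- One for a site the symbol of which is not shown, otherwise zero. -/
def hidSym (j : ℕ) (t : LState) : Split K → ℕ
  | Split.sym _ => if Shown j t then 0 else 1
  | _ => 0

/-- The number of symbols that are not shown. -/
def hc (ℓ j : ℕ) : LState → List (Split K) → ℕ
  | _, [] => 0
  | t, x :: w => hidSym j t x + hc ℓ j (lstep ℓ t x) w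

variable {k₀}

lemma adv_append (ℓ : ℕ) (t : LState) (u v : List (Split K)) :
    adv ℓ t (u ++ v) = adv ℓ (adv ℓ t u) v := by simp [adv]

lemma mk_append (ℓ j : ℕ) (t : LState) (u v : List (Split K)) :
    mk ℓ j t (u ++ v) = mk ℓ j t u ++ mk ℓ j (adv ℓ t u) v := by
  induction u generalizing t with
  | nil => rfl
  | cons x u ih => simp [mk, ih]

lemma kb_append (ℓ j : ℕ) (t : LState) (u v : List (Split K)) :
    kb k₀ ℓ j t (u ++ v) = kb k₀ ℓ j t u ++ kb k₀ ℓ j (adv ℓ t u) v := by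
  induction u generalizing t with
  | nil => rfl
  | cons x u ih => simp [kb, ih]

lemma hc_append (ℓ j : ℕ) (t : LState) (u v : List (Split K)) :
    hc ℓ j t (u ++ v) = hc ℓ j t u + hc ℓ j (adv ℓ t u) v := by
  induction u generalizing t with
  | nil => simp [hc]
  | cons x u ih => simp [hc, ih, add_assoc]

@[simp] lemma mk_length (ℓ j : ℕ) (t : LState) (w : List (Split K)) :
    (mk ℓ j t w).length = w.length := by
  induction w generalizing t with
  | nil => rfl
  | cons x w ih => simp [mk, ih]

lemma hc_le_length (ℓ j : ℕ) (t : LState) (w : List (Split K)) : hc ℓ j t w ≤ w.length := by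
  induction w generalizing t with
  | nil => simp [hc]
  | cons x w ih =>
    have h1 : hidSym j t x ≤ 1 := by
      cases x <;> simp [hidSym]
      split_ifs <;> simp
    have := ih (lstep ℓ t x)
    simp only [hc, List.length_cons]
    omega

/-- Transitions depend only on whether the letter is `a`, and masks show that. So levels can be read
from masks. -/
lemma lstep_eq_of_maskSym {j : ℕ} {t : LState} {x x' : Split K}
    (h : maskSym j t x = maskSym j t x') (ℓ : ℕ) (t' : LState) : lstep ℓ t' x = lstep ℓ t' x' := by
  cases x <;> cases x' <;> simp [maskSym] at h <;> rfl

lemma adv_eq_of_mk {ℓ j : ℕ} {t : LState} {w w' : List (Split K)}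
    (h : mk ℓ j t w = mk ℓ j t w') (t' : LState) : adv ℓ t' w = adv ℓ t' w' := by
  induction w generalizing w' t t' with
  | nil =>
    cases w' with
    | nil => rfl
    | cons x' w' => simp [mk] at h
  | cons x w ih =>
    cases w' with
    | nil => simp [mk] at h
    | cons x' w' =>
      simp only [mk, List.cons.injEq] at h
      rw [adv_cons, adv_cons, ← lstep_eq_of_maskSym h.1]
      refine ih (t := lstep ℓ t x) ?_ _
      rw [h.2, lstep_eq_of_maskSym h.1]

lemma Shown.mono {j j' : ℕ} {t t' : LState} (h : Shown j' t') (ht : LLe t' t) (hj : j' ≤ j) :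
    Shown j t := by
  obtain ⟨l, h1, h2⟩ := h
  rcases ht with rfl | ht
  · exact ⟨l, h1, h2.trans_le hj⟩
  · simp [ht.1] at h1

lemma maskSym_mono {j j' : ℕ} {t t' : LState} {x x' : Split K} (ht : LLe t' t) (hj : j' ≤ j)
    (h : maskSym j t x = maskSym j t x') : maskSym j' t' x = maskSym j' t' x' := by
  cases x <;> cases x' <;> simp only [maskSym, reduceCtorEq, Split.sym.injEq] at h ⊢
  by_cases hs : Shown j' t'
  · simpa [hs, hs.mono ht hj] using h
  · simp [hs]

/-- With less knowledge a level is unknown or the same, and a lower threshold shows fewer symbols.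
So the coarser mask is a function of the finer one. -/
lemma mk_mono {ℓ j j' : ℕ} {t t' : LState} {w w' : List (Split K)} (ht : LLe t' t) (hj : j' ≤ j)
    (h : mk ℓ j t w = mk ℓ j t w') : mk ℓ j' t' w = mk ℓ j' t' w' := by
  induction w generalizing w' t t' with
  | nil =>
    cases w' with
    | nil => rfl
    | cons x' w' => simp [mk] at h
  | cons x w ih =>
    cases w' with
    | nil => simp [mk] at h
    | cons x' w' =>
      simp only [mk, List.cons.injEq] at h ⊢
      refine ⟨maskSym_mono ht hj h.1, ?_⟩
      rw [← lstep_eq_of_maskSym h.1 ℓ t']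
      refine ih (ht.lstep x) ?_
      rw [h.2, lstep_eq_of_maskSym h.1]

lemma keySym_eq {j j' : ℕ} {t t' : LState} {x x' : Split K} (ht : LLe t' t) (hj : j' < j)
    (h : maskSym j t x = maskSym j t x') : keySym k₀ j' t' x = keySym k₀ j' t' x' := by
  cases x <;> cases x' <;> simp only [maskSym, reduceCtorEq, Split.sym.injEq, keySym] at h ⊢
  by_cases hs : t'.1 = some j'
  · have : Shown j t := by
      rcases ht with rfl | ht
      · exact ⟨j', hs, hj⟩
      · simp [ht.1] at hs
    simp only [this, if_true, Option.some.injEq] at h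
    rw [h]
  · simp [hs]

/-- Sites of level j' below the threshold j are shown, hence their key bits can be read from the
mask. -/
lemma kb_eq_of_mk {ℓ j j' : ℕ} {t t' : LState} {w w' : List (Split K)} (ht : LLe t' t)
    (hj : j' < j) (h : mk ℓ j t w = mk ℓ j t w') : kb k₀ ℓ j' t' w = kb k₀ ℓ j' t' w' := by
  induction w generalizing w' t t' with
  | nil =>
    cases w' with
    | nil => rfl
    | cons x' w' => simp [mk] at h
  | cons x w ih =>
    cases w' with
    | nil => simp [mk] at h
    | cons x' w' =>
      simp only [mk, List.cons.injEq] at h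
      simp only [kb]
      rw [keySym_eq ht hj h.1, ← lstep_eq_of_maskSym h.1 ℓ t', ih (ht.lstep x) ?_]
      rw [h.2, lstep_eq_of_maskSym h.1]

/-- With less initial knowledge no bits are produced until the level is known, and from then on the
two readings coincide. So only an initial segment is lost. -/
lemma kb_suffix (ℓ j : ℕ) {t t' : LState} (ht : LLe t' t) (w : List (Split K)) :
    ∃ p, kb k₀ ℓ j t w = p ++ kb k₀ ℓ j t' w := by
  induction w generalizing t t' with
  | nil => exact ⟨[], rfl⟩
  | cons x w ih =>
    rcases ht with rfl | ht
    · exact ⟨[], rfl⟩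
    obtain ⟨p, hp⟩ := ih (LLe.lstep (ℓ := ℓ) (Or.inr ht) x)
    refine ⟨keySym k₀ j t x ++ p, ?_⟩
    have : keySym k₀ j t' x = [] := by cases x <;> simp [keySym, ht.1]
    simp [kb, hp, this]


lemma kb_length_le_hc (ℓ j : ℕ) (t : LState) (w : List (Split K)) :
    (kb k₀ ℓ j t w).length ≤ hc ℓ j t w := by
  induction w generalizing t with
  | nil => rfl
  | cons x w ih =>
    simp only [kb, hc, List.length_append]
    refine add_le_add ?_ (ih _)
    cases x <;> simp only [keySym, hidSym, List.length_nil, le_refl]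
    by_cases h : t.1 = some j
    · have : ¬ Shown j t := by
        rintro ⟨l, h1, h2⟩
        rw [h] at h1
        simp at h1
        omega
      simp [h, this]
    · simp [h]

/-- Only the occurrences of `a`, `b` and of symbols. -/
def pat : Split K → BiState
  | Split.a => BiState.a
  | Split.b => BiState.b
  | Split.sym _ => BiState.c

lemma pat_eq_of_mk {ℓ j : ℕ} {t : LState} {w w' : List (Split K)}
    (h : mk ℓ j t w = mk ℓ j t w') : w.map pat = w'.map pat := by
  induction w generalizing w' t with
  | nil =>
    cases w' with
    | nil => rfl
    | cons x' w' => simp [mk] at h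
  | cons x w ih =>
    cases w' with
    | nil => simp [mk] at h
    | cons x' w' =>
      simp only [mk, List.cons.injEq] at h
      rw [List.map_cons, List.map_cons, ih (t := lstep ℓ t x) (w' := w')]
      · congr 1
        have := h.1
        cases x <;> cases x' <;> simp [maskSym] at this <;> rfl
      · rw [h.2, lstep_eq_of_maskSym h.1]

end Levels

/-! ### Codes -/

section Codes

/-- The code word of `n`: its binary digits, separated by `false`, after `true, true, false`. -/
def codeBit (n i : ℕ) : Bool :=
  if i < 2 then true else if i % 2 = 0 then false else n.testBit ((i - 3) / 2)

/-- The code word of length `m` of the number `n`. -/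
def code (m n : ℕ) : List Bool := List.ofFn fun i : Fin m => codeBit n i

@[simp] lemma code_length (m n : ℕ) : (code m n).length = m := by simp [code]

lemma code_getElem (m n i : ℕ) (h : i < (code m n).length) : (code m n)[i] = codeBit n i := by
  simp [code]

/-- The binary digits of n stand at the odd positions from 3 on, and (m - 3) / 2 of them fit into
the code word. -/
lemma code_injective {m n n' : ℕ} (hn : n < 2 ^ ((m - 3) / 2)) (hn' : n' < 2 ^ ((m - 3) / 2))
    (h : code m n = code m n') : n = n' := by
  refine Nat.eq_of_testBit_eq fun i => ?_
  rcases lt_or_ge i ((m - 3) / 2) with hi | hi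
  · have h1 : 3 + 2 * i < m := by omega
    have h2 : codeBit n (3 + 2 * i) = codeBit n' (3 + 2 * i) := by
      rw [← code_getElem m n _ (by simpa using h1), ← code_getElem m n' _ (by simpa using h1)]
      simp [h]
    simpa [codeBit, show ¬ 3 + 2 * i < 2 by omega, show (3 + 2 * i) % 2 = 1 by omega,
      show (3 + 2 * i - 3) / 2 = i by omega] using h2
  · have : 2 ^ ((m - 3) / 2) ≤ 2 ^ i := Nat.pow_le_pow_right (by norm_num) hi
    rw [Nat.testBit_eq_false_of_lt (by omega), Nat.testBit_eq_false_of_lt (by omega)]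

/-- Code words do not overlap. -/
lemma code_no_overlap {m n n' s : ℕ} {l : List Bool} (hm : m % 2 = 1) (hm3 : 3 ≤ m) (hs : 0 < s)
    (hsm : s < m) (h : l.take m = code m n) : (l.drop s).take m ≠ code m n' := by
  intro h'
  have hl : m ≤ l.length := by
    have := congrArg List.length h
    simp at this
    omega
  have hl' : m + s ≤ l.length := by
    have := congrArg List.length h'
    simp at this
    omega
  have e1 : ∀ i (hi : i < m), l[i]'(by omega) = codeBit n i := by
    intro i hi
    rw [← code_getElem m n i (by simpa using hi)]
    simp [← h]
  have e2 : ∀ i (hi : i < m), l[s + i]'(by omega) = codeBit n' i := by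
    intro i hi
    rw [← code_getElem m n' i (by simpa using hi)]
    simp [← h']
  have f0 := e2 0 (by omega)
  have g0 := e1 s hsm
  simp only [add_zero] at f0
  rw [f0] at g0
  have hf0 : codeBit n' 0 = true := by simp [codeBit]
  rw [hf0] at g0
  -- A code word begins with two ones, and from position 2 on a code word is zero at even positions.
  -- One of s and s + 1 is even; for odd s, the oddness of m ensures that position s + 1 still lies
  -- in the first code word.
  rcases Nat.even_or_odd s with hev | hodd
  · have : s % 2 = 0 := Nat.even_iff.1 hev
    simp [codeBit, this, show ¬ s < 2 by omega] at g0
  · have hs2 : s % 2 = 1 := Nat.odd_iff.1 hodd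
    have f1 := e2 1 (by omega)
    have g1 := e1 (s + 1) (by omega)
    rw [f1] at g1
    simp [codeBit, show (s + 1) % 2 = 0 by omega, show ¬ s + 1 < 2 by omega] at g1

/-- There is no code word of length `m` of a number up to `N` in the list. -/
def NoCode (m N : ℕ) (l : List Bool) : Prop := ∀ s n, n ≤ N → (l.drop s).take m ≠ code m n

end Codes

/-! ### Independent bits -/

section Bits

/-- The expectation of a function of `L` independent bits. -/
def Eb (β : ℝ) : ℕ → (List Bool → ℝ) → ℝ
  | 0, f => f []
  | L + 1, f => β * Eb β L (fun l => f (true :: l)) + (1 - β) * Eb β L (fun l => f (false :: l))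

variable {β : ℝ}

lemma Eb_const (L : ℕ) (c : ℝ) : Eb β L (fun _ => c) = c := by
  induction L with
  | zero => rfl
  | succ L ih => rw [Eb, ih]; ring

lemma Eb_add (L : ℕ) (f g : List Bool → ℝ) :
    Eb β L (fun l => f l + g l) = Eb β L f + Eb β L g := by
  induction L generalizing f g with
  | zero => rfl
  | succ L ih => rw [Eb, ih, ih, Eb, Eb]; ring

lemma Eb_sum {ι : Type*} (S : Finset ι) (L : ℕ) (f : ι → List Bool → ℝ) :
    Eb β L (fun l => ∑ i ∈ S, f i l) = ∑ i ∈ S, Eb β L (f i) := by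
  induction S using Finset.induction_on with
  | empty => simp [Eb_const]
  | insert i S hi ih =>
    simp only [Finset.sum_insert hi]
    rw [Eb_add, ih]

variable (h0 : 0 ≤ β) (h1 : β ≤ 1)
include h0 h1

lemma Eb_mono (L : ℕ) {f g : List Bool → ℝ} (h : ∀ l, l.length = L → f l ≤ g l) :
    Eb β L f ≤ Eb β L g := by
  induction L generalizing f g with
  | zero => exact h _ rfl
  | succ L ih =>
    refine add_le_add (mul_le_mul_of_nonneg_left (ih fun l hl => h _ (by simp [hl])) h0)
      (mul_le_mul_of_nonneg_left (ih fun l hl => h _ (by simp [hl])) (by linarith))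

lemma Eb_drop_le (L s : ℕ) (f : List Bool → ℝ) (c : ℝ) (hf : ∀ L, Eb β L f ≤ c) :
    Eb β L (fun l => f (l.drop s)) ≤ c := by
  induction s generalizing L with
  | zero => simpa using hf L
  | succ s ih =>
    cases L with
    | zero => simpa [Eb] using hf 0
    | succ L =>
      simp only [Eb, List.drop_succ_cons]
      nlinarith [ih L]

lemma Eb_take_eq_le (c : List Bool) (L : ℕ) :
    Eb β L (fun l => if l.take c.length = c then 1 else 0) ≤ (max β (1 - β)) ^ c.length := by
  induction c generalizing L with
  | nil => simp [Eb_const]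
  | cons x c ih =>
    cases L with
    | zero =>
      simp [Eb]
      positivity
    | succ L =>
      have hm : 0 ≤ (max β (1 - β)) ^ c.length := by positivity
      have h2 : 0 ≤ Eb β L (fun l => if l.take c.length = c then 1 else 0) := by
        refine (Eb_const (β := β) L 0).symm.le.trans (Eb_mono h0 h1 L fun l _ => ?_)
        split_ifs <;> simp
      rw [List.length_cons, pow_succ']
      cases x
      · simp [Eb, Eb_const]
        refine mul_le_mul (le_max_right _ _) (ih L) h2 (by positivity)
      · simp [Eb, Eb_const]
        refine mul_le_mul (le_max_left _ _) (ih L) h2 (by positivity)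

/-- Each prescribed bit costs at most a factor min β (1 - β), and the bits behind the prefix are
independent of it. -/
lemma Eb_take_mul (c : List Bool) (L : ℕ) (hL : c.length ≤ L) (f : List Bool → ℝ) (δ : ℝ)
    (hδ : 0 ≤ δ) (hf : ∀ L' ≤ L, δ ≤ Eb β L' f) :
    (min β (1 - β)) ^ c.length * δ ≤
      Eb β L (fun l => if l.take c.length = c then f (l.drop c.length) else 0) := by
  induction c generalizing L with
  | nil => simpa using hf L le_rfl
  | cons x c ih =>
    cases L with
    | zero => simp at hL
    | succ L =>
      have hm : 0 ≤ (min β (1 - β)) ^ c.length := pow_nonneg (le_min h0 (by linarith)) _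
      have := ih L (by simpa using hL) fun L' hL' => hf L' (by omega)
      rw [List.length_cons, pow_succ', mul_assoc]
      cases x
      · simp [Eb, Eb_const]
        exact mul_le_mul (min_le_right _ _) this (by positivity) (by linarith)
      · simp [Eb, Eb_const]
        exact mul_le_mul (min_le_left _ _) this (by positivity) (by linarith)

/-- Union bound over the position of the code word and the number encoded; each code word of length
m has probability at most the m-th power of the larger bit probability. -/
lemma Eb_noCode (m N L : ℕ) (hm : 0 < m) :
    1 - L * (N + 1) * (max β (1 - β)) ^ m ≤
      Eb β L (fun l => if NoCode m N l then 1 else 0) := by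
  set M := (max β (1 - β)) ^ m
  have hM : ∀ n L', Eb β L' (fun l => if l.take m = code m n then 1 else 0) ≤ M := by
    intro n L'
    have := Eb_take_eq_le h0 h1 (code m n) L'
    simpa using this
  have key : Eb β L (fun l => (if NoCode m N l then (1 : ℝ) else 0) +
      ∑ s ∈ Finset.range L, ∑ n ∈ Finset.range (N + 1),
        if (l.drop s).take m = code m n then (1 : ℝ) else 0) ≥ 1 := by
    refine (Eb_const (β := β) L 1).symm.le.trans (Eb_mono h0 h1 L fun l hl => ?_)
    have hnn : ∀ s n, 0 ≤ if (l.drop s).take m = code m n then (1 : ℝ) else 0 := by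
      intro s n
      split_ifs <;> simp
    by_cases h : NoCode m N l
    · simp only [h, if_true, le_add_iff_nonneg_right]
      exact Finset.sum_nonneg fun s _ => Finset.sum_nonneg fun n _ => hnn s n
    · have h' := h
      rw [NoCode] at h'
      push Not at h'
      obtain ⟨s, n, hn, hs⟩ := h'
      have hsL : s < L := by
        have := congrArg List.length hs
        simp at this
        omega
      simp only [h, if_false, zero_add]
      calc (1 : ℝ) = if (l.drop s).take m = code m n then (1 : ℝ) else 0 := by simp [hs]
        _ ≤ ∑ n ∈ Finset.range (N + 1), if (l.drop s).take m = code m n then (1 : ℝ) else 0 :=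
          Finset.single_le_sum (f := fun n => if (l.drop s).take m = code m n then (1 : ℝ) else 0)
            (fun n _ => hnn s n) (by simp; omega)
        _ ≤ _ := Finset.single_le_sum (f := fun s => ∑ n ∈ Finset.range (N + 1),
            if (l.drop s).take m = code m n then (1 : ℝ) else 0)
            (fun s _ => Finset.sum_nonneg fun n _ => hnn s n) (Finset.mem_range.2 hsL)
  rw [Eb_add, Eb_sum] at key
  simp_rw [Eb_sum] at key
  have : ∑ s ∈ Finset.range L, ∑ n ∈ Finset.range (N + 1),
      Eb β L (fun l => if (l.drop s).take m = code m n then (1 : ℝ) else 0) ≤ L * (N + 1) * M := by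
    calc _ ≤ ∑ s ∈ Finset.range L, ∑ n ∈ Finset.range (N + 1), M :=
          Finset.sum_le_sum fun s _ => Finset.sum_le_sum fun n _ =>
            Eb_drop_le h0 h1 L s (fun l => if l.take m = code m n then (1 : ℝ) else 0) M (hM n)
      _ = _ := by simp; ring
  linarith

end Bits



/-! ### Masks -/

/-- The part of `w` on `[i, i + l - 1]`. -/
def sub {A : Type*} (w : List A) (i l : ℕ) : List A := (w.drop i).take l

section Sub

variable {A : Type*}

lemma sub_length {w : List A} {i l : ℕ} (h : i + l ≤ w.length) : (sub w i l).length = l := by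
  simp [sub]
  omega

lemma sub_sub {w : List A} {i l i' l' : ℕ} (h : i' + l' ≤ l) :
    sub (sub w i l) i' l' = sub w (i + i') l' := by
  simp only [sub, List.drop_take, List.drop_drop, List.take_take]
  congr 1
  omega

lemma sub_self (w : List A) : sub w 0 w.length = w := by simp [sub]

lemma sub_split {w : List A} {i l : ℕ} (h : i + l ≤ w.length) :
    ∃ u v, u.length = i ∧ w = u ++ (sub w i l ++ v) := by
  refine ⟨w.take i, (w.drop i).drop l, by simp; omega, ?_⟩
  simp only [sub]
  rw [List.take_append_drop, List.take_append_drop]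

end Sub

/-- The parameters of a scheme of masks: a symbol, the length of the blocks that make up the level
of a site, and the level from which on symbols are hidden in words of given length. -/
structure Scheme (K : Type*) where
  key : K
  len : ℕ
  lvl : ℕ → ℕ
  mono : Monotone lvl

/-- The number of sites of the bits of which decide on the key event. -/
def keyLen (j : ℕ) : ℕ := 2 * j ^ 2 + 3

section Masks

variable {K : Type*} (Θ : Scheme K)

/-- The mask of a word. -/
def mask (w : List (Split K)) : List (Split (Option K)) :=
  mk Θ.len (Θ.lvl w.length) (none, none) w

/-- The bits at the key sites of a word. -/
def keys (w : List (Split K)) : List Bool :=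
  kb Θ.key Θ.len (Θ.lvl w.length) (none, none) w

/-- The key event. -/
def Kap (w : List (Split K)) : Prop :=
  (keys Θ w).take (keyLen (Θ.lvl w.length)) = code (keyLen (Θ.lvl w.length)) w.length

/-- Words that are not distinguished by their masks and by the key events of their proper parts. -/
def ME (w w' : List (Split K)) : Prop :=
  mask Θ w = mask Θ w' ∧ ∀ i l, i + l ≤ w.length → l < w.length →
    (Kap Θ (sub w i l) ↔ Kap Θ (sub w' i l))

variable {Θ}

lemma mask_length_eq {w w' : List (Split K)} (h : mask Θ w = mask Θ w') :
    w.length = w'.length := by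
  have := congrArg List.length h
  simpa [mask] using this

lemma ME.length_eq {w w' : List (Split K)} (h : ME Θ w w') : w.length = w'.length :=
  mask_length_eq h.1

lemma ME.refl (w : List (Split K)) : ME Θ w w := ⟨rfl, fun _ _ _ _ => Iff.rfl⟩

lemma ME.symm {w w' : List (Split K)} (h : ME Θ w w') : ME Θ w' w := by
  refine ⟨h.1.symm, fun i l h1 h2 => (h.2 i l ?_ ?_).symm⟩
  · rwa [h.length_eq]
  · rwa [h.length_eq]

lemma ME.trans {w w' w'' : List (Split K)} (h : ME Θ w w') (h' : ME Θ w' w'') : ME Θ w w'' := by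
  refine ⟨h.1.trans h'.1, fun i l h1 h2 => (h.2 i l h1 h2).trans (h'.2 i l ?_ ?_)⟩
  · rwa [← h.length_eq]
  · rwa [← h.length_eq]

lemma ME.pat_eq {w w' : List (Split K)} (h : ME Θ w w') : w.map pat = w'.map pat := by
  have := h.1
  rw [mask, mask, h.length_eq] at this
  exact pat_eq_of_mk this

/-- The masks of parts are part of the masks. -/
lemma mk_sub_of_mask {w w' : List (Split K)} (h : mask Θ w = mask Θ w') {i l : ℕ}
    (hi : i + l ≤ w.length) : ∃ t : LState,
      mk Θ.len (Θ.lvl w.length) t (sub w i l) = mk Θ.len (Θ.lvl w.length) t (sub w' i l) := by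
  have hl := mask_length_eq h
  obtain ⟨u, v, hu, e⟩ := sub_split hi
  obtain ⟨u', v', hu', e'⟩ := sub_split (hl ▸ hi)
  rw [mask, mask, ← hl] at h
  generalize hj : Θ.lvl w.length = j at h ⊢
  have hs := sub_length hi
  have hs' := sub_length (hl ▸ hi)
  generalize sub w i l = y at *
  generalize sub w' i l = y' at *
  rw [e, e', mk_append, mk_append, mk_append, mk_append] at h
  obtain ⟨h1, h2⟩ := List.append_inj h (by simp [hu, hu'])
  obtain ⟨h3, -⟩ := List.append_inj h2 (by simp [hs, hs'])
  rw [← adv_eq_of_mk h1] at h3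
  exact ⟨_, h3⟩

/-- A part is read without the context before it and with a threshold that is no larger, so its own
mask is coarser than what the mask of the whole word shows there. -/
lemma mask_sub {w w' : List (Split K)} (h : mask Θ w = mask Θ w') {i l : ℕ}
    (hi : i + l ≤ w.length) : mask Θ (sub w i l) = mask Θ (sub w' i l) := by
  have hl := mask_length_eq h
  obtain ⟨t, ht⟩ := mk_sub_of_mask h hi
  rw [mask, mask, sub_length hi, sub_length (hl ▸ hi)]
  exact mk_mono (LLe.init t) (Θ.mono (by omega)) ht

lemma ME.sub {w w' : List (Split K)} (h : ME Θ w w') {i l : ℕ} (hi : i + l ≤ w.length)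
    (hl : l < w.length) : ME Θ (sub w i l) (sub w' i l) := by
  refine ⟨mask_sub h.1 hi, fun i' l' h1 h2 => ?_⟩
  rw [sub_length hi] at h1 h2
  rw [sub_sub h1, sub_sub h1]
  exact h.2 _ _ (by omega) (by omega)

/-- The key sites of a part of the same level are consecutive. -/
lemma keys_sub {w : List (Split K)} {i l : ℕ} (hi : i + l ≤ w.length)
    (hl : Θ.lvl l = Θ.lvl w.length) : ∃ p q, keys Θ w = p ++ (keys Θ (sub w i l) ++ q) := by
  obtain ⟨u, v, hu, e⟩ := sub_split hi
  have hs := sub_length hi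
  rw [keys, keys, hs, hl]
  generalize Θ.lvl w.length = j
  generalize Fillers.sub w i l = y at *
  obtain ⟨p, hp⟩ := kb_suffix (k₀ := Θ.key) Θ.len j
    (LLe.init (adv Θ.len (none, none) u)) y
  rw [e, kb_append, kb_append, hp]
  exact ⟨kb Θ.key Θ.len j (none, none) u ++ p,
    kb Θ.key Θ.len j (adv Θ.len (adv Θ.len (none, none) u) y) v, by simp⟩

lemma exists_code_of_kap_sub {w : List (Split K)} {i l : ℕ} (hi : i + l ≤ w.length)
    (hl : Θ.lvl l = Θ.lvl w.length) (h : Kap Θ (sub w i l)) :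
    ∃ s, ((keys Θ w).drop s).take (keyLen (Θ.lvl w.length)) =
      code (keyLen (Θ.lvl w.length)) l := by
  obtain ⟨p, q, e⟩ := keys_sub hi hl
  rw [Kap, sub_length hi, hl] at h
  refine ⟨p.length, ?_⟩
  have := congrArg List.length h
  simp at this
  rw [e, List.drop_left, List.take_append_of_le_length (by omega), h]

lemma not_kap_sub_of_noCode {w : List (Split K)} {N : ℕ}
    (h : NoCode (keyLen (Θ.lvl w.length)) N (keys Θ w)) {i l : ℕ} (hN : l ≤ N)
    (hi : i + l ≤ w.length) (hl : Θ.lvl l = Θ.lvl w.length) : ¬ Kap Θ (sub w i l) := by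
  intro hk
  obtain ⟨s, hs⟩ := exists_code_of_kap_sub hi hl hk
  exact h s l hN hs

lemma not_kap_of_noCode {w : List (Split K)} {N : ℕ}
    (h : NoCode (keyLen (Θ.lvl w.length)) N (keys Θ w)) (hN : w.length ≤ N) : ¬ Kap Θ w := by
  have := not_kap_sub_of_noCode h (i := 0) hN (by simp) rfl
  rwa [sub_self] at this

lemma keyLen_odd (j : ℕ) : keyLen j % 2 = 1 := by
  unfold keyLen
  omega

lemma keyLen_ge (j : ℕ) : 3 ≤ keyLen j := by unfold keyLen; omega

/-- A word the key sites of which carry its own code and no other. -/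
lemma not_kap_sub_of_code {w : List (Split K)} {m : ℕ}
    (hm : m = keyLen (Θ.lvl w.length)) (h1 : (keys Θ w).take m = code m w.length)
    (h2 : NoCode m w.length ((keys Θ w).drop m)) (hw : w.length < 2 ^ (Θ.lvl w.length) ^ 2)
    {i l : ℕ} (hi : i + l ≤ w.length) (hlw : l < w.length) (hl : Θ.lvl l = Θ.lvl w.length) :
    ¬ Kap Θ (sub w i l) := by
  intro hk
  obtain ⟨s, hs⟩ := exists_code_of_kap_sub hi hl hk
  rw [← hm] at hs
  -- At the front the code word names the length of w and not a smaller one; strictly inside that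
  -- code word another one would overlap with it; further on there are none by `h2`.
  rcases Nat.eq_zero_or_pos s with rfl | hs0
  · rw [List.drop_zero, h1] at hs
    have e : (m - 3) / 2 = (Θ.lvl w.length) ^ 2 := by
      rw [hm, keyLen]
      omega
    have := code_injective (by rw [e]; exact hw) (by rw [e]; omega) hs
    omega
  rcases lt_or_ge s m with hsm | hsm
  · exact code_no_overlap (hm ▸ keyLen_odd _) (hm ▸ keyLen_ge _) hs0 hsm h1 hs
  · refine h2 (s - m) l hlw.le ?_
    rwa [List.drop_drop, Nat.add_sub_cancel' hsm]

/-- Equality of masks and absence of key events in parts of the same level. -/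
lemma ME_of_mask {w w' : List (Split K)} (h : mask Θ w = mask Θ w')
    (hw : ∀ i l, i + l ≤ w.length → l < w.length → Θ.lvl l = Θ.lvl w.length →
      ¬ Kap Θ (sub w i l))
    (hw' : ∀ i l, i + l ≤ w.length → l < w.length → Θ.lvl l = Θ.lvl w.length →
      ¬ Kap Θ (sub w' i l)) : ME Θ w w' := by
  refine ⟨h, fun i l hi hl => ?_⟩
  -- For a part of lower threshold the key bits are shown by the mask of the whole word. Only parts
  -- of equal threshold need the two hypotheses.
  rcases (Θ.mono hl.le).lt_or_eq with hj | hj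
  · obtain ⟨t, ht⟩ := mk_sub_of_mask h hi
    have := mask_length_eq h
    rw [Kap, Kap, keys, keys, sub_length hi, sub_length (this ▸ hi),
      kb_eq_of_mk (LLe.init t) hj ht]
  · exact iff_of_false (hw i l hi hl hj) (hw' i l hi hl hj)

end Masks

/-! ### Weights of symbols -/

section Weights

variable {K : Type*}

/-- The probability of the symbols of a word. -/
def wt (p : K → ℝ) : List (Split K) → ℝ
  | [] => 1
  | Split.sym k :: w => p k * wt p w
  | _ :: w => wt p w

/-- The probability of the symbols shown by the mask of a word. -/
def mwt (p : K → ℝ) (ℓ j : ℕ) : LState → List (Split K) → ℝ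
  | _, [] => 1
  | t, Split.sym k :: w =>
      (if Shown j t then p k else 1) * mwt p ℓ j (lstep ℓ t (Split.sym k)) w
  | t, x :: w => mwt p ℓ j (lstep ℓ t x) w

instance [Finite K] : Finite (Split K) := by
  refine Finite.of_injective (fun x : Split K => match x with
    | Split.a => (none : Option (Option K))
    | Split.b => some none
    | Split.sym k => some (some k)) ?_
  intro x y h
  cases x <;> cases y <;> simp_all

noncomputable instance [Finite K] : Fintype (Split K) := Fintype.ofFinite _

lemma sum_split [Fintype K] (F : Split K → ℝ) :
    ∑ x, F x = F Split.a + F Split.b + ∑ k, F (Split.sym k) := by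
  have : (Finset.univ : Finset (Split K)) =
      {Split.a, Split.b} ∪ Finset.univ.image Split.sym := by
    ext x
    cases x <;> simp
  rw [this, Finset.sum_union, Finset.sum_pair (by simp), Finset.sum_image]
  · intro k _ k' _ h
    simpa using h
  · rw [Finset.disjoint_left]
    simp

variable [Fintype K] {p : K → ℝ}

lemma wt_nonneg (hp : ∀ k, 0 ≤ p k) (w : List (Split K)) : 0 ≤ wt p w := by
  induction w with
  | nil => simp [wt]
  | cons x w ih => cases x <;> simp [wt, ih, mul_nonneg, hp]

lemma mwt_nonneg (hp : ∀ k, 0 ≤ p k) (ℓ j : ℕ) (t : LState) (w : List (Split K)) :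
    0 ≤ mwt p ℓ j t w := by
  induction w generalizing t with
  | nil => simp [mwt]
  | cons x w ih =>
    cases x <;> simp [mwt, ih]
    split_ifs
    · exact mul_nonneg (hp _) (ih _)
    · exact ih _

lemma wt_append (u v : List (Split K)) : wt p (u ++ v) = wt p u * wt p v := by
  induction u with
  | nil => simp [wt]
  | cons x u ih => cases x <;> simp [wt, ih, mul_assoc]

lemma maskSym_sym_eq {j : ℕ} {t : LState} {k : K} {x : Split K} :
    maskSym j t x = maskSym j t (Split.sym k) ↔
      ∃ k', x = Split.sym k' ∧ (Shown j t → k' = k) := by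
  cases x <;> simp [maskSym]
  split_ifs <;> simp_all

/-- Given the mask, the bits at the key sites are independent. -/
lemma sum_wt_mask (hp1 : ∑ k, p k = 1) (k₀ : K) (ℓ j : ℕ) (t : LState) (w : List (Split K))
    (f : List Bool → ℝ) :
    ∑ w' ∈ words (Split K) w.length,
      (if mk ℓ j t w' = mk ℓ j t w then wt p w' * f (kb k₀ ℓ j t w') else 0) =
    mwt p ℓ j t w * Eb (p k₀) (kb k₀ ℓ j t w).length f := by
  induction w generalizing t f with
  | nil => simp [words_zero, mk, wt, mwt, kb, Eb]
  | cons x w ih =>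
    rw [List.length_cons, sum_words_succ]
    have step : ∀ y, maskSym j t y = maskSym j t x → (keySym k₀ j t y).length =
        (keySym k₀ j t x).length := by
      intro y hy
      cases y <;> cases x <;> simp [maskSym] at hy <;> simp [keySym]
      split_ifs <;> rfl
    have inner : ∀ y, maskSym j t y = maskSym j t x → ∀ g : List Bool → ℝ,
        ∑ w' ∈ words (Split K) w.length,
          (if mk ℓ j t (y :: w') = mk ℓ j t (x :: w) then
            wt p w' * g (kb k₀ ℓ j (lstep ℓ t y) w') else 0) =
        mwt p ℓ j (lstep ℓ t x) w * Eb (p k₀) (kb k₀ ℓ j (lstep ℓ t x) w).length g := by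
      intro y hy g
      rw [← ih (lstep ℓ t x) g]
      refine Finset.sum_congr rfl fun w' _ => ?_
      simp only [mk, List.cons.injEq, hy, true_and, lstep_eq_of_maskSym hy]
    have zero : ∀ y, maskSym j t y ≠ maskSym j t x → ∀ g : List (Split K) → ℝ,
        ∑ w' ∈ words (Split K) w.length,
          (if mk ℓ j t (y :: w') = mk ℓ j t (x :: w) then g w' else 0) = 0 := by
      intro y hy g
      refine Finset.sum_eq_zero fun w' _ => ?_
      simp [mk, hy]
    rw [sum_split]
    cases x with
    | a =>
      rw [zero Split.b (by simp [maskSym]),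
        Finset.sum_eq_zero fun k _ => zero (Split.sym k) (by simp [maskSym]) _]
      simp only [wt, kb, keySym, List.nil_append, add_zero]
      rw [inner Split.a rfl f]
      rfl
    | b =>
      rw [zero Split.a (by simp [maskSym]),
        Finset.sum_eq_zero fun k _ => zero (Split.sym k) (by simp [maskSym]) _]
      simp only [wt, kb, keySym, List.nil_append, add_zero, zero_add]
      rw [inner Split.b rfl f]
      rfl
    | sym k =>
      rw [zero Split.a (by simp [maskSym]), zero Split.b (by simp [maskSym]), zero_add, zero_add]
      -- A shown symbol is fixed by the mask. A hidden symbol at a site of level j is summed out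
      -- into one bit of probability `p k₀`; any other hidden symbol sums to one.
      by_cases hs : Shown j t
      · have hj : t.1 ≠ some j := by
          obtain ⟨l, h1, h2⟩ := hs
          rw [h1]
          simp
          omega
        rw [Finset.sum_eq_single k]
        · have := inner (Split.sym k) rfl f
          simp only [wt, kb, keySym, hj, if_false, List.nil_append, mwt, hs, if_true]
          rw [mul_assoc, ← this, Finset.mul_sum]
          refine Finset.sum_congr rfl fun w' _ => ?_
          split_ifs <;> ring
        · intro k' _ hk'
          refine zero _ ?_ _
          rw [Ne, maskSym_sym_eq]
          simp [hs, hk']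
        · simp
      · have hm : ∀ k', maskSym j t (Split.sym k') = maskSym j t (Split.sym k) := by
          intro k'
          rw [maskSym_sym_eq]
          simp [hs]
        by_cases hj : t.1 = some j
        · have e : ∀ k', ∑ w' ∈ words (Split K) w.length,
              (if mk ℓ j t (Split.sym k' :: w') = mk ℓ j t (Split.sym k :: w) then
                wt p (Split.sym k' :: w') * f (kb k₀ ℓ j t (Split.sym k' :: w')) else 0) =
              p k' * (mwt p ℓ j (lstep ℓ t (Split.sym k)) w *
                Eb (p k₀) (kb k₀ ℓ j (lstep ℓ t (Split.sym k)) w).length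
                  fun l => f (decide (k' = k₀) :: l)) := by
            intro k'
            rw [← inner (Split.sym k') (hm k') fun l => f (decide (k' = k₀) :: l),
              Finset.mul_sum]
            refine Finset.sum_congr rfl fun w' _ => ?_
            simp only [wt, kb, keySym, hj, if_true, List.singleton_append]
            split_ifs <;> ring
          rw [Finset.sum_congr rfl fun k' _ => e k',
            ← Finset.add_sum_erase _ _ (Finset.mem_univ k₀)]
          have e2 : ∀ k' ∈ Finset.univ.erase k₀, p k' * (mwt p ℓ j (lstep ℓ t (Split.sym k)) w *
                Eb (p k₀) (kb k₀ ℓ j (lstep ℓ t (Split.sym k)) w).length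
                  fun l => f (decide (k' = k₀) :: l)) =
              p k' * (mwt p ℓ j (lstep ℓ t (Split.sym k)) w *
                Eb (p k₀) (kb k₀ ℓ j (lstep ℓ t (Split.sym k)) w).length
                  fun l => f (false :: l)) := by
            intro k' hk'
            simp [Finset.ne_of_mem_erase hk']
          rw [Finset.sum_congr rfl e2, ← Finset.sum_mul]
          have e3 : ∑ k' ∈ Finset.univ.erase k₀, p k' = 1 - p k₀ := by
            rw [← hp1, ← Finset.add_sum_erase _ _ (Finset.mem_univ k₀)]
            ring
          rw [e3]
          simp only [mwt, hs, if_false, one_mul, kb, keySym, hj, if_true, List.singleton_append,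
            List.length_cons, Eb, decide_true]
          ring
        · have e : ∀ k', ∑ w' ∈ words (Split K) w.length,
              (if mk ℓ j t (Split.sym k' :: w') = mk ℓ j t (Split.sym k :: w) then
                wt p (Split.sym k' :: w') * f (kb k₀ ℓ j t (Split.sym k' :: w')) else 0) =
              p k' * (mwt p ℓ j (lstep ℓ t (Split.sym k)) w *
                Eb (p k₀) (kb k₀ ℓ j (lstep ℓ t (Split.sym k)) w).length f) := by
            intro k'
            rw [← inner (Split.sym k') (hm k') f, Finset.mul_sum]
            refine Finset.sum_congr rfl fun w' _ => ?_
            simp only [wt, kb, keySym, hj, if_false, List.nil_append]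
            split_ifs <;> ring
          rw [Finset.sum_congr rfl fun k' _ => e k', ← Finset.sum_mul, hp1]
          simp only [mwt, hs, if_false, one_mul, kb, keySym, hj, List.nil_append]

/-- The hidden symbols account for the difference of the two weights. -/
lemma wt_le_mwt (hp : ∀ k, 0 ≤ p k) {γ : ℝ} (hγ0 : 0 ≤ γ) (hγ1 : ∀ k, p k ≤ γ) (ℓ j : ℕ)
    (t : LState) (w : List (Split K)) : wt p w ≤ γ ^ hc ℓ j t w * mwt p ℓ j t w := by
  induction w generalizing t with
  | nil => simp [wt, hc, mwt]
  | cons x w ih =>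
    cases x with
    | a => simpa [wt, hc, mwt, hidSym] using ih _
    | b => simpa [wt, hc, mwt, hidSym] using ih _
    | sym k =>
      have := ih (lstep ℓ t (Split.sym k))
      by_cases hs : Shown j t
      · simp only [wt, hc, mwt, hidSym, hs, if_true, zero_add]
        nlinarith [hp k, mul_le_mul_of_nonneg_left this (hp k)]
      · simp only [wt, hc, mwt, hidSym, hs, if_false, one_mul, pow_add, pow_one]
        rw [mul_assoc]
        exact mul_le_mul (hγ1 k) this (wt_nonneg hp w) hγ0

/-- As the word has positive weight, none of its symbols has probability zero, so it is enough that
γ bounds the positive probabilities from below. -/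
lemma mwt_le_wt (hp : ∀ k, 0 ≤ p k) {γ : ℝ} (hγ0 : 0 ≤ γ) (hγ1 : ∀ k, 0 < p k → γ ≤ p k)
    (ℓ j : ℕ) (t : LState) (w : List (Split K)) (hw : 0 < wt p w) :
    γ ^ hc ℓ j t w * mwt p ℓ j t w ≤ wt p w := by
  induction w generalizing t with
  | nil => simp [wt, hc, mwt]
  | cons x w ih =>
    cases x with
    | a => simpa [wt, hc, mwt, hidSym] using ih _ hw
    | b => simpa [wt, hc, mwt, hidSym] using ih _ hw
    | sym k =>
      simp only [wt] at hw
      have hw' : 0 < wt p w := (wt_nonneg hp w).lt_of_ne fun e => by simp [← e] at hw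
      have hk : 0 < p k := (hp k).lt_of_ne fun e => by simp [← e] at hw
      have := ih (lstep ℓ t (Split.sym k)) hw'
      by_cases hs : Shown j t
      · simp only [wt, hc, mwt, hidSym, hs, if_true, zero_add]
        nlinarith [mul_le_mul_of_nonneg_left this hk.le]
      · simp only [wt, hc, mwt, hidSym, hs, if_false, one_mul, pow_add, pow_one]
        rw [mul_assoc]
        exact mul_le_mul (hγ1 k hk) this (mul_nonneg (pow_nonneg hγ0 _) (mwt_nonneg hp _ _ _ _))
          hk.le

end Weights



/-! ### Masses of sets of fillers -/

section Mass

variable {A : Type*} [Fintype A] (pr : List A → ℝ) (s : A)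

/-- The conditional probability of a set of fillers, given the occurrences of `s` in `w` and an `s`
directly after it. -/
def mass (w : List A) (E : List A → Prop) : ℝ :=
  (∑ w' ∈ (words A w.length).filter (fun w' => hw s w' = hw s w ∧ E w'), pr (w' ++ [s])) /
    hpr pr s (w ++ [s])

variable {pr s}

lemma hpr_congr {w w' : List A} (h : hw s w = hw s w') : hpr pr s w = hpr pr s w' := by
  have hl : w.length = w'.length := by simpa using congrArg List.length h
  rw [hpr, hpr, h, hl]

lemma mass_congr {w w' : List A} (h : hw s w = hw s w') (E : List A → Prop) :
    mass pr s w E = mass pr s w' E := by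
  have hl : w.length = w'.length := by simpa using congrArg List.length h
  rw [mass, mass, h, hl, hpr_congr (w := w ++ [s]) (w' := w' ++ [s]) (by simp [hw_append, h])]

namespace RenewalLaw

variable (hr : RenewalLaw pr s)
include hr

lemma hpr_nonneg (w : List A) : 0 ≤ hpr pr s w := Finset.sum_nonneg fun _ _ => hr.nonneg _

lemma h0_nonneg (w : List A) : 0 ≤ h0 pr s w := div_nonneg (hr.hpr_nonneg _) hr.pos.le

lemma mass_nonneg (w : List A) (E : List A → Prop) : 0 ≤ mass pr s w E :=
  div_nonneg (Finset.sum_nonneg fun _ _ => hr.nonneg _) (hr.hpr_nonneg _)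

lemma mass_mono {w : List A} {E F : List A → Prop}
    (h : ∀ w', hw s w' = hw s w → E w' → F w') : mass pr s w E ≤ mass pr s w F := by
  refine div_le_div_of_nonneg_right ?_ (hr.hpr_nonneg _)
  refine Finset.sum_le_sum_of_subset_of_nonneg ?_ fun _ _ _ => hr.nonneg _
  intro w' hw'
  simp only [Finset.mem_filter] at hw' ⊢
  exact ⟨hw'.1, hw'.2.1, h _ hw'.2.1 hw'.2.2⟩

lemma mass_true {w : List A} (hw : 0 < hpr pr s (w ++ [s])) : mass pr s w (fun _ => True) = 1 := by
  rw [mass, div_eq_one_iff_eq hw.ne', hpr_snoc]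
  simp

/-- At an occurrence of `s` the two parts of a filler are conditionally independent, by the renewal
property. -/
lemma mass_mul (u v : List A) (E F : List A → Prop) :
    mass pr s (u ++ s :: v) (fun w => E (w.take u.length) ∧ F (w.drop u.length)) =
      mass pr s u E * mass pr s (s :: v) F := by
  obtain ⟨G, hG⟩ : ∃ G : List A → Prop,
      G = fun w => E (w.take u.length) ∧ F (w.drop u.length) := ⟨_, rfl⟩
  rw [← hG]
  have e1 : ∑ w' ∈ (words A (u ++ s :: v).length).filter (fun w' => hw s w' = hw s (u ++ s :: v) ∧
      G w'), pr (w' ++ [s]) =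
      (∑ u' ∈ (words A u.length).filter (fun w' => hw s w' = hw s u ∧ E w'), pr (u' ++ [s])) *
      ((∑ v' ∈ (words A (s :: v).length).filter (fun w' => hw s w' = hw s (s :: v) ∧ F w'),
        pr (v' ++ [s])) / pr [s]) := by
    rw [Finset.sum_filter, List.length_append, sum_words_add, Finset.sum_filter, Finset.sum_mul]
    refine Finset.sum_congr rfl fun u' hu' => ?_
    rw [mem_words] at hu'
    rw [Finset.sum_filter, Finset.sum_div, Finset.mul_sum]
    refine Finset.sum_congr rfl fun v' hv' => ?_
    rw [mem_words] at hv'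
    obtain ⟨y, v'', rfl⟩ := List.exists_cons_of_length_eq_add_one (by simpa using hv')
    have hG' : G (u' ++ y :: v'') ↔ E u' ∧ F (y :: v'') := by
      rw [hG, ← hu']
      simp
    simp only [hw_append_eq hu', hG']
    by_cases h1 : hw s u' = hw s u <;> by_cases h2 : E u' <;>
      by_cases h3 : hw s (y :: v'') = hw s (s :: v) <;> by_cases h4 : F (y :: v'') <;>
      simp only [h1, h2, h3, h4, and_self, and_true, and_false, if_true, if_false,
        mul_zero, zero_mul, zero_div]
    have := (hw_cons_self.1 h3).1
    subst this
    rw [List.append_assoc, List.cons_append, hr.pr_split, p0]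
  rw [mass, e1, mass, mass, List.append_assoc, List.cons_append, hr.hpr_split', h0,
    ← List.cons_append, div_mul_div_comm, mul_div_assoc', mul_div_assoc',
    div_div_div_cancel_right₀ hr.pos.ne']

end RenewalLaw

end Mass

/-! ### The equivalence relations -/

/-- The interval `[i, i + l - 1]` carries a skeleton inside `[0, n - 1]`, for the marks `q`. -/
def SubIv (q : ℕ → ℕ) (n i l : ℕ) : Prop :=
  ∃ r, 0 < r ∧ 0 < l ∧ i + l ≤ n ∧ (i = 0 ∨ r ≤ q i) ∧ (i + l = n ∨ r ≤ q (i + l)) ∧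
    ∀ j, i < j → j < i + l → q j < r

section Rel

variable {K : Type*} [Fintype K] (Θ : Scheme K) (pr : List (Split K) → ℝ) (s : Split K)
  (ψ : ℕ → ℝ)

/-- The words the masks of which are used for their equivalence classes. -/
def Good (w : List (Split K)) : Prop :=
  ¬ Kap Θ w ∧ Real.exp (-ψ w.length) ≤ mass pr s w (fun w' => ME Θ w' w ∧ Kap Θ w') ∧
    Real.exp (-ψ w.length) ≤ mass pr s w (fun w' => ME Θ w' w ∧ ¬ Kap Θ w')

/-- Words that cannot be distinguished on a given part. -/
def Like (i l : ℕ) (w w' : List (Split K)) : Prop :=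
  (Good Θ pr s ψ (sub w i l) ↔ Good Θ pr s ψ (sub w' i l)) ∧
    (Good Θ pr s ψ (sub w i l) → ME Θ (sub w i l) (sub w' i l))

/-- The equivalence relation for the marks `q` on `[1, n - 1]`. -/
def Rel (q : ℕ → ℕ) (n : ℕ) (w w' : List (Split K)) : Prop :=
  ∀ i l, SubIv q n i l → Like Θ pr s ψ i l w w'

variable {Θ pr s ψ}

lemma Like.refl (i l : ℕ) (w : List (Split K)) : Like Θ pr s ψ i l w w :=
  ⟨Iff.rfl, fun _ => ME.refl _⟩

lemma Like.symm {i l : ℕ} {w w' : List (Split K)} (h : Like Θ pr s ψ i l w w') :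
    Like Θ pr s ψ i l w' w := ⟨h.1.symm, fun h' => (h.2 (h.1.2 h')).symm⟩

lemma Like.trans {i l : ℕ} {w w' w'' : List (Split K)} (h : Like Θ pr s ψ i l w w')
    (h' : Like Θ pr s ψ i l w' w'') : Like Θ pr s ψ i l w w'' :=
  ⟨h.1.trans h'.1, fun g => (h.2 g).trans (h'.2 (h.1.1 g))⟩

/-- The system of fillers. -/
@[reducible] def fillers (Θ : Scheme K) (pr : List (Split K) → ℝ) (s : Split K) (ψ : ℕ → ℝ) :
    Relations (Split K) := fun S =>
  { r := Rel Θ pr s ψ (fun j => S.marks.getD (j - 1) 0) S.dist.length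
    iseqv := ⟨fun _ _ _ _ => Like.refl _ _ _, fun h i l hi => (h i l hi).symm,
      fun h h' i l hi => (h i l hi).trans (h' i l hi)⟩ }

/-- The symbol `s` is not one of the symbols into which `c` is split. -/
def NotSym (s : Split K) : Prop :=
  ∀ w w' : List (Split K), w.map pat = w'.map pat → hw s w = hw s w'

/-- The masses in `Good` are masses of subsets of the `ME`-class, and the conditioning depends only
on the pattern. So goodness is a function of the class and the key event alone, whatever the state
and the bound ψ. -/
lemma good_congr (hs : NotSym s) {w w' : List (Split K)} (h : ME Θ w w')
    (hk : Kap Θ w ↔ Kap Θ w') : Good Θ pr s ψ w ↔ Good Θ pr s ψ w' := by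
  have e : ∀ y, ME Θ y w ↔ ME Θ y w' := fun y => ⟨fun g => g.trans h, fun g => g.trans h.symm⟩
  simp only [Good, hk, h.length_eq, mass_congr (hs _ _ h.pat_eq), e]

lemma like_of_ME_of_kap (hs : NotSym s) {i l : ℕ} {w w' : List (Split K)}
    (h : ME Θ (sub w i l) (sub w' i l)) (hk : Kap Θ (sub w i l) ↔ Kap Θ (sub w' i l)) :
    Like Θ pr s ψ i l w w' := ⟨good_congr hs h hk, fun _ => h⟩

lemma like_of_ME (hs : NotSym s) {i l : ℕ} {w w' : List (Split K)} (h : ME Θ w w')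
    (hi : i + l ≤ w.length) (hl : l < w.length) : Like Θ pr s ψ i l w w' :=
  like_of_ME_of_kap hs (h.sub hi hl) (h.2 i l hi hl)

lemma SubIv.eq_or_lt {q : ℕ → ℕ} {n i l : ℕ} (h : SubIv q n i l) : i = 0 ∧ l = n ∨ l < n := by
  obtain ⟨r, -, -, h, -⟩ := h
  omega

/-- `ME` passes to proper parts together with their key events, hence with their goodness. Only for
the whole word does the key event have to be compared separately. The marks play no role, so this
serves the skeletons of both states. -/
lemma rel_of_ME (hs : NotSym s) (q : ℕ → ℕ) {w w' : List (Split K)} (h : ME Θ w w')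
    (hk : Kap Θ w ↔ Kap Θ w') : Rel Θ pr s ψ q w.length w w' := by
  intro i l hi
  rcases hi.eq_or_lt with ⟨rfl, rfl⟩ | hl
  · refine like_of_ME_of_kap hs ?_ ?_
    · rw [sub_self, h.length_eq, sub_self]
      exact h
    · rw [sub_self, h.length_eq, sub_self]
      exact hk
  · obtain ⟨-, -, -, h', -⟩ := hi
    exact like_of_ME hs h h' hl

lemma sub_take {A : Type*} {w : List A} {i l j : ℕ} (h : i + l ≤ j) :
    sub (w.take j) i l = sub w i l := by
  rw [sub, sub, List.drop_take, List.take_take, min_eq_left (by omega)]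

lemma sub_drop {A : Type*} (w : List A) (i l j : ℕ) :
    sub (w.drop j) i l = sub w (j + i) l := by
  rw [sub, sub, List.drop_drop]

/-- Every class has at least the prescribed mass. -/
theorem exp_le_mass_rel (hr : RenewalLaw pr s) (hs : NotSym s) (hψ : ∀ n, 0 ≤ ψ n)
    (hψ' : ∀ i j, ψ i + ψ j ≤ ψ (i + j)) (n : ℕ) (q : ℕ → ℕ) (w : List (Split K))
    (hw : w.length = n) (hpos : 0 < hpr pr s (w ++ [s]))
    (hq : ∀ j, 0 < j → j < n → 0 < q j → w[j]? = some s) :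
    Real.exp (-ψ n) ≤ mass pr s w (fun w' => Rel Θ pr s ψ q n w' w) := by
  induction n using Nat.strong_induction_on generalizing q w with
  | _ n ih =>
  -- The class of a good word contains the unkeyed half of its `ME`-class.
  by_cases hg : Good Θ pr s ψ w
  · rw [← hw]
    refine hg.2.2.trans (hr.mass_mono fun w' _ h => ?_)
    rw [h.1.length_eq.symm]
    exact rel_of_ME hs q h.1 (iff_of_false h.2 hg.1)
  -- If some good word w₀ has the same restrictions as w to proper sub-skeletons, then the keyed
  -- half of the `ME`-class of w₀ consists of words that are not good and have these restrictions as
  -- well. It lies in the class of w and is heavy enough.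
  by_cases hg0 : ∃ w₀, Fillers.hw s w₀ = Fillers.hw s w ∧ Good Θ pr s ψ w₀ ∧
      ∀ i l, SubIv q n i l → l < n → Like Θ pr s ψ i l w₀ w
  · obtain ⟨w₀, h1, h2, h3⟩ := hg0
    have hl : w₀.length = n := by
      rw [← hw, ← hw_length s w₀, h1, hw_length]
    rw [← mass_congr h1, ← hl]
    refine h2.2.1.trans (hr.mass_mono fun w' _ h => ?_)
    intro i l hi
    have hl' := h.1.length_eq
    rcases hi.eq_or_lt with ⟨rfl, rfl⟩ | hlt
    · have e1 : sub w' 0 w₀.length = w' := by rw [← hl', sub_self]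
      have e2 : sub w 0 w₀.length = w := by rw [hl, ← hw, sub_self]
      have : ¬ Good Θ pr s ψ w' := fun g => g.1 h.2
      rw [Like, e1, e2]
      exact ⟨iff_of_false this hg, fun g => absurd g this⟩
    · have hi' := hi
      obtain ⟨-, -, -, h', -⟩ := hi'
      exact (like_of_ME hs h.1 (by omega) (by omega)).trans (h3 i l (hl ▸ hi) (by omega))
  -- Otherwise no word with these restrictions is good, so the class of w is given by the
  -- restrictions alone.
  have key : mass pr s w (fun w' => ∀ i l, SubIv q n i l → l < n → Like Θ pr s ψ i l w' w) ≤
      mass pr s w (fun w' => Rel Θ pr s ψ q n w' w) := by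
    refine hr.mass_mono fun w' hw' h i l hi => ?_
    rcases hi.eq_or_lt with ⟨rfl, rfl⟩ | hlt
    · have hl : w'.length = w.length := by rw [← hw_length s w', hw', hw_length]
      have e1 : sub w' 0 l = w' := by rw [← hw, ← hl, sub_self]
      have e2 : sub w 0 l = w := by rw [← hw, sub_self]
      have : ¬ Good Θ pr s ψ w' := fun g => hg0 ⟨w', hw', g, h⟩
      rw [Like, e1, e2]
      exact ⟨iff_of_false this hg, fun g => absurd g this⟩
    · exact h i l hi hlt
  refine le_trans ?_ key
  -- The skeleton is cut at an interior mark of highest rank. Every proper sub-skeleton lies on one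
  -- side of it, so the mass is at least the product of the masses of the two sides, and ψ is
  -- superadditive.
  by_cases hint : ∃ j, 0 < j ∧ j < n ∧ 0 < q j
  · obtain ⟨j₀, hj0, hjn, hqj⟩ := hint
    obtain ⟨j, hj, hmax⟩ := Finset.exists_max_image (Finset.Ioo 0 n) q ⟨j₀, by simp; omega⟩
    rw [Finset.mem_Ioo] at hj
    have hqj' : 0 < q j := hqj.trans_le (hmax j₀ (by simp; omega))
    have hs' := hq j hj.1 hj.2 hqj'
    obtain ⟨hjl, hjs⟩ := List.getElem?_eq_some_iff.1 hs'
    have ew : w = w.take j ++ s :: w.drop (j + 1) := by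
      rw [← hjs, List.getElem_cons_drop, List.take_append_drop]
    have hlj : (w.take j).length = j := by simp; omega
    have ed : w.drop j = s :: w.drop (j + 1) := by
      rw [← hjs, List.getElem_cons_drop]
    have hp := hpos
    rw [ew, List.append_assoc, List.cons_append, hr.hpr_split'] at hp
    have hp1 : 0 < hpr pr s (w.take j ++ [s]) :=
      (hr.hpr_nonneg _).lt_of_ne fun e => by simp [← e] at hp
    have hp2 : 0 < hpr pr s (w.drop j ++ [s]) := by
      have : 0 < h0 pr s (w.drop (j + 1) ++ [s]) :=
        (hr.h0_nonneg _).lt_of_ne fun e => by simp [← e] at hp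
      rw [h0] at this
      rw [ed]
      exact (hr.hpr_nonneg _).lt_of_ne fun e => by
        rw [List.cons_append] at e
        simp [← e] at this
    have i1 := ih j hj.2 q (w.take j) hlj hp1 fun i hi hij hqi => by
      rw [List.getElem?_take_of_lt hij]
      exact hq i hi (by omega) hqi
    have i2 := ih (n - j) (by omega) (fun i => q (j + i)) (w.drop j) (by simp; omega) hp2
      fun i hi hij hqi => by
        rw [List.getElem?_drop]
        exact hq (j + i) (by omega) (by omega) hqi
    have := hψ' j (n - j)
    rw [Nat.add_sub_cancel' hj.2.le] at this
    calc Real.exp (-ψ n) ≤ Real.exp (-ψ j) * Real.exp (-ψ (n - j)) := by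
          rw [← Real.exp_add]
          exact Real.exp_le_exp.2 (by linarith)
      _ ≤ _ := mul_le_mul i1 i2 (Real.exp_pos _).le (hr.mass_nonneg _ _)
      _ = _ := by rw [ed, ← hr.mass_mul, ← ew, hlj]
      _ ≤ _ := by
        refine hr.mass_mono fun w' hw' h i l hi hlt => ?_
        have hl' : w'.length = n := by rw [← hw, ← hw_length s w', hw', hw_length]
        obtain ⟨r, hr0, hl0, hil, hi0, hil0, hmid⟩ := hi
        rcases le_or_gt (i + l) j with hc | hc
        · have := h.1 i l ⟨r, hr0, hl0, hc, hi0, ?_, hmid⟩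
          · rwa [Like, sub_take hc, sub_take hc] at this
          · rcases hil0 with h' | h'
            · omega
            · exact Or.inr h'
        rcases le_or_gt j i with hc' | hc'
        · have := h.2 (i - j) l ⟨r, hr0, hl0, by omega, ?_, ?_, ?_⟩
          · rw [Like, ← ed, sub_drop, sub_drop, Nat.add_sub_cancel' hc'] at this
            exact this
          · rcases hi0 with h' | h'
            · exact Or.inl (by omega)
            · refine Or.inr ?_
              simp only
              rwa [Nat.add_sub_cancel' hc']
          · rcases hil0 with h' | h'
            · exact Or.inl (by omega)
            · refine Or.inr ?_
              simp only
              rwa [show j + (i - j + l) = i + l by omega]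
          · intro k h1 h2
            exact hmid _ (by omega) (by omega)
        -- An interval with j in its interior has an end in the interior of the skeleton, as it is
        -- not the whole. The rank there is at most q j, against the requirement that both ends
        -- exceed the marks inside.
        · exfalso
          have h1 := hmid j hc' hc
          rcases hi0 with h2 | h2
          · rcases hil0 with h3 | h3
            · omega
            · rcases hil.eq_or_lt with h4 | h4
              · omega
              · have := hmax (i + l) (by simp; omega)
                omega
          · have := hmax i (by
              simp
              refine ⟨Nat.pos_of_ne_zero ?_, by omega⟩
              rintro rfl
              rcases hil0 with h3 | h3
              · omega
              · rcases hil.eq_or_lt with h4 | h4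
                · omega
                · have := hmax (0 + l) (by simp; omega)
                  omega)
            omega
  -- Without interior marks there are no proper sub-skeletons, and the condition is empty.
  · refine le_trans ?_ (hr.mass_mono (E := fun _ => True) fun w' _ _ i l hi hlt => ?_)
    · rw [hr.mass_true hpos]
      exact Real.exp_le_one_iff.2 (by linarith [hψ n])
    · exfalso
      push Not at hint
      obtain ⟨r, hr0, hl0, hil, hi0, hil0, -⟩ := hi
      have z : ∀ k, 0 < k → k < n → q k = 0 := fun k h1 h2 => by
        have := hint k h1 h2
        omega
      rcases Nat.eq_zero_or_pos i with rfl | hi'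
      · rcases hil0 with h | h
        · omega
        · rcases hil.eq_or_lt with h4 | h4
          · omega
          · have := z (0 + l) (by omega) h4
            omega
      · have := z i hi' (by omega)
        omega

end Rel



/-! ### Numbers of hidden symbols and of key sites -/

section FreeWords

variable {K : Type*} {k₀ : K}

lemma adv_free {ℓ : ℕ} {t : LState} {u : List (Split K)} (hu : Split.a ∉ u) :
    adv ℓ t u = (t.1, t.2.map (· + u.length)) := by
  induction u generalizing t with
  | nil => simp
  | cons x u ih =>
    simp only [List.mem_cons, not_or] at hu
    rw [adv_cons, ih hu.2]
    cases x with
    | a => simp at hu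
    | b => simp only [lstep, Option.map_map, Function.comp_def, List.length_cons, add_assoc,
        add_comm 1]
    | sym k => simp only [lstep, Option.map_map, Function.comp_def, List.length_cons, add_assoc,
        add_comm 1]

/-- The level after a block of given length. -/
def nextLev (ℓ : ℕ) (t : Option ℕ) (n : ℕ) : Option ℕ :=
  if n + 1 = ℓ then t.map (· + 1) else some 0

lemma lstep_adv_free {ℓ : ℕ} {t : Option ℕ} {u : List (Split K)} (hu : Split.a ∉ u) :
    lstep ℓ (adv ℓ (t, some 0) u) (Split.a : Split K) = (nextLev ℓ t u.length, some 0) := by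
  rw [adv_free hu]
  simp [lstep, nextLev]

lemma hc_block {ℓ j : ℕ} {t : Option ℕ} {u v : List (Split K)} (hu : Split.a ∉ u) :
    hc ℓ j (t, some 0) (u ++ Split.a :: v) =
      hc ℓ j (t, some 0) u + hc ℓ j (nextLev ℓ t u.length, some 0) v := by
  rw [hc_append, hc, lstep_adv_free hu]
  simp [hidSym]

lemma kb_block {ℓ j : ℕ} {t : Option ℕ} {u v : List (Split K)} (hu : Split.a ∉ u) :
    kb k₀ ℓ j (t, some 0) (u ++ Split.a :: v) =
      kb k₀ ℓ j (t, some 0) u ++ kb k₀ ℓ j (nextLev ℓ t u.length, some 0) v := by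
  rw [kb_append, kb, lstep_adv_free hu]
  simp [keySym]

lemma hc_free_shown {ℓ j : ℕ} {t : LState} {u : List (Split K)} (hu : Split.a ∉ u)
    (ht : Shown j t) : hc ℓ j t u = 0 := by
  induction u generalizing t with
  | nil => rfl
  | cons x u ih =>
    simp only [List.mem_cons, not_or] at hu
    have : Shown j (lstep ℓ t x) := by
      obtain ⟨l, h1, h2⟩ := ht
      refine ⟨l, ?_, h2⟩
      cases x with
      | a => simp at hu
      | b => simpa [lstep] using h1
      | sym k => simpa [lstep] using h1
    rw [hc, ih hu.2 this]
    cases x <;> simp [hidSym, ht]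

lemma one_le_kb_free {ℓ j : ℕ} {t : LState} {u : List (Split K)} (hu : Split.a ∉ u)
    (ht : t.1 = some j) (hk : ∃ k, Split.sym k ∈ u) : 1 ≤ (kb k₀ ℓ j t u).length := by
  induction u generalizing t with
  | nil => simp at hk
  | cons x u ih =>
    simp only [List.mem_cons, not_or] at hu
    rw [kb, List.length_append]
    cases x with
    | a => simp at hu
    | b =>
      have := ih (t := lstep ℓ t (Split.b : Split K)) hu.2 (by simpa [lstep] using ht) (by simpa using hk)
      omega
    | sym k => simp [keySym, ht]

end FreeWords

/-! ### Exponential moments of the numbers of hidden symbols and of key sites. -/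

namespace RenewalLaw

section Generic

variable {A : Type*} [Fintype A] {pr : List A → ℝ} {s : A} (hr : RenewalLaw pr s)
include hr

/-- By convexity the exponential lies below its chord between 0 and l, so the exponential moment at
l controls all smaller exponents linearly. -/
lemma exp_moment_return : ∃ l C : ℝ, 0 < l ∧ 0 ≤ C ∧ ∀ η, 0 ≤ η → η ≤ l → ∀ N,
    ∑ k ∈ Finset.range N, qh pr s k * (Real.exp (η * (k + 1)) - 1) ≤ C * η := by
  obtain ⟨l, C, r, hl, hC, hr0, hr1, h⟩ := hr.exp_moment
  refine ⟨l, C / (1 - r) / l, hl, by have := sub_pos.2 hr1; positivity, fun η h0 h1 N => ?_⟩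
  have b : ∀ k : ℕ, qh pr s k * (Real.exp (η * (k + 1)) - 1) ≤ η / l * (C * r ^ k) := by
    intro k
    have c : Real.exp (η * (k + 1)) - 1 ≤ η / l * Real.exp (l * (k + 1)) := by
      have := convexOn_exp.2 (Set.mem_univ (0 : ℝ)) (Set.mem_univ (l * ((k : ℝ) + 1)))
        (show 0 ≤ 1 - η / l from sub_nonneg.2 ((div_le_one hl).2 h1))
        (show 0 ≤ η / l by positivity) (by ring)
      simp only [smul_eq_mul, mul_zero, zero_add, Real.exp_zero, mul_one] at this
      rw [show η / l * (l * ((k : ℝ) + 1)) = η * (k + 1) by field_simp] at this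
      have : 0 ≤ η / l := by positivity
      linarith
    calc _ ≤ qh pr s k * (η / l * Real.exp (l * (k + 1))) :=
          mul_le_mul_of_nonneg_left c (hr.qh_nonneg k)
      _ = η / l * ∑ u ∈ frees s k, qb pr s u * Real.exp (l * (k + 1)) := by
          rw [qh, ← Finset.sum_mul]
          ring
      _ ≤ η / l * ∑ u ∈ frees s k, qb pr s u * Real.exp (l * (gb pr s u + (k + 1))) := by
          refine mul_le_mul_of_nonneg_left (Finset.sum_le_sum fun u hu => ?_) (by positivity)
          refine mul_le_mul_of_nonneg_left (Real.exp_le_exp.2 ?_) (hr.qb_nonneg _)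
          have := hr.gb_nonneg (mem_frees.1 hu).2
          exact mul_le_mul_of_nonneg_left (by linarith) hl.le
      _ ≤ _ := mul_le_mul_of_nonneg_left (h k) (by positivity)
  calc _ ≤ ∑ k ∈ Finset.range N, η / l * (C * r ^ k) := Finset.sum_le_sum fun k _ => b k
    _ = η / l * (C * ∑ k ∈ Finset.range N, r ^ k) := by rw [← Finset.mul_sum, ← Finset.mul_sum]
    _ ≤ η / l * (C * (1 - r)⁻¹) := by
      gcongr
      exact (hasSum_geometric_of_lt_one hr0 hr1).summable.sum_le_tsum _ (fun _ _ => by positivity)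
        |>.trans_eq (tsum_geometric_of_lt_one hr0 hr1)
    _ = _ := by
      field_simp

/-- The index k stands for the return time k + 1. Only the return time ℓ raises the level, so the
next value of a potential takes two values with the probabilities q and 1 - q. -/
lemma sum_range_qh_ite (ℓ : ℕ) (hℓ : 0 < ℓ) {X Y : ℝ} (hX : 0 ≤ X) (hY : 0 ≤ Y) (N : ℕ) :
    ∑ k ∈ Finset.range N, qh pr s k * (if k + 1 = ℓ then X else Y) ≤
      qh pr s (ℓ - 1) * X + (1 - qh pr s (ℓ - 1)) * Y := by
  have h : HasSum (fun k => qh pr s k * (if k + 1 = ℓ then X else Y))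
      (1 * Y + qh pr s (ℓ - 1) * (X - Y)) := by
    have h2 : HasSum (fun k => if k = ℓ - 1 then qh pr s (ℓ - 1) * (X - Y) else 0)
        (qh pr s (ℓ - 1) * (X - Y)) := hasSum_ite_eq _ _
    have h3 := (hr.hasSum_qh.mul_right Y).add h2
    refine Eq.subst (motive := fun f => HasSum f _) (funext fun k => ?_) h3
    by_cases hk : k + 1 = ℓ
    · simp only [if_pos hk, if_pos (show k = ℓ - 1 by omega)]
      rw [← hk, Nat.add_sub_cancel]
      ring
    · simp only [if_neg hk, if_neg (show k ≠ ℓ - 1 by omega), add_zero]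
  refine (sum_le_hasSum _ (fun k _ => ?_) h).trans_eq (by ring)
  have := hr.qh_nonneg k
  split_ifs <;> positivity

end Generic

section Counts

variable {K : Type*} [Fintype K] {pr : List (Split K) → ℝ} (hr : RenewalLaw pr Split.a)
include hr

/-- An exponential moment of the number of hidden symbols. -/
theorem hidden_moment {ℓ : ℕ} (hℓ : 0 < ℓ) (hq1 : qh pr Split.a (ℓ - 1) < 1) :
    ∃ c : ℝ, 0 < c ∧ ∀ j n : ℕ, ∑ v ∈ (words (Split K) n).filter (Ends Split.a),
      p0 pr Split.a v * Real.exp (c * hc ℓ j (none, some 0) v) ≤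
        2 * Real.exp (n * qh pr Split.a (ℓ - 1) ^ j) := by
  obtain ⟨l, C, hl, hC, hM⟩ := hr.exp_moment_return
  set q := qh pr Split.a (ℓ - 1) with hq
  have hq0 : 0 ≤ q := hr.qh_nonneg _
  -- At c = 0 the expression equals q < 1, so it stays at most 1 for small c. This is what closes
  -- the supermartingale inequality at the hidden levels.
  obtain ⟨c, hc0, hcl, hc1⟩ : ∃ c : ℝ, 0 < c ∧ c ≤ l ∧ C * c + q * Real.exp (c * ℓ) ≤ 1 := by
    have : Tendsto (fun c : ℝ => C * c + q * Real.exp (c * ℓ)) (𝓝[>] 0) (𝓝 q) := by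
      have h : Continuous fun c : ℝ => C * c + q * Real.exp (c * ℓ) := by fun_prop
      have := (h.tendsto 0).mono_left (nhdsWithin_le_nhds (s := Set.Ioi 0))
      simpa using this
    obtain ⟨c, h1, h2⟩ := ((this.eventually (eventually_lt_nhds hq1)).and
      (Ioo_mem_nhdsGT hl)).exists
    exact ⟨c, h2.1, h2.2.le, h1.le⟩
  refine ⟨c, hc0, fun j n => ?_⟩
  set ε := q ^ j with hε
  have hε0 : 0 ≤ ε := pow_nonneg hq0 j
  have hε1 : ε ≤ 1 := pow_le_one₀ hq0 hq1.le
  -- The discount per site. A restart at level 0 has potential 1 + ε, which a single factor θ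
  -- cancels; over n sites the discount amounts to at most exp(n ε).
  set θ := (1 + ε)⁻¹ with hθ
  have hθ0 : 0 < θ := by positivity
  have hθ1 : θ ≤ 1 := inv_le_one_of_one_le₀ (by linarith)
  -- At a shown level l the excess over 1 is the probability q^(j - l) of reaching level j by
  -- uninterrupted blocks of length ℓ. At a hidden or unknown level the potential is 2.
  let G : Option ℕ → ℝ := fun t => if ∃ l, t = some l ∧ l < j then 1 + q ^ (j - t.getD 0) else 2
  have hG1 : ∀ t, 1 ≤ G t := by
    intro t
    simp only [G]
    split_ifs
    · linarith [pow_nonneg hq0 (j - t.getD 0)]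
    · norm_num
  have hG2 : ∀ t, G t ≤ 2 := by
    intro t
    simp only [G]
    split_ifs
    · linarith [pow_le_one₀ (n := j - t.getD 0) hq0 hq1.le]
    · norm_num
  have hGj : ∀ l, l ≤ j → G (some l) = 1 + q ^ (j - l) := by
    intro l hl
    simp only [G]
    split_ifs with h
    · simp
    · have : l = j := by
        by_contra h'
        exact h ⟨l, rfl, by omega⟩
      rw [this]
      norm_num
  have hG0 : G (some 0) = 1 + ε := by rw [hGj 0 (Nat.zero_le _), Nat.sub_zero]
  let W : Option ℕ → List (Split K) → ℝ := fun t u =>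
    (if ∃ l, t = some l ∧ l < j then 1 else Real.exp (c * (u.length + 1))) *
      θ ^ (u.length + 1)
  have main := hr.potential (fun t u => nextLev ℓ t u.length) W G
    (fun t v => Real.exp (c * hc ℓ j (t, some 0) v) * θ ^ v.length) ?_ ?_ ?_ ?_ none n
  · have hGn : G none = 2 := by simp [G]
    have e : ∀ v ∈ (words (Split K) n).filter (Ends Split.a),
        p0 pr Split.a v * (Real.exp (c * hc ℓ j (none, some 0) v) * θ ^ v.length) =
        (p0 pr Split.a v * Real.exp (c * hc ℓ j (none, some 0) v)) * θ ^ n := by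
      intro v hv
      simp only [Finset.mem_filter, mem_words] at hv
      rw [hv.1]
      ring
    rw [Finset.sum_congr rfl e, ← Finset.sum_mul, hGn, hθ, inv_pow, ← div_eq_mul_inv,
      div_le_iff₀ (by positivity)] at main
    refine main.trans (mul_le_mul_of_nonneg_left ?_ zero_le_two)
    rw [Real.exp_nat_mul]
    exact pow_le_pow_left₀ (by positivity) (by linarith [Real.add_one_le_exp ε]) n
  · intro t
    simpa [hc] using hG1 t
  · intro t u v hu _
    simp only [W]
    rw [hc_block hu, List.length_append, List.length_cons,
      show u.length + (v.length + 1) = (u.length + 1) + v.length by ring, pow_add]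
    push_cast
    rw [mul_add, Real.exp_add]
    have : Real.exp (c * hc ℓ j (t, some 0) u) ≤
        if ∃ l, t = some l ∧ l < j then 1 else Real.exp (c * (u.length + 1)) := by
      split_ifs with h
      · rw [hc_free_shown (t := (t, some 0)) hu h]
        simp
      · refine Real.exp_le_exp.2 (mul_le_mul_of_nonneg_left ?_ hc0.le)
        have := hc_le_length ℓ j (t, some 0) u
        have : (hc ℓ j (t, some 0) u : ℝ) ≤ u.length := by exact_mod_cast this
        linarith
    calc _ = Real.exp (c * hc ℓ j (t, some 0) u) * (θ ^ (u.length + 1) *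
          (Real.exp (c * hc ℓ j (nextLev ℓ t u.length, some 0) v) * θ ^ v.length)) := by ring
      _ ≤ _ * (θ ^ (u.length + 1) *
          (Real.exp (c * hc ℓ j (nextLev ℓ t u.length, some 0) v) * θ ^ v.length)) :=
        mul_le_mul_of_nonneg_right this (by positivity)
      _ = _ := by ring
  · intro t u
    simp only [W]
    split_ifs <;> positivity
  · intro t N
    have e : ∀ k ∈ Finset.range N, ∑ u ∈ frees Split.a k, qb pr Split.a u * W t u *
        G (nextLev ℓ t u.length) = qh pr Split.a k *
          ((if ∃ l, t = some l ∧ l < j then 1 else Real.exp (c * (k + 1))) *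
            θ ^ (k + 1) * G (nextLev ℓ t k)) := by
      intro k _
      rw [qh, Finset.sum_mul]
      refine Finset.sum_congr rfl fun u hu => ?_
      simp only [W, (mem_frees.1 hu).1]
      ring
    rw [Finset.sum_congr rfl e]
    have hθk : ∀ k : ℕ, θ ^ (k + 1) ≤ θ := fun k => by
      rw [pow_succ]
      exact mul_le_of_le_one_left hθ0.le (pow_le_one₀ hθ0.le hθ1)
    -- At a shown level the block costs nothing, and the excess q^(j - l) is q times the excess at
    -- the next level. At a hidden level the potential 2 pays for the exponential cost of the block,
    -- since a return time other than ℓ leads back to level 0.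
    by_cases ht : ∃ l, t = some l ∧ l < j
    · obtain ⟨l, rfl, hl⟩ := ht
      rw [hGj l hl.le]
      have h1 := hr.sum_range_qh_ite ℓ hℓ (X := θ * (1 + q ^ (j - (l + 1))))
        (Y := θ * (1 + ε)) (by positivity) (by positivity) N
      refine (Finset.sum_le_sum fun k _ => ?_).trans (h1.trans ?_)
      · refine mul_le_mul_of_nonneg_left ?_ (hr.qh_nonneg k)
        rw [if_pos ⟨l, rfl, hl⟩, one_mul, nextLev]
        split_ifs
        · rw [Option.map_some, hGj _ hl]
          exact mul_le_mul_of_nonneg_right (hθk k) (by positivity)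
        · rw [hG0]
          exact mul_le_mul_of_nonneg_right (hθk k) (by positivity)
      · have hθe : θ * (1 + ε) = 1 := inv_mul_cancel₀ (by positivity)
        have e2 : q * q ^ (j - (l + 1)) = q ^ (j - l) := by
          rw [← pow_succ']
          congr 1
          omega
        rw [← hq, hθe]
        have : q * (θ * (1 + q ^ (j - (l + 1)))) = θ * (q + q ^ (j - l)) := by
          rw [← e2]
          ring
        rw [this]
        have h3 : θ * (q + q ^ (j - l)) ≤ q + q ^ (j - l) :=
          mul_le_of_le_one_left (by positivity) hθ1
        linarith
    · have hGt : G t = 2 := by simp only [G, if_neg ht]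
      rw [hGt]
      have b : ∀ k ∈ Finset.range N, qh pr Split.a k *
          ((if ∃ l, t = some l ∧ l < j then 1 else Real.exp (c * (k + 1))) *
            θ ^ (k + 1) * G (nextLev ℓ t k)) ≤
          qh pr Split.a k * (Real.exp (c * (k + 1)) - 1) + qh pr Split.a k *
            (if k + 1 = ℓ then 1 + Real.exp (c * ℓ) else 1) := by
        intro k _
        rw [if_neg ht, ← mul_add]
        refine mul_le_mul_of_nonneg_left ?_ (hr.qh_nonneg k)
        have h1 : Real.exp (c * (k + 1)) * θ ^ (k + 1) * G (nextLev ℓ t k) ≤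
            Real.exp (c * (k + 1)) * θ * G (nextLev ℓ t k) := by
          have := hθk k
          have := (zero_le_one.trans (hG1 (nextLev ℓ t k)))
          gcongr
        refine h1.trans ?_
        have hθe : θ * (1 + ε) = 1 := inv_mul_cancel₀ (by positivity)
        split_ifs with hk
        · have e3 : Real.exp (c * (k + 1)) = Real.exp (c * ℓ) := by
            rw [← hk]
            push_cast
            rfl
          rw [e3]
          have := hG2 (nextLev ℓ t k)
          have h4 : θ * G (nextLev ℓ t k) ≤ 2 := by nlinarith [hG1 (nextLev ℓ t k)]
          nlinarith [Real.exp_pos (c * ℓ)]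
        · have : nextLev ℓ t k = some 0 := by simp [nextLev, hk]
          rw [this, hG0, mul_assoc, hθe]
          linarith
      refine (Finset.sum_le_sum b).trans ?_
      rw [Finset.sum_add_distrib]
      have h2 := hr.sum_range_qh_ite ℓ hℓ (X := 1 + Real.exp (c * ℓ)) (Y := 1)
        (by positivity) zero_le_one N
      have h1 := hM c hc0.le hcl N
      rw [← hq] at h2
      linarith

/-- An exponential moment of the number of key sites. -/
theorem key_moment (k₀ : K) {ℓ : ℕ} (hℓ : 0 < ℓ) (hq0 : 0 < qh pr Split.a (ℓ - 1))
    (hq1 : qh pr Split.a (ℓ - 1) < 1)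
    (hs : ∃ u : List (Split K), Split.a ∉ u ∧ (∃ k, Split.sym k ∈ u) ∧ 0 < qb pr Split.a u) :
    ∃ c : ℝ, 0 < c ∧ ∀ j n : ℕ, ∑ v ∈ (words (Split K) n).filter (Ends Split.a),
      p0 pr Split.a v * Real.exp (-(kb k₀ ℓ j (none, some 0) v).length) ≤
        2 * Real.exp (-(c * n * qh pr Split.a (ℓ - 1) ^ j)) := by
  obtain ⟨l, C, hl, hC, hM⟩ := hr.exp_moment_return
  obtain ⟨u₀, hu₀, hk₀, hqu⟩ := hs
  set q := qh pr Split.a (ℓ - 1) with hq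
  have hqb1 : qb pr Split.a u₀ ≤ 1 := by
    refine (hr.qb_le_qh hu₀).trans ?_
    have := hr.sum_range_qh_le (u₀.length + 1)
    refine (Finset.single_le_sum (f := qh pr Split.a) (fun i _ => hr.qh_nonneg i)
      (Finset.self_mem_range_succ _)).trans this
  have he1 : Real.exp (-1) < 1 := Real.exp_lt_one_iff.2 (by norm_num)
  set A : ℝ := qb pr Split.a u₀ * (1 - Real.exp (-1)) / 2 with hA
  have hA0 : 0 < A := by
    have := sub_pos.2 he1
    positivity
  have hA1 : A ≤ 1 / 2 := by
    have := Real.exp_pos (-1)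
    rw [hA]
    nlinarith
  -- Chosen so that the cost C η of the growth factor exp(η), with η = c q^j, stays below the gain
  -- (1 - q) A q^j of a restart at level 0.
  set c : ℝ := min l ((1 - q) * A / (C + 1)) with hc
  have h1q : 0 < 1 - q := sub_pos.2 hq1
  have hc0 : 0 < c := lt_min hl (by positivity)
  refine ⟨c, hc0, fun j n => ?_⟩
  set η := c * q ^ j with hη
  have hqj : 0 < q ^ j := pow_pos hq0 j
  have hqj1 : q ^ j ≤ 1 := pow_le_one₀ hq0.le hq1.le
  have hη0 : 0 < η := by positivity
  have hηl : η ≤ l := (mul_le_of_le_one_right hc0.le hqj1).trans (min_le_left _ _)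
  have hCη : C * η ≤ (1 - q) * A * q ^ j := by
    have : c * (C + 1) ≤ (1 - q) * A := by
      rw [← le_div_iff₀ (by positivity)]
      exact min_le_right _ _
    calc C * η = (c * C) * q ^ j := by rw [hη]; ring
      _ ≤ _ := by
        refine mul_le_mul_of_nonneg_right ?_ hqj.le
        linarith
  have hCη' : C * η ≤ A := by
    refine hCη.trans ?_
    have : (1 - q) * q ^ j ≤ 1 := by nlinarith
    nlinarith
  -- The deficit A q^(j - l) is the gain that can be expected from reaching level j out of level l
  -- by uninterrupted blocks of length ℓ.
  let g : Option ℕ → ℝ := fun t => if ∃ l, t = some l ∧ l ≤ j then 1 - A * q ^ (j - t.getD 0) else 1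
  have hgl : ∀ l, l ≤ j → g (some l) = 1 - A * q ^ (j - l) := by
    intro l hl
    simp only [g]
    rw [if_pos ⟨l, rfl, hl⟩, Option.getD_some]
  have hg1 : ∀ t, g t ≤ 1 := by
    intro t
    simp only [g]
    split_ifs
    · have := pow_pos hq0 (j - t.getD 0)
      nlinarith
    · exact le_rfl
  have hg2 : ∀ t, 1 / 2 ≤ g t := by
    intro t
    simp only [g]
    split_ifs
    · have := pow_le_one₀ (n := j - t.getD 0) hq0.le hq1.le
      have := pow_pos hq0 (j - t.getD 0)
      nlinarith
    · norm_num
  let E : Option ℕ → List (Split K) → ℝ := fun t u =>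
    Real.exp (-(kb k₀ ℓ j (t, some 0) u).length)
  have hE1 : ∀ t u, E t u ≤ 1 := fun t u => Real.exp_le_one_iff.2 (by simp)
  have hE0 : ∀ t u, 0 < E t u := fun t u => Real.exp_pos _
  have main := hr.potential (fun t u => nextLev ℓ t u.length)
    (fun t u => E t u * Real.exp (η * (u.length + 1))) (fun t => 2 * g t)
    (fun t v => E t v * Real.exp (η * v.length)) ?_ ?_ ?_ ?_ none n
  · have hGn : g none = 1 := by simp [g]
    have e : ∀ v ∈ (words (Split K) n).filter (Ends Split.a),
        p0 pr Split.a v * (E none v * Real.exp (η * v.length)) =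
        (p0 pr Split.a v * E none v) * Real.exp (η * n) := by
      intro v hv
      simp only [Finset.mem_filter, mem_words] at hv
      rw [hv.1]
      ring
    rw [Finset.sum_congr rfl e, ← Finset.sum_mul, hGn, ← le_div_iff₀ (Real.exp_pos _), mul_one,
      div_eq_mul_inv, ← Real.exp_neg] at main
    refine main.trans_eq ?_
    rw [hη]
    ring_nf
  · intro t
    have := hg2 t
    simp [E, kb]
    linarith
  · intro t u v hu _
    simp only [E]
    rw [kb_block hu, List.length_append, List.length_append, List.length_cons, ← Real.exp_add,
      ← Real.exp_add, ← Real.exp_add, ← Real.exp_add]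
    refine Real.exp_le_exp.2 (le_of_eq ?_)
    push_cast
    ring
  · intro t u
    exact (mul_pos (hE0 t u) (Real.exp_pos _)).le
  · intro t N
    -- The growth factor is separated from the rest: it costs at most 2 C η in total, so that it
    -- remains to gain C η in the potential g.
    have sp : ∀ k : ℕ, ∑ u ∈ frees Split.a k, qb pr Split.a u *
        (E t u * Real.exp (η * (u.length + 1))) * (2 * g (nextLev ℓ t u.length)) ≤
        2 * (qh pr Split.a k * (Real.exp (η * (k + 1)) - 1)) +
        2 * ∑ u ∈ frees Split.a k, qb pr Split.a u * (E t u * g (nextLev ℓ t k)) := by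
      intro k
      rw [qh, Finset.sum_mul, Finset.mul_sum, Finset.mul_sum, ← Finset.sum_add_distrib]
      refine Finset.sum_le_sum fun u hu => ?_
      rw [(mem_frees.1 hu).1]
      have h1 := hE1 t u
      have h2 := hg1 (nextLev ℓ t k)
      have h3 : E t u * g (nextLev ℓ t k) ≤ 1 := by nlinarith [hE0 t u, hg2 (nextLev ℓ t k)]
      have h4 : 1 ≤ Real.exp (η * (k + 1)) := Real.one_le_exp (by positivity)
      have h5 := hr.qb_nonneg u
      have : E t u * g (nextLev ℓ t k) * (Real.exp (η * (k + 1)) - 1) ≤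
          1 * (Real.exp (η * (k + 1)) - 1) := mul_le_mul_of_nonneg_right h3 (by linarith)
      nlinarith [mul_le_mul_of_nonneg_left this h5]
    refine (Finset.sum_le_sum fun k _ => sp k).trans ?_
    rw [Finset.sum_add_distrib, ← Finset.mul_sum, ← Finset.mul_sum]
    have h1 := hM η hη0.le hηl N
    suffices h : ∑ k ∈ Finset.range N, ∑ u ∈ frees Split.a k,
        qb pr Split.a u * (E t u * g (nextLev ℓ t k)) ≤ g t - C * η by linarith
    -- At level j the block `u₀` yields at least one key site and lowers the mean by 2 A. At all
    -- other levels only the change of level counts, and a restart at level 0 brings the gain (1 -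
    -- q) A q^j.
    by_cases htj : t = some j
    · subst htj
      rw [hgl j le_rfl, Nat.sub_self, pow_zero, mul_one]
      have b : ∀ k ∈ Finset.range N, ∑ u ∈ frees Split.a k,
          qb pr Split.a u * (E (some j) u * g (nextLev ℓ (some j) k)) ≤
          ∑ u ∈ frees Split.a k, qb pr Split.a u * E (some j) u := by
        intro k _
        refine Finset.sum_le_sum fun u _ => ?_
        refine mul_le_mul_of_nonneg_left ?_ (hr.qb_nonneg u)
        exact mul_le_of_le_one_right (hE0 _ _).le (hg1 _)
      refine (Finset.sum_le_sum b).trans ?_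
      refine (Finset.sum_le_sum_of_subset_of_nonneg (t := Finset.range (N + u₀.length + 1))
        (by intro k; simp; omega) fun k _ _ => Finset.sum_nonneg fun u _ =>
          mul_nonneg (hr.qb_nonneg u) (hE0 _ _).le).trans ?_
      have d : ∑ k ∈ Finset.range (N + u₀.length + 1), ∑ u ∈ frees Split.a k,
          qb pr Split.a u * (1 - E (some j) u) ≥ 2 * A := by
        have nn : ∀ u : List (Split K), 0 ≤ qb pr Split.a u * (1 - E (some j) u) := fun u =>
          mul_nonneg (hr.qb_nonneg u) (by linarith [hE1 (some j) u])
        have i1 := Finset.single_le_sum (f := fun k => ∑ u ∈ frees Split.a k,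
          qb pr Split.a u * (1 - E (some j) u)) (fun k _ => Finset.sum_nonneg fun u _ => nn u)
          (show u₀.length ∈ Finset.range (N + u₀.length + 1) by simp)
        have i2 := Finset.single_le_sum (f := fun u => qb pr Split.a u * (1 - E (some j) u))
          (fun u _ => nn u) (show u₀ ∈ frees Split.a u₀.length by simp [hu₀])
        have i3 : E (some j) u₀ ≤ Real.exp (-1) := by
          refine Real.exp_le_exp.2 (neg_le_neg ?_)
          exact_mod_cast one_le_kb_free (k₀ := k₀) (ℓ := ℓ) (t := (some j, some 0)) hu₀ rfl hk₀
        have i4 : qb pr Split.a u₀ * (1 - Real.exp (-1)) ≤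
            qb pr Split.a u₀ * (1 - E (some j) u₀) :=
          mul_le_mul_of_nonneg_left (by linarith) hqu.le
        have : 2 * A = qb pr Split.a u₀ * (1 - Real.exp (-1)) := by
          rw [hA]
          ring
        linarith
      have e : ∑ k ∈ Finset.range (N + u₀.length + 1), ∑ u ∈ frees Split.a k,
          qb pr Split.a u * (1 - E (some j) u) =
          ∑ k ∈ Finset.range (N + u₀.length + 1), qh pr Split.a k -
          ∑ k ∈ Finset.range (N + u₀.length + 1), ∑ u ∈ frees Split.a k,
            qb pr Split.a u * E (some j) u := by
        rw [← Finset.sum_sub_distrib]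
        refine Finset.sum_congr rfl fun k _ => ?_
        rw [qh, ← Finset.sum_sub_distrib]
        refine Finset.sum_congr rfl fun u _ => by ring
      have := hr.sum_range_qh_le (N + u₀.length + 1)
      linarith
    · have b : ∀ k ∈ Finset.range N, ∑ u ∈ frees Split.a k,
          qb pr Split.a u * (E t u * g (nextLev ℓ t k)) ≤
          qh pr Split.a k * (if k + 1 = ℓ then g (t.map (· + 1)) else g (some 0)) := by
        intro k _
        rw [qh, Finset.sum_mul]
        refine Finset.sum_le_sum fun u _ => ?_
        refine mul_le_mul_of_nonneg_left ?_ (hr.qb_nonneg u)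
        have : g (nextLev ℓ t k) = if k + 1 = ℓ then g (t.map (· + 1)) else g (some 0) := by
          rw [nextLev]
          split_ifs <;> rfl
        rw [← this]
        exact mul_le_of_le_one_left (by linarith [hg2 (nextLev ℓ t k)]) (hE1 _ _)
      refine (Finset.sum_le_sum b).trans ((hr.sum_range_qh_ite ℓ hℓ
        (by linarith [hg2 (t.map (· + 1))]) (by linarith [hg2 (some 0)]) N).trans ?_)
      rw [← hq, hgl 0 (Nat.zero_le _), Nat.sub_zero]
      by_cases ht : ∃ l, t = some l ∧ l < j
      · obtain ⟨l, rfl, hl⟩ := ht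
        rw [Option.map_some, hgl _ hl, hgl _ hl.le]
        have e2 : q * q ^ (j - (l + 1)) = q ^ (j - l) := by
          rw [← pow_succ']
          congr 1
          omega
        rw [← e2]
        nlinarith
      · have e1 : g t = 1 := by
          simp only [g]
          rw [if_neg]
          rintro ⟨l, rfl, h⟩
          exact ht ⟨l, rfl, lt_of_le_of_ne h fun e => htj (by rw [e])⟩
        have := hg1 (t.map (· + 1))
        rw [e1]
        nlinarith

end Counts

end RenewalLaw



/-! ### Finite state Markov processes -/

section Markov

/-- Contraction over every N steps. Bernoulli's inequality turns the factor 1 - δ per N steps into 1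
- δ / N per step. -/
lemma exists_geometric_bound {f : ℕ → ℝ} {δ : ℝ} {N : ℕ} (hN : 0 < N) (hδ : 0 < δ) (hδ1 : δ < 1)
    (hf0 : ∀ n, f n ≤ 1) (hf : ∀ n, f (n + 1 + N) ≤ (1 - δ) * f (n + 1)) :
    ∃ C ρ : ℝ, 0 < ρ ∧ ρ < 1 ∧ ∀ n, f n ≤ C * ρ ^ n := by
  set ρ := 1 - δ / N with hρ
  have hN' : (1 : ℝ) ≤ N := by exact_mod_cast hN
  have h1 : δ / N < 1 := (div_le_self hδ.le hN').trans_lt hδ1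
  have h0 : 0 < δ / N := by positivity
  have hρ0 : 0 < ρ := by linarith
  have hρ1 : ρ < 1 := by linarith
  have hb : 1 - δ ≤ ρ ^ N := by
    have := one_add_mul_le_pow (a := -(δ / N)) (by linarith) N
    have e : (1 : ℝ) + N * -(δ / N) = 1 - δ := by field_simp; ring
    rw [e] at this
    exact this
  refine ⟨(ρ ^ N)⁻¹, ρ, hρ0, hρ1, fun n => ?_⟩
  have hpN : 0 < ρ ^ N := pow_pos hρ0 N
  induction n using Nat.strong_induction_on with
  | _ n ih =>
  rcases le_or_gt n N with h | h
  · refine (hf0 n).trans ?_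
    rw [← div_eq_inv_mul, one_le_div hpN]
    exact pow_le_pow_of_le_one hρ0.le hρ1.le h
  · obtain ⟨m, rfl⟩ : ∃ m, n = m + 1 + N := ⟨n - N - 1, by omega⟩
    refine (hf m).trans ?_
    have h2 := ih (m + 1) (by omega)
    have h3 : 0 ≤ (ρ ^ N)⁻¹ * ρ ^ (m + 1) := by positivity
    calc (1 - δ) * f (m + 1) ≤ (1 - δ) * ((ρ ^ N)⁻¹ * ρ ^ (m + 1)) :=
          mul_le_mul_of_nonneg_left h2 (by linarith)
      _ ≤ ρ ^ N * ((ρ ^ N)⁻¹ * ρ ^ (m + 1)) := mul_le_mul_of_nonneg_right hb h3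
      _ = _ := by rw [pow_add]; ring

variable {A : Type*} [MeasurableSpace A] [MeasurableSingletonClass A]

lemma pr_append_le_left (P : Measure (ℤ → A)) [IsFiniteMeasure P] (u v : List A) :
    pr P (u ++ v) ≤ pr P u := by
  refine measureReal_mono fun x hx => ?_
  simp only [Set.mem_ofPred_eq, List.length_append, word_add] at hx ⊢
  exact List.append_inj_left hx (by simp)

lemma WordStationary.pr_append_le_right {P : Measure (ℤ → A)} [IsFiniteMeasure P]
    (hs : WordStationary P) (u v : List A) : pr P (u ++ v) ≤ pr P v := by
  rw [← hs u.length v]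
  refine measureReal_mono fun x hx => ?_
  simp only [Set.mem_ofPred_eq, List.length_append, word_add] at hx ⊢
  have := List.append_inj_right hx (by simp)
  simpa using this

variable {ρ : Measure (ℤ → A)} (hρ : IsAperiodicMarkov ρ)
include hρ

lemma IsAperiodicMarkov.wordStationary : WordStationary ρ :=
  wordStationary_of_measurePreserving hρ.stationary

lemma pr_eq_of_Icc [IsFiniteMeasure ρ] (w : List A) (m : ℤ) (x : ℤ → A)
    (hw : word x m w.length = w) :
    (ρ {y | ∀ i ∈ Set.Icc m (m + w.length - 1), y i = x i}).toReal = pr ρ w := by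
  rw [← hρ.wordStationary m w, measureReal_def]
  congr 2
  ext y
  simp only [Set.mem_ofPred_eq, Set.mem_Icc]
  have e : word y m w.length = w ↔ word y m w.length = word x m w.length := by rw [hw]
  rw [e]
  constructor
  · intro h
    simp only [word]
    congr 1
    funext i
    exact h _ ⟨by omega, by omega⟩
  · intro h i hi
    simp only [word] at h
    have := congrFun (List.ofFn_injective h) ⟨(i - m).toNat, by omega⟩
    simp only at this
    rwa [show m + ((i - m).toNat : ℤ) = i by omega] at this

lemma IsAperiodicMarkov.pr_snoc_snoc (w : List A) (t y : A) :
    pr ρ (w ++ [t, y]) * pr ρ [t] = pr ρ (w ++ [t]) * pr ρ [t, y] := by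
  have := hρ.prob
  -- The condition `memory_one` speaks of sequences up to time 0, so w, t, y are placed on the
  -- coordinates from -|w| - 1 to 0.
  let x : ℤ → A := fun i => if i = 0 then y else if i = -1 then t else
    w.getD (i + w.length + 1).toNat y
  have hx : word x (-(w.length : ℤ) - 1) (w ++ [t, y]).length = w ++ [t, y] := by
    rw [word_eq_iff]
    refine ⟨rfl, fun i hi => ?_⟩
    simp only [List.length_append, List.length_cons, List.length_nil] at hi
    rcases lt_trichotomy i w.length with h | h | h
    · rw [List.getElem_append_left h]
      simp only [x]
      rw [if_neg (by omega), if_neg (by omega)]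
      have : (-(w.length : ℤ) - 1 + i + w.length + 1).toNat = i := by omega
      rw [this]
      simp [h]
    · subst h
      simp only [x]
      rw [if_neg (by omega), if_pos (by omega)]
      simp
    · have : i = w.length + 1 := by omega
      subst this
      simp [x]
  have hx2 : word x (-(w.length : ℤ) - 1) (w ++ [t]).length = w ++ [t] := by
    have h : (w ++ [t, y]).length = (w ++ [t]).length + 1 := by simp
    rw [h, word_snoc, show w ++ [t, y] = (w ++ [t]) ++ [y] by simp] at hx
    exact List.append_inj_left hx (by simp)
  have h := congrArg ENNReal.toReal (hρ.memory_one w.length x)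
  simp only [ENNReal.toReal_mul] at h
  have e1 := pr_eq_of_Icc hρ _ _ x hx
  have e2 := pr_eq_of_Icc hρ _ _ x hx2
  have e3 : (ρ {z | z (-1) = x (-1)}).toReal = pr ρ [t] := by
    rw [← hρ.wordStationary (-1), measureReal_def]
    congr 2
    ext z
    simp [word_succ, x]
  have e4 : (ρ {z | z (-1) = x (-1) ∧ z 0 = x 0}).toReal = pr ρ [t, y] := by
    rw [← hρ.wordStationary (-1), measureReal_def]
    congr 2
    ext z
    simp [word_succ, x]
  rw [show -(w.length : ℤ) - 1 + ((w ++ [t, y]).length : ℕ) - 1 = 0 by simp; ring] at e1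
  rw [show -(w.length : ℤ) - 1 + ((w ++ [t]).length : ℕ) - 1 = -1 by simp] at e2
  rw [e1, e2, e3, e4] at h
  exact h

/-- Letters are appended to v one by one, and each transition depends on the last letter only. The
last letter of t :: v may be t itself. -/
lemma IsAperiodicMarkov.renewal (u v : List A) (t : A) :
    pr ρ (u ++ t :: v) * pr ρ [t] = pr ρ (u ++ [t]) * pr ρ (t :: v) := by
  have := hρ.prob
  induction v using List.reverseRecOn with
  | nil => rfl
  | append_singleton v y ih =>
    obtain ⟨y', t', e⟩ : ∃ y' t', t :: v = y' ++ [t'] := by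
      rcases List.eq_nil_or_concat (t :: v) with h | ⟨y', t', h⟩
      · simp at h
      · exact ⟨y', t', by simpa using h⟩
    have h1 := hρ.pr_snoc_snoc (u ++ y') t' y
    have h2 := hρ.pr_snoc_snoc y' t' y
    have e1 : u ++ t :: (v ++ [y]) = u ++ y' ++ [t', y] := by
      rw [← List.cons_append, e]
      simp
    have e2 : t :: (v ++ [y]) = y' ++ [t', y] := by
      rw [← List.cons_append, e]
      simp
    have e3 : u ++ t :: v = u ++ y' ++ [t'] := by
      rw [e]
      simp
    rw [e1, e2]
    rw [e3, e] at ih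
    by_cases h0 : pr ρ [t'] = 0
    · have z : ∀ w, pr ρ (w ++ [t', y]) = 0 := by
        intro w
        refine le_antisymm ?_ (measureReal_nonneg)
        calc pr ρ (w ++ [t', y]) ≤ pr ρ [t', y] := hρ.wordStationary.pr_append_le_right _ _
          _ ≤ pr ρ [t'] := pr_append_le_left ρ [t'] [y]
          _ = 0 := h0
      rw [z, z]
      simp
    · apply mul_right_cancel₀ h0
      linear_combination pr ρ [t] * h1 - pr ρ (u ++ [t]) * h2 + pr ρ [t', y] * ih

variable [Fintype A]

lemma IsAperiodicMarkov.pos (s : A) : 0 < pr ρ [s] := by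
  have := hρ.prob
  obtain ⟨n, -, h⟩ := hρ.irreducible s s
  rw [pr, measureReal_def]
  refine ENNReal.toReal_pos (h.trans_le (measure_mono ?_)).ne' (measure_ne_top _ _)
  rintro x ⟨h1, -⟩
  simpa [word_succ] using h1

theorem IsAperiodicMarkov.renewalLaw (s : A) : RenewalLaw (pr ρ) s := by
  have := hρ.prob
  have hst := hρ.wordStationary
  refine ⟨pr_nil ρ, pr_nonneg ρ, hst.pr_cons, pr_snoc ρ, fun u v => hρ.renewal u v s, hρ.pos s, ?_⟩
  choose n hn hpos using fun t => hρ.irreducible t s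
  set c : A → ℝ := fun t => ρ.real {x | x 0 = t ∧ x (n t) = s} with hc
  have hc0 : ∀ t, 0 < c t := fun t => ENNReal.toReal_pos (hpos t).ne' (measure_ne_top _ _)
  obtain ⟨t₀, -, ht₀⟩ := Finset.exists_min_image Finset.univ c ⟨s, Finset.mem_univ s⟩
  set N := ∑ t, n t with hN
  have hnN : ∀ t, n t ≤ N := fun t =>
    Finset.single_le_sum (f := n) (fun _ _ => Nat.zero_le _) (Finset.mem_univ t)
  set δ := min (c t₀) (1 / 2) with hδ
  -- From every state, `s` is reached after between 1 and N steps with positive joint probability,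
  -- hence among any N further letters `s` is missing with conditional probability at most 1 - δ.
  have step : ∀ t, ∑ v ∈ frees s N, pr ρ (t :: v) ≤ (1 - δ) * pr ρ [t] := by
    intro t
    have e1 : ∑ v ∈ frees s N, pr ρ (t :: v) =
        ρ.real {x | word x 0 (N + 1) ∈ {w | ∃ v, w = t :: v ∧ s ∉ v}} := by
      rw [hst.real_word_mem, Finset.sum_filter, sum_words_succ, Finset.sum_eq_single t]
      · rw [sum_frees]
        refine Finset.sum_congr rfl fun v _ => ?_
        simp
      · intro b _ hb
        refine Finset.sum_eq_zero fun v _ => ?_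
        simp [hb]
      · simp
    have e2 : ρ.real {x | word x 0 (N + 1) ∈ {w | ∃ v, w = t :: v ∧ s ∉ v}} + c t ≤
        pr ρ [t] := by
      rw [hc, pr, ← measureReal_union]
      · refine measureReal_mono ?_
        rintro x (⟨v, hv, -⟩ | ⟨h, -⟩)
        · simp [word_succ] at hv
          simp [word_succ, hv.1]
        · simp [word_succ, h]
      · rw [Set.disjoint_left]
        rintro x ⟨v, hv, hsv⟩ ⟨-, h⟩
        simp only [word_succ, List.cons.injEq] at hv
        apply hsv
        rw [← hv.2, ← h, word, List.mem_ofFn]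
        have h1 := hn t
        refine ⟨⟨n t - 1, by have := hnN t; omega⟩, ?_⟩
        congr 1
        simp only
        omega
      · exact (measurableSet_eq_fun (measurable_pi_apply _) measurable_const).inter
          (measurableSet_eq_fun (measurable_pi_apply _) measurable_const)
    have e3 : δ ≤ c t := (min_le_left _ _).trans (ht₀ t (Finset.mem_univ t))
    have e4 : pr ρ [t] ≤ 1 := measureReal_le_one
    have e5 : 0 < δ := lt_min (hc0 _) (by norm_num)
    rw [e1]
    nlinarith [pr_nonneg ρ [t]]
  have e0 : ∀ n, ∑ u ∈ frees s n, pr ρ u ≤ 1 := by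
    intro n
    calc _ ≤ ∑ u ∈ words A n, pr ρ u :=
          Finset.sum_le_sum_of_subset_of_nonneg (Finset.filter_subset _ _)
            fun _ _ _ => pr_nonneg _ _
      _ = ρ.real {x | word x 0 n ∈ Set.univ} := by
          rw [hst.real_word_mem]
          simp
      _ ≤ 1 := measureReal_le_one
  have sf : ∀ k l (F : List A → ℝ), ∑ u ∈ frees s (k + l), F u =
      ∑ u ∈ frees s k, ∑ v ∈ frees s l, F (u ++ v) := by
    intro k l F
    rw [sum_frees, sum_words_add, sum_frees]
    refine Finset.sum_congr rfl fun u _ => ?_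
    by_cases h : s ∈ u
    · simp [h]
    · simp [h, sum_frees]
  refine exists_geometric_bound (δ := δ) (N := N) ?_ (lt_min (hc0 _) (by norm_num))
    ((min_le_right _ _).trans_lt (by norm_num)) e0 ?_
  · exact (hn s).trans (hnN s)
  · intro m
    rw [sf, sum_frees_snoc, sum_frees_snoc, Finset.mul_sum]
    refine Finset.sum_le_sum fun u _ => ?_
    rw [Finset.mul_sum]
    refine Finset.sum_le_sum fun t _ => ?_
    have ht := hρ.pos t
    have : ∀ v, pr ρ (u ++ [t] ++ v) = pr ρ (u ++ [t]) / pr ρ [t] * pr ρ (t :: v) := by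
      intro v
      rw [List.append_assoc, List.singleton_append, div_mul_eq_mul_div, eq_div_iff ht.ne']
      exact hρ.renewal u v t
    simp_rw [this]
    rw [← Finset.mul_sum]
    calc _ ≤ pr ρ (u ++ [t]) / pr ρ [t] * ((1 - δ) * pr ρ [t]) :=
          mul_le_mul_of_nonneg_left (step t) (div_nonneg (pr_nonneg _ _) ht.le)
      _ = _ := by field_simp

end Markov



/-! ### Independent splittings -/

instance : DiscreteMeasurableSpace BiState := ⟨fun _ => trivial⟩

instance {K : Type*} : DiscreteMeasurableSpace (Split K) := ⟨fun _ => trivial⟩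

instance : Fintype BiState :=
  ⟨{BiState.a, BiState.b, BiState.c}, fun x => by cases x <;> simp⟩

section Hat

variable {A : Type*} [MeasurableSpace A] [MeasurableSingletonClass A]

lemma measurableSet_coord {ι : Type*} (i : ι) (a : A) : MeasurableSet {x : ι → A | x i = a} := by
  have h : Measurable fun x : ι → A => x i := measurable_pi_apply i
  exact h (measurableSet_singleton a)

lemma measurable_hat (s : A) : Measurable (hat s) := by
  refine measurable_pi_iff.2 fun n => ?_
  refine measurable_to_bool ?_
  convert measurableSet_coord n s
  ext y
  simp [hat]

/-- The probability of a free interval depends only on the law of the occurrences of `s`. So the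
exponential tails of the Markov process carry over to the splitting. -/
lemma sum_frees_eq [Fintype A] {P : Measure (ℤ → A)} [IsFiniteMeasure P] (hP : WordStationary P)
    (s : A) (n : ℕ) : ∑ u ∈ frees s n, pr P u =
      (P.map (hat s)).real {y | word y 0 n = List.replicate n false} := by
  rw [measureReal_def, Measure.map_apply (measurable_hat s) (measurableSet_word 0 n _)]
  change _ = P.real _
  have : hat s ⁻¹' {y | word y 0 n = List.replicate n false} = {x | word x 0 n ∈ {u | s ∉ u}} := by
    ext x
    have e : word (hat s x) 0 n = (word x 0 n).map fun y => decide (y = s) :=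
      word_map (fun y => decide (y = s)) _ _ _
    simp only [Set.mem_preimage, Set.mem_ofPred_eq, e, List.eq_replicate_iff,
      word_length, true_and, List.mem_map, forall_exists_index, and_imp,
      forall_apply_eq_imp_iff₂, decide_eq_false_iff_not]
    constructor
    · intro h h'
      exact h s h' rfl
    · rintro h y hy rfl
      exact h hy
  rw [this, hP.real_word_mem]
  simp [frees]

lemma real_hat_pair (P : Measure (ℤ → A)) (s : A) (n : ℤ) :
    (P.map (hat s)).real {y | y 0 = true ∧ y n = true} = P.real {x | x 0 = s ∧ x n = s} := by
  rw [measureReal_def, Measure.map_apply (measurable_hat s), measureReal_def]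
  · congr 2
    ext x
    simp [hat]
  · exact (measurableSet_eq_fun (measurable_pi_apply _) measurable_const).inter
          (measurableSet_eq_fun (measurable_pi_apply _) measurable_const)

end Hat

section Renewal

lemma IsRenewalState.renewal {A : Type*} [MeasurableSpace A] [MeasurableSingletonClass A]
    {μ : Measure (ℤ → A)} [IsProbabilityMeasure μ] (hμ : WordStationary μ) {s : A}
    (h : IsRenewalState μ s) (u v : List A) :
    pr μ (u ++ s :: v) * pr μ [s] = pr μ (u ++ [s]) * pr μ (s :: v) := by
  set n := max u.length v.length with hn
  have hi := (indepFun_iff_measure_inter_preimage_eq_mul.1 (h n))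
    {y | ∀ i (hi : i < u.length), y ⟨-(u.length : ℤ) + i, by
      have := le_max_left u.length v.length; constructor <;> omega⟩ = u[i]}
    {y | ∀ i (hi : i < v.length), y ⟨1 + i, by
      have := le_max_right u.length v.length; constructor <;> omega⟩ = v[i]} ?_ ?_
  · set C : Set (ℤ → A) := {x | x 0 = s} with hC
    have hCm : MeasurableSet C := measurableSet_coord _ _
    have eu : (fun x : ℤ → A => (Set.Icc (-(n : ℤ)) (-1)).domRestrict x) ⁻¹'
        {y | ∀ i (hi : i < u.length), y ⟨-(u.length : ℤ) + i, by
          have := le_max_left u.length v.length; constructor <;> omega⟩ = u[i]} =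
        {x | word x (-(u.length : ℤ)) u.length = u} := by
      ext x
      simp [word_eq_iff]
    have ev : (fun x : ℤ → A => (Set.Icc (1 : ℤ) n).domRestrict x) ⁻¹'
        {y | ∀ i (hi : i < v.length), y ⟨1 + i, by
          have := le_max_right u.length v.length; constructor <;> omega⟩ = v[i]} =
        {x | word x 1 v.length = v} := by
      ext x
      simp [word_eq_iff]
    rw [eu, ev] at hi
    have hi := congrArg ENNReal.toReal hi
    simp only [cond_apply hCm, ENNReal.toReal_mul, ENNReal.toReal_inv, ← measureReal_def] at hi
    have e0 : μ.real C = pr μ [s] := by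
      rw [pr]
      congr 1
      ext x
      simp [hC, word_succ]
    have e1 : μ.real (C ∩ {x | word x (-(u.length : ℤ)) u.length = u}) = pr μ (u ++ [s]) := by
      rw [← hμ (-(u.length : ℤ))]
      congr 1
      ext x
      have e := word_add x (-(u.length : ℤ)) u.length 1
      rw [neg_add_cancel, word_succ x 0, word_zero] at e
      simp only [hC, Set.mem_inter_iff, Set.mem_ofPred_eq, List.length_append, List.length_singleton,
        e]
      constructor
      · rintro ⟨h1, h2⟩
        rw [h1, h2]
      · intro h1
        obtain ⟨h2, h3⟩ := List.append_inj h1 (by simp)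
        exact ⟨by simpa using h3, h2⟩
    have e2 : μ.real (C ∩ {x | word x 1 v.length = v}) = pr μ (s :: v) := by
      rw [pr]
      congr 1
      ext x
      simp [hC, word_succ]
    have e3 : μ.real (C ∩ ({x | word x (-(u.length : ℤ)) u.length = u} ∩
        {x | word x 1 v.length = v})) = pr μ (u ++ s :: v) := by
      rw [← hμ (-(u.length : ℤ))]
      congr 1
      ext x
      have e := word_add x (-(u.length : ℤ)) u.length (v.length + 1)
      rw [neg_add_cancel, word_succ x 0, zero_add] at e
      simp only [hC, Set.mem_inter_iff, Set.mem_ofPred_eq, List.length_append, List.length_cons, e]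
      constructor
      · rintro ⟨h1, h2, h3⟩
        simp [h1, h2, h3]
      · intro h1
        obtain ⟨h2, h3⟩ := List.append_inj h1 (by simp)
        simp at h3
        exact ⟨h3.1, h2, h3.2⟩
    rw [e0, e1, e2, e3] at hi
    -- If `s` has probability zero the conditional measure is degenerate and both sides vanish.
    by_cases h0 : pr μ [s] = 0
    · have z : pr μ (u ++ [s]) = 0 :=
        le_antisymm ((hμ.pr_append_le_right _ _).trans h0.le) measureReal_nonneg
      rw [h0, z]
      simp
    · field_simp at hi
      linarith
  · have : {y : Set.Icc (-(n : ℤ)) (-1) → A | ∀ i (hi : i < u.length), y ⟨-(u.length : ℤ) + i, by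
        have := le_max_left u.length v.length; constructor <;> omega⟩ = u[i]} =
        ⋂ i, ⋂ (hi : i < u.length), {y | y ⟨-(u.length : ℤ) + i, by
        have := le_max_left u.length v.length; constructor <;> omega⟩ = u[i]} := by
      ext y
      simp
    rw [this]
    exact MeasurableSet.iInter fun i => MeasurableSet.iInter fun h =>
      measurableSet_coord _ _
  · have : {y : Set.Icc (1 : ℤ) n → A | ∀ i (hi : i < v.length), y ⟨1 + i, by
        have := le_max_right u.length v.length; constructor <;> omega⟩ = v[i]} =
        ⋂ i, ⋂ (hi : i < v.length), {y | y ⟨1 + i, by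
        have := le_max_right u.length v.length; constructor <;> omega⟩ = v[i]} := by
      ext y
      simp
    rw [this]
    exact MeasurableSet.iInter fun i => MeasurableSet.iInter fun h =>
      measurableSet_coord _ _

end Renewal

section Splitting

variable {K : Type*} [Fintype K] [MeasurableSpace K] [MeasurableSingletonClass K]

lemma measurable_splitMap :
    Measurable fun q : (ℤ → BiState) × (ℤ → K) => splitMap q.1 q.2 := by
  refine measurable_pi_iff.2 fun n => ?_
  have h1 : Measurable fun y : BiState × K => (match y.1 with
      | BiState.a => Split.a
      | BiState.b => Split.b
      | BiState.c => Split.sym y.2 : Split K) := Measurable.of_discrete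
  have h2 : Measurable fun q : (ℤ → BiState) × (ℤ → K) => (q.1 n, q.2 n) := by fun_prop
  exact h1.comp h2

@[simp] lemma pat_splitMap (m : ℤ → BiState) (u : ℤ → K) (n : ℤ) : pat (splitMap m u n) = m n := by
  simp only [splitMap]
  cases m n <;> rfl

lemma measurable_patSeq : Measurable fun (z : ℤ → Split K) i => pat (z i) := by
  have h : Measurable (pat : Split K → BiState) := Measurable.of_discrete
  exact measurable_pi_iff.2 fun i => h.comp (measurable_pi_apply i)

/-- The sequences that agree with the symbols of a word. -/
def symBox (w : List (Split K)) (m : ℤ) : Set (ℤ → K) :=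
  {u | ∀ i : ℕ, ∀ k, w[i]? = some (Split.sym k) → u (m + i) = k}

/-- A word of the splitting is a pattern together with a box of symbols. With the independence of
the two, its probability is a product. -/
lemma word_splitMap (x : ℤ → BiState) (u : ℤ → K) (m : ℤ) (w : List (Split K)) :
    word (splitMap x u) m w.length = w ↔ word x m w.length = w.map pat ∧ u ∈ symBox w m := by
  induction w generalizing m with
  | nil => simp [symBox]
  | cons y w ih =>
    have e : u ∈ symBox (y :: w) m ↔ (∀ k, y = Split.sym k → u m = k) ∧ u ∈ symBox w (m + 1) := by
      constructor
      · intro h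
        refine ⟨fun k hk => by simpa [hk] using h 0 k, fun i k hi => ?_⟩
        have := h (i + 1) k (by simpa using hi)
        rw [← this]
        congr 1
        push_cast
        ring
      · rintro ⟨h1, h2⟩ i k hi
        cases i with
        | zero => simpa using h1 k (by simpa using hi)
        | succ i =>
          have := h2 i k (by simpa using hi)
          rw [← this]
          congr 1
          push_cast
          ring
    rw [List.length_cons, word_succ, word_succ, List.map_cons, List.cons.injEq, List.cons.injEq,
      ih, e]
    have : splitMap x u m = y ↔ x m = pat y ∧ ∀ k, y = Split.sym k → u m = k := by
      simp only [splitMap]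
      cases x m <;> cases y <;> simp [pat]
    rw [this]
    tauto

variable (p : Measure K) [IsProbabilityMeasure p]

/-- The probabilities of the symbols. -/
def wts (k : K) : ℝ := p.real {k}

lemma wts_nonneg (k : K) : 0 ≤ wts p k := measureReal_nonneg

lemma sum_wts : ∑ k, wts p k = 1 := by
  have := sum_measureReal_singleton (μ := p) Finset.univ
  rw [Finset.coe_univ, probReal_univ] at this
  exact this

lemma real_symBox (w : List (Split K)) (m : ℤ) :
    (Measure.infinitePi fun _ : ℤ => p).real (symBox w m) = wt (wts p) w := by
  let t : ℤ → Set K := fun i => {k | ∀ k', w[(i - m).toNat]? = some (Split.sym k') → k = k'}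
  have e : symBox w m = Set.pi ((Finset.range w.length).image fun i : ℕ => m + (i : ℤ)) t := by
    ext u
    simp only [symBox, Set.mem_ofPred_eq, Set.mem_pi, Finset.mem_coe, Finset.mem_image,
      Finset.mem_range, forall_exists_index, and_imp, forall_apply_eq_imp_iff₂, t,
      add_sub_cancel_left, Int.toNat_natCast]
    constructor
    · intro h i _ k hk
      exact h i k hk
    · intro h i k hk
      exact h i (List.getElem?_eq_some_iff.1 hk).1 k hk
  rw [measureReal_def, e, Measure.infinitePi_pi _ fun _ _ => (Set.toFinite _).measurableSet,
    Finset.prod_image fun i _ j _ h => by simpa using h, ENNReal.toReal_prod]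
  simp only [t, add_sub_cancel_left, Int.toNat_natCast]
  clear e t
  induction w with
  | nil => simp [wt]
  | cons y w ih =>
    rw [List.length_cons, Finset.prod_range_succ']
    simp only [List.getElem?_cons_succ, List.getElem?_cons_zero, ih]
    cases y with
    | a => simp [wt]
    | b => simp [wt]
    | sym k =>
      have : {k' : K | ∀ k'', some (Split.sym k) = some (Split.sym k'') → k' = k''} = {k} := by
        ext k'
        simp
      rw [this, wt, wts, measureReal_def]
      ring

variable (μ : Measure (ℤ → BiState)) [IsProbabilityMeasure μ]

instance : IsProbabilityMeasure (splitting μ p) :=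
  Measure.isProbabilityMeasure_map measurable_splitMap.aemeasurable

lemma real_word_splitting (m : ℤ) (w : List (Split K)) :
    (splitting μ p).real {z | word z m w.length = w} =
      μ.real {x | word x m w.length = w.map pat} * wt (wts p) w := by
  rw [← real_symBox p w m, splitting, measureReal_def,
    Measure.map_apply measurable_splitMap (measurableSet_word _ _ _), measureReal_def,
    measureReal_def, ← ENNReal.toReal_mul, ← Measure.prod_prod]
  congr 2
  ext ⟨x, u⟩
  simp [word_splitMap]

lemma map_pat_splitting : (splitting μ p).map (fun z i => pat (z i)) = μ := by
  have hm : Measurable fun (z : ℤ → Split K) i => pat (z i) := measurable_patSeq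
  rw [splitting, Measure.map_map hm measurable_splitMap]
  have : (fun (z : ℤ → Split K) i => pat (z i)) ∘
      (fun q : (ℤ → BiState) × (ℤ → K) => splitMap q.1 q.2) = Prod.fst := by
    ext q i
    simp
  rw [this]
  exact Measure.map_fst_prod.trans (by simp)

variable {p μ}

lemma pr_splitting (w : List (Split K)) :
    pr (splitting μ p) w = pr μ (w.map pat) * wt (wts p) w := by
  rw [pr, real_word_splitting, pr, List.length_map]

lemma wordStationary_splitting (hμ : WordStationary μ) : WordStationary (splitting μ p) := by
  intro m w
  rw [real_word_splitting, pr_splitting]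
  have := hμ m (w.map pat)
  rw [List.length_map] at this
  rw [this]

/-- A state that is not split, with the corresponding state of the original process. -/
structure Unsplit (μ : Measure (ℤ → BiState)) (s : Split K) (t : BiState) : Prop where
  pat_eq : ∀ y, pat y = t ↔ y = s
  ne : t ≠ BiState.c
  renewal : IsRenewalState μ t
  dist : ∃ (N : ℕ) (ρ : Measure (ℤ → Fin N)) (s : Fin N),
    IsAperiodicMarkov ρ ∧ μ.map (hat t) = ρ.map (hat s)

lemma unsplit_a (hμ : IsBiMarked μ) : Unsplit (K := K) μ Split.a BiState.a :=
  ⟨fun y => by cases y <;> simp [pat], by simp, hμ.renewal_a, hμ.dist_a⟩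

lemma unsplit_b (hμ : IsBiMarked μ) : Unsplit (K := K) μ Split.b BiState.b :=
  ⟨fun y => by cases y <;> simp [pat], by simp, hμ.renewal_b, hμ.dist_b⟩

variable {s : Split K} {t : BiState} (hs : Unsplit μ s t)
include hs

lemma Unsplit.ne_sym (k : K) : Split.sym k ≠ s := by
  intro h
  exact hs.ne ((hs.pat_eq _).2 h).symm

lemma Unsplit.notSym : NotSym s := by
  intro w w' h
  have : ∀ w : List (Split K), hw s w = (w.map pat).map fun y => decide (y = t) := by
    intro w
    simp [hw, hs.pat_eq]
  rw [this, this, h]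

lemma Unsplit.wt_cons (w : List (Split K)) (p : K → ℝ) : wt p (s :: w) = wt p w := by
  cases s with
  | a => rfl
  | b => rfl
  | sym k => exact absurd rfl (hs.ne_sym k)

lemma Unsplit.map_hat : (splitting μ p).map (hat s) = μ.map (hat t) := by
  have hm : Measurable fun (z : ℤ → Split K) i => pat (z i) := measurable_patSeq
  conv_rhs => rw [← map_pat_splitting p μ, Measure.map_map (measurable_hat t) hm]
  congr 1
  ext z i
  simp [hat, hs.pat_eq]

/-- The renewal identity holds for the patterns, and the weights of the symbols are multiplicative.
The probability of `s` and the tails come from the Markov process with the same occurrences. -/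
theorem Unsplit.renewalLaw (hμ : WordStationary μ) : RenewalLaw (pr (splitting μ p)) s := by
  have hst := wordStationary_splitting (p := p) hμ
  obtain ⟨N, ρ, s', hρ, e⟩ := hs.dist
  have := hρ.prob
  have hr := hρ.renewalLaw s'
  refine ⟨pr_nil _, pr_nonneg _, hst.pr_cons, pr_snoc _, fun u v => ?_, ?_, ?_⟩
  · have := hs.renewal.renewal hμ (u.map pat) (v.map pat)
    have hp : pat s = t := (hs.pat_eq s).2 rfl
    simp only [pr_splitting, List.map_append, List.map_cons, List.map_nil, wt_append, hs.wt_cons,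
      hp, wt]
    linear_combination (wt (wts p) u * wt (wts p) v) * this
  · have h1 := real_hat_pair (splitting μ p) s 0
    rw [hs.map_hat, e, real_hat_pair] at h1
    have e1 : pr (splitting μ p) [s] = (splitting μ p).real {x | x 0 = s ∧ x 0 = s} := by
      rw [pr]
      congr 1
      ext x
      simp [word_succ]
    have e2 : pr ρ [s'] = ρ.real {x | x 0 = s' ∧ x 0 = s'} := by
      rw [pr]
      congr 1
      ext x
      simp [word_succ]
    rw [e1, ← h1, ← e2]
    exact hr.pos
  · obtain ⟨C, r, h0, h1, h⟩ := hr.tail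
    refine ⟨C, r, h0, h1, fun n => ?_⟩
    rw [sum_frees_eq hst, hs.map_hat, e, ← sum_frees_eq hρ.wordStationary]
    exact h n

end Splitting



/-! ### Blocks of positive probability -/

section Blocks

variable {A : Type*} [Fintype A] {pr : List A → ℝ} {s : A}

/-- A word between two occurrences of `s` is a chain of blocks, so if all blocks have the same
length then it divides the distance. -/
lemma RenewalLaw.dvd_of_block (hr : RenewalLaw pr s) {d : ℕ}
    (hd : ∀ k, 0 < qh pr s k → k + 1 = d) (v : List A) (hv : 0 < p0 pr s (v ++ [s])) :
    d ∣ v.length + 1 := by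
  induction h : v.length using Nat.strong_induction_on generalizing v with
  | _ n ih =>
  by_cases hs : s ∈ v
  · obtain ⟨u, v', rfl, hu⟩ := List.eq_append_cons_of_mem hs
    rw [List.append_assoc, List.cons_append, hr.p0_split] at hv
    have h1 : 0 < qb pr s u := (hr.qb_nonneg u).lt_of_ne fun e => by simp [← e] at hv
    have h2 : 0 < p0 pr s (v' ++ [s]) := (hr.p0_nonneg _).lt_of_ne fun e => by simp [← e] at hv
    have h3 := hd _ (h1.trans_le (hr.qb_le_qh hu))
    simp only [List.length_append, List.length_cons] at h
    have h4 := ih v'.length (by omega) v' h2 rfl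
    rw [← h, show u.length + (v'.length + 1) + 1 = (u.length + 1) + (v'.length + 1) by ring, h3]
    exact (dvd_refl d).add h4
  · rw [← h, hd _ (lt_of_lt_of_le hv (hr.qb_le_qh hs))]

/-- The distribution of return times of an aperiodic state is not a point mass. -/
lemma RenewalLaw.exists_return (hr : RenewalLaw pr s) (h1 : pr [s] < 1)
    (hper : ∀ d : ℕ, (∀ v, 0 < p0 pr s (v ++ [s]) → d ∣ v.length + 1) → d = 1) :
    ∃ ℓ, 0 < ℓ ∧ 0 < qh pr s (ℓ - 1) ∧ qh pr s (ℓ - 1) < 1 := by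
  by_contra! hcon
  have hq : ∀ k, 0 < qh pr s k → 1 ≤ qh pr s k := fun k hk => by
    simpa using hcon (k + 1) (by omega) hk
  obtain ⟨k, hk⟩ : ∃ k, 0 < qh pr s k := by
    by_contra! h
    have : qh pr s = 0 := by
      funext k
      exact le_antisymm (h k) (hr.qh_nonneg k)
    have h2 := hr.hasSum_qh
    rw [this] at h2
    exact zero_ne_one (hasSum_zero.unique h2)
  have huniq : ∀ k', 0 < qh pr s k' → k' = k := by
    intro k' hk'
    by_contra hne
    have := sum_le_hasSum {k, k'} (fun i _ => hr.qh_nonneg i) hr.hasSum_qh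
    rw [Finset.sum_pair (Ne.symm hne)] at this
    linarith [hq k hk, hq k' hk']
  have hd := hper (k + 1) (hr.dvd_of_block fun k' hk' => by rw [huniq k' hk'])
  have hk0 : k = 0 := by omega
  subst hk0
  -- A single return time must be 1 by aperiodicity. Then `s` is always followed by `s`, so the
  -- probability of a free interval does not depend on its length; it tends to zero, and `s` has
  -- probability one.
  have t1 : tl pr s 1 = 0 := by
    have := hr.tl_eq 0
    have := hr.tl_zero
    have := hr.tl_nonneg 1
    linarith [hq 0 hk]
  have tz : ∀ n, tl pr s (n + 1) = 0 := by
    intro n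
    induction n with
    | zero => exact t1
    | succ n ih =>
      have := hr.tl_eq (n + 1)
      have := hr.tl_nonneg (n + 1 + 1)
      have := hr.qh_nonneg (n + 1)
      linarith
  have zc : ∀ n, zf pr s (n + 1) = zf pr s 1 := by
    intro n
    induction n with
    | zero => rfl
    | succ n ih =>
      have := hr.zf_eq (n + 1)
      rw [tz] at this
      linarith
  have h2 := hr.tendsto_zf.comp (tendsto_add_atTop_nat 1)
  have h3 : (zf pr s ∘ fun a => a + 1) = fun _ => zf pr s 1 := by
    funext n
    exact zc n
  rw [h3] at h2
  have h4 := tendsto_nhds_unique tendsto_const_nhds h2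
  have h5 := hr.zf_eq 0
  rw [hr.zf_zero, hr.tl_zero, zero_add, h4] at h5
  linarith

lemma exists_last {s : A} {w : List A} (h : s ∈ w) : ∃ y u, w = y ++ s :: u ∧ s ∉ u := by
  obtain ⟨u, y, e, hu⟩ := List.eq_append_cons_of_mem (List.mem_reverse.2 h)
  refine ⟨y.reverse, u.reverse, ?_, by simpa using hu⟩
  have := congrArg List.reverse e
  simpa using this

end Blocks

section Positive

variable {A : Type*} [MeasurableSpace A] [MeasurableSingletonClass A] [Fintype A]
  {P : Measure (ℤ → A)} [IsProbabilityMeasure P] {s : A}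

lemma WordStationary.real_free (hP : WordStationary P) (s : A) (m : ℤ) (n : ℕ) :
    P.real {z | s ∉ word z m n} = zf (pr P) s n := by
  have := hP.real_word_mem m n {u | s ∉ u}
  simp only [Set.mem_ofPred_eq] at this
  rw [this]
  simp [zf, frees]

/-- Every letter of positive probability occurs in some block. -/
lemma WordStationary.exists_block (hP : WordStationary P) (hr : RenewalLaw (pr P) s) {x : A}
    (hx : 0 < pr P [x]) (hxs : x ≠ s) :
    ∃ u, s ∉ u ∧ x ∈ u ∧ 0 < qb (pr P) s u := by
  -- T is so large that x has an `s` within distance T on both sides with positive probability; the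
  -- nearest ones enclose a block that contains x.
  obtain ⟨T, hT⟩ := (hr.tendsto_zf.eventually (eventually_lt_nhds (half_pos hx))).exists
  let E : Set (List A) := {w | ∃ w₁ w₂, w = w₁ ++ x :: w₂ ∧ s ∈ w₁ ∧ s ∈ w₂}
  have h1 : P.real {z | word z (T : ℤ) 1 = [x]} ≤ P.real {z | s ∉ word z 0 T} +
      P.real {z | s ∉ word z (T + 1) T} + P.real {z | word z 0 (T + (T + 1)) ∈ E} := by
    refine le_trans (measureReal_mono ?_) ((measureReal_union_le _ _).trans
      (add_le_add_left (measureReal_union_le _ _) _))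
    intro z hz
    by_cases h1 : s ∈ word z 0 T
    · by_cases h2 : s ∈ word z (T + 1) T
      · refine Or.inr ⟨word z 0 T, word z (T + 1) T, ?_, h1, h2⟩
        have hz : z T = x := by simpa [word_succ] using hz
        rw [word_add, word_succ, zero_add, hz]
      · exact Or.inl (Or.inr h2)
    · exact Or.inl (Or.inl h1)
  rw [hP.real_free, hP.real_free] at h1
  have h2 : P.real {z | word z (T : ℤ) 1 = [x]} = pr P [x] := hP T [x]
  rw [h2, hP.real_word_mem] at h1
  have h3 : 0 < ∑ w ∈ (words A (T + (T + 1))).filter (· ∈ E), pr P w := by linarith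
  obtain ⟨w, hw, hw0⟩ := Finset.exists_ne_zero_of_sum_ne_zero h3.ne'
  obtain ⟨-, w₁, w₂, rfl, hs1, hs2⟩ := Finset.mem_filter.1 hw
  obtain ⟨y₁, u₁, rfl, hu₁⟩ := exists_last hs1
  obtain ⟨u₂, y₂, rfl, hu₂⟩ := List.eq_append_cons_of_mem hs2
  refine ⟨u₁ ++ x :: u₂, ?_, by simp, ?_⟩
  · simp [hu₁, hu₂, hxs.symm]
  · rw [qb, p0]
    refine div_pos ?_ hr.pos
    refine ((pr_nonneg _ _).lt_of_ne' hw0).trans_le ?_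
    calc _ = pr P (y₁ ++ (s :: (u₁ ++ x :: u₂ ++ [s]) ++ y₂)) := by simp
      _ ≤ _ := hP.pr_append_le_right _ _
      _ ≤ _ := pr_append_le_left _ _ _

end Positive

section Splitting

variable {K : Type*} [Fintype K] [MeasurableSpace K] [MeasurableSingletonClass K]
  {p : Measure K} [IsProbabilityMeasure p] {μ : Measure (ℤ → BiState)} [IsProbabilityMeasure μ]
  {s : Split K} {t : BiState}

lemma exists_wts_pos : ∃ k, 0 < wts p k := by
  by_contra! h
  have : ∑ k, wts p k ≤ 0 := Finset.sum_nonpos fun k _ => h k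
  rw [sum_wts] at this
  linarith

lemma wts_lt_one (hp : ∀ k, p {k} ≠ 1) (k : K) : wts p k < 1 := by
  refine lt_of_le_of_ne measureReal_le_one fun h => hp k ?_
  rw [wts, measureReal_def] at h
  rwa [ENNReal.toReal_eq_one_iff] at h

lemma pr_c_pos (hc : 0 < μ {x | x 0 = BiState.c}) : 0 < pr μ [BiState.c] := by
  have : pr μ [BiState.c] = μ.real {x | x 0 = BiState.c} := by
    rw [pr]
    congr 1
    ext x
    simp [word_succ]
  rw [this]
  exact ENNReal.toReal_pos hc.ne' (measure_ne_top _ _)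

lemma pr_sym_pos (hc : 0 < μ {x | x 0 = BiState.c}) {k : K} (hk : 0 < wts p k) :
    0 < pr (splitting μ p) [Split.sym k] := by
  rw [pr_splitting]
  simp only [List.map_cons, List.map_nil, pat, wt, mul_one]
  exact mul_pos (pr_c_pos hc) hk

lemma Unsplit.exists_block_sym (hs : Unsplit μ s t) (hμ : WordStationary μ)
    (hc : 0 < μ {x | x 0 = BiState.c}) {k : K} (hk : 0 < wts p k) :
    ∃ u, s ∉ u ∧ Split.sym k ∈ u ∧ 0 < qb (pr (splitting μ p)) s u :=
  (wordStationary_splitting hμ).exists_block (hs.renewalLaw hμ) (pr_sym_pos hc hk) (hs.ne_sym k)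

/-- Exchanging one symbol for another of positive probability turns a block into a different block
of the same length and positive probability. So the first block carries positive conditional
information. -/
lemma Unsplit.hrate_pos (hs : Unsplit μ s t) (hμ : WordStationary μ)
    (hc : 0 < μ {x | x 0 = BiState.c}) (hp : ∀ k, p {k} ≠ 1) :
    0 < hrate (pr (splitting μ p)) s := by
  have hr := hs.renewalLaw (p := p) hμ
  obtain ⟨k, hk⟩ := exists_wts_pos (p := p)
  obtain ⟨k', hkk', hk'⟩ : ∃ k', k' ≠ k ∧ 0 < wts p k' := by
    by_contra! h
    have h1 := sum_wts p
    rw [Finset.sum_eq_single k (fun b _ hb => le_antisymm (h b hb) (wts_nonneg p b))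
      (by simp)] at h1
    exact (wts_lt_one hp k).ne h1
  obtain ⟨u, hu, hku, hq⟩ := hs.exists_block_sym hμ hc hk
  obtain ⟨u₁, u₂, rfl⟩ := List.append_of_mem hku
  have hu' : s ∉ u₁ ++ Split.sym k' :: u₂ := by
    simp only [List.mem_append, List.mem_cons, not_or] at hu ⊢
    exact ⟨hu.1, (hs.ne_sym k').symm, hu.2.2⟩
  have hq' : 0 < qb (pr (splitting μ p)) s (u₁ ++ Split.sym k' :: u₂) := by
    rw [qb, p0] at hq ⊢
    refine div_pos ?_ hr.pos
    have h1 : 0 < pr (splitting μ p) (s :: (u₁ ++ Split.sym k :: u₂ ++ [s])) :=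
      (pr_nonneg _ _).lt_of_ne fun e => by rw [← e] at hq; simp at hq
    rw [pr_splitting] at h1 ⊢
    simp only [hs.wt_cons, wt_append, wt, List.map_cons, List.map_append, pat] at h1 ⊢
    refine (mul_pos h1 (div_pos hk' hk)).trans_eq ?_
    field_simp
  have hlt : qb (pr (splitting μ p)) s (u₁ ++ Split.sym k :: u₂) <
      qh (pr (splitting μ p)) s (u₁ ++ Split.sym k :: u₂).length := by
    have : qb (pr (splitting μ p)) s (u₁ ++ Split.sym k :: u₂) +
        qb (pr (splitting μ p)) s (u₁ ++ Split.sym k' :: u₂) ≤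
        qh (pr (splitting μ p)) s (u₁ ++ Split.sym k :: u₂).length := by
      rw [← Finset.sum_pair (f := qb (pr (splitting μ p)) s)
        (a := u₁ ++ Split.sym k :: u₂) (b := u₁ ++ Split.sym k' :: u₂) (by simp [hkk'.symm])]
      refine Finset.sum_le_sum_of_subset_of_nonneg ?_ fun _ _ _ => hr.qb_nonneg _
      intro y hy
      simp only [Finset.mem_insert, Finset.mem_singleton] at hy
      rcases hy with rfl | rfl
      · simp [hu, - List.mem_append]
      · simp [hu', - List.mem_append]
    linarith
  have hg : 0 < gb (pr (splitting μ p)) s (u₁ ++ Split.sym k :: u₂) :=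
    Real.log_pos ((one_lt_div hq).2 hlt)
  rw [hrate]
  refine mul_pos hr.pos (hr.summable_gb.tsum_pos (fun j => ?_)
    (u₁ ++ Split.sym k :: u₂).length ?_)
  · exact Finset.sum_nonneg fun u hu =>
      mul_nonneg (hr.qb_nonneg u) (hr.gb_nonneg (mem_frees.1 hu).2)
  · refine (mul_pos hq hg).trans_le ?_
    exact Finset.single_le_sum (f := fun u => qb (pr (splitting μ p)) s u *
      gb (pr (splitting μ p)) s u) (fun u hu =>
      mul_nonneg (hr.qb_nonneg u) (hr.gb_nonneg (mem_frees.1 hu).2)) (by simp [hu, - List.mem_append])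

/-- The period is taken from the Markov process with the same occurrences, and `s` does not have
probability one because some symbol has positive probability. -/
lemma Unsplit.exists_return (hs : Unsplit μ s t) (hμ : WordStationary μ)
    (hc : 0 < μ {x | x 0 = BiState.c}) :
    ∃ ℓ, 0 < ℓ ∧ 0 < qh (pr (splitting μ p)) s (ℓ - 1) ∧
      qh (pr (splitting μ p)) s (ℓ - 1) < 1 := by
  have hr := hs.renewalLaw (p := p) hμ
  have hst := wordStationary_splitting (p := p) hμ
  refine hr.exists_return ?_ fun d hd => ?_
  · obtain ⟨k, hk⟩ := exists_wts_pos (p := p)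
    have h1 := pr_sym_pos hc hk
    have h2 := Finset.sum_le_sum_of_subset_of_nonneg (Finset.subset_univ {s, Split.sym k})
      (f := fun y => pr (splitting μ p) [y]) fun _ _ _ => pr_nonneg _ _
    rw [Finset.sum_pair (hs.ne_sym k).symm] at h2
    have h3 := hr.cons []
    rw [hr.nil] at h3
    linarith
  · obtain ⟨N, ρ, s', hρ, e⟩ := hs.dist
    have := hρ.prob
    refine hρ.period_one s' s' d fun n hn hpos => ?_
    have h1 := real_hat_pair (splitting μ p) s n
    rw [hs.map_hat, e, real_hat_pair] at h1
    have h2 : 0 < ρ.real {x | x 0 = s' ∧ x n = s'} :=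
      ENNReal.toReal_pos hpos.ne' (measure_ne_top _ _)
    rw [h1] at h2
    have h3 : {x : ℤ → Split K | x 0 = s ∧ x n = s} =
        {x | word x 0 (n + 1) ∈ {w | ∃ v, w = s :: (v ++ [s])}} := by
      ext x
      obtain ⟨n, rfl⟩ := Nat.exists_eq_add_of_le' hn
      have e : word x 0 (n + 1 + 1) = x 0 :: (word x 1 n ++ [x (n + 1)]) := by
        rw [word_succ, word_snoc, zero_add, add_comm (1 : ℤ)]
      simp only [Set.mem_ofPred_eq, e, List.cons.injEq]
      push_cast
      constructor
      · rintro ⟨h1, h2⟩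
        exact ⟨_, h1, by rw [h2]⟩
      · rintro ⟨v, h1, h2⟩
        exact ⟨h1, by simpa using List.append_inj_right' h2 rfl⟩
    rw [h3, hst.real_word_mem] at h2
    obtain ⟨w, hw, hw0⟩ := Finset.exists_ne_zero_of_sum_ne_zero h2.ne'
    simp only [Finset.mem_filter, mem_words, Set.mem_ofPred_eq] at hw
    obtain ⟨hl, v, rfl⟩ := hw
    have := hd v (div_pos ((pr_nonneg _ _).lt_of_ne' hw0) hr.pos)
    simp only [List.length_cons, List.length_append, List.length_nil] at hl
    rwa [show v.length + 1 = n by omega] at this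

end Splitting



/-! ### Words at arbitrary places -/

section Trim

variable {A : Type*} [MeasurableSpace A] [MeasurableSingletonClass A] [Fintype A]
  {P : Measure (ℤ → A)} [IsProbabilityMeasure P] {s : A}

lemma WordStationary.real_after_le (hP : WordStationary P) (hr : RenewalLaw (pr P) s) (m : ℤ)
    (N : ℕ) (E : List A → Prop) :
    P.real {x | x m = s ∧ E (word x (m + 1) N)} ≤
      ∑ y ∈ (words A N).filter E, p0 (pr P) s y := by
  have h : {x : ℤ → A | x m = s ∧ E (word x (m + 1) N)} =
      {x | word x m (N + 1) ∈ {w | ∃ y, w = s :: y ∧ E y}} := by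
    ext x
    simp only [Set.mem_ofPred_eq, word_succ, List.cons.injEq]
    constructor
    · rintro ⟨h1, h2⟩
      exact ⟨_, ⟨h1, rfl⟩, h2⟩
    · rintro ⟨y, ⟨h1, rfl⟩, h2⟩
      exact ⟨h1, h2⟩
  rw [h, hP.real_word_mem, Finset.sum_filter, sum_words_succ, Finset.sum_eq_single s,
    Finset.sum_filter]
  · refine Finset.sum_le_sum fun y _ => ?_
    simp only [Set.mem_ofPred_eq, List.cons.injEq, true_and, exists_eq_left']
    split_ifs
    · rw [p0, le_div_iff₀ hr.pos]
      exact mul_le_of_le_one_right (pr_nonneg _ _) measureReal_le_one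
    · exact le_rfl
  · intro b _ hb
    refine Finset.sum_eq_zero fun v _ => ?_
    simp [hb]
  · simp

/-- Estimates for words that follow an occurrence of `s` and end with `s` yield estimates for
arbitrary words. -/
theorem WordStationary.trim (hP : WordStationary P) (hr : RenewalLaw (pr P) s)
    {Bad Bad' : List A → Prop} {n T : ℕ} (hT : 2 * T + 1 ≤ n) {B : ℝ}
    (hbad : ∀ u y v, u.length < T → v.length < T → s ∉ u → s ∉ v →
      Bad (u ++ s :: (y ++ v)) → Bad' y)
    (hB : ∀ N, N ≤ n → n ≤ N + (2 * T + 1) →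
      ∑ y ∈ (words A N).filter (fun y => Ends s y ∧ Bad' y), p0 (pr P) s y ≤ B) :
    P.real {x | Bad (word x 0 n)} ≤ 2 * zf (pr P) s T + T ^ 2 * B := by
  -- Outside the first two events there is an `s` within distance T of either end. The lengths cut
  -- off at the two ends run over at most T² pairs, which accounts for the factor of B.
  have hsub : {x : ℤ → A | Bad (word x 0 n)} ⊆ ({x | s ∉ word x 0 T} ∪
      {x | s ∉ word x ((n - T : ℕ) : ℤ) T}) ∪ ⋃ c ∈ Finset.range T ×ˢ Finset.range T,
        {x | x (c.1 : ℤ) = s ∧ (fun y => Ends s y ∧ Bad' y)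
          (word x ((c.1 : ℤ) + 1) (n - 1 - c.1 - c.2))} := by
    intro x hx
    by_cases h1 : s ∈ word x 0 T
    swap
    · exact Or.inl (Or.inl h1)
    by_cases h2 : s ∈ word x ((n - T : ℕ) : ℤ) T
    swap
    · exact Or.inl (Or.inr h2)
    right
    have e1 : word x 0 n = word x 0 T ++ (word x T (n - 2 * T) ++ word x ((n - T : ℕ) : ℤ) T) := by
      have h1 := word_add x 0 T (n - T)
      have h2 := word_add x T (n - 2 * T) T
      rw [show n - 2 * T + T = n - T by omega,
        show (T : ℤ) + ((n - 2 * T : ℕ) : ℤ) = ((n - T : ℕ) : ℤ) by omega] at h2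
      rwa [Nat.add_sub_cancel' (by omega), zero_add, h2] at h1
    obtain ⟨u, v', hv', hu⟩ := List.eq_append_cons_of_mem h1
    obtain ⟨y', v, hy', hv⟩ := exists_last h2
    have hul : u.length < T := by
      have := congrArg List.length hv'
      simp at this
      omega
    have hvl : v.length < T := by
      have := congrArg List.length hy'
      simp at this
      omega
    obtain ⟨y, hy, E⟩ : ∃ y, Ends s y ∧ word x 0 n = u ++ s :: (y ++ v) :=
      ⟨(v' ++ word x T (n - 2 * T) ++ y') ++ [s], ends_snoc _ _, by rw [e1, hv', hy']; simp⟩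
    change Bad (word x 0 n) at hx
    rw [E] at hx
    have hlen := congrArg List.length E
    simp only [word_length, List.length_append, List.length_cons] at hlen
    simp only [Set.mem_iUnion]
    refine ⟨(u.length, v.length), by simp [hul, hvl], ?_⟩
    have E3 : word x 0 n = word x 0 u.length ++ (x u.length :: (word x ((u.length : ℤ) + 1)
        (n - 1 - u.length - v.length) ++ word x ((n - v.length : ℕ) : ℤ) v.length)) := by
      have h1 := word_add x 0 u.length (n - u.length)
      rw [Nat.add_sub_cancel' (by omega), zero_add,
        show n - u.length = (n - 1 - u.length - v.length + v.length) + 1 by omega, word_succ x u.length,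
        word_add, show (u.length : ℤ) + 1 + ((n - 1 - u.length - v.length : ℕ) : ℤ) =
          ((n - v.length : ℕ) : ℤ) by omega] at h1
      exact h1
    rw [E3] at E
    obtain ⟨-, h4⟩ := List.append_inj E (by simp)
    rw [List.cons.injEq] at h4
    obtain ⟨h5, h6⟩ := h4
    obtain ⟨h7, -⟩ := List.append_inj h6 (by simp; omega)
    refine ⟨h5, ?_⟩
    simp only
    rw [h7]
    exact ⟨hy, hbad u y v hul hvl hu hv hx⟩
  refine (measureReal_mono hsub).trans ((measureReal_union_le _ _).trans ?_)
  refine add_le_add ((measureReal_union_le _ _).trans ?_) ?_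
  · rw [hP.real_free, hP.real_free, two_mul]
  · refine (measureReal_biUnion_finset_le _ _).trans ?_
    refine (Finset.sum_le_card_nsmul _ _ B fun c hc => ?_).trans ?_
    · simp only [Finset.mem_product, Finset.mem_range] at hc
      refine (hP.real_after_le hr c.1 (n - 1 - c.1 - c.2) fun y => Ends s y ∧ Bad' y).trans ?_
      refine le_of_eq_of_le ?_ (hB (n - 1 - c.1 - c.2) (by omega) (by omega))
      congr
    · simp [sq]

end Trim

/-! ### Deviations of the numbers of hidden symbols and of key sites. -/

section Failure

variable {K : Type*} [Fintype K] [MeasurableSpace K] [MeasurableSingletonClass K]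
  {P : Measure (ℤ → Split K)} [IsProbabilityMeasure P]

/-- There are not many hidden symbols. -/
lemma WordStationary.real_hidden_le (hP : WordStationary P) (hr : RenewalLaw (pr P) Split.a)
    {ℓ : ℕ} {c : ℝ} (hc0 : 0 < c) (hq0 : 0 ≤ qh (pr P) Split.a (ℓ - 1))
    (h : ∀ j n : ℕ, ∑ v ∈ (words (Split K) n).filter (Ends Split.a),
      p0 (pr P) Split.a v * Real.exp (c * hc ℓ j (none, some 0) v) ≤
        2 * Real.exp (n * qh (pr P) Split.a (ℓ - 1) ^ j)) (j n T : ℕ) (hT : 2 * T + 1 ≤ n) (τ : ℝ) :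
    P.real {x | τ < hc ℓ j (none, none) (word x 0 n)} ≤ 2 * zf (pr P) Split.a T +
      T ^ 2 * (2 * Real.exp (n * qh (pr P) Split.a (ℓ - 1) ^ j - c * (τ - 2 * T))) := by
  refine hP.trim hr (Bad := fun w => τ < hc ℓ j (none, none) w)
    (Bad' := fun y => τ - 2 * T < hc ℓ j (none, some 0) y) hT ?_ ?_
  · intro u y v hu hv hsu _ h
    -- After the first `a` the position in the block is known but the level is not, which is the
    -- initial state of the exponential moments. The margins add at most 2 T hidden symbols.
    have e : adv ℓ (none, none) (u ++ [Split.a]) = (none, some 0) := by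
      rw [adv_append, adv_free hsu]
      rfl
    rw [show u ++ Split.a :: (y ++ v) = (u ++ [Split.a]) ++ (y ++ v) by simp, hc_append, e,
      hc_append, hc_append] at h
    have h1 := hc_le_length ℓ j (none, none) u
    have h2 := hc_le_length ℓ j (adv ℓ (none, some 0) y) v
    have h3 : hc ℓ j (adv ℓ (none, none) u) [(Split.a : Split K)] = 0 := by simp [hc, hidSym]
    rw [h3] at h
    have h4 : ((hc ℓ j (none, none) u : ℕ) : ℝ) + hc ℓ j (adv ℓ (none, some 0) y) v ≤ 2 * T := by
      have : hc ℓ j (none, none) u + hc ℓ j (adv ℓ (none, some 0) y) v ≤ 2 * T := by omega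
      exact_mod_cast this
    push_cast at h
    linarith
  · intro N hN _
    refine le_trans ?_ (le_trans (mul_le_mul_of_nonneg_right (h j N)
      (Real.exp_pos (-(c * (τ - 2 * T)))).le) ?_)
    · rw [Finset.sum_mul]
      refine (Finset.sum_le_sum fun y hy => ?_).trans (Finset.sum_le_sum_of_subset_of_nonneg
        (s := (words (Split K) N).filter fun y => Ends Split.a y ∧
          τ - 2 * T < hc ℓ j (none, some 0) y) ?_ fun y _ _ => ?_)
      · have h1 := (Finset.mem_filter.1 hy).2.2
        rw [mul_assoc, ← Real.exp_add]
        refine le_mul_of_one_le_right (hr.p0_nonneg y) (Real.one_le_exp ?_)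
        nlinarith
      · intro y hy
        simp only [Finset.mem_filter] at hy ⊢
        exact ⟨hy.1, hy.2.1⟩
      · have := hr.p0_nonneg y
        positivity
    · rw [mul_assoc, ← Real.exp_add]
      refine mul_le_mul_of_nonneg_left (Real.exp_le_exp.2 ?_) zero_le_two
      have : (N : ℝ) * qh (pr P) Split.a (ℓ - 1) ^ j ≤ n * qh (pr P) Split.a (ℓ - 1) ^ j := by
        have := pow_nonneg hq0 j
        gcongr
      linarith

/-- There are many key sites. -/
lemma WordStationary.real_keys_le (hP : WordStationary P) (hr : RenewalLaw (pr P) Split.a)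
    (k₀ : K) {ℓ : ℕ} {c : ℝ} (hc0 : 0 < c) (hq0 : 0 ≤ qh (pr P) Split.a (ℓ - 1))
    (h : ∀ j n : ℕ, ∑ v ∈ (words (Split K) n).filter (Ends Split.a),
      p0 (pr P) Split.a v * Real.exp (-(kb k₀ ℓ j (none, some 0) v).length) ≤
        2 * Real.exp (-(c * n * qh (pr P) Split.a (ℓ - 1) ^ j))) (j n T : ℕ)
    (hT : 2 * T + 1 ≤ n) (τ : ℝ) :
    P.real {x | (kb k₀ ℓ j (none, none) (word x 0 n)).length < τ} ≤ 2 * zf (pr P) Split.a T +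
      T ^ 2 * (2 * Real.exp (τ - c * (n - (2 * T + 1)) * qh (pr P) Split.a (ℓ - 1) ^ j)) := by
  refine hP.trim hr (Bad := fun w => (kb k₀ ℓ j (none, none) w).length < τ)
    (Bad' := fun y => (kb k₀ ℓ j (none, some 0) y).length < τ) hT ?_ ?_
  · intro u y v hu hv hsu _ h
    have e : adv ℓ (none, none) (u ++ [Split.a]) = (none, some 0) := by
      rw [adv_append, adv_free hsu]
      rfl
    rw [show u ++ Split.a :: (y ++ v) = (u ++ [Split.a]) ++ (y ++ v) by simp, kb_append, e,
      kb_append, kb_append] at h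
    simp only [List.length_append, Nat.cast_add] at h
    have h0 : (0 : ℝ) ≤ (kb k₀ ℓ j (none, none) u).length := Nat.cast_nonneg _
    have h1 : (0 : ℝ) ≤ (kb k₀ ℓ j (adv ℓ (none, none) u) [Split.a]).length := Nat.cast_nonneg _
    have h2 : (0 : ℝ) ≤ (kb k₀ ℓ j (adv ℓ (none, some 0) y) v).length := Nat.cast_nonneg _
    linarith
  · intro N hN hN'
    refine le_trans ?_ (le_trans (mul_le_mul_of_nonneg_right (h j N) (Real.exp_pos τ).le) ?_)
    · rw [Finset.sum_mul]
      refine (Finset.sum_le_sum fun y hy => ?_).trans (Finset.sum_le_sum_of_subset_of_nonneg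
        (s := (words (Split K) N).filter fun y => Ends Split.a y ∧
          (kb k₀ ℓ j (none, some 0) y).length < τ) ?_ fun y _ _ => ?_)
      · have h1 := (Finset.mem_filter.1 hy).2.2
        rw [mul_assoc, ← Real.exp_add]
        refine le_mul_of_one_le_right (hr.p0_nonneg y) (Real.one_le_exp ?_)
        linarith
      · intro y hy
        simp only [Finset.mem_filter] at hy ⊢
        exact ⟨hy.1, hy.2.1⟩
      · have := hr.p0_nonneg y
        positivity
    · rw [mul_assoc, ← Real.exp_add]
      refine mul_le_mul_of_nonneg_left (Real.exp_le_exp.2 ?_) zero_le_two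
      have h1 : (n : ℝ) - (2 * T + 1) ≤ N := by
        have : (n : ℝ) ≤ N + (2 * T + 1) := by exact_mod_cast hN'
        linarith
      have : c * (n - (2 * T + 1)) * qh (pr P) Split.a (ℓ - 1) ^ j ≤
          c * N * qh (pr P) Split.a (ℓ - 1) ^ j := by
        have := pow_nonneg hq0 j
        gcongr
      linarith

end Failure

/-! ### Improbability of accidental code words. -/

section CodeFailure

variable {K : Type*} [Fintype K] [MeasurableSpace K] [MeasurableSingletonClass K]
  {p : Measure K} [IsProbabilityMeasure p] {μ : Measure (ℤ → BiState)} [IsProbabilityMeasure μ]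

/-- Sums over all words are estimated by sums over the words with a given mask. -/
lemma sum_keys_le (ℓ j : ℕ) (k₀ : K) (n : ℕ) (f : List Bool → ℝ) (ε : ℝ)
    (hf : ∀ L ≤ n, Eb (wts p k₀) L f ≤ ε) :
    ∑ w ∈ words (Split K) n, pr (splitting μ p) w * f (kb k₀ ℓ j (none, none) w) ≤ ε := by
  have h1 : ∑ w ∈ words (Split K) n, pr (splitting μ p) w = 1 := by
    have := real_word_mem (splitting μ p) 0 n Set.univ
    simp only [Set.mem_univ, Set.ofPred_true, probReal_univ, Finset.filter_true] at this
    rw [this]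
    refine Finset.sum_congr rfl fun w hw => ?_
    rw [pr, mem_words.1 hw]
  let φ : List (Split K) → List (Split (Option K)) := mk ℓ j (none, none)
  have fib : ∀ g : List (Split K) → ℝ, ∑ w ∈ words (Split K) n, g w =
      ∑ M ∈ (words (Split K) n).image φ, ∑ w ∈ (words (Split K) n).filter (fun w => φ w = M), g w :=
    fun g => (Finset.sum_fiberwise_of_maps_to (fun w hw => Finset.mem_image_of_mem φ hw) g).symm
  have key : ∀ M ∈ (words (Split K) n).image φ,
      ∑ w ∈ (words (Split K) n).filter (fun w => φ w = M),
        pr (splitting μ p) w * f (kb k₀ ℓ j (none, none) w) ≤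
      ε * ∑ w ∈ (words (Split K) n).filter (fun w => φ w = M), pr (splitting μ p) w := by
    intro M hM
    obtain ⟨w₀, hw₀, rfl⟩ := Finset.mem_image.1 hM
    rw [mem_words] at hw₀
    have e : ∀ g : List Bool → ℝ, ∑ w ∈ (words (Split K) n).filter (fun w => φ w = φ w₀),
        pr (splitting μ p) w * g (kb k₀ ℓ j (none, none) w) =
        pr μ (w₀.map pat) * (mwt (wts p) ℓ j (none, none) w₀ *
          Eb (wts p k₀) (kb k₀ ℓ j (none, none) w₀).length g) := by
      intro g
      rw [← sum_wt_mask (sum_wts p), hw₀, Finset.sum_filter, Finset.mul_sum]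
      refine Finset.sum_congr rfl fun w _ => ?_
      by_cases h : φ w = φ w₀
      · rw [if_pos h, if_pos h, pr_splitting, pat_eq_of_mk h]
        ring
      · rw [if_neg h, if_neg h, mul_zero]
    have e1 := e fun _ => 1
    simp only [mul_one, Eb_const] at e1
    rw [e, e1]
    have hL : (kb k₀ ℓ j (none, none) w₀).length ≤ n :=
      (kb_length_le_hc _ _ _ _).trans ((hc_le_length _ _ _ _).trans hw₀.le)
    have n1 := pr_nonneg μ (w₀.map pat)
    have n2 := mwt_nonneg (wts_nonneg p) ℓ j (none, none) w₀
    calc _ ≤ pr μ (w₀.map pat) * (mwt (wts p) ℓ j (none, none) w₀ * ε) := by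
          gcongr
          exact hf _ hL
      _ = _ := by ring
  rw [fib]
  refine (Finset.sum_le_sum key).trans_eq ?_
  rw [← Finset.mul_sum, ← fib, h1, mul_one]

/-- Codes are not likely to occur. -/
lemma real_code_le (ℓ j : ℕ) (k₀ : K) (n m : ℕ) (hm : 0 < m) :
    (splitting μ p).real {x | ¬ NoCode m n (kb k₀ ℓ j (none, none) (word x 0 n))} ≤
      n * (n + 1) * (max (wts p k₀) (1 - wts p k₀)) ^ m := by
  have h0 := wts_nonneg p k₀
  have h1 : wts p k₀ ≤ 1 := measureReal_le_one
  have := real_word_mem (splitting μ p) 0 n {w | ¬ NoCode m n (kb k₀ ℓ j (none, none) w)}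
  simp only [Set.mem_ofPred_eq] at this
  rw [this, Finset.sum_filter]
  refine le_trans (le_of_eq ?_) (sum_keys_le (p := p) (μ := μ) ℓ j k₀ n
    (fun l => 1 - if NoCode m n l then 1 else 0) _ fun L hL => ?_)
  · refine Finset.sum_congr rfl fun w hw => ?_
    rw [pr, mem_words.1 hw]
    split_ifs <;> simp
  · have e : Eb (wts p k₀) L (fun l => 1 - if NoCode m n l then 1 else 0) =
        1 - Eb (wts p k₀) L (fun l => if NoCode m n l then 1 else 0) := by
      have := Eb_add (β := wts p k₀) L (fun l => 1 - if NoCode m n l then 1 else 0)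
        (fun l => if NoCode m n l then 1 else 0)
      simp only [sub_add_cancel, Eb_const] at this
      linarith
    rw [e]
    have h2 := Eb_noCode h0 h1 m n L hm
    have h3 : (L : ℝ) * (n + 1) * (max (wts p k₀) (1 - wts p k₀)) ^ m ≤
        n * (n + 1) * (max (wts p k₀) (1 - wts p k₀)) ^ m := by
      have : (0 : ℝ) ≤ max (wts p k₀) (1 - wts p k₀) := le_max_of_le_left h0
      gcongr
    linarith

end CodeFailure



/-! ### Masses of words with given masks -/

section MaskMass

variable {K : Type*} [Fintype K] [MeasurableSpace K] [MeasurableSingletonClass K]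
  {p : Measure K} [IsProbabilityMeasure p] {μ : Measure (ℤ → BiState)} [IsProbabilityMeasure μ]
  {s : Split K} {t : BiState} {Θ : Scheme K}

/-- The conditional information of a word between two occurrences of `s`. -/
def cinfo (pr : List (Split K) → ℝ) (s : Split K) (w : List (Split K)) : ℝ :=
  Real.log (hpr pr s (w ++ [s]) / pr (w ++ [s]))

variable (hs : Unsplit μ s t) (hμ : WordStationary μ) {w : List (Split K)}
  (hw : 0 < pr (splitting μ p) (w ++ [s]))

include hs in
lemma Unsplit.pr_snoc_eq (w : List (Split K)) :
    pr (splitting μ p) (w ++ [s]) = pr μ ((w ++ [s]).map pat) * wt (wts p) w := by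
  rw [pr_splitting, wt_append, hs.wt_cons, wt, mul_one]

include hs hw

lemma Unsplit.wt_pos : 0 < wt (wts p) w := by
  rw [hs.pr_snoc_eq] at hw
  exact (wt_nonneg (wts_nonneg p) w).lt_of_ne fun e => by simp [← e] at hw

include hμ

lemma Unsplit.hpr_pos : 0 < hpr (pr (splitting μ p)) s (w ++ [s]) :=
  hw.trans_le ((hs.renewalLaw hμ).pr_le_hpr _)

/-- All words with the given mask have the same pattern, so only the weights of their symbols vary.
The single word w accounts for exp(-cinfo), the hidden symbols for the quotient of weights, and the
condition on the independent key bits for the last factor. -/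
lemma Unsplit.mass_mask (f : List Bool → Prop) :
    mass (pr (splitting μ p)) s w (fun w' => mask Θ w' = mask Θ w ∧ f (keys Θ w')) =
      Real.exp (-cinfo (pr (splitting μ p)) s w) *
        (mwt (wts p) Θ.len (Θ.lvl w.length) (none, none) w / wt (wts p) w) *
          Eb (wts p Θ.key) (keys Θ w).length (fun l => if f l then 1 else 0) := by
  have hh := hs.hpr_pos hμ hw
  have hwt := hs.wt_pos hw
  obtain ⟨E, hE⟩ : ∃ E : List (Split K) → Prop,
      E = fun w' => mask Θ w' = mask Θ w ∧ f (keys Θ w') := ⟨_, rfl⟩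
  rw [← hE]
  have e1 : ∑ w' ∈ (words (Split K) w.length).filter
      (fun w' => Fillers.hw s w' = Fillers.hw s w ∧ E w'),
      pr (splitting μ p) (w' ++ [s]) = pr μ ((w ++ [s]).map pat) *
        (mwt (wts p) Θ.len (Θ.lvl w.length) (none, none) w *
          Eb (wts p Θ.key) (keys Θ w).length (fun l => if f l then 1 else 0)) := by
    rw [keys, ← sum_wt_mask (sum_wts p), Finset.sum_filter, Finset.mul_sum]
    refine Finset.sum_congr rfl fun w' hw' => ?_
    rw [mem_words] at hw'
    have em : mask Θ w' = Fillers.mk Θ.len (Θ.lvl w.length) (none, none) w' := by rw [mask, hw']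
    have ek : keys Θ w' = kb Θ.key Θ.len (Θ.lvl w.length) (none, none) w' := by rw [keys, hw']
    have hE' : E w' ↔ Fillers.mk Θ.len (Θ.lvl w.length) (none, none) w' =
        Fillers.mk Θ.len (Θ.lvl w.length) (none, none) w ∧
        f (kb Θ.key Θ.len (Θ.lvl w.length) (none, none) w') := by
      simp only [hE, ek, em]
      rfl
    simp only [hE']
    by_cases h : Fillers.mk Θ.len (Θ.lvl w.length) (none, none) w' =
        Fillers.mk Θ.len (Θ.lvl w.length) (none, none) w
    · have h1 := pat_eq_of_mk h
      have h2 : Fillers.hw s w' = Fillers.hw s w := hs.notSym _ _ h1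
      by_cases h3 : f (kb Θ.key Θ.len (Θ.lvl w.length) (none, none) w')
      · rw [if_pos ⟨h2, h, h3⟩, if_pos h, if_pos h3, hs.pr_snoc_eq]
        simp [h1]
      · rw [if_neg (fun h' => h3 h'.2.2), if_pos h, if_neg h3]
        simp
    · rw [if_neg (fun h' => h h'.2.1), if_neg h, mul_zero]
  have e2 : Real.exp (-cinfo (pr (splitting μ p)) s w) =
      pr (splitting μ p) (w ++ [s]) / hpr (pr (splitting μ p)) s (w ++ [s]) := by
    rw [cinfo, ← Real.log_inv, inv_div, Real.exp_log (div_pos hw hh)]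
  rw [mass, e1, e2, hs.pr_snoc_eq]
  field_simp

/-- The class of words with a given mask is small. -/
lemma Unsplit.mass_mask_le {γ : ℝ} (hγ0 : 0 < γ) (hγ1 : ∀ k, 0 < wts p k → γ ≤ wts p k) :
    mass (pr (splitting μ p)) s w (fun w' => mask Θ w' = mask Θ w) ≤
      Real.exp (-cinfo (pr (splitting μ p)) s w) *
        (γ ^ hc Θ.len (Θ.lvl w.length) (none, none) w)⁻¹ := by
  have h := hs.mass_mask hμ hw (Θ := Θ) fun _ => True
  simp only [and_true, if_true, Eb_const, mul_one] at h
  rw [h]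
  refine mul_le_mul_of_nonneg_left ?_ (Real.exp_pos _).le
  rw [div_le_iff₀ (hs.wt_pos hw), ← div_eq_inv_mul, le_div_iff₀ (by positivity), mul_comm]
  exact mwt_le_wt (wts_nonneg p) hγ0.le hγ1 _ _ _ _ (hs.wt_pos hw)

/-- Typical words are good. -/
theorem Unsplit.good_of_noCode {γ : ℝ} (hγ0 : 0 < γ) (hγ1 : ∀ k, wts p k ≤ γ) {ψ : ℕ → ℝ} {m : ℕ}
    (hm : m = keyLen (Θ.lvl w.length)) (hlen : w.length < 2 ^ (Θ.lvl w.length) ^ 2)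
    (hno : NoCode m w.length (keys Θ w)) (hL : m ≤ (keys Θ w).length)
    (hε : (w.length : ℝ) * (w.length + 1) * (max (wts p Θ.key) (1 - wts p Θ.key)) ^ m ≤ 1 / 2)
    (hψ : Real.exp (-ψ w.length) ≤ Real.exp (-cinfo (pr (splitting μ p)) s w) *
      (γ ^ hc Θ.len (Θ.lvl w.length) (none, none) w)⁻¹ *
        ((min (wts p Θ.key) (1 - wts p Θ.key)) ^ m * (1 / 2))) :
    Good Θ (pr (splitting μ p)) s ψ w := by
  have hr := hs.renewalLaw (p := p) hμ
  have hm0 : 0 < m := by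
    rw [hm, keyLen]
    omega
  have h0 : 0 ≤ wts p Θ.key := wts_nonneg p Θ.key
  have h1 : wts p Θ.key ≤ 1 := measureReal_le_one
  have hm1 : (min (wts p Θ.key) (1 - wts p Θ.key)) ^ m ≤ 1 :=
    pow_le_one₀ (le_min h0 (by linarith)) ((min_le_left _ _).trans h1)
  have hk : ¬ Kap Θ w := not_kap_of_noCode (hm ▸ hno) le_rfl
  have hsub : ∀ i l, i + l ≤ w.length → l < w.length → Θ.lvl l = Θ.lvl w.length →
      ¬ Kap Θ (sub w i l) := fun i l hi hl hj =>
    not_kap_sub_of_noCode (hm ▸ hno) hl.le hi hj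
  have hLn : (keys Θ w).length ≤ w.length :=
    (kb_length_le_hc _ _ _ _).trans (hc_le_length _ _ _ _)
  have hE : ∀ L' ≤ (keys Θ w).length, 1 / 2 ≤
      Eb (wts p Θ.key) L' (fun l => if NoCode m w.length l then 1 else 0) := by
    intro L' hL'
    refine le_trans ?_ (Eb_noCode h0 h1 m w.length L' hm0)
    have : (L' : ℝ) * (w.length + 1) * (max (wts p Θ.key) (1 - wts p Θ.key)) ^ m ≤
        w.length * (w.length + 1) * (max (wts p Θ.key) (1 - wts p Θ.key)) ^ m := by
      have : (0 : ℝ) ≤ max (wts p Θ.key) (1 - wts p Θ.key) := le_max_of_le_left h0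
      have : (L' : ℝ) ≤ w.length := by exact_mod_cast hL'.trans hLn
      gcongr
    linarith
  have hq : (γ ^ hc Θ.len (Θ.lvl w.length) (none, none) w)⁻¹ ≤
      mwt (wts p) Θ.len (Θ.lvl w.length) (none, none) w / wt (wts p) w := by
    rw [le_div_iff₀ (hs.wt_pos hw), ← div_eq_inv_mul, div_le_iff₀ (by positivity), mul_comm]
    exact wt_le_mwt (wts_nonneg p) hγ0.le hγ1 _ _ _ _
  -- Any event of the key bits that is at least as likely as a code prefix with a clean rest gives
  -- enough mass; this serves the keyed and the unkeyed half of the class.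
  have lower : ∀ (f : List Bool → Prop) (E : List (Split K) → Prop),
      (min (wts p Θ.key) (1 - wts p Θ.key)) ^ m * (1 / 2) ≤
        Eb (wts p Θ.key) (keys Θ w).length (fun l => if f l then 1 else 0) →
      (∀ w', mask Θ w' = mask Θ w → f (keys Θ w') → E w') →
      Real.exp (-ψ w.length) ≤ mass (pr (splitting μ p)) s w E := by
    intro f E h2 h3
    refine hψ.trans (le_trans ?_ (hr.mass_mono (E := fun w' => mask Θ w' = mask Θ w ∧
      f (keys Θ w')) fun w' _ h => h3 w' h.1 h.2))
    rw [hs.mass_mask hμ hw]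
    have n1 : 0 ≤ min (wts p Θ.key) (1 - wts p Θ.key) := le_min h0 (by linarith)
    exact mul_le_mul (mul_le_mul_of_nonneg_left hq (Real.exp_pos _).le) h2 (by positivity)
      (mul_nonneg (Real.exp_pos _).le (div_nonneg (mwt_nonneg (wts_nonneg p) _ _ _ _)
        (hs.wt_pos hw).le))
  refine ⟨hk, ?_, ?_⟩
  -- The keyed half: the bits begin with the code of the length and contain no code afterwards, so
  -- no proper part of equal threshold has its key event.
  · refine lower (fun l => l.take m = code m w.length ∧ NoCode m w.length (l.drop m)) _ ?_ ?_
    · have := Eb_take_mul h0 h1 (code m w.length) (keys Θ w).length (by simpa using hL)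
        (fun l => if NoCode m w.length l then 1 else 0) (1 / 2) (by norm_num) hE
      rw [code_length] at this
      refine this.trans (Eb_mono h0 h1 _ fun l _ => le_of_eq ?_)
      by_cases g1 : l.take m = code m w.length <;> by_cases g2 : NoCode m w.length (l.drop m) <;>
        simp [g1, g2]
    · rintro w' h2 ⟨h3, h4⟩
      have hl := mask_length_eq h2
      refine ⟨ME_of_mask h2 (fun i l hi hlw hj => ?_) (fun i l hi hlw hj => ?_), ?_⟩
      · rw [hl] at hi hlw hj
        refine not_kap_sub_of_code (m := m) ?_ ?_ ?_ ?_ (hl ▸ hi) (hl ▸ hlw) (hl ▸ hj)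
        · rw [hl, hm]
        · rw [hl, h3]
        · rwa [hl]
        · rwa [hl]
      · rw [hl] at hi hlw hj
        exact hsub i l hi hlw hj
      · rw [Kap, hl, ← hm, h3]
  -- The unkeyed half: there is no code among the key bits at all.
  · refine lower (fun l => NoCode m w.length l) _ ?_ ?_
    · refine le_trans ?_ (hE _ le_rfl)
      linarith
    · rintro w' h2 h3
      have hl := mask_length_eq h2
      have h3' : NoCode (keyLen (Θ.lvl w'.length)) w.length (keys Θ w') := by rwa [hl, ← hm]
      refine ⟨ME_of_mask h2 (fun i l hi hlw hj => ?_) (fun i l hi hlw hj => ?_), ?_⟩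
      · exact not_kap_sub_of_noCode h3' (by omega) hi hj
      · rw [hl] at hi hlw hj
        exact hsub i l hi hlw hj
      · exact not_kap_of_noCode h3' hl.le

end MaskMass



/-! ### Rates -/

section Decay

lemma tendsto_log_nat : Tendsto (fun n : ℕ => Real.log n) atTop atTop :=
  Real.tendsto_log_atTop.comp tendsto_natCast_atTop_atTop

/-- The quadratic exponent in log n beats every power of n, by completing the square. -/
lemma superpolyDecay_of_le {f : ℕ → ℝ} {A c : ℝ} (j : ℕ) (hc : 0 < c)
    (h : ∀ᶠ n : ℕ in atTop, |f n| ≤ A * n ^ j * Real.exp (-(c * Real.log n ^ 2))) :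
    SuperpolyDecay (fun n => (n : ℝ)) f := by
  intro k
  refine IsBigO.of_bound (|A| * Real.exp ((j + k) ^ 2 / (4 * c))) ?_
  filter_upwards [h, eventually_gt_atTop 0] with n hn h0
  have hn0 : (0 : ℝ) < n := by exact_mod_cast h0
  rw [Real.norm_eq_abs, Real.norm_eq_abs, abs_of_nonneg (a := ((n : ℝ) ^ k)⁻¹) (by positivity),
    ← div_eq_mul_inv,
    le_div_iff₀ (by positivity)]
  have e : ∀ i : ℕ, (n : ℝ) ^ i = Real.exp (i * Real.log n) := fun i => by
    rw [Real.exp_nat_mul, Real.exp_log hn0]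
  calc |f n| * n ^ k ≤ (A * n ^ j * Real.exp (-(c * Real.log n ^ 2))) * n ^ k := by gcongr
    _ = A * Real.exp ((j + k) * Real.log n - c * Real.log n ^ 2) := by
      rw [e j, e k, mul_assoc, mul_assoc, ← Real.exp_add, ← Real.exp_add]
      ring_nf
    _ ≤ |A| * Real.exp ((j + k) ^ 2 / (4 * c)) := by
      refine mul_le_mul (le_abs_self A) (Real.exp_le_exp.2 ?_) (Real.exp_pos _).le (abs_nonneg _)
      rw [le_div_iff₀ (by positivity)]
      nlinarith [sq_nonneg ((j + k) - 2 * c * Real.log n)]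

lemma SuperpolyDecay.add {L f g : ℕ → ℝ} (hf : SuperpolyDecay L f) (hg : SuperpolyDecay L g) :
    SuperpolyDecay L (fun n => f n + g n) := fun k => (hf k).add (hg k)

lemma SuperpolyDecay.mono {L f g : ℕ → ℝ} (hg : SuperpolyDecay L g)
    (h : ∀ᶠ n in atTop, |f n| ≤ |g n|) : SuperpolyDecay L f := fun k =>
  (IsBigO.of_bound 1 (h.mono fun n hn => by simpa using hn)).trans (hg k)

end Decay

/-! ### A superadditive bound for the information of classes. -/

section Psi

/-- The bound for the information of classes. -/
def psi (h : ℝ) (n₁ n : ℕ) : ℝ :=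
  n * (if n < n₁ then 0 else h - Real.log n ^ 2 / √n)

lemma psi_eq {h : ℝ} {n₁ n : ℕ} (hn : n₁ ≤ n) :
    psi h n₁ n = n * h - √n * Real.log n ^ 2 := by
  rw [psi, if_neg (by omega)]
  rcases Nat.eq_zero_or_pos n with rfl | h0
  · simp
  have h1 : (0 : ℝ) < √n := Real.sqrt_pos.2 (by exact_mod_cast h0)
  have h2 : (n : ℝ) = √n * √n := (Real.mul_self_sqrt n.cast_nonneg).symm
  field_simp
  rw [mul_sub]
  nth_rewrite 3 [h2]
  ring_nf

/-- The function is the square of log x / x^(1/4), which decreases from exp 4 on. -/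
lemma sq_log_div_sqrt_antitone : AntitoneOn (fun x : ℝ => Real.log x ^ 2 / √x)
    {x | Real.exp 4 ≤ x} := by
  intro x hx y hy hxy
  have h := Real.log_div_self_rpow_antitoneOn (a := 1 / 4) (by norm_num)
    (show x ∈ _ by rw [Set.mem_Ici]; norm_num; exact hx)
    (show y ∈ _ by rw [Set.mem_Ici]; norm_num; exact hy) hxy
  have e : ∀ z : ℝ, Real.exp 4 ≤ z → Real.log z ^ 2 / √z = (Real.log z / z ^ (1 / 4 : ℝ)) ^ 2 := by
    intro z hz
    have hz0 : 0 < z := (Real.exp_pos _).trans_le hz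
    rw [div_pow, Real.sqrt_eq_rpow, ← Real.rpow_natCast, ← Real.rpow_natCast, ← Real.rpow_mul hz0.le]
    norm_num
  simp only at h ⊢
  rw [e x hx, e y hy]
  have hy1 : 1 ≤ y := (Real.one_le_exp (by norm_num)).trans hy
  exact pow_le_pow_left₀ (div_nonneg (Real.log_nonneg hy1) (by positivity)) h 2

lemma tendsto_sq_log_div_sqrt :
    Tendsto (fun n : ℕ => Real.log n ^ 2 / √(n : ℝ)) atTop (𝓝 0) := by
  have h := (Real.isLittleO_pow_log_id_atTop (n := 4)).tendsto_div_nhds_zero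
  have h2 := (h.sqrt).comp (tendsto_natCast_atTop_atTop (R := ℝ))
  rw [Real.sqrt_zero] at h2
  refine h2.congr fun n => ?_
  simp only [Function.comp, id]
  rw [Real.sqrt_div' _ n.cast_nonneg, show Real.log n ^ 4 = (Real.log n ^ 2) ^ 2 by ring,
    Real.sqrt_sq (sq_nonneg _)]

/-- ψ(n) is n times a rate that is nonnegative and nondecreasing once n₁ is large, and such
functions are superadditive. -/
lemma exists_psi {h : ℝ} (hh : 0 < h) : ∃ n₁ : ℕ, (∀ n, 0 ≤ psi h n₁ n) ∧
    ∀ i j, psi h n₁ i + psi h n₁ j ≤ psi h n₁ (i + j) := by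
  obtain ⟨N, hN⟩ := eventually_atTop.1 (tendsto_sq_log_div_sqrt.eventually (eventually_le_nhds hh))
  set n₁ := max N ⌈Real.exp 4⌉₊ with hn₁
  have hge : ∀ n : ℕ, n₁ ≤ n → Real.exp 4 ≤ n := fun n hn =>
    (Nat.le_ceil _).trans (by exact_mod_cast (le_max_right _ _).trans hn)
  let rate : ℕ → ℝ := fun n => if n < n₁ then 0 else h - Real.log n ^ 2 / √n
  have h0 : ∀ n, 0 ≤ rate n := by
    intro n
    simp only [rate]
    split_ifs with hn
    · exact le_rfl
    · linarith [hN n ((le_max_left _ _).trans (not_lt.1 hn))]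
  have hm : Monotone rate := by
    intro i j hij
    by_cases hi : i < n₁
    · have : rate i = 0 := if_pos hi
      rw [this]
      exact h0 j
    · have hj : ¬ j < n₁ := by omega
      simp only [rate, if_neg hi, if_neg hj]
      have := sq_log_div_sqrt_antitone (hge i (not_lt.1 hi)) (hge j (not_lt.1 hj))
        (by exact_mod_cast hij)
      simp only at this
      linarith
  refine ⟨n₁, fun n => mul_nonneg n.cast_nonneg (h0 n), fun i j => ?_⟩
  change i * rate i + j * rate j ≤ ((i + j : ℕ) : ℝ) * rate (i + j)
  have h1 := mul_le_mul_of_nonneg_left (hm (Nat.le_add_right i j)) (Nat.cast_nonneg (α := ℝ) i)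
  have h2 := mul_le_mul_of_nonneg_left (hm (Nat.le_add_left j i)) (Nat.cast_nonneg (α := ℝ) j)
  push_cast
  linarith

end Psi

/-! ### The threshold level. -/

section Lvl

/-- The level from which on symbols are hidden. -/
def lvl (q : ℝ) (n : ℕ) : ℕ :=
  if Real.log n < 6 then 0 else
    ⌊(Real.log n / 2 - 3 * Real.log (Real.log n)) / -Real.log q⌋₊

variable {q : ℝ} (hq0 : 0 < q) (hq1 : q < 1)
include hq0 hq1

/-- With y = log n, the function y / 2 - 3 log y is nondecreasing from y = 6 on, which is the reason
for the cutoff in `lvl`. -/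
lemma lvl_mono : Monotone (lvl q) := by
  have hlam : 0 < -Real.log q := neg_pos.2 (Real.log_neg hq0 hq1)
  intro i j hij
  rw [lvl]
  split_ifs with hi
  · exact Nat.zero_le _
  rw [not_lt] at hi
  have hi0 : (0 : ℝ) < i := by
    rcases Nat.eq_zero_or_pos i with rfl | h
    · norm_num at hi
    · exact_mod_cast h
  have hlog : Real.log i ≤ Real.log j := Real.log_le_log hi0 (by exact_mod_cast hij)
  rw [lvl, if_neg (by linarith)]
  refine Nat.floor_le_floor (div_le_div_of_nonneg_right ?_ hlam.le)
  have hj6 : 6 ≤ Real.log j := hi.trans hlog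
  have h1 : Real.log (Real.log j / Real.log i) ≤ Real.log j / Real.log i - 1 :=
    Real.log_le_sub_one_of_pos (by positivity)
  rw [Real.log_div (by linarith) (by linarith)] at h1
  have h2 : Real.log j / Real.log i - 1 ≤ (Real.log j - Real.log i) / 6 := by
    rw [← sub_nonneg]
    have : (Real.log j - Real.log i) / 6 - (Real.log j / Real.log i - 1) =
        (Real.log j - Real.log i) * (1 / 6 - 1 / Real.log i) := by
      field_simp
    rw [this]
    refine mul_nonneg (by linarith) ?_
    rw [sub_nonneg]
    exact one_div_le_one_div_of_le (by norm_num) hi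
  linarith

/-- Estimates for the level. -/
lemma eventually_lvl : ∀ᶠ n : ℕ in atTop, 0 < n ∧ 1 ≤ Real.log n ∧
    Real.log n ^ 3 ≤ √n * q ^ lvl q n ∧ √n * q ^ lvl q n ≤ q⁻¹ * Real.log n ^ 3 ∧
    Real.log n / (4 * -Real.log q) ≤ lvl q n ∧ lvl q n ≤ Real.log n / (2 * -Real.log q) := by
  have hlam : 0 < -Real.log q := neg_pos.2 (Real.log_neg hq0 hq1)
  set lam := -Real.log q with hl
  have hlittle : ∀ᶠ y : ℝ in atTop, 3 * Real.log y + lam ≤ y / 4 := by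
    have h := (Real.isLittleO_log_id_atTop.def (c := 1 / 24) (by norm_num))
    filter_upwards [h, eventually_ge_atTop 1, eventually_ge_atTop (8 * lam)] with y h1 h2 h3
    rw [Real.norm_eq_abs, Real.norm_eq_abs, id, abs_of_nonneg (Real.log_nonneg h2),
      abs_of_nonneg (by linarith)] at h1
    linarith
  filter_upwards [eventually_gt_atTop 0, tendsto_log_nat.eventually_ge_atTop 6,
    tendsto_log_nat.eventually hlittle] with n h0 h6 hlit
  have hn0 : (0 : ℝ) < n := by exact_mod_cast h0
  set y := Real.log n with hy
  have hly : 0 ≤ Real.log y := Real.log_nonneg (by linarith)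
  have hdef : lvl q n = ⌊(y / 2 - 3 * Real.log y) / lam⌋₊ := by
    rw [lvl, if_neg (by linarith)]
  have hφ0 : 0 ≤ (y / 2 - 3 * Real.log y) / lam := div_nonneg (by linarith) hlam.le
  have up : (lvl q n : ℝ) * lam ≤ y / 2 - 3 * Real.log y := by
    rw [← le_div_iff₀ hlam, hdef]
    exact Nat.floor_le hφ0
  have lo : y / 2 - 3 * Real.log y - lam ≤ (lvl q n : ℝ) * lam := by
    have := Nat.lt_floor_add_one ((y / 2 - 3 * Real.log y) / lam)
    rw [← hdef, div_lt_iff₀ hlam] at this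
    linarith
  have hsq : √(n : ℝ) = Real.exp (y / 2) := by
    rw [Real.exp_half, hy, Real.exp_log hn0]
  have hqe : q ^ lvl q n = Real.exp (-(lvl q n * lam)) := by
    rw [hl, ← Real.exp_log hq0, ← Real.exp_nat_mul, Real.exp_log hq0]
    ring_nf
  have hy3 : y ^ 3 = Real.exp (3 * Real.log y) := by
    have := Real.exp_nat_mul (Real.log y) 3
    rw [Real.exp_log (by linarith)] at this
    exact_mod_cast this.symm
  have hqi : q⁻¹ = Real.exp lam := by
    rw [hl, Real.exp_neg, Real.exp_log hq0]
  refine ⟨h0, by linarith, ?_, ?_, ?_, ?_⟩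
  · rw [hsq, hqe, hy3, ← Real.exp_add]
    exact Real.exp_le_exp.2 (by linarith)
  · rw [hsq, hqe, hy3, hqi, ← Real.exp_add, ← Real.exp_add]
    exact Real.exp_le_exp.2 (by linarith)
  · rw [div_le_iff₀ (by positivity)]
    linarith
  · rw [le_div_iff₀ (by positivity)]
    linarith

/-- The scheme of masks. -/
def scheme {K : Type*} (k₀ : K) (ℓ : ℕ) : Scheme K := ⟨k₀, ℓ, lvl q, lvl_mono hq0 hq1⟩

end Lvl



/-! ### Typical words -/

section Typical

variable {K : Type*} [Fintype K] [MeasurableSpace K] [MeasurableSingletonClass K]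
  {p : Measure K} [IsProbabilityMeasure p] {μ : Measure (ℤ → BiState)} [IsProbabilityMeasure μ]
  {s : Split K} {t : BiState}

/-- Typical words. -/
structure Typ (Θ : Scheme K) (pr : List (Split K) → ℝ) (s : Split K) (κ : ℝ)
    (w : List (Split K)) : Prop where
  info : |cinfo pr s w - hrate pr s * w.length| ≤ √(w.length : ℝ) * Real.log w.length ^ 2
  noCode : NoCode (keyLen (Θ.lvl w.length)) w.length (keys Θ w)
  keys_ge : κ * (√(w.length : ℝ) * Real.log w.length ^ 3) ≤ (keys Θ w).length
  hidden_le : hc Θ.len (Θ.lvl w.length) (none, none) w ≤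
    √(w.length : ℝ) * Real.log w.length ^ 4

variable {q : ℝ} (hq0 : 0 < q) (hq1 : q < 1) {k₀ : K} (ℓ : ℕ)

lemma one_le_sqrt_nat {n : ℕ} (hn : 0 < n) : 1 ≤ √(n : ℝ) := by
  rw [Real.one_le_sqrt]
  exact_mod_cast hn

set_option maxHeartbeats 1000000 in
-- The information of a typical word exceeds ψ by at most 2 √n log² n. The hidden symbols, at least
-- as many as the key sites, give back a multiple of √n log³ n, which also covers the cost of order
-- log² n of prescribing the code.
lemma eventually_typ_good (hs : Unsplit μ s t) (hμ : WordStationary μ) (hk0 : 0 < wts p k₀)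
    (hk1 : wts p k₀ < 1) {γ : ℝ} (hγ0 : 0 < γ) (hγ1 : γ < 1) (hγ : ∀ k, wts p k ≤ γ) {κ : ℝ}
    (hκ : 0 < κ) (n₁ : ℕ) : ∀ᶠ n : ℕ in atTop, ∀ w : List (Split K), w.length = n →
      0 < pr (splitting μ p) (w ++ [s]) →
      Typ (scheme hq0 hq1 k₀ ℓ) (pr (splitting μ p)) s κ w →
      Good (scheme hq0 hq1 k₀ ℓ) (pr (splitting μ p)) s
        (psi (hrate (pr (splitting μ p)) s) n₁) w := by
  set Θ := scheme hq0 hq1 k₀ ℓ with hΘ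
  set h := hrate (pr (splitting μ p)) s with hh
  have hlam : 0 < -Real.log q := neg_pos.2 (Real.log_neg hq0 hq1)
  set lam := -Real.log q with hl
  set pm := max (wts p k₀) (1 - wts p k₀) with hpm
  set pn := min (wts p k₀) (1 - wts p k₀) with hpn
  have hpm0 : 0 < pm := lt_max_of_lt_left hk0
  have hpm1 : pm < 1 := max_lt hk1 (by linarith)
  have hpn0 : 0 < pn := lt_min hk0 (by linarith)
  have hpn1 : pn < 1 := min_lt_of_left_lt hk1
  set G := -Real.log γ with hG
  have hG0 : 0 < G := neg_pos.2 (Real.log_neg hγ0 hγ1)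
  set c := -Real.log pn with hc
  have hc0 : 0 < c := neg_pos.2 (Real.log_neg hpn0 hpn1)
  set d := -Real.log pm with hd
  have hd0 : 0 < d := neg_pos.2 (Real.log_neg hpm0 hpm1)
  have l2 : 0 < Real.log 2 := Real.log_pos one_lt_two
  filter_upwards [eventually_lvl hq0 hq1, eventually_ge_atTop n₁,
    tendsto_log_nat.eventually_ge_atTop ((1 / (2 * lam ^ 2) + 3) / κ),
    tendsto_log_nat.eventually_ge_atTop ((2 + c / (2 * lam ^ 2) + 3 * c + Real.log 2) / (κ * G)),
    tendsto_log_nat.eventually_gt_atTop (16 * lam ^ 2 / Real.log 2),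
    tendsto_log_nat.eventually_ge_atTop (8 * lam ^ 2 * (2 + 2 * Real.log 2) / d)]
    with n hlv hn1 h1 h2 h3 h4 w hw hpos htyp
  obtain ⟨h0, hy1, -, -, hlo, hup⟩ := hlv
  have hn0 : (0 : ℝ) < n := by exact_mod_cast h0
  have hr1 := one_le_sqrt_nat h0
  set y := Real.log n with hy
  set r := √(n : ℝ) with hr
  have hΘl : Θ.lvl w.length = lvl q n := by rw [hw]; rfl
  set j := lvl q n with hj
  -- m is of order log² n: large enough to encode all numbers up to n and to make code words
  -- superpolynomially rare, and small enough for the probability pn^m of a given code word to be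
  -- negligible against the hidden symbols.
  set m := keyLen j with hm
  have hmj : (m : ℝ) = 2 * (j : ℝ) ^ 2 + 3 := by rw [hm, keyLen]; push_cast; ring
  have hm_up : (m : ℝ) ≤ y ^ 2 / (2 * lam ^ 2) + 3 := by
    rw [hmj]
    have : (j : ℝ) ^ 2 ≤ (y / (2 * lam)) ^ 2 := by gcongr
    have e : (y / (2 * lam)) ^ 2 = y ^ 2 / (2 * lam ^ 2) / 2 := by field_simp
    linarith
  have hj2 : y ^ 2 / (16 * lam ^ 2) ≤ (j : ℝ) ^ 2 := by
    have : (y / (4 * lam)) ^ 2 ≤ (j : ℝ) ^ 2 := by gcongr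
    have e : (y / (4 * lam)) ^ 2 = y ^ 2 / (16 * lam ^ 2) := by field_simp; ring
    linarith
  have hm_lo : y ^ 2 / (8 * lam ^ 2) ≤ m := by
    rw [hmj]
    have e : y ^ 2 / (8 * lam ^ 2) = 2 * (y ^ 2 / (16 * lam ^ 2)) := by field_simp; ring
    linarith
  have hexp : Real.exp y = n := Real.exp_log hn0
  obtain ⟨t1, t2, t3, t4⟩ := htyp
  rw [hΘl] at t2 t4
  rw [hw] at t1 t2 t3 t4
  refine hs.good_of_noCode hμ hpos hγ0 hγ (m := m) (by rw [hΘl]) ?_ (by rwa [hw]) ?_ ?_ ?_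
  · rw [hΘl, hw]
    have : (n : ℝ) < (2 : ℝ) ^ (j ^ 2) := by
      rw [← hexp, ← Real.exp_log (show (0 : ℝ) < 2 ^ j ^ 2 by positivity), Real.log_pow]
      refine Real.exp_lt_exp.2 ?_
      push_cast
      rw [div_lt_iff₀ l2] at h3
      have : y ≤ y ^ 2 / (16 * lam ^ 2) * Real.log 2 := by
        rw [div_mul_eq_mul_div, le_div_iff₀ (by positivity)]
        nlinarith
      have h5 : y < y ^ 2 / (16 * lam ^ 2) * Real.log 2 := by
        rw [div_mul_eq_mul_div, lt_div_iff₀ (by positivity)]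
        nlinarith
      nlinarith
    exact_mod_cast this
  · have : (m : ℝ) ≤ (keys Θ w).length := by
      refine le_trans ?_ t3
      rw [div_le_iff₀ hκ] at h1
      have e1 : y ^ 2 / (2 * lam ^ 2) + 3 ≤ y ^ 2 * (1 / (2 * lam ^ 2) + 3) := by
        have e : y ^ 2 * (1 / (2 * lam ^ 2) + 3) = y ^ 2 / (2 * lam ^ 2) + y ^ 2 * 3 := by ring
        rw [e]
        linarith [one_le_pow₀ hy1 (n := 2)]
      have e2 : y ^ 2 * (1 / (2 * lam ^ 2) + 3) ≤ y ^ 2 * (y * κ) := by gcongr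
      have e3 : y ^ 2 * (y * κ) ≤ κ * (r * y ^ 3) := by
        have e : κ * (r * y ^ 3) = r * (y ^ 2 * (y * κ)) := by ring
        rw [e]
        exact le_mul_of_one_le_left (by positivity) hr1
      linarith
    exact_mod_cast this
  · rw [hw]
    change (n : ℝ) * (n + 1) * pm ^ m ≤ 1 / 2
    have e1 : pm ^ m = Real.exp (-(m * d)) := by
      rw [hd, ← Real.exp_log hpm0, ← Real.exp_nat_mul, Real.exp_log hpm0]
      ring_nf
    have e2 : (n : ℝ) * (n + 1) ≤ Real.exp (2 * y + Real.log 2) := by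
      rw [Real.exp_add, two_mul, Real.exp_add, hexp, Real.exp_log two_pos]
      have : (1 : ℝ) ≤ n := by exact_mod_cast h0
      nlinarith
    calc _ ≤ Real.exp (2 * y + Real.log 2) * Real.exp (-(m * d)) := by
          rw [e1]
          gcongr
      _ = Real.exp (2 * y + Real.log 2 - m * d) := by rw [← Real.exp_add]; ring_nf
      _ ≤ Real.exp (-Real.log 2) := by
        refine Real.exp_le_exp.2 ?_
        rw [div_le_iff₀ hd0] at h4
        have : y ^ 2 / (8 * lam ^ 2) * d ≥ y * (2 + 2 * Real.log 2) := by
          rw [ge_iff_le, div_mul_eq_mul_div, le_div_iff₀ (by positivity)]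
          nlinarith
        have : y ^ 2 / (8 * lam ^ 2) * d ≤ m * d := by gcongr
        nlinarith
      _ = 1 / 2 := by rw [Real.exp_neg, Real.exp_log two_pos]; norm_num
  · rw [hΘl, hw, psi_eq hn1]
    change _ ≤ _ * (pn ^ m * _)
    have hkeysH : κ * (r * y ^ 3) ≤ Fillers.hc Θ.len j (none, none) w := by
      refine t3.trans ?_
      have := kb_length_le_hc (k₀ := Θ.key) Θ.len j (none, none) w
      rw [keys, hΘl]
      exact_mod_cast this
    set H := Fillers.hc Θ.len j (none, none) w with hH
    have e1 : (γ ^ H)⁻¹ = Real.exp (H * G) := by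
      rw [hG, ← Real.exp_log hγ0, ← Real.exp_nat_mul, Real.exp_log hγ0, ← Real.exp_neg]
      ring_nf
    have e2 : pn ^ m = Real.exp (-(m * c)) := by
      rw [hc, ← Real.exp_log hpn0, ← Real.exp_nat_mul, Real.exp_log hpn0]
      ring_nf
    have e3 : (1 / 2 : ℝ) = Real.exp (-Real.log 2) := by
      rw [Real.exp_neg, Real.exp_log two_pos]; norm_num
    rw [e1, e2, e3, ← Real.exp_add, ← Real.exp_add, ← Real.exp_add]
    refine Real.exp_le_exp.2 ?_
    rw [abs_le] at t1
    rw [div_le_iff₀ (by positivity)] at h2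
    have i1 : κ * (r * y ^ 3) * G ≤ H * G := by gcongr
    have i2 : m * c ≤ (y ^ 2 / (2 * lam ^ 2) + 3) * c := by gcongr
    have i3 : r * y ^ 2 * (2 + c / (2 * lam ^ 2) + 3 * c + Real.log 2) ≤
        r * y ^ 2 * (y * (κ * G)) := by gcongr
    have i4 : y ^ 2 / (2 * lam ^ 2) * c ≤ r * y ^ 2 * (c / (2 * lam ^ 2)) := by
      have : y ^ 2 / (2 * lam ^ 2) * c = y ^ 2 * (c / (2 * lam ^ 2)) := by ring
      rw [this]
      have e : r * y ^ 2 * (c / (2 * lam ^ 2)) = r * (y ^ 2 * (c / (2 * lam ^ 2))) := by ring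
      rw [e]
      exact le_mul_of_one_le_left (by positivity) hr1
    have hry : 1 ≤ r * y ^ 2 := one_le_mul_of_one_le_of_one_le hr1 (one_le_pow₀ hy1)
    have i5 : 3 * c + Real.log 2 ≤ r * y ^ 2 * (3 * c + Real.log 2) :=
      le_mul_of_one_le_left (by positivity) hry
    have e4 : r * y ^ 2 * (y * (κ * G)) = κ * (r * y ^ 3) * G := by ring
    linarith [t1.2]

/-- A typical word has at most √n log⁴ n hidden symbols, each worth at most |log γ|. One more
logarithm absorbs this constant and the deviation of the information. -/
lemma eventually_typ_mass (hs : Unsplit μ s t) (hμ : WordStationary μ)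
    {γ : ℝ} (hγ0 : 0 < γ) (hγ : ∀ k, 0 < wts p k → γ ≤ wts p k) (κ : ℝ) :
    ∀ᶠ n : ℕ in atTop, ∀ w : List (Split K), w.length = n →
      0 < pr (splitting μ p) (w ++ [s]) →
      Typ (scheme hq0 hq1 k₀ ℓ) (pr (splitting μ p)) s κ w →
      mass (pr (splitting μ p)) s w
        (fun w' => mask (scheme hq0 hq1 k₀ ℓ) w' = mask (scheme hq0 hq1 k₀ ℓ) w) ≤
      Real.exp (-(n * hrate (pr (splitting μ p)) s - √(n : ℝ) * Real.log n ^ 5)) := by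
  set Θ := scheme hq0 hq1 k₀ ℓ with hΘ
  filter_upwards [eventually_gt_atTop 0,
    tendsto_log_nat.eventually_ge_atTop (1 + |Real.log γ|)] with n h0 h1 w hw hpos htyp
  have hr1 := one_le_sqrt_nat h0
  obtain ⟨t1, -, -, t4⟩ := htyp
  rw [hw] at t1 t4
  refine (hs.mass_mask_le hμ hpos hγ0 hγ).trans ?_
  rw [hw]
  set y := Real.log n with hy
  set r := √(n : ℝ) with hr
  set H := hc Θ.len (Θ.lvl n) (none, none) w with hH
  have e1 : (γ ^ H)⁻¹ = Real.exp (H * -Real.log γ) := by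
    rw [← Real.exp_log hγ0, ← Real.exp_nat_mul, Real.exp_log hγ0, ← Real.exp_neg]
    ring_nf
  rw [e1, ← Real.exp_add]
  refine Real.exp_le_exp.2 ?_
  rw [abs_le] at t1
  have hy1 : 1 ≤ y := by linarith [abs_nonneg (Real.log γ)]
  have i1 : H * -Real.log γ ≤ r * y ^ 4 * |Real.log γ| := by
    refine (mul_le_mul_of_nonneg_left (neg_le_abs _) (Nat.cast_nonneg _)).trans ?_
    gcongr
  have i2 : r * y ^ 4 * (1 + |Real.log γ|) ≤ r * y ^ 4 * y := by gcongr
  have i3 : r * y ^ 2 ≤ r * y ^ 4 := by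
    exact mul_le_mul_of_nonneg_left (pow_le_pow_right₀ hy1 (by norm_num)) (by linarith)
  nlinarith [t1.1]

end Typical

/-! ### Superpolynomial rarity of atypical words. -/

section Decay

variable {K : Type*} [Fintype K] [MeasurableSpace K] [MeasurableSingletonClass K]
  {p : Measure K} [IsProbabilityMeasure p] {μ : Measure (ℤ → BiState)} [IsProbabilityMeasure μ]
  {s : Split K} {t : BiState}

lemma decay_concentration {P : Measure (ℤ → Split K)} [IsProbabilityMeasure P]
    (hP : WordStationary P) (hr : RenewalLaw (pr P) s) :
    SuperpolyDecay (fun n => (n : ℝ)) fun n => P.real {x | x 0 = s ∧ x n = s ∧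
      ¬ |cinfo (pr P) s (word x 0 n) - hrate (pr P) s * n| ≤ √(n : ℝ) * Real.log n ^ 2} := by
  obtain ⟨t₀, C, ht₀, hC, h⟩ := hr.concentration
  refine superpolyDecay_of_le (A := 2 * Real.exp C) (c := 1) 0 one_pos ?_
  have ht : ∀ᶠ n : ℕ in atTop, (√(n : ℝ))⁻¹ ≤ t₀ := by
    have : Tendsto (fun n : ℕ => (√(n : ℝ))⁻¹) atTop (𝓝 0) :=
      (Real.tendsto_sqrt_atTop.comp tendsto_natCast_atTop_atTop).inv_tendsto_atTop
    exact this.eventually (eventually_le_nhds ht₀)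
  filter_upwards [ht, eventually_gt_atTop 0] with n hn h0
  have hr1 := one_le_sqrt_nat h0
  rw [abs_of_nonneg measureReal_nonneg]
  -- The exponent t = 1 / √n makes the quadratic term constant and turns a deviation of √n log² n
  -- into the bound exp(C - log² n).
  have h1 := h (√(n : ℝ))⁻¹ (by positivity) hn n (√(n : ℝ) * Real.log n ^ 2)
  have e : C * (√(n : ℝ))⁻¹ ^ 2 * n - (√(n : ℝ))⁻¹ * (√(n : ℝ) * Real.log n ^ 2) =
      C - Real.log n ^ 2 := by
    rw [inv_pow, Real.sq_sqrt n.cast_nonneg]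
    have : (n : ℝ) ≠ 0 := by exact_mod_cast h0.ne'
    have : √(n : ℝ) ≠ 0 := by positivity
    field_simp
  rw [e] at h1
  have h2 := hP.real_after_le hr 0 n (fun y => Ends s y ∧
    √(n : ℝ) * Real.log n ^ 2 ≤ |D0 (pr P) s y - hrate (pr P) s * n|)
  refine (measureReal_mono fun x hx => ?_).trans (h2.trans ((le_of_eq ?_).trans (h1.trans ?_)))
  · obtain ⟨h3, h4, h5⟩ := hx
    have e1 : word x 0 n ++ [s] = s :: word x (0 + 1) n := by
      have := word_snoc x 0 n
      rw [word_succ, zero_add (n : ℤ), h3, h4] at this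
      exact this.symm
    refine ⟨h3, ?_, ?_⟩
    · obtain ⟨k, rfl⟩ := Nat.exists_eq_add_of_le' h0
      rw [word_snoc, show (0 : ℤ) + 1 + (k : ℤ) = ((k + 1 : ℕ) : ℤ) by push_cast; ring, h4]
      exact ends_snoc _ _
    · rw [cinfo, e1] at h5
      rw [D0, Fillers.h0, p0, div_div_div_cancel_right₀ hr.pos.ne']
      exact (not_le.1 h5).le
  · congr
  · rw [pow_zero, mul_one, one_mul, sub_eq_add_neg, Real.exp_add, mul_assoc]

lemma decay_code {q : ℝ} (hq0 : 0 < q) (hq1 : q < 1) {k₀ : K} (hk0 : 0 < wts p k₀)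
    (hk1 : wts p k₀ < 1) (ℓ : ℕ) :
    SuperpolyDecay (fun n => (n : ℝ)) fun n => (splitting μ p).real
      {x | ¬ NoCode (keyLen (lvl q n)) n (kb k₀ ℓ (lvl q n) (none, none) (word x 0 n))} := by
  have hlam : 0 < -Real.log q := neg_pos.2 (Real.log_neg hq0 hq1)
  set lam := -Real.log q with hl
  set pm := max (wts p k₀) (1 - wts p k₀) with hpm
  have hpm0 : 0 < pm := lt_max_of_lt_left hk0
  have hpm1 : pm < 1 := max_lt hk1 (by linarith)
  set d := -Real.log pm with hd
  have hd0 : 0 < d := neg_pos.2 (Real.log_neg hpm0 hpm1)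
  refine superpolyDecay_of_le (A := 2) (c := d / (8 * lam ^ 2)) 2 (by positivity) ?_
  filter_upwards [eventually_lvl hq0 hq1] with n hlv
  obtain ⟨h0, hy1, -, -, hlo, -⟩ := hlv
  rw [abs_of_nonneg measureReal_nonneg]
  refine (real_code_le ℓ (lvl q n) k₀ n (keyLen (lvl q n)) (by rw [keyLen]; omega)).trans ?_
  set y := Real.log n with hy
  set j := lvl q n with hj
  have hm_lo : y ^ 2 / (8 * lam ^ 2) ≤ keyLen j := by
    have : (y / (4 * lam)) ^ 2 ≤ (j : ℝ) ^ 2 := by gcongr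
    have e : y ^ 2 / (8 * lam ^ 2) = 2 * (y / (4 * lam)) ^ 2 := by field_simp; ring
    rw [keyLen]
    push_cast
    linarith
  have e1 : pm ^ keyLen j = Real.exp (-(keyLen j * d)) := by
    rw [hd, ← Real.exp_log hpm0, ← Real.exp_nat_mul, Real.exp_log hpm0]
    ring_nf
  have hn1 : (1 : ℝ) ≤ n := by exact_mod_cast h0
  rw [e1]
  have e2 : Real.exp (-(keyLen j * d)) ≤ Real.exp (-(d / (8 * lam ^ 2) * y ^ 2)) := by
    refine Real.exp_le_exp.2 (neg_le_neg ?_)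
    calc d / (8 * lam ^ 2) * y ^ 2 = y ^ 2 / (8 * lam ^ 2) * d := by ring
      _ ≤ _ := by gcongr
  have e3 : (n : ℝ) * (n + 1) ≤ 2 * n ^ 2 := by nlinarith
  gcongr

/-- The length of the margins. -/
def margin (n : ℕ) : ℕ := ⌈Real.log n ^ 2⌉₊

lemma eventually_margin : ∀ᶠ n : ℕ in atTop, 0 < n ∧ 2 * margin n + 1 ≤ n ∧
    ((2 * margin n + 1 : ℕ) : ℝ) ≤ n / 2 ∧ (margin n : ℝ) ≤ 2 * Real.log n ^ 2 ∧
    (margin n : ℝ) ≤ n := by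
  have h := (((Real.isLittleO_pow_log_id_atTop (n := 2)).comp_tendsto
    (tendsto_natCast_atTop_atTop (R := ℝ)))).def (c := 1 / 16) (by norm_num)
  filter_upwards [h, eventually_gt_atTop 0, tendsto_log_nat.eventually_ge_atTop 1] with n h1 h0 h2
  simp only [Function.comp, id, Real.norm_eq_abs] at h1
  rw [abs_of_nonneg (sq_nonneg _), abs_of_nonneg n.cast_nonneg] at h1
  have h3 := (Nat.ceil_lt_add_one (sq_nonneg (Real.log n))).le
  have h4 : (margin n : ℝ) ≤ Real.log n ^ 2 + 1 := h3
  have h5 : 1 ≤ Real.log n ^ 2 := by nlinarith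
  have h6 : ((2 * margin n + 1 : ℕ) : ℝ) ≤ n / 2 := by
    push_cast
    linarith
  refine ⟨h0, ?_, h6, by linarith, by push_cast at h6; linarith [(margin n).cast_nonneg (α := ℝ)]⟩
  have : ((2 * margin n + 1 : ℕ) : ℝ) ≤ n := by linarith [n.cast_nonneg (α := ℝ)]
  exact_mod_cast this

/-- Margins of length log² n are free of `s` with probability of order exp(-c log² n) only. -/
lemma decay_zf {A : Type*} [Fintype A] {pr : List A → ℝ} {s : A} (hr : RenewalLaw pr s) :
    SuperpolyDecay (fun n => (n : ℝ)) fun n => 2 * zf pr s (margin n) := by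
  obtain ⟨C, ρ, hC, h0, h1, h, -, -⟩ := hr.exists_tail
  refine superpolyDecay_of_le (A := 2 * C) (c := -Real.log ρ) 0
    (neg_pos.2 (Real.log_neg h0 h1)) (Eventually.of_forall fun n => ?_)
  rw [abs_of_nonneg (mul_nonneg zero_le_two (hr.zf_nonneg _)), pow_zero, mul_one, mul_assoc]
  refine mul_le_mul_of_nonneg_left ((h _).trans (mul_le_mul_of_nonneg_left ?_ hC.le)) zero_le_two
  rw [← Real.exp_log (pow_pos h0 _), Real.log_pow]
  refine Real.exp_le_exp.2 ?_
  have := Nat.le_ceil (Real.log n ^ 2)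
  have h2 : Real.log ρ < 0 := Real.log_neg h0 h1
  change (margin n : ℝ) * _ ≤ _
  have h3 : Real.log n ^ 2 ≤ margin n := this
  nlinarith

variable {P : Measure (ℤ → Split K)} [IsProbabilityMeasure P]

/-- The mean number n q^j is at most of order √n log³ n, so the threshold √n log⁴ n leaves room for
the constants and the margins. -/
lemma decay_hidden (hP : WordStationary P) (hr : RenewalLaw (pr P) Split.a)
    {ℓ : ℕ} (hℓ : 0 < ℓ) (hq0 : 0 < qh (pr P) Split.a (ℓ - 1))
    (hq1 : qh (pr P) Split.a (ℓ - 1) < 1) :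
    SuperpolyDecay (fun n => (n : ℝ)) fun n => P.real
      {x | √(n : ℝ) * Real.log n ^ 4 <
        hc ℓ (lvl (qh (pr P) Split.a (ℓ - 1)) n) (none, none) (word x 0 n)} := by
  obtain ⟨c, hc0, h⟩ := hr.hidden_moment hℓ hq1
  set q := qh (pr P) Split.a (ℓ - 1) with hq
  have hdec := (decay_zf hr).add (superpolyDecay_of_le (A := 2) (c := 1) 2 one_pos
    (f := fun n => (margin n : ℝ) ^ 2 * (2 * Real.exp (n * q ^ lvl q n -
      c * (√(n : ℝ) * Real.log n ^ 4 - 2 * margin n)))) ?_)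
  · refine hdec.mono ?_
    filter_upwards [eventually_margin] with n hn
    rw [abs_of_nonneg measureReal_nonneg]
    refine le_trans ?_ (le_abs_self _)
    exact hP.real_hidden_le hr hc0 hq0.le h (lvl q n) n (margin n) hn.2.1 _
  · filter_upwards [eventually_margin, eventually_lvl hq0 hq1,
      tendsto_log_nat.eventually_ge_atTop ((q⁻¹ + 4 * c + 1) / c)] with n hm hlv h1
    obtain ⟨h0, hT1, -, hT2, hT3⟩ := hm
    obtain ⟨-, hy1, -, hup, -, -⟩ := hlv
    have hr1 := one_le_sqrt_nat h0
    rw [abs_of_nonneg (by positivity)]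
    have : (margin n : ℝ) ^ 2 ≤ n ^ 2 := by gcongr
    have e : Real.exp (n * q ^ lvl q n - c * (√(n : ℝ) * Real.log n ^ 4 - 2 * margin n)) ≤
        Real.exp (-(1 * Real.log n ^ 2)) := by
      refine Real.exp_le_exp.2 ?_
      set y := Real.log n with hy
      set r := √(n : ℝ) with hr'
      have hrr : (n : ℝ) = r * r := (Real.mul_self_sqrt n.cast_nonneg).symm
      rw [div_le_iff₀ hc0] at h1
      have i1 : n * q ^ lvl q n ≤ r * (q⁻¹ * y ^ 3) := by
        rw [hrr, mul_assoc]
        gcongr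
      have i2 : r * y ^ 3 * (q⁻¹ + 4 * c + 1) ≤ r * y ^ 3 * (y * c) := by gcongr
      have i3 : c * (2 * margin n) ≤ c * (2 * (2 * y ^ 2)) := by gcongr
      have i4 : y ^ 2 ≤ r * y ^ 3 := by
        have h6 : 0 ≤ y ^ 2 := by positivity
        have h7 : 1 ≤ r * y := by nlinarith
        calc y ^ 2 ≤ (r * y) * y ^ 2 := by nlinarith
          _ = _ := by ring
      have i5 : (4 * c + 1) * y ^ 2 ≤ (4 * c + 1) * (r * y ^ 3) := by gcongr
      nlinarith
    calc _ ≤ (n : ℝ) ^ 2 * (2 * Real.exp (-(1 * Real.log n ^ 2))) := by gcongr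
      _ = _ := by ring

lemma decay_keys (hP : WordStationary P) (hr : RenewalLaw (pr P) Split.a) (k₀ : K)
    {ℓ : ℕ} (hℓ : 0 < ℓ) (hq0 : 0 < qh (pr P) Split.a (ℓ - 1))
    (hq1 : qh (pr P) Split.a (ℓ - 1) < 1)
    (hb : ∃ u : List (Split K), Split.a ∉ u ∧ (∃ k, Split.sym k ∈ u) ∧
      0 < qb (pr P) Split.a u) :
    ∃ κ : ℝ, 0 < κ ∧ SuperpolyDecay (fun n => (n : ℝ)) fun n => P.real
      {x | (kb k₀ ℓ (lvl (qh (pr P) Split.a (ℓ - 1)) n) (none, none) (word x 0 n)).length <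
        κ * (√(n : ℝ) * Real.log n ^ 3)} := by
  obtain ⟨c, hc0, h⟩ := hr.key_moment k₀ hℓ hq0 hq1 hb
  set q := qh (pr P) Split.a (ℓ - 1) with hq
  -- The margins leave at least n / 2 sites and hence an exponent of at least (c / 2) √n log³ n.
  -- Half of it is spent on the threshold.
  refine ⟨c / 4, by positivity, ?_⟩
  have hdec := (decay_zf hr).add (superpolyDecay_of_le (A := 2) (c := c / 4) 2 (by positivity)
    (f := fun n => (margin n : ℝ) ^ 2 * (2 * Real.exp (c / 4 * (√(n : ℝ) * Real.log n ^ 3) -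
      c * (n - (2 * margin n + 1)) * q ^ lvl q n))) ?_)
  · refine hdec.mono ?_
    filter_upwards [eventually_margin] with n hn
    rw [abs_of_nonneg measureReal_nonneg]
    refine le_trans ?_ (le_abs_self _)
    exact hP.real_keys_le hr k₀ hc0 hq0.le h (lvl q n) n (margin n) hn.2.1 _
  · filter_upwards [eventually_margin, eventually_lvl hq0 hq1] with n hm hlv
    obtain ⟨h0, hT1, hT2, -, hT3⟩ := hm
    obtain ⟨-, hy1, hlo, -, -, -⟩ := hlv
    have hr1 := one_le_sqrt_nat h0
    rw [abs_of_nonneg (by positivity)]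
    have : (margin n : ℝ) ^ 2 ≤ n ^ 2 := by gcongr
    have e : Real.exp (c / 4 * (√(n : ℝ) * Real.log n ^ 3) -
        c * (n - (2 * margin n + 1)) * q ^ lvl q n) ≤
        Real.exp (-(c / 4 * Real.log n ^ 2)) := by
      refine Real.exp_le_exp.2 ?_
      set y := Real.log n with hy
      set r := √(n : ℝ) with hr'
      have hrr : (n : ℝ) = r * r := (Real.mul_self_sqrt n.cast_nonneg).symm
      push_cast at hT2
      have i1 : c * (n / 2) * q ^ lvl q n ≤ c * (n - (2 * margin n + 1)) * q ^ lvl q n := by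
        gcongr
        linarith
      have i2 : c / 2 * r * y ^ 3 ≤ c * (n / 2) * q ^ lvl q n := by
        calc c / 2 * r * y ^ 3 ≤ c / 2 * r * (r * q ^ lvl q n) := by gcongr
          _ = _ := by rw [hrr]; ring
      have i4 : y ^ 2 ≤ r * y ^ 3 := by
        have h6 : 0 ≤ y ^ 2 := by positivity
        have h7 : 1 ≤ r * y := by nlinarith
        calc y ^ 2 ≤ (r * y) * y ^ 2 := by nlinarith
          _ = _ := by ring
      have i5 : c / 4 * y ^ 2 ≤ c / 4 * (r * y ^ 3) := by gcongr
      nlinarith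
    calc _ ≤ (n : ℝ) ^ 2 * (2 * Real.exp (-(c / 4 * Real.log n ^ 2))) := by gcongr
      _ = _ := by ring

/-- Words between two occurrences of `s` are typical. -/
theorem decay_typ (hμ : IsBiMarked μ) (hs : Unsplit μ s t) {k₀ : K} (hk0 : 0 < wts p k₀)
    (hk1 : wts p k₀ < 1) {ℓ : ℕ} (hℓ : 0 < ℓ)
    (hq0 : 0 < qh (pr (splitting μ p)) Split.a (ℓ - 1))
    (hq1 : qh (pr (splitting μ p)) Split.a (ℓ - 1) < 1) :
    ∃ κ : ℝ, 0 < κ ∧ SuperpolyDecay (fun n => (n : ℝ)) fun n => (splitting μ p).real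
      {x | x 0 = s ∧ x n = s ∧
        ¬ Typ (scheme hq0 hq1 k₀ ℓ) (pr (splitting μ p)) s κ (word x 0 n)} := by
  have hst := wordStationary_of_measurePreserving hμ.stationary
  have hP := wordStationary_splitting (p := p) hst
  have ha : Unsplit (K := K) μ Split.a BiState.a := unsplit_a hμ
  have hra := ha.renewalLaw (p := p) hst
  have hb : ∃ u : List (Split K), Split.a ∉ u ∧ (∃ k, Split.sym k ∈ u) ∧
      0 < qb (pr (splitting μ p)) Split.a u := by
    obtain ⟨u, h1, h2, h3⟩ := ha.exists_block_sym hst hμ.pos_c hk0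
    exact ⟨u, h1, ⟨k₀, h2⟩, h3⟩
  obtain ⟨κ, hκ, hkeys⟩ := decay_keys hP hra k₀ hℓ hq0 hq1 hb
  refine ⟨κ, hκ, ((((decay_concentration hP (hs.renewalLaw (p := p) hst)).add
    (decay_code (μ := μ) hq0 hq1 hk0 hk1 ℓ)).add hkeys).add
    (decay_hidden hP hra hℓ hq0 hq1)).mono (Eventually.of_forall fun n => ?_)⟩
  rw [abs_of_nonneg measureReal_nonneg]
  refine le_trans ?_ (le_abs_self _)
  refine le_trans ?_ (add_le_add_left (add_le_add_left (measureReal_union_le _ _) _) _)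
  refine le_trans ?_ (add_le_add_left (measureReal_union_le _ _) _)
  refine le_trans ?_ (measureReal_union_le _ _)
  refine measureReal_mono ?_
  rintro x ⟨h0, hn, hx⟩
  by_contra hcon
  simp only [Set.mem_union, Set.mem_ofPred_eq, not_or, h0, hn, true_and, not_not, not_lt] at hcon
  obtain ⟨⟨⟨h1, h2⟩, h3⟩, h4⟩ := hcon
  refine hx ⟨?_, ?_, ?_, ?_⟩ <;> simp only [word_length, keys]
  · exact h1
  · exact h2
  · exact h3
  · exact h4

end Decay



/-! ### Marked points -/

section Marked

variable {A : Type*} {s : A} {ξ : (ℤ → Bool) → ℤ → ℕ} {x : ℤ → A}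

lemma left_nonpos (s : A) (ξ : (ℤ → Bool) → ℤ → ℕ) (r : ℕ) (x : ℤ → A) : left s ξ r x ≤ 0 := by
  rw [left]
  rcases Set.eq_empty_or_nonempty {i : ℤ | i ≤ 0 ∧ r ≤ ξ (hat s x) i} with h | h
  · rw [h, Int.csSup_empty]
  · exact csSup_le h fun i hi => hi.1

lemma right_nonneg (s : A) (ξ : (ℤ → Bool) → ℤ → ℕ) (r : ℕ) (x : ℤ → A) : 0 ≤ right s ξ r x := by
  rw [right]
  rcases Set.eq_empty_or_nonempty {i : ℤ | 0 < i ∧ r ≤ ξ (hat s x) i} with h | h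
  · rw [h, Int.csInf_empty]
  · exact le_csInf h fun i hi => hi.1.le

lemma left_add_size (s : A) (ξ : (ℤ → Bool) → ℤ → ℕ) (r : ℕ) (x : ℤ → A) :
    left s ξ r x + size s ξ r x = right s ξ r x := by
  have h1 := left_nonpos s ξ r x
  have h2 := right_nonneg s ξ r x
  rw [size]
  omega

/-- The points whose marks occur at `s` only, and occur in all ranks arbitrarily far on either
side. -/
structure Marked (s : A) (ξ : (ℤ → Bool) → ℤ → ℕ) (x : ℤ → A) : Prop where
  eq : ∀ i, 0 < ξ (hat s x) i → x i = s
  before : ∀ (r : ℕ) (N : ℤ), ∃ i ≤ N, r ≤ ξ (hat s x) i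
  after : ∀ (r : ℕ) (N : ℤ), ∃ i, N < i ∧ r ≤ ξ (hat s x) i

lemma Marked.isRankSkeleton (h : Marked s ξ x) (r : ℕ) :
    IsRankSkeleton (ξ (hat s x)) r (left s ξ r x) (size s ξ r x) := by
  have h1 : left s ξ r x ∈ {i : ℤ | i ≤ 0 ∧ r ≤ ξ (hat s x) i} :=
    Int.csSup_mem (h.before r 0) ⟨0, fun i hi => hi.1⟩
  have h2 : right s ξ r x ∈ {i : ℤ | 0 < i ∧ r ≤ ξ (hat s x) i} :=
    Int.csInf_mem (h.after r 0) ⟨0, fun i hi => hi.1.le⟩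
  have e := left_add_size s ξ r x
  refine ⟨?_, h1.2, by rw [e]; exact h2.2, fun i hi hi' => ?_⟩
  · have := h1.1
    have := h2.1
    omega
  · rw [e] at hi'
    by_contra! hc
    rcases le_or_gt i 0 with h0 | h0
    · exact hi.not_ge (le_csSup ⟨0, fun i hi => hi.1⟩ ⟨h0, hc⟩)
    · exact hi'.not_ge (csInf_le ⟨0, fun i hi => hi.1.le⟩ ⟨h0, hc⟩)

lemma Marked.isSkeleton (h : Marked s ξ x) {r : ℕ} (hr : 0 < r) :
    IsSkeleton (ξ (hat s x)) (left s ξ r x) (size s ξ r x) := ⟨r, hr, h.isRankSkeleton r⟩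

lemma Marked.eq_left (h : Marked s ξ x) {m : ℤ} {n : ℕ} (hS : IsSkeleton (ξ (hat s x)) m n) :
    x m = s := by
  obtain ⟨r, hr, h1⟩ := hS
  exact h.eq _ (hr.trans_le h1.2.1)

lemma Marked.eq_right (h : Marked s ξ x) {m : ℤ} {n : ℕ} (hS : IsSkeleton (ξ (hat s x)) m n) :
    x (m + n) = s := by
  obtain ⟨r, hr, h1⟩ := hS
  exact h.eq _ (hr.trans_le h1.2.2.1)

lemma getD_word (q : ℤ → ℕ) (m : ℤ) {n j : ℕ} (h0 : 0 < j) (hj : j < n) :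
    (word q (m + 1) (n - 1)).getD (j - 1) 0 = q (m + j) := by
  rw [List.getD_eq_getElem _ _ (by simp; omega)]
  simp only [word, List.getElem_ofFn]
  congr 1
  omega

/-- The marks at the two ends of the skeleton are not among its data, so `SubIv` puts no condition
there. Those marks exceed all marks inside, and replacing r by its minimum with the rank of the
skeleton makes both ends comply. -/
lemma subIv_iff {q : ℤ → ℕ} {m : ℤ} {n i l : ℕ} (hS : IsSkeleton q m n) {f : ℕ → ℕ}
    (hf : ∀ j, 0 < j → j < n → f j = q (m + j)) :
    SubIv f n i l ↔ i + l ≤ n ∧ IsSkeleton q (m + i) l := by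
  constructor
  · rintro ⟨r, hr, hl, hil, h1, h2, h3⟩
    obtain ⟨r', hr', hn, g1, g2, g3⟩ := hS
    refine ⟨hil, min r r', lt_min hr hr', hl, ?_, ?_, fun k hk hk' => ?_⟩
    · rcases Nat.eq_zero_or_pos i with rfl | hi
      · simpa using Or.inr g1
      · rcases h1 with rfl | h1
        · omega
        · rw [hf _ hi (by omega)] at h1
          exact (min_le_left _ _).trans h1
    · rcases hil.lt_or_eq with hlt | heq
      · rcases h2 with h2 | h2
        · omega
        · rw [hf _ (by omega) hlt, Nat.cast_add, ← add_assoc] at h2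
          exact (min_le_left _ _).trans h2
      · rw [add_assoc, ← Nat.cast_add, heq]
        exact (min_le_right _ _).trans g2
    · obtain ⟨j, rfl⟩ : ∃ j : ℕ, k = m + j := ⟨(k - m).toNat, by omega⟩
      refine lt_min ?_ (g3 _ (by omega) (by omega))
      have := h3 j (by omega) (by omega)
      rwa [hf _ (by omega) (by omega)] at this
  · rintro ⟨hil, r, hr, hl, g1, g2, g3⟩
    refine ⟨r, hr, hl, hil, ?_, ?_, fun j hj hj' => ?_⟩
    · rcases Nat.eq_zero_or_pos i with rfl | hi
      · exact Or.inl rfl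
      · right
        rwa [hf _ hi (by omega)]
    · rcases hil.lt_or_eq with hlt | heq
      · right
        rwa [hf _ (by omega) hlt, Nat.cast_add, ← add_assoc]
      · exact Or.inl heq
    · rw [hf _ (by omega) (by omega)]
      exact g3 _ (by omega) (by omega)

end Marked

/-! ### Almost sure recurrence of marks. -/

section Stationary

variable {ρ : Measure (ℤ → Bool)} {ξ : (ℤ → Bool) → ℤ → ℕ}

lemma IsMarkerFactor.measure_shift (hξ : IsMarkerFactor ρ ξ) (hρ : MeasurePreserving shift ρ ρ)
    {E : Set ((ℤ → Bool) × (ℤ → ℕ))} (hE : MeasurableSet E) (k : ℤ) :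
    ρ {y | (fun i => y (i + k), fun i => ξ y (i + k)) ∈ E} = ρ {y | (y, ξ y) ∈ E} := by
  have hm : ∀ k : ℤ, MeasurableSet {y | (fun i => y (i + k), fun i => ξ y (i + k)) ∈ E} := by
    intro k
    have h1 : Measurable fun (y : ℤ → Bool) i => y (i + k) :=
      measurable_pi_iff.2 fun i => measurable_pi_apply _
    have h2 : Measurable fun (y : ℤ → Bool) i => ξ y (i + k) :=
      measurable_pi_iff.2 fun i => (measurable_pi_apply (i + k)).comp hξ.measurable
    exact (h1.prodMk h2) hE
  have key : ∀ k : ℤ, ρ {y | (fun i => y (i + (k + 1)), fun i => ξ y (i + (k + 1))) ∈ E} =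
      ρ {y | (fun i => y (i + k), fun i => ξ y (i + k)) ∈ E} := by
    intro k
    rw [← hρ.measure_preimage (hm k).nullMeasurableSet]
    refine measure_congr ?_
    filter_upwards [hξ.stationary] with y hy
    have e : (fun i => shift y (i + k), fun i => ξ (shift y) (i + k)) =
        ((fun i => y (i + (k + 1)), fun i => ξ y (i + (k + 1))) :
          (ℤ → Bool) × (ℤ → ℕ)) := by
      rw [hy]
      simp only [shift, add_assoc]
    change ((fun i => y (i + (k + 1)), fun i => ξ y (i + (k + 1))) ∈ E) =
      ((fun i => shift y (i + k), fun i => ξ (shift y) (i + k)) ∈ E)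
    rw [e]
  induction k using Int.induction_on with
  | zero => simp
  | succ i ih => rw [key, ih]
  | pred i ih => rw [← ih, ← key]; simp

/-- Infinitely many disjoint events of equal probability have probability zero. -/
lemma measure_eq_zero_of_disjoint {Ω : Type*} [MeasurableSpace Ω] {P : Measure Ω}
    [IsFiniteMeasure P] {E : ℤ → Set Ω} (hE : ∀ i, MeasurableSet (E i))
    (hd : Pairwise fun i j => Disjoint (E i) (E j)) (h : ∀ i, P (E i) = P (E 0)) :
    P (E 0) = 0 := by
  by_contra h0
  have h1 := measure_iUnion (μ := P) hd hE
  simp_rw [h] at h1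
  rw [ENNReal.tsum_const_eq_top_of_ne_zero h0] at h1
  exact measure_ne_top _ _ h1

variable [IsProbabilityMeasure ρ]

lemma IsMarkerFactor.ae_eq (hξ : IsMarkerFactor ρ ξ) (hρ : MeasurePreserving shift ρ ρ) :
    ∀ᵐ y ∂ρ, ∀ i, 0 < ξ y i → y i = true := by
  refine ae_all_iff.2 fun i => ?_
  have hE : MeasurableSet {z : (ℤ → Bool) × (ℤ → ℕ) | ¬ (0 < z.2 0 → z.1 0 = true)} := by
    have h1 : MeasurableSet {z : (ℤ → Bool) × (ℤ → ℕ) | 0 < z.2 0} :=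
      measurableSet_lt measurable_const ((measurable_pi_apply 0).comp measurable_snd)
    have h2 : MeasurableSet {z : (ℤ → Bool) × (ℤ → ℕ) | z.1 0 = true} :=
      measurableSet_eq_fun ((measurable_pi_apply 0).comp measurable_fst) measurable_const
    exact (h1.compl.union h2).compl.congr (by ext z; simp)
  have h := hξ.measure_shift hρ hE i
  have h0 : ρ {y | (y, ξ y) ∈ {z : (ℤ → Bool) × (ℤ → ℕ) | ¬ (0 < z.2 0 → z.1 0 = true)}} = 0 :=
    hξ.marks
  rw [h0] at h
  refine measure_mono_null (fun y hy => ?_) h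
  simpa using hy

/-- The events that i is the first, or the last, place of a mark of rank r are disjoint for
different i and equally likely by stationarity. The relation c covers both directions. -/
lemma IsMarkerFactor.ae_no_first (hξ : IsMarkerFactor ρ ξ) (hρ : MeasurePreserving shift ρ ρ)
    (r : ℕ) {c : ℤ → Prop} (hc1 : ∀ i, i ≠ 0 → c i ∨ c (-i)) :
    ∀ᵐ y ∂ρ, ∀ i, ¬ (r ≤ ξ y i ∧ ∀ j, c (j - i) → ξ y j < r) := by
  have hE : MeasurableSet {z : (ℤ → Bool) × (ℤ → ℕ) | r ≤ z.2 0 ∧ ∀ j, c j → z.2 j < r} := by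
    have h1 : MeasurableSet {z : (ℤ → Bool) × (ℤ → ℕ) | r ≤ z.2 0} :=
      measurableSet_le measurable_const ((measurable_pi_apply 0).comp measurable_snd)
    have h2 : ∀ j, MeasurableSet {z : (ℤ → Bool) × (ℤ → ℕ) | c j → z.2 j < r} := fun j => by
      by_cases h : c j
      · simp only [h, true_imp_iff]
        exact measurableSet_lt ((measurable_pi_apply j).comp measurable_snd) measurable_const
      · simp [h]
    have := h1.inter (MeasurableSet.iInter h2)
    convert this using 1
    ext z
    simp
  let E : ℤ → Set (ℤ → Bool) := fun k => {y | (fun i => y (i + k), fun i => ξ y (i + k)) ∈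
    {z : (ℤ → Bool) × (ℤ → ℕ) | r ≤ z.2 0 ∧ ∀ j, c j → z.2 j < r}}
  have hs := hξ.measure_shift hρ hE
  have h0 : ρ (E 0) = 0 := by
    refine measure_eq_zero_of_disjoint (fun k => ?_) (fun i j hij => ?_) fun k => ?_
    · have h1 : Measurable fun (y : ℤ → Bool) i => y (i + k) :=
        measurable_pi_iff.2 fun i => measurable_pi_apply _
      have h2 : Measurable fun (y : ℤ → Bool) i => ξ y (i + k) :=
        measurable_pi_iff.2 fun i => (measurable_pi_apply (i + k)).comp hξ.measurable
      exact (h1.prodMk h2) hE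
    · change Disjoint (E i) (E j)
      rw [Set.disjoint_left]
      rintro y ⟨h1, h2⟩ ⟨h3, h4⟩
      simp only [zero_add] at h1 h2 h3 h4
      rcases hc1 (j - i) (sub_ne_zero.2 hij.symm) with h | h
      · have := h2 _ h
        rw [sub_add_cancel] at this
        omega
      · have := h4 _ h
        rw [neg_sub, sub_add_cancel] at this
        omega
    · rw [hs k, ← hs 0]
  refine ae_all_iff.2 fun i => ?_
  have h1 : ρ (E i) = 0 := by rw [hs i, ← hs 0, h0]
  refine measure_mono_null (fun y hy => ?_) h1
  simp only [Set.mem_compl_iff, Set.mem_ofPred_eq, not_not] at hy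
  refine ⟨by simpa using hy.1, fun j hj => hy.2 _ ?_⟩
  simpa using hj

end Stationary

/-! ### Union bounds for skeletons of random place and size. -/

section HighProb

variable {Ω : Type*} [MeasurableSpace Ω] {P : Measure Ω} [IsProbabilityMeasure P] {L : ℕ → ℝ}

lemma WithHighProb.mono {E E' : ℕ → Set Ω} (h : WithHighProb P L E)
    (h' : ∀ᶠ r in atTop, ∀ᵐ x ∂P, x ∈ E r → x ∈ E' r) : WithHighProb P L E' := by
  refine SuperpolyDecay.mono h (h'.mono fun r hr => ?_)
  rw [abs_of_nonneg measureReal_nonneg, abs_of_nonneg measureReal_nonneg]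
  refine ENNReal.toReal_mono (measure_ne_top _ _) (measure_mono_ae ?_)
  filter_upwards [hr] with x hx hx' h
  exact hx' (hx h)

lemma SuperpolyDecay.tendsto_zero {f : ℕ → ℝ} (hL : Tendsto L atTop atTop)
    (h : SuperpolyDecay L f) : Tendsto f atTop (𝓝 0) := by
  refine (h 1).trans_tendsto ?_
  simp only [pow_one]
  exact hL.inv_tendsto_atTop

/-- For nice marker factors the sizes are only a power of a logarithm below L, so √L is a convenient
lower bound for them. -/
lemma eventually_sqrt_le (hL : Tendsto L atTop atTop) (c : ℝ) :
    ∀ᶠ r in atTop, 1 ≤ L r ∧ √(L r) ≤ L r / Real.log (L r) ^ c := by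
  have h := hL.eventually ((isLittleO_log_rpow_rpow_atTop c (show (0 : ℝ) < 1 / 2 by norm_num)).def
    one_pos)
  filter_upwards [h, hL.eventually_ge_atTop 1, hL.eventually_gt_atTop (Real.exp 0)]
    with r h1 h2 h3
  refine ⟨h2, ?_⟩
  have hl : 0 < Real.log (L r) := Real.log_pos (by rwa [Real.exp_zero] at h3)
  rw [one_mul, Real.norm_of_nonneg (by positivity), Real.norm_of_nonneg (by positivity),
    ← Real.sqrt_eq_rpow] at h1
  rw [le_div_iff₀ (by positivity)]
  calc √(L r) * Real.log (L r) ^ c ≤ √(L r) * √(L r) := by gcongr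
    _ = L r := Real.mul_self_sqrt (by linarith)

/-- An interval of random place and size avoids events that are unlikely for each interval. -/
lemma WithHighProb.notMem {P : Measure Ω} [IsProbabilityMeasure P] (hL : Tendsto L atTop atTop)
    {l : ℕ → Ω → ℤ} {sz : ℕ → Ω → ℕ} (hl : ∀ r x, l r x ≤ 0 ∧ 0 ≤ l r x + sz r x) {c : ℝ}
    (hsz : WithHighProb P L fun r =>
      {x | L r / Real.log (L r) ^ c ≤ sz r x ∧ (sz r x : ℝ) ≤ L r})
    {B : ℤ → ℕ → Set Ω} {f : ℕ → ℝ} (hf : SuperpolyDecay (fun n => (n : ℝ)) f)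
    (hB : ∀ m n, P.real (B m n) ≤ f n) :
    WithHighProb P L fun r => {x | x ∉ B (l r x) (sz r x)} := by
  intro k
  -- The sizes are at least √L, so the exponent 2 (k + 2) in the size yields k + 2 in L. Two powers
  -- are lost to the choice of place and size.
  obtain ⟨C, hC, hb⟩ := (hf (2 * (k + 2))).exists_pos
  obtain ⟨N, hN⟩ := eventually_atTop.1 hb.bound
  have h1 : (fun r => P.real {x | x ∉ B (l r x) (sz r x)}ᶜ) =O[atTop] fun r =>
      P.real {x | L r / Real.log (L r) ^ c ≤ sz r x ∧ (sz r x : ℝ) ≤ L r}ᶜ +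
        4 * C * (L r ^ k)⁻¹ := by
    refine IsBigO.of_bound 1 ?_
    filter_upwards [eventually_sqrt_le hL c, hL.eventually_ge_atTop ((N + 1 : ℝ) ^ 2)]
      with r ⟨hr1, hr2⟩ hr3
    have hL0 : 0 < L r := by linarith
    rw [Real.norm_of_nonneg measureReal_nonneg, one_mul, Real.norm_of_nonneg (by positivity)]
    have hNr : (N : ℝ) + 1 ≤ √(L r) := Real.le_sqrt_of_sq_le hr3
    set F := ⌊L r⌋₊ with hF
    have hFl : (F : ℝ) ≤ L r := Nat.floor_le hL0.le
    have hsub : {x | x ∉ B (l r x) (sz r x)}ᶜ ⊆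
        {x | L r / Real.log (L r) ^ c ≤ sz r x ∧ (sz r x : ℝ) ≤ L r}ᶜ ∪
        ⋃ m ∈ Finset.range (F + 1), ⋃ n ∈ (Finset.range (F + 1)).filter fun n : ℕ => √(L r) ≤ n,
          B (-(m : ℤ)) n := by
      intro x hx
      simp only [Set.mem_compl_iff, Set.mem_ofPred_eq, not_not] at hx
      by_cases hx' : x ∈ {x | L r / Real.log (L r) ^ c ≤ sz r x ∧ (sz r x : ℝ) ≤ L r}
      · right
        have h3 : sz r x ≤ F := Nat.le_floor hx'.2
        have h4 := hl r x
        simp only [Set.mem_iUnion, Finset.mem_range, Finset.mem_filter]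
        refine ⟨(-(l r x)).toNat, by omega, sz r x, ⟨by omega, hr2.trans hx'.1⟩, ?_⟩
        rwa [show -((-(l r x)).toNat : ℤ) = l r x by omega]
      · exact Or.inl hx'
    refine (measureReal_mono hsub).trans ((measureReal_union_le _ _).trans ?_)
    gcongr
    refine (measureReal_biUnion_finset_le _ _).trans ?_
    have hterm : ∀ m ∈ Finset.range (F + 1), P.real (⋃ n ∈ (Finset.range (F + 1)).filter
        fun n : ℕ => √(L r) ≤ n, B (-(m : ℤ)) n) ≤ (F + 1) * (C * (L r ^ (k + 2))⁻¹) := by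
      intro m _
      refine (measureReal_biUnion_finset_le _ _).trans ?_
      refine (Finset.sum_le_card_nsmul _ _ (C * (L r ^ (k + 2))⁻¹) fun n hn => ?_).trans ?_
      · have hn' := (Finset.mem_filter.1 hn).2
        refine (hB _ _).trans ((le_abs_self _).trans ?_)
        have hNn : N ≤ n := by
          have : (N : ℝ) ≤ n := by linarith
          exact_mod_cast this
        refine (hN n hNn).trans ?_
        rw [Real.norm_of_nonneg (by positivity)]
        gcongr
        calc L r ^ (k + 2) = (√(L r) ^ 2) ^ (k + 2) := by rw [Real.sq_sqrt hL0.le]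
          _ = √(L r) ^ (2 * (k + 2)) := by rw [pow_mul]
          _ ≤ _ := by gcongr
      · rw [nsmul_eq_mul]
        refine mul_le_mul_of_nonneg_right ?_ (by positivity)
        have := Finset.card_filter_le (Finset.range (F + 1)) fun n : ℕ => √(L r) ≤ n
        rw [Finset.card_range] at this
        exact_mod_cast this
    refine (Finset.sum_le_card_nsmul _ _ _ hterm).trans ?_
    rw [nsmul_eq_mul, Finset.card_range]
    have hF2 : (F : ℝ) + 1 ≤ 2 * L r := by linarith
    calc ((F + 1 : ℕ) : ℝ) * ((F + 1) * (C * (L r ^ (k + 2))⁻¹)) ≤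
        (2 * L r) * ((2 * L r) * (C * (L r ^ (k + 2))⁻¹)) := by
          push_cast
          gcongr
      _ = 4 * C * (L r ^ k)⁻¹ := by
        rw [pow_add]
        field_simp
        ring
  exact h1.trans ((hsz k).add ((isBigO_refl _ _).const_mul_left _))

end HighProb

/-! ### Regular points of nice marker factors. -/

section Nice

variable {A : Type*} [MeasurableSpace A] [MeasurableSingletonClass A] {P : Measure (ℤ → A)}
  [IsProbabilityMeasure P] {s : A} {ξ : (ℤ → Bool) → ℤ → ℕ} {L : ℕ → ℝ}

/-- A point without marks of rank r has none of any rank r' ≥ r, so its size at rank r' violates the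
lower bound, and that has probability tending to zero. -/
lemma IsNice.ae_exists (hξ : IsNice P s ξ L) (r : ℕ) : ∀ᵐ x ∂P, ∃ i, r ≤ ξ (hat s x) i := by
  obtain ⟨c, hc, h⟩ := hξ.size_bounds
  have h0 : P.real {x | ¬ ∃ i, r ≤ ξ (hat s x) i} ≤ 0 := by
    refine ge_of_tendsto (SuperpolyDecay.tendsto_zero hξ.tendsto h) ?_
    filter_upwards [eventually_ge_atTop r, eventually_sqrt_le hξ.tendsto c] with r' hr' hL
    refine measureReal_mono fun x hx => ?_
    simp only [Set.mem_compl_iff, Set.mem_ofPred_eq, not_exists, not_and] at hx ⊢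
    intro h1
    have e1 : {i : ℤ | i ≤ 0 ∧ r' ≤ ξ (hat s x) i} = ∅ := by
      ext i
      exact iff_of_false (fun h => hx i (hr'.trans h.2)) fun h => h
    have e2 : {i : ℤ | 0 < i ∧ r' ≤ ξ (hat s x) i} = ∅ := by
      ext i
      exact iff_of_false (fun h => hx i (hr'.trans h.2)) fun h => h
    -- The supremum and the infimum of the empty set of integers are zero by default.
    have e3 : size s ξ r' x = 0 := by
      rw [size, left, right, e1, e2, Int.csSup_empty, Int.csInf_empty]
      rfl
    rw [e3] at h1
    have : 0 < √(L r') := Real.sqrt_pos.2 (by linarith [hL.1])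
    push_cast at h1
    linarith [hL.2]
  have h1 := le_antisymm h0 measureReal_nonneg
  rw [measureReal_eq_zero_iff] at h1
  exact h1

lemma IsNice.ae_marked (hξ : IsNice P s ξ L)
    (hρ : MeasurePreserving shift (P.map (hat s)) (P.map (hat s))) :
    ∀ᵐ x ∂P, Marked s ξ x := by
  have hm := (measurable_hat (A := A) s).aemeasurable (μ := P)
  have : IsProbabilityMeasure (P.map (hat s)) := Measure.isProbabilityMeasure_map hm
  have h1 := ae_of_ae_map hm (hξ.marker.ae_eq hρ)
  have h2 := ae_all_iff.2 fun r => ae_of_ae_map hm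
    (hξ.marker.ae_no_first hρ r (c := fun i => i < 0) fun i hi => by omega)
  have h3 := ae_all_iff.2 fun r => ae_of_ae_map hm
    (hξ.marker.ae_no_first hρ r (c := fun i => 0 < i) fun i hi => by omega)
  filter_upwards [h1, h2, h3, ae_all_iff.2 hξ.ae_exists] with x h1 h2 h3 h4
  refine ⟨fun i hi => ?_, fun r N => ?_, fun r N => ?_⟩
  · simpa [hat] using h1 i hi
  · by_contra! hcon
    have hb : BddBelow {i | r ≤ ξ (hat s x) i} := ⟨N, fun i hi => by
      by_contra! hiN
      have := hcon i hiN.le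
      simp only [Set.mem_ofPred_eq] at hi
      omega⟩
    set k := sInf {i | r ≤ ξ (hat s x) i}
    refine h2 r k ⟨Int.csInf_mem (h4 r) hb, fun j hj => ?_⟩
    by_contra! hjr
    have : k ≤ j := csInf_le hb hjr
    omega
  · by_contra! hcon
    have hb : BddAbove {i | r ≤ ξ (hat s x) i} := ⟨N, fun i hi => by
      by_contra! hiN
      have := hcon i hiN
      simp only [Set.mem_ofPred_eq] at hi
      omega⟩
    set k := sSup {i | r ≤ ξ (hat s x) i}
    refine h3 r k ⟨Int.csSup_mem (h4 r) hb, fun j hj => ?_⟩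
    by_contra! hjr
    have : j ≤ k := le_csSup hb hjr
    omega

lemma ae_pr_pos [Fintype A] (hP : WordStationary P) :
    ∀ᵐ x ∂P, ∀ (m : ℤ) (n : ℕ), 0 < pr P (word x m n) := by
  refine ae_all_iff.2 fun m => ae_all_iff.2 fun n => ?_
  obtain ⟨E, hE⟩ : ∃ E, E = {w | ¬ 0 < pr P w} := ⟨_, rfl⟩
  have h : P.real {x | word x m n ∈ E} = 0 := by
    rw [hP.real_word_mem]
    refine Finset.sum_eq_zero fun w hw => ?_
    have := (Finset.mem_filter.1 hw).2
    rw [hE] at this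
    exact le_antisymm (not_lt.1 this) (pr_nonneg _ _)
  rw [hE] at h
  rw [measureReal_eq_zero_iff] at h
  exact h

end Nice



/-! ### The fraction of determined coordinates -/

section Fraction

variable {A : Type*} {s : A} {ξ : (ℤ → Bool) → ℤ → ℕ} {x : ℤ → A}

lemma Marked.eq_of_isRankSkeleton (h : Marked s ξ x) {r : ℕ} {m : ℤ} {n : ℕ}
    (hr : IsRankSkeleton (ξ (hat s x)) r m n) (hm : m ≤ 0) (hn : 0 < m + n) :
    left s ξ r x = m ∧ size s ξ r x = n := by
  obtain ⟨-, a1, a2, a3⟩ := h.isRankSkeleton r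
  obtain ⟨-, b1, b2, b3⟩ := hr
  have h0 := left_nonpos s ξ r x
  have h2 : 0 < left s ξ r x + size s ξ r x := by
    rw [left_add_size]
    have : right s ξ r x ∈ {i : ℤ | 0 < i ∧ r ≤ ξ (hat s x) i} :=
      Int.csInf_mem (h.after r 0) ⟨0, fun i hi => hi.1.le⟩
    exact this.1
  have c1 : ¬ left s ξ r x < m := fun h => by
    have := a3 m h (by omega)
    omega
  have c2 : ¬ m < left s ξ r x := fun h => by
    have := b3 _ h (by omega)
    omega
  have c3 : ¬ left s ξ r x + size s ξ r x < m + n := fun h => by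
    have := b3 _ (by omega) h
    omega
  have c4 : ¬ m + n < left s ξ r x + size s ξ r x := fun h => by
    have := a3 _ (by omega) h
    omega
  omega

instance : Countable Skeleton :=
  Function.Injective.countable (f := fun S : Skeleton => (S.pos, S.dist, S.marks))
    fun S T h => by
      cases S
      cases T
      simp only [Prod.mk.injEq] at h
      obtain ⟨rfl, rfl, rfl⟩ := h
      rfl

variable [MeasurableSpace A] [MeasurableSingletonClass A]

lemma measurableSet_filler (hξ : Measurable ξ) (m : ℤ) (n : ℕ) (v : Skeleton × List A) :
    MeasurableSet {x | (skel s ξ x m n, word x m n) = v} := by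
  have hh := measurable_hat (A := A) s
  obtain ⟨⟨k, d, l⟩, w⟩ := v
  have h1 : MeasurableSet {x : ℤ → A | word (hat s x) m n = d} := hh (measurableSet_word m n d)
  have h2 : MeasurableSet {x : ℤ → A | word (ξ (hat s x)) (m + 1) (n - 1) = l} :=
    (hξ.comp hh) (measurableSet_word (m + 1) (n - 1) l)
  by_cases hk : m = k
  · convert (h1.inter h2).inter (measurableSet_word m n w) using 1
    ext x
    simp [skel, hk, Prod.mk.injEq]
  · convert MeasurableSet.empty using 1
    ext x
    simp [skel, hk]

lemma measurableSet_isRankSkeleton (hξ : Measurable ξ) (r : ℕ) (m : ℤ) (n : ℕ) :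
    MeasurableSet {x : ℤ → A | IsRankSkeleton (ξ (hat s x)) r m n} := by
  have hq : ∀ i, Measurable fun x : ℤ → A => ξ (hat s x) i := fun i =>
    (measurable_pi_apply i).comp (hξ.comp (measurable_hat s))
  refine (MeasurableSet.const _).inter ((measurableSet_le measurable_const (hq _)).inter
    ((measurableSet_le measurable_const (hq _)).inter ?_))
  have : MeasurableSet (⋂ i : ℤ, ⋂ (_ : m < i), ⋂ (_ : i < m + n),
      {x : ℤ → A | ξ (hat s x) i < r}) :=
    MeasurableSet.iInter fun i => MeasurableSet.iInter fun _ => MeasurableSet.iInter fun _ =>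
      measurableSet_lt (hq i) measurable_const
  have e : (⋂ i : ℤ, ⋂ (_ : m < i), ⋂ (_ : i < m + n), {x : ℤ → A | ξ (hat s x) i < r}) =
      {x : ℤ → A | ∀ i : ℤ, m < i → i < m + n → ξ (hat s x) i < r} := by
    ext x
    simp
  rw [e] at this
  exact this

/-- At marked points the filler is found by trying the countably many intervals around zero, so up
to a null set the event is a countable union of measurable ones. -/
lemma nullMeasurableSet_filler₀ [Countable A] {P : Measure (ℤ → A)} (hξ : Measurable ξ)
    (hm : ∀ᵐ x ∂P, Marked s ξ x) {r : ℕ} (V : Set (Skeleton × List A)) :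
    NullMeasurableSet {x | filler₀ s ξ r x ∈ V} P := by
  have h : MeasurableSet (⋃ v ∈ V, ⋃ m : ℤ, ⋃ n : ℕ, ⋃ (_ : m ≤ 0 ∧ 0 < m + n),
      {x : ℤ → A | IsRankSkeleton (ξ (hat s x)) r m n} ∩
        {x | (skel s ξ x m n, word x m n) = v}) :=
    MeasurableSet.biUnion (Set.to_countable V) fun v _ => MeasurableSet.iUnion fun m =>
      MeasurableSet.iUnion fun n => MeasurableSet.iUnion fun _ =>
        (measurableSet_isRankSkeleton hξ r m n).inter (measurableSet_filler hξ m n v)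
  refine h.nullMeasurableSet.congr ?_
  filter_upwards [hm] with x hx
  refine propext ?_
  change x ∈ (⋃ v ∈ V, ⋃ m : ℤ, ⋃ n : ℕ, ⋃ (_ : m ≤ 0 ∧ 0 < m + n), _) ↔ _
  simp only [Set.mem_iUnion, Set.mem_inter_iff, Set.mem_ofPred_eq, exists_prop]
  constructor
  · rintro ⟨v, hv, m, n, ⟨h1, h2⟩, h3, rfl⟩
    obtain ⟨rfl, rfl⟩ := hx.eq_of_isRankSkeleton h3 h1 h2
    exact hv
  · intro hV
    have h3 : right s ξ r x ∈ {i : ℤ | 0 < i ∧ r ≤ ξ (hat s x) i} :=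
      Int.csInf_mem (hx.after r 0) ⟨0, fun i hi => hi.1.le⟩
    exact ⟨_, hV, left s ξ r x, size s ξ r x,
      ⟨left_nonpos _ _ _ _, by rw [left_add_size]; exact h3.1⟩, hx.isRankSkeleton r, rfl⟩

/-- The fraction of coordinates determined by the class of the filler. -/
def fraction (P : Measure (ℤ → A)) (s : A) (ξ : (ℤ → Bool) → ℤ → ℕ) (R : Relations A) (r : ℕ)
    (x : ℤ → A) : ℝ :=
  (Set.ncard {i : ℤ | left s ξ r x ≤ i ∧ i < right s ξ r x ∧
      x ∈ Determines P (cls₀ s ξ R r) fun y => y i} : ℝ) / size s ξ r x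

variable {P : Measure (ℤ → A)} {R : Relations A}

lemma fraction_nonneg (r : ℕ) (x : ℤ → A) : 0 ≤ fraction P s ξ R r x := by
  unfold fraction
  positivity

lemma fraction_le_one (r : ℕ) (x : ℤ → A) : fraction P s ξ R r x ≤ 1 := by
  refine div_le_one_of_le₀ ?_ (Nat.cast_nonneg _)
  have h := Set.ncard_le_ncard (s := {i : ℤ | left s ξ r x ≤ i ∧ i < right s ξ r x ∧
    x ∈ Determines P (cls₀ s ξ R r) fun y => y i}) (t := Set.Ico (left s ξ r x) (right s ξ r x))
    (fun i hi => ⟨hi.1, hi.2.1⟩) (Set.finite_Ico _ _)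
  rw [← Finset.coe_Ico, Set.ncard_coe_finset, Int.card_Ico] at h
  exact_mod_cast h

lemma fraction_congr {r : ℕ} {x y : ℤ → A} (h : filler₀ s ξ r x = filler₀ s ξ r y) :
    fraction P s ξ R r x = fraction P s ξ R r y := by
  have h0 : skel₀ s ξ r x = skel₀ s ξ r y := congrArg Prod.fst h
  simp only [filler₀, skel₀, skel, Prod.mk.injEq, Skeleton.mk.injEq] at h
  obtain ⟨⟨h1, h2, h3⟩, h4⟩ := h
  have h5 : size s ξ r x = size s ξ r y := by simpa using congrArg List.length h4
  have h6 : right s ξ r x = right s ξ r y := by rw [← left_add_size, ← left_add_size, h1, h5]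
  have h7 : cls₀ s ξ R r x = cls₀ s ξ R r y := by
    change (skel₀ s ξ r x, {w | R (skel₀ s ξ r x) w (word x (left s ξ r x) (size s ξ r x))}) =
      (skel₀ s ξ r y, {w | R (skel₀ s ξ r y) w (word y (left s ξ r y) (size s ξ r y))})
    rw [h0, h4]
  rw [fraction, fraction, h5, h6, h1]
  congr 3
  ext i
  simp only [Set.mem_ofPred_eq, Determines, h7]
  refine and_congr_right fun h8 => and_congr_right fun h9 => ?_
  have : x i = y i := by
    obtain ⟨j, rfl⟩ : ∃ j : ℕ, i = left s ξ r y + j := ⟨(i - left s ξ r y).toNat, by omega⟩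
    have hj : j < size s ξ r y := by
      have := left_add_size s ξ r y
      omega
    rw [h1, h5] at h4
    have := congrArg (fun l => l[j]?) h4
    simpa [word, hj] using this
  rw [this]

/-- The fraction is bounded by one, so it suffices that it is close to one with high probability. It
depends on the filler only, which makes it integrable. -/
theorem tendsto_fraction [Countable A] [IsProbabilityMeasure P] {L : ℕ → ℝ}
    (hL : Tendsto L atTop atTop) (hξ : Measurable ξ) (hm : ∀ᵐ x ∂P, Marked s ξ x)
    (h : ∀ ε : ℝ, 0 < ε → WithHighProb P L fun r => {x | 1 - ε ≤ fraction P s ξ R r x}) :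
    Tendsto (fun r : ℕ => ∫ x, fraction P s ξ R r x ∂P) atTop (𝓝 1) := by
  have hint : ∀ r, Integrable (fraction P s ξ R r) P := fun r => by
    have hn : NullMeasurable (fraction P s ξ R r) P := fun V _ => by
      convert nullMeasurableSet_filler₀ (r := r) hξ hm
        (filler₀ s ξ r '' (fraction P s ξ R r ⁻¹' V)) using 1
      ext x
      constructor
      · intro hx
        exact ⟨x, hx, rfl⟩
      · rintro ⟨y, hy, e⟩
        change fraction P s ξ R r x ∈ V
        rw [← fraction_congr e]
        exact hy
    refine Integrable.of_bound hn.aemeasurable.aestronglyMeasurable 1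
      (Eventually.of_forall fun x => ?_)
    rw [Real.norm_of_nonneg (fraction_nonneg r x)]
    exact fraction_le_one r x
  refine tendsto_order.2 ⟨fun a ha => ?_, fun a ha => Eventually.of_forall fun r => ?_⟩
  -- By Markov's inequality the integral is at least (1 - ε)² ≥ 1 - 2 ε > a.
  · set ε := min ((1 - a) / 3) 1 with hε
    have hε0 : 0 < ε := lt_min (by linarith) one_pos
    have hε1 : ε ≤ 1 := min_le_right _ _
    have hε2 : ε ≤ (1 - a) / 3 := min_le_left _ _
    have ht := SuperpolyDecay.tendsto_zero hL (h ε hε0)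
    filter_upwards [ht.eventually (eventually_le_nhds hε0)] with r hr
    have h1 := mul_meas_ge_le_integral_of_nonneg (μ := P)
      (Eventually.of_forall (fraction_nonneg (P := P) (s := s) (ξ := ξ) (R := R) r)) (hint r)
      (1 - ε)
    have h2 := measureReal_union_le (μ := P) {x | 1 - ε ≤ fraction P s ξ R r x}
      {x | 1 - ε ≤ fraction P s ξ R r x}ᶜ
    rw [Set.union_compl_self, probReal_univ] at h2
    have h3 : (1 - ε) * (1 - ε) ≤ (1 - ε) * P.real {x | 1 - ε ≤ fraction P s ξ R r x} :=
      mul_le_mul_of_nonneg_left (by linarith) (by linarith)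
    nlinarith
  · refine lt_of_le_of_lt ?_ ha
    have := integral_mono (hint r) (integrable_const (1 : ℝ)) fun x => fraction_le_one r x
    simpa using this

end Fraction

/-! ### Symbols that are read off the mask. -/

section Shown

variable {K : Type*}

lemma eq_of_hidSym {j : ℕ} {t : LState} {x y : Split K} (h : hidSym j t x = 0)
    (e : maskSym j t y = maskSym j t x) : y = x := by
  cases x <;> cases y <;> simp_all [maskSym, hidSym]

/-- Every site that is not counted as hidden has the same letter in all words with the same mask. -/
lemma length_le_shown (ℓ j : ℕ) (t : LState) (w : List (Split K)) :
    w.length ≤ ((Finset.range w.length).filter fun i => ∀ w', mk ℓ j t w' = mk ℓ j t w →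
      w'[i]? = w[i]?).card + hc ℓ j t w := by
  induction w generalizing t with
  | nil => simp
  | cons x w ih =>
    have hmk : ∀ y v, mk ℓ j t (y :: v) = mk ℓ j t (x :: w) →
        maskSym j t y = maskSym j t x ∧ mk ℓ j (lstep ℓ t x) v = mk ℓ j (lstep ℓ t x) w := by
      intro y v h
      simp only [mk, List.cons.injEq] at h
      have h1 : lstep ℓ t y = lstep ℓ t x :=
        adv_eq_of_mk (ℓ := ℓ) (j := j) (t := t) (w := [y]) (w' := [x]) (by simp [mk, h.1]) t
      rw [h1] at h
      exact h
    set D := (Finset.range w.length).filter fun i => ∀ w',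
      mk ℓ j (lstep ℓ t x) w' = mk ℓ j (lstep ℓ t x) w → w'[i]? = w[i]? with hD
    have hsub : D.map ⟨Nat.succ, Nat.succ_injective⟩ ⊆ ((Finset.range (x :: w).length).filter
        fun i => ∀ w', mk ℓ j t w' = mk ℓ j t (x :: w) → w'[i]? = (x :: w)[i]?) := by
      intro i hi
      obtain ⟨i, hi', rfl⟩ := Finset.mem_map.1 hi
      rw [hD, Finset.mem_filter, Finset.mem_range] at hi'
      simp only [Function.Embedding.coeFn_mk, Finset.mem_filter, Finset.mem_range,
        List.length_cons]
      refine ⟨by omega, fun w' h => ?_⟩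
      cases w' with
      | nil => simp [mk] at h
      | cons y v => simpa using hi'.2 v (hmk y v h).2
    have ih := ih (lstep ℓ t x)
    rw [← hD] at ih
    simp only [hc]
    rcases Nat.eq_zero_or_pos (hidSym j t x) with h0 | h0
    · have h1 : insert 0 (D.map ⟨Nat.succ, Nat.succ_injective⟩) ⊆
          ((Finset.range (x :: w).length).filter
          fun i => ∀ w', mk ℓ j t w' = mk ℓ j t (x :: w) → w'[i]? = (x :: w)[i]?) := by
        refine Finset.insert_subset ?_ hsub
        simp only [Finset.mem_filter, Finset.mem_range, List.length_cons]
        refine ⟨by omega, fun w' h => ?_⟩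
        cases w' with
        | nil => simp [mk] at h
        | cons y v => simp [eq_of_hidSym h0 (hmk y v h).1]
      have h2 := Finset.card_le_card h1
      rw [Finset.card_insert_of_notMem (by simp), Finset.card_map] at h2
      rw [List.length_cons] at h2 ⊢
      omega
    · have h2 := Finset.card_le_card hsub
      rw [Finset.card_map] at h2
      rw [List.length_cons] at h2 ⊢
      omega

end Shown



/-! ### Classes of fillers -/

/-! ### Conditional probabilities as masses of words. -/

section Cond

variable {A : Type*} [Fintype A] [MeasurableSpace A] [MeasurableSingletonClass A]
  {P : Measure (ℤ → A)} [IsProbabilityMeasure P] {s : A}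

lemma word_hat (s : A) (x : ℤ → A) (m : ℤ) (n : ℕ) : word (hat s x) m n = hw s (word x m n) :=
  word_map (fun y => decide (y = s)) x m n

/-- Conditioning on the occurrences of `s` up to the site after the skeleton, where there is an `s`,
is what the denominator of `mass` expresses. -/
lemma cond_real_eq_mass (hP : WordStationary P) {x : ℤ → A} {m : ℤ} {n : ℕ} (hx : x (m + n) = s)
    (E : List A → Prop) :
    (P[|{y | word (hat s y) m (n + 1) = word (hat s x) m (n + 1)}]).real {y | E (word y m n)} =
      mass (pr P) s (word x m n) E := by
  have hm : MeasurableSet {y : ℤ → A | word (hat s y) m (n + 1) = word (hat s x) m (n + 1)} :=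
    measurable_hat s (measurableSet_word m (n + 1) _)
  have hw1 : word x m (n + 1) = word x m n ++ [s] := by rw [word_snoc, hx]
  have h1 : P.real {y : ℤ → A | word (hat s y) m (n + 1) = word (hat s x) m (n + 1)} =
      hpr (pr P) s (word x m n ++ [s]) := by
    have := hP.real_word_mem m (n + 1) {v | hw s v = hw s (word x m n ++ [s])}
    simp only [Set.mem_ofPred_eq] at this
    simp only [word_hat, hw1]
    rw [this, hpr, List.length_append, List.length_singleton, word_length]
  have h2 : P.real ({y : ℤ → A | word (hat s y) m (n + 1) = word (hat s x) m (n + 1)} ∩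
      {y | E (word y m n)}) = ∑ w' ∈ (words A n).filter
        (fun w' => hw s w' = hw s (word x m n) ∧ E w'), pr P (w' ++ [s]) := by
    have := hP.real_word_mem m (n + 1)
      {v | hw s v = hw s (word x m n ++ [s]) ∧ E (v.take n)}
    rw [Finset.sum_filter, sum_words_snoc] at this
    rw [Finset.sum_filter]
    have e : {y : ℤ → A | word (hat s y) m (n + 1) = word (hat s x) m (n + 1)} ∩
        {y | E (word y m n)} = {y : ℤ → A | word y m (n + 1) ∈
          {v | hw s v = hw s (word x m n ++ [s]) ∧ E (v.take n)}} := by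
      ext y
      simp only [Set.mem_inter_iff, Set.mem_ofPred_eq, word_hat, hw1]
      rw [word_snoc, List.take_left' (by simp)]
    rw [e, this]
    refine Finset.sum_congr rfl fun u hu => ?_
    rw [mem_words] at hu
    have hl : u.length = (word x m n).length := by simp [hu]
    rw [Finset.sum_eq_single s]
    · simp only [Set.mem_ofPred_eq, hw_append_eq hl, and_true, List.take_left' hu]
    · intro b _ hb
      rw [if_neg]
      simp only [Set.mem_ofPred_eq, hw_append_eq hl]
      rintro ⟨⟨-, h⟩, -⟩
      simp [hw, hb] at h
    · simp
  rw [measureReal_def, cond_apply hm, ENNReal.toReal_mul, ENNReal.toReal_inv, ← measureReal_def,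
    ← measureReal_def, h1, h2, mass, word_length, inv_mul_eq_div]

end Cond

lemma lam_natCast (k n : ℕ) : lam k n = √(n : ℝ) * Real.log n ^ k := by
  rw [lam, ← Real.sqrt_eq_rpow, Real.rpow_natCast]

section Good

variable {K : Type*} [Fintype K] [MeasurableSpace K] [MeasurableSingletonClass K]
  {p : Measure K} [IsProbabilityMeasure p] {μ : Measure (ℤ → BiState)} [IsProbabilityMeasure μ]
  {s : Split K} {t : BiState} {Θ : Scheme K} {pr : List (Split K) → ℝ} {ψ : ℕ → ℝ}
  {ξ : (ℤ → Bool) → ℤ → ℕ} {x : ℤ → Split K}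

lemma fillers_skel {m : ℤ} {n : ℕ} {w w' : List (Split K)} :
    fillers Θ pr s ψ (skel s ξ x m n) w w' ↔
      Rel Θ pr s ψ (fun j => (word (ξ (hat s x)) (m + 1) (n - 1)).getD (j - 1) 0) n w w' := by
  change Rel Θ pr s ψ _ (word (hat s x) m n).length w w' ↔ _
  rw [word_length]
  rfl

lemma fillers_skel_iff {m : ℤ} {n : ℕ} (hS : IsSkeleton (ξ (hat s x)) m n)
    {w w' : List (Split K)} :
    fillers Θ pr s ψ (skel s ξ x m n) w w' ↔
      ∀ i l : ℕ, i + l ≤ n → IsSkeleton (ξ (hat s x)) (m + i) l → Like Θ pr s ψ i l w w' := by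
  rw [fillers_skel, Rel]
  refine forall_congr' fun i => forall_congr' fun l => ?_
  rw [subIv_iff hS fun j h0 hj => getD_word _ m h0 hj, and_imp]

/-- The relation on a part depends only on the letters there. Hence equivalence of fillers passes to
sub-skeletons, whose own sub-skeletons are among those of the whole. -/
lemma like_sub {m m' : ℤ} {n n' i₀ : ℕ} (hm : m' = m + i₀) (hn : i₀ + n' ≤ n) {i l : ℕ}
    (hi : i + l ≤ n') (z z' : ℤ → Split K) :
    Like Θ pr s ψ i l (word z m' n') (word z' m' n') ↔
      Like Θ pr s ψ (i₀ + i) l (word z m n) (word z' m n) := by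
  subst hm
  simp only [Like, sub]
  rw [word_sub _ _ hi, word_sub _ _ hi, word_sub _ _ (by omega), word_sub _ _ (by omega)]
  push_cast
  rw [add_assoc]

lemma IsSkeleton.pos {q : ℤ → ℕ} {m : ℤ} {n : ℕ} (h : IsSkeleton q m n) : 0 < n := by
  obtain ⟨r, -, h, -⟩ := h
  exact h

/-- Equivalent fillers are not distinguished by their masks if one of them is good. -/
lemma ME_of_fillers {z z' : ℤ → Split K} {m : ℤ} {n : ℕ} (hS : IsSkeleton (ξ (hat s z)) m n)
    (h : fillers Θ pr s ψ (skel s ξ z m n) (word z' m n) (word z m n))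
    (hg : Good Θ pr s ψ (word z m n)) :
    ME Θ (word z' m n) (word z m n) ∧ ¬ Kap Θ (word z' m n) := by
  have h1 := (fillers_skel_iff hS).1 h 0 n (by omega) (by simpa using hS)
  have e : ∀ y : ℤ → Split K, sub (word y m n) 0 n = word y m n := fun y => by
    rw [sub, word_sub _ _ (by omega)]
    simp
  rw [Like, e, e] at h1
  exact ⟨h1.2 (h1.1.2 hg), (h1.1.2 hg).1⟩

lemma fillers_refines {m m' : ℤ} {n n' : ℕ} (hS : IsSkeleton (ξ (hat s x)) m n)
    (hS' : IsSkeleton (ξ (hat s x)) m' n') (hm : m ≤ m') (hn : m' + n' ≤ m + n)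
    {z z' : ℤ → Split K}
    (h : fillers Θ pr s ψ (skel s ξ x m n) (word z m n) (word z' m n)) :
    fillers Θ pr s ψ (skel s ξ x m' n') (word z m' n') (word z' m' n') := by
  rw [fillers_skel_iff hS] at h
  rw [fillers_skel_iff hS']
  intro i l hi hil
  obtain ⟨i₀, rfl⟩ : ∃ i₀ : ℕ, m' = m + i₀ := ⟨(m' - m).toNat, by omega⟩
  rw [like_sub (m := m) (n := n) (i₀ := i₀) rfl (by omega) hi]
  refine h _ _ (by omega) ?_
  push_cast
  rwa [← add_assoc]

lemma classInfo_eq {P : Measure (ℤ → Split K)} [IsProbabilityMeasure P] (hP : WordStationary P)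
    {m : ℤ} {n : ℕ} (hx : x (m + n) = s) :
    classInfo P s ξ (fillers Θ pr s ψ) x m n = -Real.log (mass (Fillers.pr P) s (word x m n)
      fun w => Rel Θ pr s ψ (fun j => (word (ξ (hat s x)) (m + 1) (n - 1)).getD (j - 1) 0) n w
        (word x m n)) := by
  rw [classInfo, ← cond_real_eq_mass hP hx]
  simp only [fillers_skel]

lemma mass_class_ge (hs : Unsplit μ s t) (hμ : WordStationary μ) (hψ : ∀ n, 0 ≤ ψ n)
    (hψ' : ∀ i j, ψ i + ψ j ≤ ψ (i + j)) (hx : Marked s ξ x)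
    (hpos : ∀ (m : ℤ) (n : ℕ), 0 < Fillers.pr (splitting μ p) (word x m n)) {m : ℤ} {n : ℕ}
    (hS : IsSkeleton (ξ (hat s x)) m n) :
    Real.exp (-ψ n) ≤ mass (Fillers.pr (splitting μ p)) s (word x m n)
      fun w => Rel Θ (Fillers.pr (splitting μ p)) s ψ
        (fun j => (word (ξ (hat s x)) (m + 1) (n - 1)).getD (j - 1) 0) n w (word x m n) := by
  refine exp_le_mass_rel (hs.renewalLaw hμ) hs.notSym hψ hψ' n _ _ (word_length _ _ _) ?_ ?_
  · refine hs.hpr_pos hμ ?_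
    have := hpos m (n + 1)
    rwa [word_snoc, hx.eq_right hS] at this
  · intro j h0 hj hq
    simp only [getD_word _ _ h0 hj] at hq
    have := hx.eq _ hq
    simp [word, hj, this]

end Good



/-! ### Good systems of fillers -/

lemma getElem?_word {A : Type*} (x : ℤ → A) (m : ℤ) {n i : ℕ} (h : i < n) :
    (word x m n)[i]? = some (x (m + i)) := by
  simp [word, h]

section HighProb

variable {K : Type*} [Fintype K] [MeasurableSpace K] [MeasurableSingletonClass K]
  {p : Measure K} [IsProbabilityMeasure p] {μ : Measure (ℤ → BiState)} [IsProbabilityMeasure μ]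
  {s : Split K} {t : BiState} {ξ : (ℤ → Bool) → ℤ → ℕ} {L : ℕ → ℝ}

lemma Unsplit.measurePreserving_hat (hμ : IsBiMarked μ) (hs : Unsplit μ s t) :
    MeasurePreserving shift ((splitting μ p).map (hat s)) ((splitting μ p).map (hat s)) := by
  have hsh : Measurable (shift : (ℤ → Bool) → ℤ → Bool) :=
    measurable_pi_iff.2 fun i => measurable_pi_apply _
  refine ⟨hsh, ?_⟩
  rw [hs.map_hat, Measure.map_map hsh (measurable_hat t)]
  conv_rhs => rw [← hμ.stationary.map_eq, Measure.map_map (measurable_hat t)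
    hμ.stationary.measurable]
  rfl

/-- Almost every point is marked and has words of positive probability only. -/
lemma IsNice.ae_regular (hμ : IsBiMarked μ) (hs : Unsplit μ s t)
    (hξ : IsNice (splitting μ p) s ξ L) : ∀ᵐ x ∂splitting μ p, Marked s ξ x ∧
      ∀ (m : ℤ) (n : ℕ), 0 < pr (splitting μ p) (word x m n) :=
  (hξ.ae_marked (hs.measurePreserving_hat hμ)).and (ae_pr_pos
    (wordStationary_splitting (wordStationary_of_measurePreserving hμ.stationary)))

/-- Fillers of large skeletons have any property that is likely for words between two occurrences
of `s`. -/
theorem IsNice.withHighProb_word (hμ : IsBiMarked μ) (hs : Unsplit μ s t)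
    (hξ : IsNice (splitting μ p) s ξ L) {E : List (Split K) → Prop}
    (hE : SuperpolyDecay (fun n => (n : ℝ)) fun n => (splitting μ p).real
      {x | x 0 = s ∧ x n = s ∧ ¬ E (word x 0 n)}) (n₀ : ℕ) :
    WithHighProb (splitting μ p) L fun r => {x |
      (Marked s ξ x ∧ ∀ (m : ℤ) (n : ℕ), 0 < pr (splitting μ p) (word x m n)) ∧
      n₀ ≤ size s ξ r x ∧ E (word x (left s ξ r x) (size s ξ r x))} := by
  have hst := wordStationary_of_measurePreserving hμ.stationary
  have hP := wordStationary_splitting (p := p) hst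
  obtain ⟨c, -, hsz⟩ := hξ.size_bounds
  have hf : SuperpolyDecay (fun n => (n : ℝ)) fun n : ℕ => if n < n₀ then (1 : ℝ) else 0 := by
    intro k
    refine IsBigO.of_bound 1 ?_
    filter_upwards [eventually_ge_atTop n₀] with n hn
    rw [if_neg (by omega), norm_zero]
    positivity
  have h := WithHighProb.notMem hξ.tendsto (l := left s ξ) (sz := size s ξ)
    (fun r x => ⟨left_nonpos s ξ r x, by rw [left_add_size]; exact right_nonneg s ξ r x⟩) hsz
    (hE.add hf)
    -- The second event excludes sizes below n₀; its probability bound vanishes for large n.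
    (B := fun m n => {x | x m = s ∧ x (m + n) = s ∧ ¬ E (word x m n)} ∪ {_x | n < n₀})
    fun m n => by
      refine (measureReal_union_le _ _).trans (add_le_add (le_of_eq ?_) ?_)
      · have key : ∀ m : ℤ, {x : ℤ → Split K | x m = s ∧ x (m + n) = s ∧ ¬ E (word x m n)} =
            {x | word x m (n + 1) ∈ {v : List (Split K) | v[0]? = some s ∧ v[n]? = some s ∧
              ¬ E (v.take n)}} := by
          intro m
          ext x
          have e1 : (word x m (n + 1)).take n = word x m n := by
            rw [word_snoc, List.take_left' (by simp)]
          simp only [Set.mem_ofPred_eq, e1, getElem?_word x m (show 0 < n + 1 by omega),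
            getElem?_word x m (show n < n + 1 by omega)]
          simp
        have h0 := key 0
        simp only [zero_add] at h0
        rw [key, h0, hP.real_word_mem, hP.real_word_mem]
      · split_ifs with hn
        · exact measureReal_le_one
        · simp [hn]
  refine h.mono ((eventually_gt_atTop 0).mono fun r hr => ?_)
  filter_upwards [hξ.ae_regular hμ hs] with x hx hB
  refine ⟨hx, ?_⟩
  have hS := hx.1.isSkeleton hr
  simp only [Set.mem_ofPred_eq, Set.mem_union, not_or, not_and, not_not, not_lt] at hB
  exact ⟨hB.2, hB.1 (hx.1.eq_left hS) (hx.1.eq_right hS)⟩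

end HighProb

section Good

variable {K : Type*} [Fintype K] [MeasurableSpace K] [MeasurableSingletonClass K]
  {p : Measure K} [IsProbabilityMeasure p] {μ : Measure (ℤ → BiState)} [IsProbabilityMeasure μ]
  {s : Split K} {t : BiState} {ξ : (ℤ → Bool) → ℤ → ℕ} {L : ℕ → ℝ} {Θ : Scheme K} {ψ : ℕ → ℝ}

/-- Most symbols of a good filler are determined by its class. -/
lemma fraction_ge {P : Measure (ℤ → Split K)} {pr : List (Split K) → ℝ} {r : ℕ} (hr : 0 < r)
    {x : ℤ → Split K} (hx : Marked s ξ x)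
    (hg : Good Θ pr s ψ (word x (left s ξ r x) (size s ξ r x))) :
    1 - (hc Θ.len (Θ.lvl (size s ξ r x)) (none, none)
      (word x (left s ξ r x) (size s ξ r x)) : ℝ) / size s ξ r x ≤
      fraction P s ξ (fillers Θ pr s ψ) r x := by
  have hS := hx.isSkeleton hr
  have h := length_le_shown Θ.len (Θ.lvl (size s ξ r x)) (none, none)
    (word x (left s ξ r x) (size s ξ r x))
  rw [word_length] at h
  set n := size s ξ r x with hn
  set m := left s ξ r x with hm
  set D := (Finset.range n).filter fun i => ∀ w', mk Θ.len (Θ.lvl n) (none, none) w' =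
    mk Θ.len (Θ.lvl n) (none, none) (word x m n) → w'[i]? = (word x m n)[i]? with hD
  have hn0 : (0 : ℝ) < n := by exact_mod_cast hS.pos
  have hcard : D.card ≤ Set.ncard {i : ℤ | m ≤ i ∧ i < right s ξ r x ∧
      x ∈ Determines P (cls₀ s ξ (fillers Θ pr s ψ) r) fun y => y i} := by
    have hinj : Function.Injective fun i : ℕ => m + (i : ℤ) := fun i j h => by
      have : m + (i : ℤ) = m + (j : ℤ) := h
      omega
    rw [← Finset.card_image_of_injective D hinj, ← Set.ncard_coe_finset]
    refine Set.ncard_le_ncard ?_ ((Set.finite_Ico m (right s ξ r x)).subset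
      fun i hi => ⟨hi.1, hi.2.1⟩)
    intro i hi
    rw [Finset.mem_coe, Finset.mem_image] at hi
    obtain ⟨i, hi, rfl⟩ := hi
    rw [hD, Finset.mem_filter, Finset.mem_range] at hi
    refine ⟨by omega, ?_, ?_⟩
    · rw [← left_add_size s ξ r x]
      have := hi.1
      omega
    · change ∀ᵐ y ∂P, cls₀ s ξ (fillers Θ pr s ψ) r y = cls₀ s ξ (fillers Θ pr s ψ) r x →
        y (m + i) = x (m + i)
      refine Eventually.of_forall fun y hy => ?_
      have h1 : skel₀ s ξ r y = skel₀ s ξ r x := congrArg Prod.fst hy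
      have h2 : left s ξ r y = m := congrArg Skeleton.pos h1
      have h3 : size s ξ r y = n := by
        have := congrArg (fun S => S.dist.length) h1
        simpa [skel₀, skel] using this
      have h5 : fillers Θ pr s ψ (skel s ξ x m n) (word y m n) (word x m n) := by
        have h6 : word y m n ∈ (cls₀ s ξ (fillers Θ pr s ψ) r y).2 := by
          rw [cls₀, h2, h3]
          exact (fillers Θ pr s ψ (skel s ξ y m n)).refl _
        rw [hy] at h6
        exact h6
      have h6 := (ME_of_fillers hS h5 hg).1.1
      rw [mask, mask, word_length, word_length] at h6
      have h7 := hi.2 _ h6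
      rwa [getElem?_word _ _ hi.1, getElem?_word _ _ hi.1, Option.some_inj] at h7
  rw [fraction, ← hn, le_div_iff₀ hn0, sub_mul, div_mul_cancel₀ _ hn0.ne', one_mul,
    sub_le_iff_le_add]
  exact_mod_cast h.trans (Nat.add_le_add_right hcard _)

/-- The properties of the system of fillers from which it is good. -/
structure Parameters (P : Measure (ℤ → Split K)) (Θ : Scheme K) (s : Split K) (ψ : ℕ → ℝ)
    (E : List (Split K) → Prop) : Prop where
  nonneg : ∀ n, 0 ≤ ψ n
  add : ∀ i j, ψ i + ψ j ≤ ψ (i + j)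
  eq : ∀ᶠ n : ℕ in atTop, ψ n = n * hrate (pr P) s - √(n : ℝ) * Real.log n ^ 2
  decay : SuperpolyDecay (fun n => (n : ℝ)) fun n => P.real
    {x | x 0 = s ∧ x n = s ∧ ¬ E (word x 0 n)}
  good : ∀ᶠ n : ℕ in atTop, ∀ w : List (Split K), w.length = n → 0 < pr P (w ++ [s]) → E w →
    Good Θ (pr P) s ψ w
  mass : ∀ᶠ n : ℕ in atTop, ∀ w : List (Split K), w.length = n → 0 < pr P (w ++ [s]) → E w →
    mass (pr P) s w (fun w' => mask Θ w' = mask Θ w) ≤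
      Real.exp (-(n * hrate (pr P) s - √(n : ℝ) * Real.log n ^ 5))
  hidden : ∀ w, E w → hc Θ.len (Θ.lvl w.length) (none, none) w ≤
    √(w.length : ℝ) * Real.log w.length ^ 4

variable {E : List (Split K) → Prop}

/-- The fillers of large skeletons are good. -/
lemma Parameters.withHighProb (hμ : IsBiMarked μ) (hs : Unsplit μ s t)
    (hξ : IsNice (splitting μ p) s ξ L) (hE : Parameters (splitting μ p) Θ s ψ E) (n₀ : ℕ) :
    WithHighProb (splitting μ p) L fun r => {x |
      (Marked s ξ x ∧ ∀ (m : ℤ) (n : ℕ), 0 < pr (splitting μ p) (word x m n)) ∧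
      n₀ ≤ size s ξ r x ∧ E (word x (left s ξ r x) (size s ξ r x)) ∧
      Good Θ (pr (splitting μ p)) s ψ (word x (left s ξ r x) (size s ξ r x))} := by
  obtain ⟨n₁, hn₁⟩ := eventually_atTop.1 hE.good
  refine (hξ.withHighProb_word hμ hs hE.decay (max n₀ n₁)).mono
    ((eventually_gt_atTop 0).mono fun r hr => Eventually.of_forall fun x hx => ?_)
  obtain ⟨h1, h2, h3⟩ := hx
  refine ⟨h1, (le_max_left _ _).trans h2, h3, hn₁ _ ((le_max_right _ _).trans h2) _
    (word_length _ _ _) ?_ h3⟩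
  have := h1.2 (left s ξ r x) (size s ξ r x + 1)
  rwa [word_snoc, h1.1.eq_right (h1.1.isSkeleton hr)] at this

lemma tendsto_pow_log_div_sqrt :
    Tendsto (fun n : ℕ => √(n : ℝ) * Real.log n ^ 4 / n) atTop (𝓝 0) := by
  have h := ((isLittleO_log_rpow_rpow_atTop 4 (show (0 : ℝ) < 1 / 2 by norm_num)).comp_tendsto
    (tendsto_natCast_atTop_atTop (R := ℝ))).tendsto_div_nhds_zero
  refine h.congr' ?_
  filter_upwards [eventually_gt_atTop 0] with n hn
  have h0 : (0 : ℝ) < n := by exact_mod_cast hn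
  have h1 : 0 < √(n : ℝ) := Real.sqrt_pos.2 h0
  simp only [Function.comp]
  rw [← Real.sqrt_eq_rpow, show (4 : ℝ) = ((4 : ℕ) : ℝ) by norm_num, Real.rpow_natCast,
    div_eq_div_iff h1.ne' h0.ne']
  have : (n : ℝ) = √(n : ℝ) * √(n : ℝ) := (Real.mul_self_sqrt h0.le).symm
  nth_rewrite 2 [this]
  ring

/-- The class of a good filler shows its mask, hence all symbols except the hidden ones, whose
fraction is at most log⁴ n / √n. -/
theorem Parameters.isSOF (hμ : IsBiMarked μ) (hs : Unsplit μ s t)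
    (hξ : IsNice (splitting μ p) s ξ L) (hE : Parameters (splitting μ p) Θ s ψ E) :
    IsSOF (splitting μ p) s ξ (fillers Θ (pr (splitting μ p)) s ψ) := by
  refine ⟨fun S k => rfl, Eventually.of_forall fun x m n m' n' hS hS' hm hn z z' _ _ h =>
    fillers_refines hS hS' hm hn h, ?_⟩
  refine tendsto_fraction hξ.tendsto hξ.marker.measurable
    ((hξ.ae_regular hμ hs).mono fun x hx => hx.1) fun ε hε => ?_
  obtain ⟨n₀, hn₀⟩ := eventually_atTop.1
    (tendsto_pow_log_div_sqrt.eventually (eventually_le_nhds hε))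
  refine (hE.withHighProb hμ hs hξ n₀).mono
    ((eventually_gt_atTop 0).mono fun r hr => Eventually.of_forall fun x hx => ?_)
  obtain ⟨h1, h2, h3, h4⟩ := hx
  refine le_trans ?_ (fraction_ge hr h1.1 h4)
  have h5 := hE.hidden _ h3
  rw [word_length] at h5
  refine sub_le_sub_left (le_trans ?_ (hn₀ _ h2)) _
  exact div_le_div_of_nonneg_right h5 (Nat.cast_nonneg _)

theorem Parameters.isGoodSOF (hμ : IsBiMarked μ) (hs : Unsplit μ s t)
    (hξ : IsNice (splitting μ p) s ξ L) (hE : Parameters (splitting μ p) Θ s ψ E) :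
    IsGoodSOF (splitting μ p) s ξ L (fillers Θ (pr (splitting μ p)) s ψ) := by
  have hst := wordStationary_of_measurePreserving hμ.stationary
  have hP := wordStationary_splitting (p := p) hst
  have hr := hs.renewalLaw (p := p) hst
  have hrate := condEntropyRate_eq hr
  -- The exponent 2 is that of ψ, which bounds the information of all classes; the exponent 5 is
  -- that of the bound for the masses of typical masks.
  refine ⟨hE.isSOF hμ hs hξ, (2 : ℕ), (5 : ℕ), by norm_num, ?_, ?_⟩
  · obtain ⟨n₀, hn₀⟩ := eventually_atTop.1 hE.eq
    refine ⟨n₀, ?_⟩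
    filter_upwards [hξ.ae_regular hμ hs] with x hx m n hS hn
    rw [classInfo_eq hP (hx.1.eq_right hS), lam_natCast, hrate, ← hn₀ n hn, neg_le]
    have h := mass_class_ge (Θ := Θ) hs hst hE.nonneg hE.add hx.1 hx.2 hS
    have := Real.log_le_log (Real.exp_pos _) h
    rwa [Real.log_exp] at this
  · obtain ⟨n₀, hn₀⟩ := eventually_atTop.1 hE.mass
    refine (hE.withHighProb hμ hs hξ n₀).mono
      ((eventually_gt_atTop 0).mono fun r hr' => Eventually.of_forall fun x hx => ?_)
    obtain ⟨h1, h2, h3, h4⟩ := hx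
    have hS := h1.1.isSkeleton hr'
    have hpos := h1.2 (left s ξ r x) (size s ξ r x + 1)
    rw [word_snoc, h1.1.eq_right hS] at hpos
    have hm := hn₀ _ h2 _ (word_length _ _ _) hpos h3
    have hge := mass_class_ge (Θ := Θ) hs hst hE.nonneg hE.add h1.1 h1.2 hS
    rw [Set.mem_ofPred_eq]
    rw [classInfo_eq hP (h1.1.eq_right hS), lam_natCast, hrate, le_neg]
    refine (Real.log_le_log ((Real.exp_pos _).trans_le hge) (le_trans ?_ hm)).trans
      (Real.log_exp _).le
    -- The whole interval is one of those tested by `Rel`, so the class of a good filler is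
    -- contained in its mask class.
    refine hr.mass_mono fun w hw hw' => ?_
    have hl : w.length = size s ξ r x := by
      have := congrArg List.length hw
      simpa using this
    have h5 := hw' 0 (size s ξ r x) ((subIv_iff hS fun j h0 hj => getD_word _ _ h0 hj).2
      ⟨by omega, by simpa using hS⟩)
    have e1 : sub w 0 (size s ξ r x) = w := by rw [← hl, sub_self]
    have e2 : ∀ y : ℤ → Split K, sub (word y (left s ξ r x) (size s ξ r x)) 0 (size s ξ r x) =
        word y (left s ξ r x) (size s ξ r x) := fun y => by
      rw [sub, word_sub _ _ (by omega)]
      simp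
    rw [Like, e1, e2] at h5
    exact (h5.2 (h5.1.2 h4)).1

end Good



/-! ### Nested fillers -/

section Nested

variable {K : Type*} [Fintype K] [MeasurableSpace K] [MeasurableSingletonClass K]
  {p : Measure K} [IsProbabilityMeasure p] {μ : Measure (ℤ → BiState)} [IsProbabilityMeasure μ]
  {s s' : Split K} {t t' : BiState} {ξ η : (ℤ → Bool) → ℤ → ℕ} {L : ℕ → ℝ} {Θ : Scheme K}
  {ψ ψ' : ℕ → ℝ}

/-- Since the symbols are independent of the pattern, a property of the pattern that is determined
by a word is determined by the pattern of the word. -/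
lemma ae_pat_of_ae_word {w : List (Split K)} (hw : 0 < wt (wts p) w) (m : ℤ)
    {D : (ℤ → BiState) → Prop}
    (h : ∀ᵐ z ∂splitting μ p, word z m w.length = w → D fun i => pat (z i)) :
    ∀ᵐ z ∂splitting μ p, (word z m w.length).map pat = w.map pat → D fun i => pat (z i) := by
  set N : Set (ℤ → BiState) := {x | word x m w.length = w.map pat ∧ ¬ D x} with hN
  have h1 : (μ.prod (Measure.infinitePi fun _ : ℤ => p)) (N ×ˢ symBox w m) = 0 := by
    refine measure_mono_null ?_ (ae_of_ae_map measurable_splitMap.aemeasurable h)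
    rintro ⟨x, u⟩ ⟨⟨h2, h3⟩, h4⟩
    simp only [Set.mem_compl_iff, Set.mem_ofPred_eq, Classical.not_imp]
    refine ⟨(word_splitMap x u m w).2 ⟨h2, h4⟩, ?_⟩
    have := pat_splitMap x u
    simp only [this]
    exact h3
  rw [Measure.prod_prod, mul_eq_zero] at h1
  have h2 : μ N = 0 := by
    refine h1.resolve_right fun h0 => ?_
    have := real_symBox p w m
    rw [measureReal_def, h0, ENNReal.toReal_zero] at this
    exact hw.ne this
  have h3 : ∀ᵐ x ∂(splitting μ p).map fun z i => pat (z i), x ∉ N := by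
    rw [map_pat_splitting]
    exact measure_eq_zero_iff_ae_notMem.1 h2
  filter_upwards [ae_of_ae_map measurable_patSeq.aemeasurable h3] with z hz hzw
  by_contra hD
  exact hz ⟨by rw [← hzw]; exact word_map pat z m w.length, hD⟩

lemma Unsplit.hat_pat (hs : Unsplit μ s t) (z : ℤ → Split K) :
    hat t (fun i => pat (z i)) = hat s z := by
  ext i
  simp [hat, hs.pat_eq]

/-- Every interval inside the word counts here, including the whole one, where the agreement of the
key events is needed. The state and the marks are arbitrary; this is where one scheme of masks
serves both systems. -/
lemma fillers_of_ME (hs : NotSym s) {pr : List (Split K) → ℝ} {z z' : ℤ → Split K} {l : ℤ}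
    {N : ℕ} (h : ME Θ (word z' l N) (word z l N))
    (hk : Kap Θ (word z' l N) ↔ Kap Θ (word z l N)) {m : ℤ} {n : ℕ} (hm : l ≤ m)
    (hn : m + n ≤ l + N) : fillers Θ pr s ψ (skel s η z m n) (word z' m n) (word z m n) := by
  rw [fillers_skel]
  obtain ⟨i, rfl⟩ : ∃ i : ℕ, m = l + i := ⟨(m - l).toNat, by omega⟩
  have e : ∀ y : ℤ → Split K, word y (l + i) n = sub (word y l N) i n := fun y =>
    (word_sub y l (by omega)).symm
  have key : ME Θ (word z' (l + i) n) (word z (l + i) n) ∧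
      (Kap Θ (word z' (l + i) n) ↔ Kap Θ (word z (l + i) n)) := by
    rcases Nat.lt_or_ge n N with hlt | hge
    · rw [e, e]
      exact ⟨h.sub (by rw [word_length]; omega) (by rwa [word_length]),
        h.2 _ _ (by rw [word_length]; omega) (by rwa [word_length])⟩
    · obtain ⟨rfl, rfl⟩ : i = 0 ∧ n = N := by omega
      simp only [Nat.cast_zero, add_zero]
      exact ⟨h, hk⟩
  have := rel_of_ME (pr := pr) (ψ := ψ) hs
    (fun j => (word (η (hat s z)) (l + i + 1) (n - 1)).getD (j - 1) 0) key.1 key.2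
  rwa [word_length] at this

/-- If the outer filler is good, its class shows the pattern and the key events of all its parts.
The pattern determines the inner skeleton, since the symbols are independent of it, and the masks
and key events of the parts give the inner class. -/
theorem nestedFillers (hμ : IsBiMarked μ) (hs : Unsplit μ s t) (hs' : Unsplit μ s' t')
    (hξ : IsNice (splitting μ p) s ξ L) {E : List (Split K) → Prop}
    (hE : Parameters (splitting μ p) Θ s ψ E) :
    NestedFillers (splitting μ p) s ξ L (fillers Θ (pr (splitting μ p)) s ψ) s' η
      (fillers Θ (pr (splitting μ p)) s' ψ') := by
  intro ε _ _
  refine (hE.withHighProb hμ hs hξ 0).mono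
    ((eventually_gt_atTop 0).mono fun r hr => Eventually.of_forall fun z hz => ?_)
  obtain ⟨⟨h1, hpos⟩, -, -, hg⟩ := hz
  intro m n hT hm hn _ hdet
  have hS := h1.isSkeleton hr
  rw [← left_add_size] at hn
  set l := left s ξ r z with hl
  set N := size s ξ r z with hN
  -- The statement that the inner skeleton is the same is expressed through the pattern alone, as
  -- both marker factors depend on occurrences of unsplit states. The outer skeleton enters as a
  -- premise, because it is part of what the filler and the class record.
  let D : (ℤ → BiState) → Prop := fun x => skel₀ t ξ r x = skel₀ s ξ r z →
    IsSkeleton (η (hat t' x)) m n ∧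
      word (η (hat t' x)) (m + 1) (n - 1) = word (η (hat s' z)) (m + 1) (n - 1)
  have hD : ∀ y : ℤ → Split K, (D fun i => pat (y i)) ↔ (skel₀ s ξ r y = skel₀ s ξ r z →
      IsSkeleton (η (hat s' y)) m n ∧
        word (η (hat s' y)) (m + 1) (n - 1) = word (η (hat s' z)) (m + 1) (n - 1)) := by
    intro y
    simp only [D, skel₀, skel, size, left, right, hs.hat_pat, hs'.hat_pat]
  have hcoord : ∀ y : ℤ → Split K, skel₀ s ξ r y = skel₀ s ξ r z →
      left s ξ r y = l ∧ size s ξ r y = N := by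
    intro y hy
    refine ⟨congrArg Skeleton.pos hy, ?_⟩
    have := congrArg (fun S => S.dist.length) hy
    simpa [skel₀, skel] using this
  have hw : 0 < wt (wts p) (word z l N) := by
    have := hpos l N
    rw [pr_splitting] at this
    exact (wt_nonneg (wts_nonneg p) _).lt_of_ne fun e => by simp [← e] at this
  have hz : clsAt s' η (fillers Θ (pr (splitting μ p)) s' ψ') m n z =
      some (cls s' η (fillers Θ (pr (splitting μ p)) s' ψ') z m n) := if_pos hT
  have key := ae_pat_of_ae_word (μ := μ) hw l (D := D) <| by
    filter_upwards [hdet] with y hy hyw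
    rw [word_length] at hyw
    rw [hD]
    intro hsk
    obtain ⟨c1, c2⟩ := hcoord y hsk
    have hy := hy (by rw [filler₀, filler₀, hsk, c1, c2, hyw])
    rw [hz, clsAt] at hy
    split_ifs at hy with hyT
    refine ⟨hyT, ?_⟩
    have := congrArg Prod.fst (Option.some_injective _ hy)
    exact congrArg Skeleton.marks this
  change ∀ᵐ y ∂_, _ → _
  filter_upwards [key] with y hy hcls
  have hsk : skel₀ s ξ r y = skel₀ s ξ r z := congrArg Prod.fst hcls
  obtain ⟨c1, c2⟩ := hcoord y hsk
  have hrel : fillers Θ (pr (splitting μ p)) s ψ (skel s ξ z l N) (word y l N) (word z l N) := by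
    have h6 : word y l N ∈ (cls₀ s ξ (fillers Θ (pr (splitting μ p)) s ψ) r y).2 := by
      rw [cls₀, c1, c2]
      exact (fillers Θ (pr (splitting μ p)) s ψ (skel s ξ y l N)).refl _
    rw [hcls] at h6
    exact h6
  obtain ⟨hME, hkap⟩ := ME_of_fillers hS hrel hg
  -- Neither word has the key event: z because it is good, y because a filler equivalent to a good
  -- one is good.
  have hiff : Kap Θ (word y l N) ↔ Kap Θ (word z l N) := iff_of_false hkap hg.1
  have hy := (hD y).1 (hy (by rw [word_length]; exact hME.pat_eq)) hsk
  have hpat : (word y m n).map pat = (word z m n).map pat := by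
    obtain ⟨i, rfl⟩ : ∃ i : ℕ, m = l + i := ⟨(m - l).toNat, by omega⟩
    have := congrArg (fun v => (v.drop i).take n) hME.pat_eq
    simp only [← List.map_drop, ← List.map_take] at this
    rwa [word_sub _ _ (by omega), word_sub _ _ (by omega)] at this
  have hskel : skel s' η y m n = skel s' η z m n := by
    rw [skel, skel, hy.2, word_hat, word_hat, hs'.notSym _ _ hpat]
  have hT' := fillers_of_ME (ψ := ψ') (pr := pr (splitting μ p)) (η := η) hs'.notSym hME hiff hm hn
  rw [hz, clsAt, if_pos hy.1, cls, cls, hskel]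
  congr 2
  ext v
  exact ⟨fun h => (fillers Θ (pr (splitting μ p)) s' ψ' (skel s' η z m n)).trans h hT',
    fun h => (fillers Θ (pr (splitting μ p)) s' ψ' (skel s' η z m n)).trans h
      ((fillers Θ (pr (splitting μ p)) s' ψ' (skel s' η z m n)).symm hT')⟩

end Nested

/-! ### Choice of the parameters. -/

section Choice

variable {K : Type*} [Fintype K] [MeasurableSpace K] [MeasurableSingletonClass K]
  {p : Measure K} [IsProbabilityMeasure p] {μ : Measure (ℤ → BiState)} [IsProbabilityMeasure μ]
  {s : Split K} {t : BiState}

/-- The bound ψ and the typical words depend on the state s, but the scheme of masks is built from a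
return time of `a` for either state. -/
theorem exists_parameters (hμ : IsBiMarked μ) (hs : Unsplit μ s t) (hp : ∀ k, p {k} ≠ 1) {k₀ : K}
    (hk0 : 0 < wts p k₀) {ℓ : ℕ} (hℓ : 0 < ℓ)
    (hq0 : 0 < qh (pr (splitting μ p)) Split.a (ℓ - 1))
    (hq1 : qh (pr (splitting μ p)) Split.a (ℓ - 1) < 1) :
    ∃ (ψ : ℕ → ℝ) (E : List (Split K) → Prop),
      Parameters (splitting μ p) (scheme hq0 hq1 k₀ ℓ) s ψ E := by
  have hst := wordStationary_of_measurePreserving hμ.stationary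
  have hk1 := wts_lt_one hp k₀
  obtain ⟨n₁, h1, h2⟩ := exists_psi (hs.hrate_pos hst hμ.pos_c hp)
  obtain ⟨κ, hκ, hdec⟩ := decay_typ hμ hs hk0 hk1 hℓ hq0 hq1
  obtain ⟨γ, hγ0, hγ1, hγ⟩ : ∃ γ : ℝ, 0 < γ ∧ γ < 1 ∧ ∀ k, wts p k ≤ γ := by
    obtain ⟨k, -, hk⟩ := Finset.exists_max_image Finset.univ (wts p) ⟨k₀, Finset.mem_univ _⟩
    exact ⟨wts p k, hk0.trans_le (hk k₀ (Finset.mem_univ _)), wts_lt_one hp k,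
      fun k' => hk k' (Finset.mem_univ _)⟩
  obtain ⟨γ', hγ0', hγ'⟩ : ∃ γ : ℝ, 0 < γ ∧ ∀ k, 0 < wts p k → γ ≤ wts p k := by
    obtain ⟨k, hk, hk'⟩ := Finset.exists_min_image (Finset.univ.filter fun k => 0 < wts p k)
      (wts p) ⟨k₀, by simpa using hk0⟩
    exact ⟨wts p k, (Finset.mem_filter.1 hk).2, fun k' h => hk' k' (by simpa using h)⟩
  refine ⟨psi (hrate (pr (splitting μ p)) s) n₁,
    Typ (scheme hq0 hq1 k₀ ℓ) (pr (splitting μ p)) s κ, h1, h2, ?_, hdec,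
    eventually_typ_good hq0 hq1 ℓ hs hst hk0 hk1 hγ0 hγ1 hγ hκ n₁,
    eventually_typ_mass hq0 hq1 ℓ hs hst hγ0' hγ' κ, fun w hw => hw.hidden_le⟩
  filter_upwards [eventually_ge_atTop n₁] with n hn
  exact psi_eq hn

end Choice

end Fillers

end

theorem mainTheorem6 {K : Type*} [Finite K] [MeasurableSpace K] [MeasurableSingletonClass K]
    (μ : MeasureTheory.Measure (ℤ → Fillers.BiState)) (hμ : Fillers.IsBiMarked μ)
    (p : MeasureTheory.Measure K) [MeasureTheory.IsProbabilityMeasure p]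
    (hp : ∀ k : K, p {k} ≠ 1)
    (ς ϑ : (ℤ → Bool) → ℤ → ℕ) (Lς Lϑ : ℕ → ℝ)
    (hς : Fillers.IsNice (Fillers.splitting μ p) Fillers.Split.a ς Lς)
    (hϑ : Fillers.IsNice (Fillers.splitting μ p) Fillers.Split.b ϑ Lϑ) :
    ∃ Ra Rb : Fillers.Relations (Fillers.Split K),
      Fillers.IsGoodSOF (Fillers.splitting μ p) Fillers.Split.a ς Lς Ra ∧
      Fillers.IsGoodSOF (Fillers.splitting μ p) Fillers.Split.b ϑ Lϑ Rb ∧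
      Fillers.NestedFillers (Fillers.splitting μ p) Fillers.Split.a ς Lς Ra
        Fillers.Split.b ϑ Rb ∧
      Fillers.NestedFillers (Fillers.splitting μ p) Fillers.Split.b ϑ Lϑ Rb
        Fillers.Split.a ς Ra := by
  have := Fintype.ofFinite K
  have := hμ.prob
  have ha : Fillers.Unsplit (K := K) μ Fillers.Split.a Fillers.BiState.a := Fillers.unsplit_a hμ
  have hb : Fillers.Unsplit (K := K) μ Fillers.Split.b Fillers.BiState.b := Fillers.unsplit_b hμ
  obtain ⟨k₀, hk0⟩ := Fillers.exists_wts_pos (p := p)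
  obtain ⟨ℓ, hℓ, hq0, hq1⟩ := ha.exists_return (p := p)
    (Fillers.wordStationary_of_measurePreserving hμ.stationary) hμ.pos_c
  obtain ⟨ψ, E, hE⟩ := Fillers.exists_parameters hμ ha hp hk0 hℓ hq0 hq1
  obtain ⟨ψ', E', hE'⟩ := Fillers.exists_parameters hμ hb hp hk0 hℓ hq0 hq1
  -- The two systems share k₀ and ℓ and thus the scheme of masks, so the nesting theorem applies in
  -- both directions.
  exact ⟨_, _, hE.isGoodSOF hμ ha hς, hE'.isGoodSOF hμ hb hϑ,
    Fillers.nestedFillers hμ ha hb hς hE, Fillers.nestedFillers hμ hb ha hϑ hE'⟩
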